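/- **Conventions.** For $\alpha=\{\alpha_1<\dots<\alpha_k\}$ with $0<\alpha_1$, $\alpha_k<n$, let $\mathbb{F}\ell(\alpha;n)$ be the manifold of flags $E_{\alpha_1}\subset\dots\subset E_{\alpha_k}\subset\mathbb C^n$ with $\dim E_{\alpha_i}=\alpha_i$, and put $\alpha_0=0$. For $\tau\in\mathbb P^1$ let $F_\bullet(\tau)$ be the flag osculating the rational normal curve $\gamma(z)=(1,z,\dots,z^{n-1})$ at $\tau$: $F_j(\tau)=\mathrm{span}\{\gamma(\tau),\gamma'(\tau),\dots,\gamma^{(j-1)}(\tau)\}$ for finite $\tau$, and $F_j(\infty)=\mathrm{span}\{e_{n+1-j},\dots,e_n\}$. For a permutation $w\in S_n$ with descent set $\delta(w)\subset\alpha$ let $$X_w(\tau)=\{E_\bullet\mid \dim(E_{\alpha_i}\cap F_j(\tau))\ge \#\{l\le\alpha_i: j+w(l)>n\}\ \text{for all } i,j\},$$ a Schubert variety of codimension $\ell(w)$, the number of inversions of $w$. Permutations are written in one-line notation. A list $(w_1,\dots,w_m)$ of such permutations is a Schubert problem if $\sum_i\ell(w_i)=\sum_i(n-\alpha_i)(\alpha_i-\alpha_{i-1})$,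 the dimension of $\mathbb{F}\ell(\alpha;n)$. The intersection $X_{w_1}(\tau_1)\cap\dots\cap X_{w_m}(\tau_m)$ is transverse if at each of its points the Schubert varieties are all smooth and their tangent spaces meet transversally (so an empty intersection is transverse). Distinct points $\tau_1,\dots,\tau_m\in\mathbb{RP}^1$ are *monotone* for $(w_1,\dots,w_m)$ if, after some real projective change of coordinate that makes them all finite, $\tau_i<\tau_j$ implies $a\le b$ for all $a\in\delta(w_i)$, $b\in\delta(w_j)$. Fix three of the points and let the remaining ones be parameters. *The discriminant* of the resulting family of intersections is the squarefree real polynomial $\Delta$ in the parameters, unique up to a non-zero scalar, that has no factor in common with a difference of two of the finite points and satisfies: for all complex values of the parameters for which the points are pairwise distinct, the intersection is not transverse if and only if $\Delta=0$. The *preorder* generated by polynomials $g_1,\dots,g_l$ is the set of all $\sum_{\varepsilon\in\{0,1\}^l}c_\varepsilon g_1^{\varepsilon_1}\cdots g_l^{\varepsilon_l}$ with each $c_\varepsilon$ a sum of squares of real polynomials. A *non-negative combination* of products of $g_1,\dots,g_l$ is an element $c(g_1,\dots,g_l)$ where $c$ is a polynomial with non-negative real coefficients. **Theorem.** Each of the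 following three lists is a Schubert problem. In each case the intersection has exactly $d$ points whenever the parameters are complex numbers such that the points are pairwise distinct and the intersection is transverse; the discriminant is the polynomial $\Delta$ displayed; and $\Delta$ lies in the preorder stated, which is generated by differences of the points. 1. On $\mathbb{F}\ell(1,2,4,5;6)$, with $d=2$: $X_{213456}(t)\cap X_{431256}(\infty)\cap X_{132546}(-1)\cap X_{125643}(0)\cap X_{123465}(s)$. Here $$\begin{aligned}\Delta={}&2500s^4t^4+18000s^3t^4+4000s^4t^3+50000s^2t^4+31100s^3t^3+2260s^4t^2+64000st^4+91400s^2t^3\\&+20040s^3t^2+480s^4t+32000t^4+122800st^3+63905s^2t^2+5550s^3t+9s^4+64000t^3+91400st^2\\&+20040s^2t+480s^3+50000t^2+31100st+2260s^2+18000t+4000s+2500,\end{aligned}$$ a non-negative combination of monomials in $s$ and $t$, and $\Delta$ lies in the preorder generated by $s,\ t,\ 1+s,\ 1+t,\ t-s$. For real $s,t$ the points are monotone if and only if $0<s<t$, and $\Delta>0$ whenever $s,t>0$. 2. On $\mathbb{F}\ell(2,3;5)$, with $d=3$: $X_{24135}(\infty)\cap X_{13245}(-1)\cap X_{13425}(0)\cap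 X_{12435}(s)\cap X_{12435}(t)$. Here $\Delta=(s+t+2)\,P(t,s-t)$, where $$\begin{aligned}P(t,u)={}&800t^9+3600t^8u+7744t^7u^2+10304t^6u^3+8736t^5u^4+4480t^4u^5+1248t^3u^6+144t^2u^7\\ &+5760t^8+23040t^7u+45792t^6u^2+56736t^5u^3+43632t^4u^4+19584t^3u^5+4608t^2u^6+432tu^7\\ &+17888t^7+62608t^6u+114816t^5u^2+130520t^4u^3+87520t^3u^4+32064t^2u^5+5616tu^6+324u^7\\ &+31712t^6+95136t^5u+161496t^4u^2+164432t^3u^3+90048t^2u^4+23688tu^5+2268u^6\\ &+35456t^5+88640t^4u+141256t^3u^2+123244t^2u^3+48726tu^4+6777u^5\\ &+25376t^4+50752t^3u+79184t^2u^2+53808tu^3+11394u^4\\ &+10752t^3+16128t^2u+27264tu^2+10944u^3+2048t^2+2048tu+4608u^2.\end{aligned}$$ $\Delta$ lies in the preorder generated by $1+s$ and $1+t$. It is symmetric in $s$ and $t$, and it is a non-negative combination of products of $t,\ s-t$; also one of products of $1+t,\ -t,\ s$; and also one of products of $1+t,\ s-t,\ -s$. For real $s,t$ the points are monotone if and only if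 $s,t>-1$, $s,t\ne0$ and $s\neq t$, and then $\Delta>0$. 3. On $\mathbb{F}\ell(3,4;7)$, with $d=4$: $X_{1462357}(\infty)\cap X_{1352467}(0)\cap X_{1246357}(s)\cap X_{1256347}(1)$. Here $$\begin{aligned}\Delta={}&3515625+45243750s+221792500s^2+565872594s^3+777678231s^4+1273923370s^5+932192307s^6\\&+909742337s^{10}+1560886138s^{11}+867109112s^{12}+367416324s^{13}+114976512s^{14}+13608000s^{15}+648000s^{16}\\&+(42966406s^3+352158344s^4+135425340s^5)(1-s^4)^2,\end{aligned}$$ a non-negative combination of products of $s$ and $(1-s^4)^2$, and $\Delta$ lies in the preorder generated by $s$. For real $s$ the points are monotone if and only if $s>0$ and $s\ne1$, and $\Delta>0$ whenever $s>0$. -/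

import Mathlib

open MvPolynomial OnePoint

namespace FlagSchubert

/-! ### Permutations as Schubert conditions -/

/-- The permutation with one-line notation `v 0, v 1, …, v (n-1)`, whose values are written, as
usual, in `1, …, n`. As a permutation of `Fin n` all positions and values are shifted by one. -/
noncomputable def oneLine {n : ℕ} (v : Fin n → ℕ) (hv : ∀ i, 1 ≤ v i ∧ v i ≤ n)
    (hinj : Function.Injective v) : Equiv.Perm (Fin n) :=
  Equiv.ofBijective (fun i => (⟨v i - 1, by have := hv i; omega⟩ : Fin n))
    (Finite.injective_iff_bijective.mp (by
      intro i j h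
      have h' : v i - 1 = v j - 1 := congrArg Fin.val h
      have hi := hv i
      have hj := hv j
      exact hinj (by omega)))

/-- The descent set `{d | w(d) > w(d+1)}` (positions are counted from `1`). -/
def descents {n : ℕ} (w : Equiv.Perm (Fin n)) : Set ℕ :=
  {d | ∃ i j : Fin n, (i : ℕ) + 1 = d ∧ (j : ℕ) = d ∧ w j < w i}

/-- The number of inversions of `w`. -/
def length {n : ℕ} (w : Equiv.Perm (Fin n)) : ℕ :=
  (Finset.univ.filter fun q : Fin n × Fin n => q.1 < q.2 ∧ w q.2 < w q.1).card

/-- The rank numbers `r_w(i,j) = #{l ≤ i | j + w(l) > n}`. -/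
def rankNumber {n : ℕ} (w : Equiv.Perm (Fin n)) (i j : ℕ) : ℕ :=
  (Finset.univ.filter fun l : Fin n => (l : ℕ) < i ∧ n < j + ((w l : ℕ) + 1)).card

/-- The dimension `∑ᵢ (n - αᵢ)(αᵢ - αᵢ₋₁)`, with `α₀ = 0`, of the manifold of flags of type
`α` in `n`-space. -/
def flagDim {k : ℕ} (α : Fin k → ℕ) (n : ℕ) : ℕ :=
  ∑ i : Fin k, (n - α i) *
    (α i - if h : (i : ℕ) = 0 then 0 else α ⟨(i : ℕ) - 1, by omega⟩)

/-- `w` is a Schubert problem on the manifold of flags of type `α` in `n`-space: all descents of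
the `w l` lie in `α`, and the codimensions add up to the dimension. -/
structure IsSchubertProblem {k n m : ℕ} (α : Fin k → ℕ) (w : Fin m → Equiv.Perm (Fin n)) :
    Prop where
  strictMono : StrictMono α
  pos : ∀ i, 0 < α i
  lt : ∀ i, α i < n
  descents_subset : ∀ l, descents (w l) ⊆ Set.range α
  length_sum : ∑ l, length (w l) = flagDim α n

/-! ### Flags, osculating flags and Schubert varieties -/

/-- Flags of type `α` in `ℂⁿ`. -/
structure PartialFlag {k : ℕ} (α : Fin k → ℕ) (n : ℕ) where
  space : Fin k → Submodule ℂ (Fin n → ℂ)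
  monotone : Monotone space
  finrank_eq : ∀ i, Module.finrank ℂ (space i) = α i

/-- The `j`-dimensional subspace (`j ≤ n`) of `ℂⁿ` osculating the rational normal curve
`γ(z) = (1, z, z², …, zⁿ⁻¹)` at a point of the complex projective line: the span of
`γ(τ), γ'(τ), …, γ⁽ʲ⁻¹⁾(τ)` for finite `τ`, and the span of the last `j` basis vectors
for `τ = ∞`. -/
noncomputable def osculatingSpace (n : ℕ) (τ : OnePoint ℂ) (j : ℕ) : Submodule ℂ (Fin n → ℂ) :=
  τ.elim
    (Submodule.span ℂ {v | ∃ i : Fin n, n ≤ (i : ℕ) + j ∧ v = Pi.single i 1})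
    (fun z => Submodule.span ℂ
      {v | ∃ d : ℕ, d < j ∧ v = fun i : Fin n => iteratedDeriv d (fun y : ℂ => y ^ (i : ℕ)) z})

/-- The Schubert variety `X_w(τ)` defined by the flag osculating the rational normal curve
at `τ`. -/
def schubertVariety {k n : ℕ} (α : Fin k → ℕ) (w : Equiv.Perm (Fin n)) (τ : OnePoint ℂ) :
    Set (PartialFlag α n) :=
  {E | ∀ i : Fin k, ∀ j : ℕ, j ≤ n →
    rankNumber w (α i) j ≤ Module.finrank ℂ ↥(E.space i ⊓ osculatingSpace n τ j)}

/-- The intersection `X_{w₁}(τ₁) ∩ ⋯ ∩ X_{w_m}(τ_m)`. -/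
def intersection {k n m : ℕ} (α : Fin k → ℕ) (w : Fin m → Equiv.Perm (Fin n))
    (τ : Fin m → OnePoint ℂ) : Set (PartialFlag α n) :=
  {E | ∀ l, E ∈ schubertVariety α (w l) (τ l)}

/-! ### Transversality

The tangent space of the flag manifold at `E` is `End(ℂⁿ)` modulo the endomorphisms that preserve
`E`; the class of `ψ` is the velocity of `(1 + εψ) E`. -/

/-- The class of `ψ` lies in the (Zariski) tangent space at `E` of the Schubert variety, that is,
of the scheme cut out by the minors expressing `rank (E_i + F_j) ≤ α_i + j - r_w(α_i,j)`.
To first order, a rank condition that holds with equality at `E` says that `ψ` maps the kernel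
`E_i ∩ F_j` to zero in the cokernel `ℂⁿ / (E_i + F_j)`; where the rank is strictly smaller all
these minors vanish to second order, and there is no condition. -/
def IsTangent {k n : ℕ} (α : Fin k → ℕ) (w : Equiv.Perm (Fin n)) (τ : OnePoint ℂ)
    (E : PartialFlag α n) (ψ : Module.End ℂ (Fin n → ℂ)) : Prop :=
  ∀ i : Fin k, ∀ j : ℕ, j ≤ n →
    Module.finrank ℂ ↥(E.space i ⊓ osculatingSpace n τ j) = rankNumber w (α i) j →
      (E.space i ⊓ osculatingSpace n τ j).map ψ ≤ E.space i ⊔ osculatingSpace n τ j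

/-- Transversality of the intersection of a Schubert problem: at every point `E` of the
intersection, only the zero tangent vector (a `ψ` that preserves `E`) is tangent to all the
Schubert varieties. As the codimensions add up to the dimension of the flag manifold, this says
exactly that all the Schubert varieties are smooth at `E` and that their tangent spaces meet
transversally. -/
def IsTransverse {k n m : ℕ} (α : Fin k → ℕ) (w : Fin m → Equiv.Perm (Fin n))
    (τ : Fin m → OnePoint ℂ) : Prop :=
  ∀ E ∈ intersection α w τ, ∀ ψ : Module.End ℂ (Fin n → ℂ),
    (∀ l, IsTangent α (w l) (τ l) E ψ) → ∀ i, (E.space i).map ψ ≤ E.space i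

/-! ### Families of points, monotone points, discriminants -/

/-- The values at `x` of a list of points of the projective line that depend polynomially on
parameters (a list entry `∞` is the constant point at infinity). -/
noncomputable def pointsAt {m p : ℕ} (pts : Fin m → OnePoint (MvPolynomial (Fin p) ℝ))
    {K : Type*} [CommRing K] [Algebra ℝ K] (x : Fin p → K) : Fin m → OnePoint K :=
  fun l => (pts l).map (fun f => aeval x f)

/-- A set of positions precedes another one if each of its elements is at most each element of
the other one. -/
def Precedes (S T : Set ℕ) : Prop := ∀ a ∈ S, ∀ b ∈ T, a ≤ b

/-- Distinct points of the real projective line are monotone with respect to `w` if, after a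
projective change of coordinate (either orientation) that makes all of them finite, the descent
sets `δ(w l)` increase along the line. -/
def IsMonotone {n m : ℕ} (w : Fin m → Equiv.Perm (Fin n)) (τ : Fin m → OnePoint ℝ) : Prop :=
  Function.Injective τ ∧ ∃ (g : GL (Fin 2) ℝ) (u : Fin m → ℝ),
    (∀ l, g • τ l = (u l : OnePoint ℝ)) ∧
    ∀ l l', u l < u l' → Precedes (descents (w l)) (descents (w l'))

/-- `Δ` is the discriminant polynomial of the family of intersections
`X_{w₁}(pts₁) ∩ ⋯ ∩ X_{w_m}(pts_m)`: for complex parameters with pairwise distinct points the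
intersection is not transverse exactly where `Δ` vanishes, and `Δ` is squarefree without factors
that vanish only where points collide. This determines `Δ` up to a non-zero scalar. -/
structure IsDiscriminantPolynomial {k n m p : ℕ} (α : Fin k → ℕ)
    (w : Fin m → Equiv.Perm (Fin n)) (pts : Fin m → OnePoint (MvPolynomial (Fin p) ℝ))
    (Δ : MvPolynomial (Fin p) ℝ) : Prop where
  squarefree : Squarefree Δ
  isRelPrime : ∀ (l l' : Fin m) (f g : MvPolynomial (Fin p) ℝ), l ≠ l' →
    pts l = (f : OnePoint (MvPolynomial (Fin p) ℝ)) →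
    pts l' = (g : OnePoint (MvPolynomial (Fin p) ℝ)) → IsRelPrime Δ (f - g)
  not_isTransverse_iff : ∀ x : Fin p → ℂ, Function.Injective (pointsAt pts x) →
    (¬ IsTransverse α w (pointsAt pts x) ↔ aeval x Δ = 0)

/-- The preorder generated by `g₁, …, g_l`: all `∑_ε c_ε g^ε` with `ε ∈ {0,1}^l` (given as a
subset of the index set) and each `c_ε` a sum of squares of polynomials. -/
def generatedPreorder {l p : ℕ} (g : Fin l → MvPolynomial (Fin p) ℝ) :
    Set (MvPolynomial (Fin p) ℝ) :=
  {f | ∃ c : Finset (Fin l) → MvPolynomial (Fin p) ℝ, (∀ ε, IsSumSq (c ε)) ∧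
    f = ∑ ε, c ε * ∏ i ∈ ε, g i}

/-- Linear combinations with non-negative real coefficients of products of the `gᵢ`. -/
def nonnegCombinations {l p : ℕ} (g : Fin l → MvPolynomial (Fin p) ℝ) :
    Set (MvPolynomial (Fin p) ℝ) :=
  {f | ∃ c : MvPolynomial (Fin l) ℝ, (∀ e, 0 ≤ c.coeff e) ∧ f = aeval g c}

/-! ### The problem on flags of type `(1,2,4,5)` in 6-space, parameters `s = X 0`, `t = X 1` -/

def typeA : Fin 4 → ℕ := ![1, 2, 4, 5]

noncomputable def condA : Fin 5 → Equiv.Perm (Fin 6) :=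
  ![oneLine ![2, 1, 3, 4, 5, 6] (by decide) (by decide),
    oneLine ![4, 3, 1, 2, 5, 6] (by decide) (by decide),
    oneLine ![1, 3, 2, 5, 4, 6] (by decide) (by decide),
    oneLine ![1, 2, 5, 6, 4, 3] (by decide) (by decide),
    oneLine ![1, 2, 3, 4, 6, 5] (by decide) (by decide)]

/-- The points `t, ∞, -1, 0, s`. -/
noncomputable def pointsA : Fin 5 → OnePoint (MvPolynomial (Fin 2) ℝ) :=
  ![((X 1 : MvPolynomial (Fin 2) ℝ) : OnePoint (MvPolynomial (Fin 2) ℝ)),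
    ∞,
    ((-1 : MvPolynomial (Fin 2) ℝ) : OnePoint (MvPolynomial (Fin 2) ℝ)),
    ((0 : MvPolynomial (Fin 2) ℝ) : OnePoint (MvPolynomial (Fin 2) ℝ)),
    ((X 0 : MvPolynomial (Fin 2) ℝ) : OnePoint (MvPolynomial (Fin 2) ℝ))]

/-- The polynomial written in two commuting elements. -/
def polyA {R : Type*} [CommRing R] (s t : R) : R :=
  2500*s^4*t^4 + 18000*s^3*t^4 + 4000*s^4*t^3 + 50000*s^2*t^4 + 31100*s^3*t^3 + 2260*s^4*t^2
  + 64000*s*t^4 + 91400*s^2*t^3 + 20040*s^3*t^2 + 480*s^4*t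
  + 32000*t^4 + 122800*s*t^3 + 63905*s^2*t^2 + 5550*s^3*t + 9*s^4
  + 64000*t^3 + 91400*s*t^2 + 20040*s^2*t + 480*s^3
  + 50000*t^2 + 31100*s*t + 2260*s^2 + 18000*t + 4000*s + 2500

noncomputable def discA : MvPolynomial (Fin 2) ℝ := polyA (X 0) (X 1)

/-! ### The problem on flags of type `(2,3)` in 5-space, parameters `s = X 0`, `t = X 1` -/

def typeB : Fin 2 → ℕ := ![2, 3]

noncomputable def condB : Fin 5 → Equiv.Perm (Fin 5) :=
  ![oneLine ![2, 4, 1, 3, 5] (by decide) (by decide),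
    oneLine ![1, 3, 2, 4, 5] (by decide) (by decide),
    oneLine ![1, 3, 4, 2, 5] (by decide) (by decide),
    oneLine ![1, 2, 4, 3, 5] (by decide) (by decide),
    oneLine ![1, 2, 4, 3, 5] (by decide) (by decide)]

/-- The points `∞, -1, 0, s, t`. -/
noncomputable def pointsB : Fin 5 → OnePoint (MvPolynomial (Fin 2) ℝ) :=
  ![∞,
    ((-1 : MvPolynomial (Fin 2) ℝ) : OnePoint (MvPolynomial (Fin 2) ℝ)),
    ((0 : MvPolynomial (Fin 2) ℝ) : OnePoint (MvPolynomial (Fin 2) ℝ)),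
    ((X 0 : MvPolynomial (Fin 2) ℝ) : OnePoint (MvPolynomial (Fin 2) ℝ)),
    ((X 1 : MvPolynomial (Fin 2) ℝ) : OnePoint (MvPolynomial (Fin 2) ℝ))]

/-- A polynomial of degree 9 in `t` and `u`; below, `u = s - t`. -/
def polyB {R : Type*} [CommRing R] (t u : R) : R :=
  800*t^9 + 3600*t^8*u + 7744*t^7*u^2 + 10304*t^6*u^3 + 8736*t^5*u^4 + 4480*t^4*u^5
  + 1248*t^3*u^6 + 144*t^2*u^7 + 5760*t^8 + 23040*t^7*u + 45792*t^6*u^2 + 56736*t^5*u^3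
  + 43632*t^4*u^4 + 19584*t^3*u^5 + 4608*t^2*u^6 + 432*t*u^7 + 17888*t^7 + 62608*t^6*u
  + 114816*t^5*u^2 + 130520*t^4*u^3 + 87520*t^3*u^4 + 32064*t^2*u^5 + 5616*t*u^6
  + 324*u^7 + 31712*t^6 + 95136*t^5*u + 161496*t^4*u^2 + 164432*t^3*u^3
  + 90048*t^2*u^4 + 23688*t*u^5 + 2268*u^6 + 35456*t^5 + 88640*t^4*u
  + 141256*t^3*u^2 + 123244*t^2*u^3 + 48726*t*u^4 + 6777*u^5 + 25376*t^4
  + 50752*t^3*u + 79184*t^2*u^2 + 53808*t*u^3 + 11394*u^4 + 10752*t^3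
  + 16128*t^2*u + 27264*t*u^2 + 10944*u^3 + 2048*t^2 + 2048*t*u + 4608*u^2

noncomputable def discB : MvPolynomial (Fin 2) ℝ :=
  (X 0 + X 1 + 2) * polyB (X 1) (X 0 - X 1)

/-! ### The problem on flags of type `(3,4)` in 7-space, parameter `s = X 0` -/

def typeC : Fin 2 → ℕ := ![3, 4]

noncomputable def condC : Fin 4 → Equiv.Perm (Fin 7) :=
  ![oneLine ![1, 4, 6, 2, 3, 5, 7] (by decide) (by decide),
    oneLine ![1, 3, 5, 2, 4, 6, 7] (by decide) (by decide),
    oneLine ![1, 2, 4, 6, 3, 5, 7] (by decide) (by decide),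
    oneLine ![1, 2, 5, 6, 3, 4, 7] (by decide) (by decide)]

/-- The points `∞, 0, s, 1`. -/
noncomputable def pointsC : Fin 4 → OnePoint (MvPolynomial (Fin 1) ℝ) :=
  ![∞,
    ((0 : MvPolynomial (Fin 1) ℝ) : OnePoint (MvPolynomial (Fin 1) ℝ)),
    ((X 0 : MvPolynomial (Fin 1) ℝ) : OnePoint (MvPolynomial (Fin 1) ℝ)),
    ((1 : MvPolynomial (Fin 1) ℝ) : OnePoint (MvPolynomial (Fin 1) ℝ))]

def polyC {R : Type*} [CommRing R] (s : R) : R :=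
  3515625 + 45243750*s + 221792500*s^2 + 565872594*s^3 + 777678231*s^4
  + 1273923370*s^5 + 932192307*s^6 + 909742337*s^10 + 1560886138*s^11
  + 867109112*s^12 + 367416324*s^13 + 114976512*s^14 + 13608000*s^15 + 648000*s^16
  + (42966406*s^3 + 352158344*s^4 + 135425340*s^5) * (1 - s^4)^2

noncomputable def discC : MvPolynomial (Fin 1) ℝ := polyC (X 0)

end FlagSchubert

open FlagSchubert

set_option maxHeartbeats 400000

local notation "osc" => osculatingSpace
local notation:max "dim" V:max => Module.finrank ℂ V

namespace FlagSchubert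

/-! ### One-line notation -/

lemma rankNumber_oneLine {n : ℕ} (v : Fin n → ℕ) (hv : ∀ i, 1 ≤ v i ∧ v i ≤ n)
    (hinj : Function.Injective v) (i j : ℕ) : rankNumber (oneLine v hv hinj) i j =
      (Finset.univ.filter fun l : Fin n => (l : ℕ) < i ∧ n < j + v l).card := by
  unfold rankNumber
  congr 1
  ext l
  have := hv l
  simp only [Finset.mem_filter, Finset.mem_univ, true_and, oneLine, Equiv.ofBijective_apply]
  constructor <;> rintro ⟨h1, h2⟩ <;> exact ⟨h1, by omega⟩

/-- The descent set of a sequence of natural numbers, as a finite set. -/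
def descentFinset {n : ℕ} (v : Fin n → ℕ) : Finset ℕ :=
  (Finset.univ.filter fun q : Fin n × Fin n => (q.1 : ℕ) + 1 = q.2 ∧ v q.2 < v q.1).image
    fun q => (q.2 : ℕ)

lemma descents_oneLine {n : ℕ} (v : Fin n → ℕ) (hv : ∀ i, 1 ≤ v i ∧ v i ≤ n)
    (hinj : Function.Injective v) : descents (oneLine v hv hinj) = (descentFinset v : Set ℕ) := by
  ext d
  simp only [descents, descentFinset, Set.mem_ofPred_eq, Finset.coe_image, Set.mem_image,
    Finset.mem_coe, Finset.mem_filter, Finset.mem_univ, true_and, Prod.exists, oneLine,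
    Equiv.ofBijective_apply, Fin.lt_def]
  constructor
  · rintro ⟨i, j, h1, h2, h3⟩
    exact ⟨i, j, ⟨by omega, by have := hv i; have := hv j; omega⟩, h2⟩
  · rintro ⟨i, j, ⟨h1, h2⟩, h3⟩
    exact ⟨i, j, by omega, h3, by have := hv i; have := hv j; omega⟩

lemma descents_condA :
    descents (condA 0) = {1} ∧ descents (condA 1) = {1, 2} ∧ descents (condA 2) = {2, 4} ∧
      descents (condA 3) = {4, 5} ∧ descents (condA 4) = {5} := by
  refine ⟨?_, ?_, ?_, ?_, ?_⟩ <;>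
  · simp only [condA, Matrix.cons_val]
    rw [descents_oneLine, ← Finset.coe_singleton]
    try rw [← Finset.coe_insert]
    exact congrArg _ (by decide)

lemma descents_condB :
    descents (condB 0) = {2} ∧ descents (condB 1) = {2} ∧ descents (condB 2) = {3} ∧
      descents (condB 3) = {3} ∧ descents (condB 4) = {3} := by
  refine ⟨?_, ?_, ?_, ?_, ?_⟩ <;>
  · simp only [condB, Matrix.cons_val]
    rw [descents_oneLine, ← Finset.coe_singleton]
    exact congrArg _ (by decide)

lemma descents_condC :
    descents (condC 0) = {3} ∧ descents (condC 1) = {3} ∧ descents (condC 2) = {4} ∧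
      descents (condC 3) = {4} := by
  refine ⟨?_, ?_, ?_, ?_⟩ <;>
  · simp only [condC, Matrix.cons_val]
    rw [descents_oneLine, ← Finset.coe_singleton]
    exact congrArg _ (by decide)

theorem isSchubertProblem_A : IsSchubertProblem typeA condA where
  strictMono := by decide
  pos := by decide
  lt := by decide
  descents_subset := by
    obtain ⟨h0, h1, h2, h3, h4⟩ := descents_condA
    intro l
    fin_cases l <;> simp [h0, h1, h2, h3, h4, typeA, Set.insert_subset_iff]
  length_sum := by
    simp only [Fin.sum_univ_five, condA, Matrix.cons_val, length, oneLine, Equiv.ofBijective_apply]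
    decide

theorem isSchubertProblem_B : IsSchubertProblem typeB condB where
  strictMono := by decide
  pos := by decide
  lt := by decide
  descents_subset := by
    obtain ⟨h0, h1, h2, h3, h4⟩ := descents_condB
    intro l
    fin_cases l <;> simp [h0, h1, h2, h3, h4, typeB]
  length_sum := by
    simp only [Fin.sum_univ_five, condB, Matrix.cons_val, length, oneLine, Equiv.ofBijective_apply]
    decide

theorem isSchubertProblem_C : IsSchubertProblem typeC condC where
  strictMono := by decide
  pos := by decide
  lt := by decide
  descents_subset := by
    obtain ⟨h0, h1, h2, h3⟩ := descents_condC
    intro l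
    fin_cases l <;> simp [h0, h1, h2, h3, typeC]
  length_sum := by
    simp only [Fin.sum_univ_four, condC, Matrix.cons_val, length, oneLine, Equiv.ofBijective_apply]
    decide

/-! ### Monotone points -/

lemma div_lt_div_iff_of_neg {a b c d : ℝ} (hb : b < 0) (hd : d < 0) :
    a / b < c / d ↔ a * d < c * b := by
  rw [← neg_div_neg_eq a, ← neg_div_neg_eq c, div_lt_div_iff₀ (by linarith) (by linarith)]
  constructor <;> intro h <;> linarith

/-- The coordinate `r + e / (x - x₀)` on the projective line, which is `r` at infinity. -/
lemma exists_chart (g : GL (Fin 2) ℝ) {r : ℝ} (h : g • (∞ : OnePoint ℝ) = (r : OnePoint ℝ)) :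
    ∃ e x₀ : ℝ, e ≠ 0 ∧ ∀ x u : ℝ, g • (x : OnePoint ℝ) = (u : OnePoint ℝ) →
      x ≠ x₀ ∧ u = r + e / (x - x₀) := by
  classical
  rw [OnePoint.smul_infty_eq_ite] at h
  split_ifs at h with hc
  · exact absurd h (OnePoint.infty_ne_coe r)
  have hr := OnePoint.coe_injective h
  have hdet : g 0 0*g 1 1 - g 0 1*g 1 0 ≠ 0 := by
    have := g.det_ne_zero
    rwa [Matrix.det_fin_two] at this
  refine ⟨-(g 0 0*g 1 1 - g 0 1*g 1 0) / g 1 0^2, -(g 1 1 / g 1 0),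
    div_ne_zero (neg_ne_zero.mpr hdet) (pow_ne_zero 2 hc), fun x u hx => ?_⟩
  rw [OnePoint.smul_some_eq_ite] at hx
  split_ifs at hx with hd
  · exact absurd hx (OnePoint.infty_ne_coe u)
  have hu := OnePoint.coe_injective hx
  have hx0 : x - -(g 1 1 / g 1 0) ≠ 0 := by
    intro h0
    apply hd
    field_simp at h0
    linarith
  refine ⟨sub_ne_zero.mp hx0, ?_⟩
  rw [← hu, ← hr]
  have : x - -(g 1 1 / g 1 0) = (g 1 0*x + g 1 1) / g 1 0 := by field_simp; ring
  rw [this]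
  generalize g 0 0 = a at *
  generalize g 0 1 = b at *
  generalize g 1 0 = c at *
  generalize g 1 1 = d at *
  obtain ⟨k, rfl⟩ : ∃ k, d = k - c * x := ⟨c * x + d, by ring⟩
  rw [add_sub_cancel] at hd ⊢
  field_simp
  ring

/-- The coordinate `e / (x - x₀)` exists. -/
lemma exists_gl_chart (e x₀ : ℝ) (he : e ≠ 0) :
    ∃ g : GL (Fin 2) ℝ, g • (∞ : OnePoint ℝ) = ((0 : ℝ) : OnePoint ℝ) ∧
      ∀ x : ℝ, x ≠ x₀ → g • (x : OnePoint ℝ) = ((e / (x - x₀) : ℝ) : OnePoint ℝ) := by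
  classical
  refine ⟨Matrix.GeneralLinearGroup.mkOfDetNeZero !![0, e; 1, -x₀]
    (by rw [Matrix.det_fin_two]; simpa using he), ?_, fun x hx => ?_⟩
  · rw [OnePoint.smul_infty_eq_ite]
    simp [Matrix.GeneralLinearGroup.mkOfDetNeZero]
  · rw [OnePoint.smul_some_eq_ite]
    have : x + -x₀ ≠ 0 := by rwa [← sub_eq_add_neg, sub_ne_zero]
    simp [Matrix.GeneralLinearGroup.mkOfDetNeZero, this, sub_eq_add_neg]

lemma pointsAt_A {K : Type*} [CommRing K] [Algebra ℝ K] (x : Fin 2 → K) :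
    pointsAt pointsA x = ![(x 1 : OnePoint K), ∞, ((-1 : K) : OnePoint K),
      ((0 : K) : OnePoint K), (x 0 : OnePoint K)] := by
  ext l
  fin_cases l <;> simp [pointsAt, pointsA]

lemma pointsAt_B {K : Type*} [CommRing K] [Algebra ℝ K] (x : Fin 2 → K) :
    pointsAt pointsB x = ![∞, ((-1 : K) : OnePoint K),
      ((0 : K) : OnePoint K), (x 0 : OnePoint K), (x 1 : OnePoint K)] := by
  ext l
  fin_cases l <;> simp [pointsAt, pointsB]

lemma pointsAt_C {K : Type*} [CommRing K] [Algebra ℝ K] (x : Fin 1 → K) :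
    pointsAt pointsC x = ![∞, ((0 : K) : OnePoint K), (x 0 : OnePoint K),
      ((1 : K) : OnePoint K)] := by
  ext l
  fin_cases l <;> simp [pointsAt, pointsC]

lemma injective_fin_five {α : Type*} (a b c d e : α) : Function.Injective ![a, b, c, d, e] ↔
      (a ≠ b ∧ a ≠ c ∧ a ≠ d ∧ a ≠ e) ∧ (b ≠ c ∧ b ≠ d ∧ b ≠ e) ∧ (c ≠ d ∧ c ≠ e) ∧ d ≠ e := by
  constructor
  · intro h
    have key : ∀ i j : Fin 5, i ≠ j → ![a, b, c, d, e] i ≠ ![a, b, c, d, e] j :=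
      fun i j hij => h.ne hij
    exact ⟨⟨key 0 1 (by decide), key 0 2 (by decide), key 0 3 (by decide), key 0 4 (by decide)⟩,
      ⟨key 1 2 (by decide), key 1 3 (by decide), key 1 4 (by decide)⟩,
      ⟨key 2 3 (by decide), key 2 4 (by decide)⟩, key 3 4 (by decide)⟩
  · rintro ⟨⟨h1, h2, h3, h4⟩, ⟨h5, h6, h7⟩, ⟨h8, h9⟩, h10⟩ i j hij
    fin_cases i <;> fin_cases j <;> first | rfl | simp_all

lemma injective_fin_four {α : Type*} (a b c d : α) : Function.Injective ![a, b, c, d] ↔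
      (a ≠ b ∧ a ≠ c ∧ a ≠ d) ∧ (b ≠ c ∧ b ≠ d) ∧ c ≠ d := by
  constructor
  · intro h
    have key : ∀ i j : Fin 4, i ≠ j → ![a, b, c, d] i ≠ ![a, b, c, d] j :=
      fun i j hij => h.ne hij
    exact ⟨⟨key 0 1 (by decide), key 0 2 (by decide), key 0 3 (by decide)⟩,
      ⟨key 1 2 (by decide), key 1 3 (by decide)⟩, key 2 3 (by decide)⟩
  · rintro ⟨⟨h1, h2, h3⟩, ⟨h4, h5⟩, h6⟩ i j hij
    fin_cases i <;> fin_cases j <;> first | rfl | simp_all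

lemma injective_pointsAt_A {K : Type*} [CommRing K] [Nontrivial K] [Algebra ℝ K] (x : Fin 2 → K) :
    Function.Injective (pointsAt pointsA x) ↔
      x 0 ≠ 0 ∧ x 1 ≠ 0 ∧ x 0 ≠ -1 ∧ x 1 ≠ -1 ∧ x 0 ≠ x 1 := by
  rw [pointsAt_A, injective_fin_five]
  simp only [ne_eq, OnePoint.coe_ne_infty, OnePoint.infty_ne_coe, not_false_eq_true,
    OnePoint.coe_eq_coe, true_and, and_true, neg_eq_zero, one_ne_zero]
  constructor
  · rintro ⟨⟨h1, h2, h3⟩, h4, h5⟩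
    exact ⟨fun h => h5 h.symm, h2, fun h => h4 h.symm, h1, fun h => h3 h.symm⟩
  · rintro ⟨h1, h2, h3, h4, h5⟩
    exact ⟨⟨h4, h2, fun h => h5 h.symm⟩, fun h => h3 h.symm, fun h => h1 h.symm⟩

lemma injective_pointsAt_B {K : Type*} [CommRing K] [Nontrivial K] [Algebra ℝ K] (x : Fin 2 → K) :
    Function.Injective (pointsAt pointsB x) ↔
      x 0 ≠ 0 ∧ x 1 ≠ 0 ∧ x 0 ≠ -1 ∧ x 1 ≠ -1 ∧ x 0 ≠ x 1 := by
  rw [pointsAt_B, injective_fin_five]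
  simp only [ne_eq, OnePoint.infty_ne_coe, not_false_eq_true,
    OnePoint.coe_eq_coe, true_and, and_true, neg_eq_zero, one_ne_zero]
  constructor
  · rintro ⟨⟨h1, h2⟩, ⟨h3, h4⟩, h5⟩
    exact ⟨fun h => h3 h.symm, fun h => h4 h.symm, fun h => h1 h.symm, fun h => h2 h.symm, h5⟩
  · rintro ⟨h1, h2, h3, h4, h5⟩
    exact ⟨⟨fun h => h3 h.symm, fun h => h4 h.symm⟩, ⟨fun h => h1 h.symm, fun h => h2 h.symm⟩, h5⟩

lemma injective_pointsAt_C {K : Type*} [CommRing K] [Nontrivial K] [Algebra ℝ K] (x : Fin 1 → K) :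
    Function.Injective (pointsAt pointsC x) ↔ x 0 ≠ 0 ∧ x 0 ≠ 1 := by
  rw [pointsAt_C, injective_fin_four]
  simp only [ne_eq, OnePoint.infty_ne_coe, not_false_eq_true,
    OnePoint.coe_eq_coe, true_and, and_true, zero_ne_one]
  exact ⟨fun ⟨h1, h2⟩ => ⟨fun h => h1 h.symm, h2⟩, fun ⟨h1, h2⟩ => ⟨fun h => h1 h.symm, h2⟩⟩

lemma lt_of_not_precedes {n m : ℕ} {w : Fin m → Equiv.Perm (Fin n)} {u : Fin m → ℝ}
    (hu : Function.Injective u)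
    (h : ∀ l l', u l < u l' → Precedes (descents (w l)) (descents (w l'))) {l l' : Fin m}
    (hl : l ≠ l') (hp : ¬ Precedes (descents (w l')) (descents (w l))) : u l < u l' := by
  rcases lt_trichotomy (u l) (u l') with h1 | h1 | h1
  · exact h1
  · exact absurd (hu h1) hl
  · exact absurd (h _ _ h1) hp

lemma injective_chart {m : ℕ} {τ : Fin m → OnePoint ℝ} {g : GL (Fin 2) ℝ} {u : Fin m → ℝ}
    (hτ : Function.Injective τ) (hg : ∀ l, g • τ l = (u l : OnePoint ℝ)) :
    Function.Injective u := by
  intro l l' h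
  apply hτ
  apply MulAction.injective g
  change g • τ l = g • τ l'
  rw [hg, hg, h]

lemma pos_of_div_pos {e y : ℝ} (he : 0 < e) (h : 0 < e / y) : 0 < y := by
  by_contra hc
  exact absurd h (not_lt.mpr (div_nonpos_of_nonneg_of_nonpos he.le (not_lt.mp hc)))

lemma neg_of_div_pos {e y : ℝ} (he : e < 0) (h : 0 < e / y) : y < 0 := by
  by_contra hc
  exact absurd h (not_lt.mpr (div_nonpos_of_nonpos_of_nonneg he.le (not_lt.mp hc)))

theorem isMonotone_A_iff (s t : ℝ) :
    IsMonotone condA (pointsAt pointsA ![s, t]) ↔ 0 < s ∧ s < t := by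
  obtain ⟨d0, d1, d2, d3, d4⟩ := descents_condA
  unfold IsMonotone
  rw [injective_pointsAt_A, pointsAt_A]
  simp only [Matrix.cons_val_zero, Matrix.cons_val_one]
  constructor
  · rintro ⟨hinj, g, u, hg, hu⟩
    have hinj' := (injective_pointsAt_A ![s, t]).mpr hinj
    rw [pointsAt_A] at hinj'
    have hui := injective_chart hinj' hg
    have h01 : u 0 < u 1 := lt_of_not_precedes hui hu (by decide) (by
      rw [d0, d1]; intro h; have := h 2 (by simp) 1 (by simp); omega)
    have h12 : u 1 < u 2 := lt_of_not_precedes hui hu (by decide) (by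
      rw [d1, d2]; intro h; have := h 4 (by simp) 1 (by simp); omega)
    have h23 : u 2 < u 3 := lt_of_not_precedes hui hu (by decide) (by
      rw [d2, d3]; intro h; have := h 5 (by simp) 2 (by simp); omega)
    have h34 : u 3 < u 4 := lt_of_not_precedes hui hu (by decide) (by
      rw [d3, d4]; intro h; have := h 5 (by simp) 4 (by simp); omega)
    obtain ⟨e, x₀, he, hx⟩ := exists_chart g (hg 1)
    obtain ⟨n0, e0⟩ := hx _ _ (hg 0)
    obtain ⟨n2, e2⟩ := hx _ _ (hg 2)
    obtain ⟨n3, e3⟩ := hx _ _ (hg 3)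
    obtain ⟨n4, e4⟩ := hx _ _ (hg 4)
    have k0 : e / (t - x₀) < 0 := by linarith
    have k2 : 0 < e / (-1 - x₀) := by linarith
    have k23 : e / (-1 - x₀) < e / (0 - x₀) := by linarith
    have k34 : e / (0 - x₀) < e / (s - x₀) := by linarith
    have k3 : 0 < e / (0 - x₀) := by linarith
    have k4 : 0 < e / (s - x₀) := by linarith
    rcases lt_or_gt_of_ne he with hneg | hpos
    · have m0 : 0 < t - x₀ := by
        by_contra hc
        exact absurd k0 (not_lt.mpr (div_nonneg_of_nonpos hneg.le (not_lt.mp hc)))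
      have m2 : -1 - x₀ < 0 := neg_of_div_pos hneg k2
      have m3 : 0 - x₀ < 0 := neg_of_div_pos hneg k3
      have m4 : s - x₀ < 0 := neg_of_div_pos hneg k4
      rw [div_lt_div_iff_of_neg m3 m4] at k34
      exact ⟨by nlinarith, by linarith⟩
    · have m2 : 0 < -1 - x₀ := pos_of_div_pos hpos k2
      rw [div_lt_div_iff₀ m2 (by linarith)] at k23
      nlinarith
  · rintro ⟨hs, hst⟩
    refine ⟨⟨hs.ne', (hs.trans hst).ne', by linarith, by linarith, hst.ne⟩, ?_⟩
    obtain ⟨g, g0, gx⟩ := exists_gl_chart (-1) ((s + t) / 2) (by norm_num)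
    have q0 : -1 / (t - (s + t) / 2) < 0 := div_neg_of_neg_of_pos (by norm_num) (by linarith)
    have q2 : 0 < -1 / (-1 - (s + t) / 2) := div_pos_of_neg_of_neg (by norm_num) (by linarith)
    have q23 : -1 / (-1 - (s + t) / 2) < -1 / (0 - (s + t) / 2) := by
      rw [div_lt_div_iff_of_neg (by linarith) (by linarith)]; linarith
    have q34 : -1 / (0 - (s + t) / 2) < -1 / (s - (s + t) / 2) := by
      rw [div_lt_div_iff_of_neg (by linarith) (by linarith)]; linarith
    refine ⟨g, ![-1 / (t - (s + t) / 2), 0, -1 / (-1 - (s + t) / 2), -1 / (0 - (s + t) / 2),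
      -1 / (s - (s + t) / 2)], ?_, ?_⟩
    · intro l
      fin_cases l
      · exact gx _ (by linarith)
      · exact g0
      all_goals exact gx _ (by linarith)
    · intro l l' hl a ha b hb
      fin_cases l <;> fin_cases l' <;>
        simp only [Fin.zero_eta, Fin.mk_one, Fin.reduceFinMk, Matrix.cons_val, d0, d1, d2, d3, d4,
          Set.mem_singleton_iff, Set.mem_insert_iff] at hl ha hb <;>
        first
          | omega
          | (exfalso; linarith)

/-- If `0` and `e / (a - x₀)` both lie below `e / (x - x₀)` and `e / (y - x₀)` for some `y > a`,
then `a < x`. -/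
lemma lt_of_chart {e x₀ a x y : ℝ} (he : e ≠ 0) (ha : a ≠ x₀) (hay : a < y)
    (hx : 0 < e / (x - x₀)) (hy : 0 < e / (y - x₀))
    (hax : e / (a - x₀) < e / (x - x₀)) (hxy : e / (a - x₀) < e / (y - x₀)) : a < x := by
  rcases lt_or_gt_of_ne he with hneg | hpos
  · have h1 := neg_of_div_pos hneg hx
    have h2 := neg_of_div_pos hneg hy
    rw [div_lt_div_iff_of_neg (by linarith) (by linarith)] at hax
    nlinarith
  · have h1 := pos_of_div_pos hpos hx
    have h2 := pos_of_div_pos hpos hy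
    rcases lt_or_gt_of_ne ha with h3 | h3
    · linarith
    · rw [div_lt_div_iff₀ (by linarith) (by linarith)] at hxy
      nlinarith

theorem isMonotone_B_iff (s t : ℝ) : IsMonotone condB (pointsAt pointsB ![s, t]) ↔
      -1 < s ∧ -1 < t ∧ s ≠ 0 ∧ t ≠ 0 ∧ s ≠ t := by
  obtain ⟨d0, d1, d2, d3, d4⟩ := descents_condB
  unfold IsMonotone
  rw [injective_pointsAt_B, pointsAt_B]
  simp only [Matrix.cons_val_zero, Matrix.cons_val_one]
  constructor
  · rintro ⟨hinj, g, u, hg, hu⟩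
    have hinj' := (injective_pointsAt_B ![s, t]).mpr hinj
    rw [pointsAt_B] at hinj'
    have hui := injective_chart hinj' hg
    have key : ∀ l l' : Fin 5, l ≠ l' → descents (condB l) = {2} → descents (condB l') = {3} →
        u l < u l' := fun l l' hl hd hd' => lt_of_not_precedes hui hu hl (by
      rw [hd, hd']; intro h; have := h 3 (by simp) 2 (by simp); omega)
    have h02 := key 0 2 (by decide) d0 d2
    have h03 := key 0 3 (by decide) d0 d3
    have h04 := key 0 4 (by decide) d0 d4
    have h12 := key 1 2 (by decide) d1 d2
    have h13 := key 1 3 (by decide) d1 d3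
    have h14 := key 1 4 (by decide) d1 d4
    obtain ⟨e, x₀, he, hx⟩ := exists_chart g (hg 0)
    obtain ⟨n1, e1⟩ := hx _ _ (hg 1)
    obtain ⟨n2, e2⟩ := hx _ _ (hg 2)
    obtain ⟨n3, e3⟩ := hx _ _ (hg 3)
    obtain ⟨n4, e4⟩ := hx _ _ (hg 4)
    exact ⟨lt_of_chart (y := 0) he n1 (by norm_num) (by linarith) (by linarith) (by linarith)
        (by linarith),
      lt_of_chart (y := 0) he n1 (by norm_num) (by linarith) (by linarith) (by linarith)
        (by linarith), hinj.1, hinj.2.1, hinj.2.2.2.2⟩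
  · rintro ⟨hs, ht, hs0, ht0, hst⟩
    refine ⟨⟨hs0, ht0, hs.ne', ht.ne', hst⟩, ?_⟩
    obtain ⟨x₀, hx₀, hx₁⟩ : ∃ x₀, -1 < x₀ ∧ x₀ < min 0 (min s t) :=
      exists_between (by simp [hs, ht])
    simp only [lt_min_iff] at hx₁
    obtain ⟨g, g0, gx⟩ := exists_gl_chart 1 x₀ (by norm_num)
    have q1 : 1 / (-1 - x₀) < 0 := div_neg_of_pos_of_neg (by norm_num) (by linarith)
    have q2 : 0 < 1 / (0 - x₀) := div_pos (by norm_num) (by linarith)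
    have q3 : 0 < 1 / (s - x₀) := div_pos (by norm_num) (by linarith)
    have q4 : 0 < 1 / (t - x₀) := div_pos (by norm_num) (by linarith)
    refine ⟨g, ![0, 1 / (-1 - x₀), 1 / (0 - x₀), 1 / (s - x₀), 1 / (t - x₀)], ?_, ?_⟩
    · intro l
      fin_cases l
      · exact g0
      all_goals exact gx _ (by linarith)
    · intro l l' hl a ha b hb
      fin_cases l <;> fin_cases l' <;>
        simp only [Fin.zero_eta, Fin.mk_one, Fin.reduceFinMk, Matrix.cons_val, d0, d1, d2, d3, d4,
          Set.mem_singleton_iff] at hl ha hb <;>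
        first
          | omega
          | (exfalso; linarith)

theorem isMonotone_C_iff (s : ℝ) : IsMonotone condC (pointsAt pointsC ![s]) ↔ 0 < s ∧ s ≠ 1 := by
  obtain ⟨d0, d1, d2, d3⟩ := descents_condC
  unfold IsMonotone
  rw [injective_pointsAt_C, pointsAt_C]
  simp only [Matrix.cons_val_fin_one]
  constructor
  · rintro ⟨hinj, g, u, hg, hu⟩
    have hinj' := (injective_pointsAt_C ![s]).mpr hinj
    rw [pointsAt_C] at hinj'
    have hui := injective_chart hinj' hg
    have key : ∀ l l' : Fin 4, l ≠ l' → descents (condC l) = {3} → descents (condC l') = {4} →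
        u l < u l' := fun l l' hl hd hd' => lt_of_not_precedes hui hu hl (by
      rw [hd, hd']; intro h; have := h 4 (by simp) 3 (by simp); omega)
    have h02 := key 0 2 (by decide) d0 d2
    have h03 := key 0 3 (by decide) d0 d3
    have h12 := key 1 2 (by decide) d1 d2
    have h13 := key 1 3 (by decide) d1 d3
    obtain ⟨e, x₀, he, hx⟩ := exists_chart g (hg 0)
    obtain ⟨n1, e1⟩ := hx _ _ (hg 1)
    obtain ⟨n2, e2⟩ := hx _ _ (hg 2)
    obtain ⟨n3, e3⟩ := hx _ _ (hg 3)
    exact ⟨lt_of_chart (y := 1) he n1 (by norm_num) (by linarith) (by linarith) (by linarith)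
        (by linarith), hinj.2⟩
  · rintro ⟨hs, hs1⟩
    refine ⟨⟨hs.ne', hs1⟩, ?_⟩
    obtain ⟨x₀, hx₀, hx₁⟩ : ∃ x₀, 0 < x₀ ∧ x₀ < min s 1 :=
      exists_between (by simp [hs])
    simp only [lt_min_iff] at hx₁
    obtain ⟨g, g0, gx⟩ := exists_gl_chart 1 x₀ (by norm_num)
    have q1 : 1 / (0 - x₀) < 0 := div_neg_of_pos_of_neg (by norm_num) (by linarith)
    have q2 : 0 < 1 / (s - x₀) := div_pos (by norm_num) (by linarith)
    have q3 : 0 < 1 / (1 - x₀) := div_pos (by norm_num) (by linarith)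
    refine ⟨g, ![0, 1 / (0 - x₀), 1 / (s - x₀), 1 / (1 - x₀)], ?_, ?_⟩
    · intro l
      fin_cases l
      · exact g0
      all_goals exact gx _ (by linarith)
    · intro l l' hl a ha b hb
      fin_cases l <;> fin_cases l' <;>
        simp only [Fin.zero_eta, Fin.mk_one, Fin.reduceFinMk, Matrix.cons_val, d0, d1, d2, d3,
          Set.mem_singleton_iff] at hl ha hb <;>
        first
          | omega
          | (exfalso; linarith)

/-! ### Cones of polynomials -/

/-- The non-negative combinations of products of the `g i`, as a subsemiring. -/
noncomputable def nonnegSubsemiring {l p : ℕ} (g : Fin l → MvPolynomial (Fin p) ℝ) :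
    Subsemiring (MvPolynomial (Fin p) ℝ) where
  carrier := nonnegCombinations g
  zero_mem' := ⟨0, by simp, by simp⟩
  one_mem' := ⟨1, fun e => by
    classical
    rw [coeff_one]
    split_ifs <;> norm_num, by simp⟩
  add_mem' := by
    rintro _ _ ⟨c, hc, rfl⟩ ⟨d, hd, rfl⟩
    exact ⟨c + d, fun e => by rw [coeff_add]; exact add_nonneg (hc e) (hd e), by simp⟩
  mul_mem' := by
    classical
    rintro _ _ ⟨c, hc, rfl⟩ ⟨d, hd, rfl⟩
    refine ⟨c * d, fun e => ?_, by simp⟩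
    rw [coeff_mul]
    exact Finset.sum_nonneg fun q _ => mul_nonneg (hc _) (hd _)

lemma generator_mem_nonneg {l p : ℕ} (g : Fin l → MvPolynomial (Fin p) ℝ) (i : Fin l) :
    g i ∈ nonnegSubsemiring g :=
  ⟨X i, fun e => by
    classical
    rw [coeff_X]
    split_ifs <;> norm_num, by simp⟩

lemma mul_prod_mem_preorder {l p : ℕ} (g : Fin l → MvPolynomial (Fin p) ℝ)
    {q : MvPolynomial (Fin p) ℝ} (hq : IsSumSq q) (ε : Finset (Fin l)) :
    q * ∏ i ∈ ε, g i ∈ generatedPreorder g := by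
  classical
  refine ⟨Pi.single ε q, fun ε' => ?_, ?_⟩
  · by_cases h : ε' = ε
    · subst h; simp [hq]
    · simp [h]
  · rw [Finset.sum_eq_single ε]
    · simp
    · intro b _ hb; simp [hb]
    · simp

lemma add_mem_preorder {l p : ℕ} {g : Fin l → MvPolynomial (Fin p) ℝ}
    {f f' : MvPolynomial (Fin p) ℝ} (hf : f ∈ generatedPreorder g)
    (hf' : f' ∈ generatedPreorder g) : f + f' ∈ generatedPreorder g := by
  obtain ⟨c, hc, rfl⟩ := hf
  obtain ⟨d, hd, rfl⟩ := hf'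
  exact ⟨c + d, fun ε => (hc ε).add (hd ε), by
    simp [add_mul, Finset.sum_add_distrib]⟩

lemma isSumSq_C {p : ℕ} {r : ℝ} (hr : 0 ≤ r) : IsSumSq (C r : MvPolynomial (Fin p) ℝ) := by
  rw [← Real.mul_self_sqrt hr, C_mul]
  exact IsSumSq.mul_self _

lemma isSumSq_sq {R : Type*} [CommRing R] (x : R) : IsSumSq (x^2) := by
  rw [sq]; exact IsSumSq.mul_self x

lemma isSumSq_ofNat {R : Type*} [CommRing R] (n : ℕ) [n.AtLeastTwo] :
    IsSumSq (OfNat.ofNat n : R) := by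
  exact Subsemiring.mem_sumSq.mp (ofNat_mem (Subsemiring.sumSq R) n)

lemma IsSumSq.mul' {R : Type*} [CommRing R] {x y : R} (hx : IsSumSq x) (hy : IsSumSq y) :
    IsSumSq (x * y) :=
  Subsemiring.mem_sumSq.mp (mul_mem (Subsemiring.mem_sumSq.mpr hx) (Subsemiring.mem_sumSq.mpr hy))

lemma IsSumSq.add' {R : Type*} [CommRing R] {x y : R} (hx : IsSumSq x) (hy : IsSumSq y) :
    IsSumSq (x + y) :=
  hx.add hy

/-! ### Squarefree polynomials -/

lemma separable_of_bezout {f : Polynomial ℝ} (u v : Polynomial ℝ) (N : ℕ) (hN : N ≠ 0)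
    (h : u * f + v * Polynomial.derivative f = N) : f.Separable := by
  refine ⟨Polynomial.C ((N : ℝ)⁻¹) * u, Polynomial.C ((N : ℝ)⁻¹) * v, ?_⟩
  rw [mul_assoc, mul_assoc, ← mul_add, h, ← Polynomial.C_eq_natCast, ← Polynomial.C_mul,
    inv_mul_cancel₀ (Nat.cast_ne_zero.mpr hN), Polynomial.C_1]

lemma natDegree_aeval_le {p : ℕ} (f : MvPolynomial (Fin p) ℝ) (L : Fin p → Polynomial ℝ)
    (hL : ∀ i, (L i).natDegree ≤ 1) : (aeval L f).natDegree ≤ f.totalDegree := by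
  rw [aeval_def, eval₂_eq]
  refine Polynomial.natDegree_sum_le_of_forall_le _ _ fun d hd => ?_
  refine (Polynomial.natDegree_C_mul_le _ _).trans ?_
  refine (Polynomial.natDegree_prod_le _ _).trans ?_
  refine (Finset.sum_le_sum fun i _ => Polynomial.natDegree_pow_le).trans ?_
  refine (Finset.sum_le_sum fun i _ => Nat.mul_le_mul_left _ (hL i)).trans ?_
  simp only [mul_one]
  exact le_totalDegree hd

/-- A polynomial is squarefree if its restriction to some line is squarefree and of the same
degree. -/
lemma squarefree_of_line {p : ℕ} {f : MvPolynomial (Fin p) ℝ} (L : Fin p → Polynomial ℝ)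
    (hL : ∀ i, (L i).natDegree ≤ 1) (hd : f.totalDegree ≤ (aeval L f).natDegree)
    (hs : Squarefree (aeval L f)) : Squarefree f := by
  rintro q ⟨r, hr⟩
  have hf0 : aeval L f ≠ 0 := hs.ne_zero
  have hf : f ≠ 0 := by rintro rfl; simp at hf0
  have hq : q ≠ 0 := by rintro rfl; simp at hr; exact hf hr
  have hr0 : r ≠ 0 := by rintro rfl; simp at hr; exact hf hr
  have hu : IsUnit (aeval L q) := hs _ ⟨aeval L r, by rw [hr, map_mul, map_mul]⟩
  have h1 := natDegree_aeval_le (q * r) L hL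
  have h2 : f.totalDegree = q.totalDegree + (q * r).totalDegree := by
    rw [hr, mul_assoc, totalDegree_mul_of_isDomain hq (mul_ne_zero hq hr0)]
  have h3 : (aeval L f).natDegree ≤ (aeval L q).natDegree + (aeval L (q * r)).natDegree := by
    rw [hr, mul_assoc, map_mul]
    exact Polynomial.natDegree_mul_le
  have h4 : (aeval L q).natDegree = 0 := Polynomial.natDegree_eq_zero_of_isUnit hu
  have h5 : q.totalDegree = 0 := by omega
  rw [totalDegree_eq_zero_iff_eq_C] at h5
  rw [h5] at hq ⊢
  refine (isUnit_iff_ne_zero.mpr fun h0 => hq ?_).map C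
  rw [h0, C_0]

/-- A polynomial has no factor in common with a linear polynomial on whose zero set it does not
vanish identically. -/
lemma isRelPrime_of_linear {p : ℕ} {f g : MvPolynomial (Fin p) ℝ} (hg : g ≠ 0)
    (hd : g.totalDegree ≤ 1) (x : Fin p → ℝ) (hx : eval x g = 0) (hf : eval x f ≠ 0) :
    IsRelPrime f g := by
  rintro q ⟨a, ha⟩ ⟨b, hb⟩
  have hq : q ≠ 0 := by rintro rfl; simp at hb; exact hg hb
  have hb0 : b ≠ 0 := by rintro rfl; simp at hb; exact hg hb
  have h2 : g.totalDegree = q.totalDegree + b.totalDegree := by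
    rw [hb, totalDegree_mul_of_isDomain hq hb0]
  rcases Nat.eq_zero_or_pos q.totalDegree with h | h
  · rw [totalDegree_eq_zero_iff_eq_C] at h
    rw [h] at hq ⊢
    refine (isUnit_iff_ne_zero.mpr fun h0 => hq ?_).map C
    rw [h0, C_0]
  · have h3 : b.totalDegree = 0 := by omega
    rw [totalDegree_eq_zero_iff_eq_C] at h3
    exfalso
    apply hf
    have hq0 : eval x q = 0 := by
      rw [hb, map_mul, mul_eq_zero] at hx
      refine hx.resolve_right fun h4 => hb0 ?_
      rw [h3, eval_C] at h4
      rw [h3, h4, C_0]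
    rw [ha, map_mul, hq0, zero_mul]

lemma isRelPrime_one_right' {p : ℕ} (f g : MvPolynomial (Fin p) ℝ) (r : ℝ) (hr : r ≠ 0)
    (hg : g = C r) : IsRelPrime f g := by
  rw [hg]
  exact ((isUnit_iff_ne_zero.mpr hr).map C).isRelPrime_right

lemma totalDegree_add_le_of {p n : ℕ} {f g : MvPolynomial (Fin p) ℝ} (hf : f.totalDegree ≤ n)
    (hg : g.totalDegree ≤ n) : (f + g).totalDegree ≤ n :=
  (totalDegree_add f g).trans (max_le hf hg)

lemma totalDegree_sub_le_of {p n : ℕ} {f g : MvPolynomial (Fin p) ℝ} (hf : f.totalDegree ≤ n)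
    (hg : g.totalDegree ≤ n) : (f - g).totalDegree ≤ n :=
  (totalDegree_sub f g).trans (max_le hf hg)

lemma totalDegree_mul_le_of {p n m k : ℕ} {f g : MvPolynomial (Fin p) ℝ} (hf : f.totalDegree ≤ n)
    (hg : g.totalDegree ≤ m) (h : n + m ≤ k) : (f * g).totalDegree ≤ k :=
  (totalDegree_mul f g).trans (by omega)

lemma totalDegree_pow_le_of {p n m k : ℕ} {f : MvPolynomial (Fin p) ℝ} (hf : f.totalDegree ≤ n)
    (h : m * n ≤ k) : (f^m).totalDegree ≤ k :=
  (totalDegree_pow f m).trans ((Nat.mul_le_mul_left m hf).trans h)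

lemma totalDegree_ofNat_le {p : ℕ} (n : ℕ) [n.AtLeastTwo] :
    (OfNat.ofNat n : MvPolynomial (Fin p) ℝ).totalDegree ≤ 0 := by
  rw [← map_ofNat (C : ℝ →+* MvPolynomial (Fin p) ℝ), totalDegree_C]


lemma expand_line_A {R : Type*} [CommRing R] (x : R) : polyA (2*x) x =
      40000*x^8 + 208000*x^7 + 484960*x^6 + 661600*x^5 + 577764*x^4 + 330800*x^3 + 121240*x^2 +
      26000*x + 2500 := by
  simp only [polyA]
  ring

open Polynomial in
lemma separable_line_A {x : Polynomial ℝ} (hx : derivative x = 1) :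
    (polyA (2*x) x : Polynomial ℝ).Separable := by
  rw [expand_line_A]
  refine separable_of_bezout
    (4561152662960000*x^6 + 17253068564468000*x^5 + 28171674557695280*x^4 + 25328082969013000*x^3
    + 13226709038970268*x^2 + 3798338499783100*x + 468387320074440)
    (-570144082870000*x^7 - 2527227224424000*x^6 - 4965176730665880*x^5 - 5589311640863800*x^4 -
    3894162272287567*x^3 - 1678038341523250*x^2 - 413588630894345*x - 45037166645250)
    1967409600000 (by norm_num) ?_
  simp only [derivative_add, derivative_mul, derivative_ofNat, derivative_pow, hx, Nat.cast_ofNat,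
    map_ofNat]
  ring

lemma natDegree_line_A {x : Polynomial ℝ} (hx : x = Polynomial.X) :
    (polyA (2*x) x : Polynomial ℝ).natDegree = 8 := by
  rw [expand_line_A, hx]
  compute_degree!

lemma expand_line_B {R : Type*} [CommRing R] (x : R) : (x - 1 + x + 2) * polyB x (x - 1 - x) =
      1600*x^10 + 5120*x^9 + 7344*x^8 + 11776*x^7 + 18864*x^6 + 20864*x^5 + 18880*x^4 + 14624*x^3
      + 7568*x^2 + 2080*x + 225 := by
  simp only [polyB]
  ring

open Polynomial in
lemma separable_line_B {x : Polynomial ℝ} (hx : derivative x = 1) :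
    ((x - 1 + x + 2) * polyB x (x - 1 - x) : Polynomial ℝ).Separable := by
  rw [expand_line_B]
  refine separable_of_bezout
    (-291170050928327471733450051016000*x^8 - 693920276324714984137941445046080*x^7 -
    724452768287577895811389699116352*x^6 - 1140222070497794091446212347047072*x^5 -
    1493299932738688448182595104125824*x^4 - 1156598298946702534828003710043200*x^3 -
    799763433076841102189072377090720*x^2 - 401091139612769582398930966058272*x -
    76201150171684786999011353781776)
    (29117005092832747173345005101600*x^9 + 78709469262177977509264546137120*x^8 +
    94545904452814471183729054134744*x^7 + 167333471025000008859167743638856*x^6 +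
    260161852528474968424708150813984*x^5 + 250443928993948744027934571878244*x^4 +
    219167813783259403836362319072010*x^3 + 157253296700135302865018400346974*x^2 +
    59605352050795145036292338184998*x + 8242915334587976435135770335915)
    5107313913910304847697803600 (by norm_num) ?_
  simp only [derivative_add, derivative_mul, derivative_ofNat, derivative_pow, hx, Nat.cast_ofNat,
    map_ofNat]
  ring

lemma natDegree_line_B {x : Polynomial ℝ} (hx : x = Polynomial.X) :
    ((x - 1 + x + 2) * polyB x (x - 1 - x) : Polynomial ℝ).natDegree = 10 := by
  rw [expand_line_B, hx]
  compute_degree!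

lemma expand_line_C {R : Type*} [CommRing R] (x : R) : polyC x =
      648000*x^16 + 13608000*x^15 + 114976512*x^14 + 502841664*x^13 + 1219267456*x^12 +
      1603852544*x^11 + 909742337*x^10 - 270850680*x^9 - 704316688*x^8 - 85932812*x^7 +
      932192307*x^6 + 1409348710*x^5 + 1129836575*x^4 + 608839000*x^3 + 221792500*x^2 + 45243750*x
      + 3515625 := by
  simp only [polyC]
  ring

open Polynomial in
/-- An integral polynomial that is separable modulo a prime not dividing the leading coefficient
is separable. -/
lemma separable_map_of_bezout_mod {f : ℤ[X]} {p : ℤ} (hp : Prime p) (hf : ¬ p ∣ f.leadingCoeff)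
    (u v w : ℤ[X]) (h : u * f + v * derivative f = 1 + (p : ℤ[X]) * w) :
    (f.map (Int.castRingHom ℝ)).Separable := by
  refine (isCoprime_iff_aeval_ne_zero_of_isAlgClosed ℝ ℂ _ _).mpr fun α => ?_
  by_contra! hα
  obtain ⟨h0, h1⟩ := hα
  rw [derivative_map] at h1
  have hmap : ∀ q : ℤ[X], aeval α (q.map (Int.castRingHom ℝ)) = aeval α q := fun q =>
    aeval_map_algebraMap ℝ α q
  rw [hmap] at h0 h1
  have hw : (p : ℂ) * aeval α w = -1 := by
    have := congrArg (Polynomial.aeval α) h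
    simp only [_root_.map_add, _root_.map_mul, h0, h1, mul_zero, add_zero, _root_.map_one,
      map_intCast] at this
    linear_combination -this
  set b := (algebraMap ℤ ℂ) f.leadingCoeff * α with hb
  have hbi : IsIntegral ℤ b := by
    have := isIntegral_leadingCoeff_smul f α h0
    rwa [Algebra.smul_def] at this
  have hz : IsIntegral ℤ (aeval b (scaleRoots w f.leadingCoeff)) :=
    adjoin_le_integralClosure hbi (aeval_mem_adjoin_singleton ℤ b)
  have hz' : aeval b (scaleRoots w f.leadingCoeff) =
      (f.leadingCoeff : ℂ)^w.natDegree * aeval α w := by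
    rw [Polynomial.aeval_def, hb, scaleRoots_eval₂_mul, ← Polynomial.aeval_def]
    simp
  have hp0 : (p : ℂ) ≠ 0 := Int.cast_ne_zero.mpr hp.ne_zero
  rw [hz', show (f.leadingCoeff : ℂ)^w.natDegree * aeval α w =
    algebraMap ℚ ℂ (-(f.leadingCoeff^w.natDegree : ℤ) / p) by
      rw [eq_ratCast]
      push_cast
      field_simp
      linear_combination (f.leadingCoeff : ℂ)^w.natDegree * hw,
    isIntegral_algebraMap_iff (algebraMap ℚ ℂ).injective, IsIntegrallyClosed.isIntegral_iff] at hz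
  obtain ⟨y, hy⟩ := hz
  rw [eq_intCast] at hy
  have hpQ : (p : ℚ) ≠ 0 := Int.cast_ne_zero.mpr hp.ne_zero
  rw [eq_div_iff hpQ] at hy
  refine hf (hp.dvd_of_dvd_pow (n := w.natDegree) ⟨-y, ?_⟩)
  have : y * p = -f.leadingCoeff^w.natDegree := by exact_mod_cast hy
  linear_combination this

open Polynomial in
lemma separable_polyC : (polyC Polynomial.X : ℝ[X]).Separable := by
  obtain ⟨x, hx⟩ : ∃ x : ℤ[X], x = Polynomial.X := ⟨_, rfl⟩
  have hd : (polyC x : ℤ[X]).natDegree = 16 := by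
    rw [expand_line_C, hx]
    compute_degree!
  have hl : (polyC x : ℤ[X]).leadingCoeff = 648000 := by
    rw [leadingCoeff, hd, expand_line_C, hx]
    compute_degree!
  have := separable_map_of_bezout_mod (f := polyC x) (p := 7) (by norm_num [Int.prime_iff_natAbs_prime])
    (by rw [hl]; norm_num)
    (2*x^14 - 3*x^13 + 3*x^12 + 3*x^10 + x^9 + x^8 + 3*x^7 + x^6 + 2*x^4 - 3*x^3 + x^2 + x + 1)
    (-x^15 - 2*x^14 + 2*x^13 + 2*x^12 + 3*x^11 + 3*x^9 - 2*x^8 - 2*x^7 - x^6 + 2*x^5 + 3*x^4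
      - 3*x^3 - x^2)
    (-1296000*x^30 - 28512000*x^29 - 258014592*x^28 - 1232247168*x^27 - 3252788992*x^26
      - 4128473088*x^25 + 548450760*x^24 + 10310302279*x^23 + 16961907513*x^22 + 14587268056*x^21
      + 5908741815*x^20 - 3278051494*x^19 - 8564240864*x^18 - 5671753956*x^17 + 5279851063*x^16
      + 14317608489*x^15 + 10648433694*x^14 - 2090871022*x^13 - 8929149682*x^12 - 4721730908*x^11
      + 2229422119*x^10 + 4238892618*x^9 + 1390203730*x^8 - 1416688141*x^7 - 1741620569*x^6
      - 857788645*x^5 - 169967525*x^4 + 40858875*x^3 + 32186875*x^2 + 6965625*x + 502232) (by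
    rw [expand_line_C, Int.cast_ofNat]
    simp only [derivative_add, derivative_sub, derivative_mul, derivative_ofNat, derivative_pow,
      hx, derivative_X, Nat.cast_ofNat, map_ofNat]
    ring)
  simpa [polyC, hx] using this

lemma natDegree_line_C {x : Polynomial ℝ} (hx : x = Polynomial.X) :
    (polyC x : Polynomial ℝ).natDegree = 16 := by
  rw [expand_line_C, hx]
  compute_degree!

lemma totalDegree_mul_le_add {p n m : ℕ} {f g : MvPolynomial (Fin p) ℝ} (hf : f.totalDegree ≤ n)
    (hg : g.totalDegree ≤ m) : (f * g).totalDegree ≤ n + m :=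
  totalDegree_mul_le_of hf hg le_rfl

lemma totalDegree_pow_le_mul {p n m : ℕ} {f : MvPolynomial (Fin p) ℝ} (hf : f.totalDegree ≤ n) :
    (f^m).totalDegree ≤ m * n :=
  totalDegree_pow_le_of hf le_rfl

lemma totalDegree_X_le {p : ℕ} (i : Fin p) : (X i : MvPolynomial (Fin p) ℝ).totalDegree ≤ 1 :=
  (totalDegree_X i).le

/-! ### Certificates for the second discriminant -/

/-- A sum of squares. -/
def sosFree {R : Type*} [CommRing R] (a b : R) : R :=

  9917430885405557657166062612378919589286175093741391443875772778177235170315432285951624101382606368934180285700296919695254134798409854760000*(-1164*a^3*b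
  + 160*a^3 + 3064*a^2*b^2 - 751*a^2*b - 48*a^2 - 1164*a*b^3 - 751*a*b^2 + 542*a*b + 160*b^3 -
  48*b^2)^2 +
  9197257992795677705771070480541109121727543272847605398367409511220162765303845288338828790592817017975634200869604294614087260072920000*(-530996*a^3*b
  - 39168*a^3 + 1078303*a^2*b + 86512*a^2 - 530996*a*b^3 + 1078303*a*b^2 - 1189302*a*b - 39168*b^3
  + 86512*b^2)^2 +
  16737321748589415926205110929888486259820196659564727656710234904144747106470093203808115326935996147190335011326764448362967485696000*(2067365*a^3*b
  - 3361036*a^3 + 6734745*a^2 + 2067365*a*b^3 - 10882148*a*b - 3361036*b^3 + 6734745*b^2)^2 +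
  12121839814268634345713877747313605507126452871193770146193344926769536219728332406646563466631561046766034632671435872697931611940864*(7444375*a^3*b
  - 3261101*a^3 + 7444375*a*b^3 - 8366548*a*b - 3261101*b^3)^2 +
  386400917080897732243204148336514842887299424894261361074378969802054159997426684349228334299110262285156438360285836010954976565155259268215822336*(a^3
  - 2*a*b + b^3)^2 +
  185853261363196505575271044919443483923992908178737757700522127170244945332394400759362545850986580516295586516120549002729410819708426880640000*(-189*a^3*b
  - 11*a^3 + 654*a^2*b - 19*a^2 + 189*a*b^3 - 654*a*b^2 + 11*b^3 + 19*b^2)^2 +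
  66637956745498926344665129049639112199352064603348066583191870623967352216706490053554157709209960744458797603485316960462320121802949760000*(8367*a^3*b
  - 1783*a^3 + 111*a^2 - 8367*a*b^3 + 1783*b^3 - 111*b^2)^2 +
  319087015848150898217255653410532792836311421431894886883296237310274843131372917865767706648972509550201372318839350218129588739715840000*(-26867*a^3
  + 45527*a^2 + 26867*b^3 - 45527*b^2)^2 +
  386171594687971466104226320491934313912417316936979772176353057957734227384123137743038591137321651894759967011367824049629915230518615826830080000*(a^3
  - b^3)^2

/-- A sum of squares. -/
def sosLeft {R : Type*} [CommRing R] (a b : R) : R :=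

  238329476336334342443582869367286349973120317546851948110081316018314106367423408032594323503029850309131987414789880485853009168802570941056000*(43*a^3*b
  - 7*a^3 - 78*a^2*b^2 - 251*a^2*b + 34*a^2 - 40*a*b^3 + 510*a*b^2 - 87*a*b - 33*b^3 - 122*b^2 +
  31*b)^2 +
  12700293603726717717298410361153508178399576400883809871400677621453049347252433062113131614634697247231574724130409106303338144242281344000*(-793*a^3*b
  + 2517*a^3 + 19668*a^2*b^2 - 40599*a^2*b - 5644*a^2 - 12720*a*b^3 + 56297*a*b + 170*a +
  19613*b^3 - 38898*b^2 + 389*b)^2 +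
  251946366439233324315837518019769697349641509747763673308939046899409688143879462729271304783974735447887188001473651233282383758250*(-49170000*a^3*b
  + 5867152*a^3 + 267796320*a^2*b^2 - 126023424*a^2*b + 9095432*a^2 - 163895776*a*b^3 - 3500523*a
  + 48004512*b^3 + 7708960*b^2 + 4117347*b)^2 +
  326952623790591540195599584448748123668730789031492932647999400083754459393332321634875416680119106678909278065732151719993036875*(420382864*a^3*b
  - 28828080*a^3 - 3162068480*a^2*b + 377523096*a^2 + 1518487168*a*b^3 + 40002255*a -
  4389006528*b^3 + 6941103296*b^2 - 1717595591*b)^2 +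
  298787792044300675819053050777740746764619583402715523144244635318730606109177009628235735015190897009351966111095594065648000*(-30811805960*a^3*b
  + 11451868042*a^3 + 125030307016*a^2*b - 44321351458*a^2 - 14782688826*a*b^3 - 2775402483*a -
  41751860508*b^3 - 2039065823*b)^2 +
  103433948405874911758700383780557901157811026772562869479407704486026395471975115537313243319764816694485261841074101617500*(525328194192*a^3*b
  - 89992515336*a^3 - 57639564960*a^2 - 3701512977688*a*b^3 + 78106332137*a + 4699368897056*b^3 -
  1453658365401*b)^2 +
  9535847697944093502558413099433426252403198180621286212613940096715759093799124284022263433284115650876672683243141875*(3180636183984*a^3*b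
  - 136734891499792*a^3 + 339046373607976*a^2 - 40561320258048*a*b^3 - 34697207062655*a -
  130233590971465*b)^2 +
  2447902884340504059984043543254863050290901379056623007107276856839247890929652638974680487874929136514377343941100*(-11005755991564496*a^3*b
  + 1640509716159800*a^3 + 18306472191136200*a*b^3 - 9996864525715177*a + 1055638609983673*b)^2 +
  5944617365595199213895093423766716816282165039749565119399114808384836389757172342702979463390504620217027262850*(279228264777325792*a^3*b
  - 92654378385794800*a^3 - 171362483794222621*a - 15211402597308371*b)^2 +
  2508592522831066745815592000029745236722328674587893637691736870579989715535732710925615442261876616202919251250*(260285330917114416*a^3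
  - 124885010234587237*a - 135400320682527179*b)^2 +
  70250191263752256410891909534990662085691276710615029748492755615651497814303494155046378787518279062618700028638926834491993738611362403365887500*(-a
  + b)^2

/-- A sum of squares. -/
def sosMixed {R : Type*} [CommRing R] (a b : R) : R :=

  679039290120282204727526611046458315565873530440751360537103190890168682946290156964374888192990076299761528388507480713882875285415146256640000*(31*a^3
  - 65*a^2*b - 128*a^2 - 65*a*b^2 + 358*a*b - 17*a + 31*b^3 - 128*b^2 - 17*b)^2 +
  49608364269453697013992300631681641990493390593275230898385680222835233996660590076298574531925049408223372909739003558875137002148973280000*(-1581*a^3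
  - 5814*a^2*b + 13688*a^2 - 5814*a*b^2 - 6293*a - 1581*b^3 + 13688*b^2 - 6293*b)^2 +
  270291821271488502283037220743037589148580553258340679110310679690972114735404548250005930697792708248013385409042755213790202519851040000*(-44449*a^3
  + 65706*a^2*b + 65706*a*b^2 - 21257*a - 44449*b^3 - 21257*b)^2 +
  269549310177444591820093553118976571392482983780740182664265760311492076586234131006835690405738861437381098782360365314139545440634427763845120000*(a^3
  - a + b^3 - b)^2 +
  230641428712581621719596325194148080619148694400179304622659338082239457774925878741220313067448242234643858788506335954051299195615391233280000*(-31*a^3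
  + 527*a^2*b - 170*a^2 - 527*a*b^2 + 67*a + 31*b^3 + 170*b^2 - 67*b)^2 +
  1002532418336458084692696887829331979167866991767590943130966184453610529832201467297556973190135545381985578983535594788768112075034940160000*(-806*a^3
  + 3911*a^2 - 2647*a + 806*b^3 - 3911*b^2 + 2647*b)^2 +
  659522898565808243139880745450989178172949583983911095199790973771327539682104973386170127762907893723797727169873247489338080365120000*(-376041*a^3
  + 2771924*a + 376041*b^3 - 2771924*b)^2 +
  613935820172376187949977594181473961173256211677514336676827753406637529405839047792870831489783214473557655718158107971589810255226920384630720000*(a^3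
  - b^3)^2

lemma polyB_eq_sos {R : Type*} [CommRing R] (a b : R) :
    15193504116441314330778407922164504810786420243611811692017683896167524280923242262077888123318152957207164197692854880973129334511163897492320000*polyB (b - 1) (a - b) =
      sosFree a b + a * sosLeft a b + b * sosLeft b a + a * b * sosMixed a b := by
  simp only [polyB, sosFree, sosLeft, sosMixed]
  ring

/-- A polynomial with non-negative coefficients. -/
def polyBMixed {R : Type*} [CommRing R] (s x y : R) : R :=
  324*s^8*x^2 + 216*s^8*x*y + 36*s^8*y^2 + 2916*s^7*x^3 + 4212*s^7*x^2*y + 1980*s^7*x*y^2 +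
  300*s^7*y^3 + 11313*s^6*x^4 + 26208*s^6*x^3*y + 22434*s^6*x^2*y^2 + 8424*s^6*x*y^3 +
  1141*s^6*y^4 + 24948*s^5*x^5 + 82962*s^5*x^4*y + 108420*s^5*x^3*y^2 + 69680*s^5*x^2*y^3 +
  21960*s^5*x*y^4 + 2654*s^5*y^5 + 33732*s^4*x^6 + 153084*s^4*x^5*y + 281647*s^4*x^4*y^2 +
  268800*s^4*x^3*y^3 + 141002*s^4*x^2*y^4 + 38412*s^4*x*y^5 + 4171*s^4*y^6 + 26496*s^3*x^7 +
  163632*s^3*x^6*y + 411952*s^3*x^5*y^2 + 548900*s^3*x^4*y^3 + 422948*s^3*x^3*y^4 +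
  189612*s^3*x^2*y^5 + 45612*s^3*x*y^6 + 4480*s^3*y^7 + 9216*s^2*x^8 + 87424*s^2*x^7*y +
  315032*s^2*x^6*y^2 + 583808*s^2*x^5*y^3 + 630487*s^2*x^4*y^4 + 414712*s^2*x^3*y^5 +
  163358*s^2*x^2*y^6 + 35136*s^2*x*y^7 + 3131*s^2*y^8 + 14336*s*x^7*y + 86656*s*x^6*y^2 +
  197040*s*x^5*y^3 + 236428*s*x^4*y^4 + 164894*s*x^3*y^5 + 66774*s*x^2*y^6 + 14426*s*x*y^7 +
  1270*s*y^8 + 9216*x^6*y^2 + 28800*x^5*y^3 + 39492*x^4*y^4 + 29340*x^3*y^5 + 12141*x^2*y^6 +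
  2610*x*y^7 + 225*y^8

/-- A polynomial with non-negative coefficients. -/
def polyBNeg {R : Type*} [CommRing R] (x y z : R) : R :=
  9216*x^8*y^2 + 4096*x^8*y*z + 4096*x^8*z^2 + 47232*x^7*y^3 + 40704*x^7*y^2*z + 27136*x^7*y*z^2
  + 7168*x^7*z^3 + 106308*x^6*y^4 + 141536*x^6*y^3*z + 101792*x^6*y^2*z^2 + 40576*x^6*y*z^3 +
  7744*x^6*z^4 + 137124*x^5*y^5 + 252152*x^5*y^4*z + 221176*x^5*y^3*z^2 + 109904*x^5*y^2*z^3 +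
  32352*x^5*y*z^4 + 3648*x^5*z^5 + 110313*x^4*y^6 + 260556*x^4*y^5*z + 278572*x^4*y^4*z^2 +
  166088*x^4*y^3*z^3 + 59344*x^4*y^2*z^4 + 10848*x^4*y*z^5 + 576*x^4*z^6 + 56232*x^3*y^7 +
  161956*x^3*y^6*z + 205576*x^3*y^5*z^2 + 143712*x^3*y^4*z^3 + 58888*x^3*y^3*z^4 +
  13264*x^3*y^2*z^5 + 1152*x^3*y*z^6 + 17586*x^2*y^8 + 59488*x^2*y^7*z + 87366*x^2*y^6*z^2 +
  70152*x^2*y^5*z^3 + 32332*x^2*y^4*z^4 + 8184*x^2*y^3*z^5 + 864*x^2*y^2*z^6 + 3060*x*y^9 +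
  11844*x*y^8*z + 19728*x*y^7*z^2 + 17892*x*y^6*z^3 + 9180*x*y^5*z^4 + 2520*x*y^4*z^5 +
  288*x*y^3*z^6 + 225*y^10 + 980*y^9*z + 1826*y^8*z^2 + 1848*y^7*z^3 + 1049*y^6*z^4 + 308*y^5*z^5
  + 36*y^4*z^6

lemma polyB_eq_mixed {R : Type*} [CommRing R] (s t : R) :
    (s + t + 2) * polyB t (s - t) = polyBMixed s (1 + t) (-t) := by
  simp only [polyB, polyBMixed]
  ring

lemma polyB_eq_neg {R : Type*} [CommRing R] (s t : R) :
    (s + t + 2) * polyB t (s - t) = polyBNeg (1 + t) (s - t) (-s) := by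
  simp only [polyB, polyBNeg]
  ring

lemma polyB_symm {R : Type*} [CommRing R] (s t : R) :
    (t + s + 2) * polyB s (t - s) = (s + t + 2) * polyB t (s - t) := by
  simp only [polyB]
  ring

/-! ### Positivity of the discriminants -/

theorem discA_mem_nonneg : discA ∈ nonnegCombinations ![X 0, X 1] := by
  change discA ∈ nonnegSubsemiring _
  have h0 : (X 0 : MvPolynomial (Fin 2) ℝ) ∈ nonnegSubsemiring ![X 0, X 1] :=
    generator_mem_nonneg ![X 0, X 1] 0
  have h1 : (X 1 : MvPolynomial (Fin 2) ℝ) ∈ nonnegSubsemiring ![X 0, X 1] :=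
    generator_mem_nonneg ![X 0, X 1] 1
  simp only [discA, polyA]
  repeat' first
    | with_reducible exact h0
    | with_reducible exact h1
    | with_reducible apply add_mem
    | with_reducible apply mul_mem
    | with_reducible apply pow_mem
    | apply ofNat_mem

theorem discA_pos (s t : ℝ) (hs : 0 < s) (ht : 0 < t) : 0 < eval ![s, t] discA := by
  simp only [discA, polyA, map_add, map_mul, map_pow, eval_X, map_ofNat, Matrix.cons_val_zero,
    Matrix.cons_val_one]
  positivity

theorem discA_mem_preorder :
    discA ∈ generatedPreorder ![X 0, X 1, 1 + X 0, 1 + X 1, X 1 - X 0] := by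
  set g : Fin 5 → MvPolynomial (Fin 2) ℝ := ![X 0, X 1, 1 + X 0, 1 + X 1, X 1 - X 0] with hg
  set s : MvPolynomial (Fin 2) ℝ := X 0
  set t : MvPolynomial (Fin 2) ℝ := X 1
  have e : discA =
      (((2500*(s^2*t^2)^2 + 50000*(s*t^2)^2 + 2260*(s^2*t)^2 + 32000*(t^2)^2 + 63905*(s*t)^2
        + 9*(s^2)^2 + 50000*t^2 + 2260*s^2 + 2500*1^2) * ∏ i ∈ (∅ : Finset (Fin 5)), g i
      + (18000*(s*t^2)^2 + 64000*(t^2)^2 + 20040*(s*t)^2 + 91400*t^2 + 480*s^2 + 4000*1^2)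
        * ∏ i ∈ ({0} : Finset (Fin 5)), g i)
      + (4000*(s^2*t)^2 + 91400*(s*t)^2 + 480*(s^2)^2 + 64000*t^2 + 20040*s^2 + 18000*1^2)
        * ∏ i ∈ ({1} : Finset (Fin 5)), g i)
      + (31100*(s*t)^2 + 122800*t^2 + 5550*s^2 + 31100*1^2)
        * ∏ i ∈ ({0, 1} : Finset (Fin 5)), g i := by
    rw [Finset.prod_empty, Finset.prod_singleton, Finset.prod_singleton,
      Finset.prod_pair (by decide)]
    simp only [hg, Matrix.cons_val_zero, Matrix.cons_val_one, discA, polyA]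
    ring
  rw [e]
  refine add_mem_preorder (add_mem_preorder (add_mem_preorder
    (mul_prod_mem_preorder g ?_ _) (mul_prod_mem_preorder g ?_ _))
    (mul_prod_mem_preorder g ?_ _)) (mul_prod_mem_preorder g ?_ _) <;>
  repeat' first
    | with_reducible apply IsSumSq.add'
    | with_reducible apply isSumSq_sq
    | with_reducible apply IsSumSq.mul'
    | with_reducible apply isSumSq_ofNat

lemma discB_eq : discB = (X 0 + X 1 + 2) * polyB (X 1) (X 0 - X 1) := rfl

theorem discB_symm : rename (Equiv.swap (0 : Fin 2) 1) discB = discB := by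
  refine Eq.trans ?_ (polyB_symm (X 0 : MvPolynomial (Fin 2) ℝ) (X 1))
  simp only [discB, polyB, map_add, map_mul, map_sub, map_pow, map_ofNat, rename_X,
    Equiv.swap_apply_left, Equiv.swap_apply_right]

set_option maxRecDepth 4000 in
theorem discB_mem_nonneg : discB ∈ nonnegCombinations ![X 1, X 0 - X 1] := by
  change discB ∈ nonnegSubsemiring _
  set g : Fin 2 → MvPolynomial (Fin 2) ℝ := ![X 1, X 0 - X 1]
  have h0 : X 1 ∈ nonnegSubsemiring g := generator_mem_nonneg g 0
  have h1 : X 0 - X 1 ∈ nonnegSubsemiring g := generator_mem_nonneg g 1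
  have h2 : (X 0 + X 1 + 2 : MvPolynomial (Fin 2) ℝ) ∈ nonnegSubsemiring g := by
    have : (X 0 + X 1 + 2 : MvPolynomial (Fin 2) ℝ) = (X 0 - X 1) + (X 1 + X 1) + 2 := by ring
    rw [this]
    exact add_mem (add_mem h1 (add_mem h0 h0)) (ofNat_mem _ 2)
  rw [discB_eq]
  refine mul_mem h2 ?_
  simp only [polyB]
  repeat' first
    | with_reducible exact h0
    | with_reducible exact h1
    | with_reducible apply add_mem
    | with_reducible apply mul_mem
    | with_reducible apply pow_mem
    | apply ofNat_mem

set_option maxRecDepth 4000 in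
theorem discB_mem_nonneg_mixed : discB ∈ nonnegCombinations ![1 + X 1, -X 1, X 0] := by
  change discB ∈ nonnegSubsemiring _
  set g : Fin 3 → MvPolynomial (Fin 2) ℝ := ![1 + X 1, -X 1, X 0]
  have h0 : 1 + X 1 ∈ nonnegSubsemiring g := generator_mem_nonneg g 0
  have h1 : -X 1 ∈ nonnegSubsemiring g := generator_mem_nonneg g 1
  have h2 : X 0 ∈ nonnegSubsemiring g := generator_mem_nonneg g 2
  rw [discB_eq, polyB_eq_mixed]
  simp only [polyBMixed]
  repeat' first
    | with_reducible exact h0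
    | with_reducible exact h1
    | with_reducible exact h2
    | with_reducible apply add_mem
    | with_reducible apply mul_mem
    | with_reducible apply pow_mem
    | apply ofNat_mem

set_option maxRecDepth 4000 in
theorem discB_mem_nonneg_neg : discB ∈ nonnegCombinations ![1 + X 1, X 0 - X 1, -X 0] := by
  change discB ∈ nonnegSubsemiring _
  set g : Fin 3 → MvPolynomial (Fin 2) ℝ := ![1 + X 1, X 0 - X 1, -X 0]
  have h0 : 1 + X 1 ∈ nonnegSubsemiring g := generator_mem_nonneg g 0
  have h1 : X 0 - X 1 ∈ nonnegSubsemiring g := generator_mem_nonneg g 1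
  have h2 : -X 0 ∈ nonnegSubsemiring g := generator_mem_nonneg g 2
  rw [discB_eq, polyB_eq_neg]
  simp only [polyBNeg]
  repeat' first
    | with_reducible exact h0
    | with_reducible exact h1
    | with_reducible exact h2
    | with_reducible apply add_mem
    | with_reducible apply mul_mem
    | with_reducible apply pow_mem
    | apply ofNat_mem

lemma polyBMixed_pos {s x y : ℝ} (hs : 0 < s) (hx : 0 < x) (hy : 0 < y) : 0 < polyBMixed s x y := by
  simp only [polyBMixed]
  positivity

lemma polyBNeg_pos {x y z : ℝ} (hx : 0 < x) (hy : 0 < y) (hz : 0 < z) : 0 < polyBNeg x y z := by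
  simp only [polyBNeg]
  positivity

lemma polyB_pos_of_pos {t u : ℝ} (ht : 0 < t) (hu : 0 < u) : 0 < polyB t u := by
  simp only [polyB]
  positivity

theorem discB_pos (s t : ℝ) (hs : -1 < s) (ht : -1 < t) (hs0 : s ≠ 0) (ht0 : t ≠ 0)
    (hst : s ≠ t) : 0 < eval ![s, t] discB := by
  have e : eval ![s, t] discB = (s + t + 2) * polyB t (s - t) := by
    simp only [discB, polyB, map_add, map_sub, map_mul, map_pow, eval_X, map_ofNat,
      Matrix.cons_val_zero, Matrix.cons_val_one]
  rw [e]
  have key : ∀ s t : ℝ, t < s → -1 < s → -1 < t → s ≠ 0 → t ≠ 0 →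
      0 < (s + t + 2) * polyB t (s - t) := by
    intro s t h hs ht hs0 ht0
    rcases lt_or_gt_of_ne ht0 with ht1 | ht1
    · rcases lt_or_gt_of_ne hs0 with hs1 | hs1
      · rw [polyB_eq_neg]
        exact polyBNeg_pos (by linarith) (by linarith) (by linarith)
      · rw [polyB_eq_mixed]
        exact polyBMixed_pos hs1 (by linarith) (by linarith)
    · exact mul_pos (by linarith) (polyB_pos_of_pos ht1 (by linarith))
  rcases lt_or_gt_of_ne hst with h | h
  · rw [← polyB_symm]
    exact key t s h ht hs ht0 hs0
  · exact key s t h hs ht hs0 ht0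

lemma isSumSq_sos {R : Type*} [CommRing R] (a b : R) :
    IsSumSq (sosFree a b) ∧ IsSumSq (sosLeft a b) ∧ IsSumSq (sosMixed a b) := by
  refine ⟨?_, ?_, ?_⟩
  · simp only [sosFree]
    repeat' first
      | with_reducible apply IsSumSq.add'
      | with_reducible apply isSumSq_sq
      | with_reducible apply IsSumSq.mul'
      | with_reducible apply isSumSq_ofNat
  · simp only [sosLeft]
    repeat' first
      | with_reducible apply IsSumSq.add'
      | with_reducible apply isSumSq_sq
      | with_reducible apply IsSumSq.mul'
      | with_reducible apply isSumSq_ofNat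
  · simp only [sosMixed]
    repeat' first
      | with_reducible apply IsSumSq.add'
      | with_reducible apply isSumSq_sq
      | with_reducible apply IsSumSq.mul'
      | with_reducible apply isSumSq_ofNat

theorem discB_mem_preorder : discB ∈ generatedPreorder ![1 + X 0, 1 + X 1] := by
  set g : Fin 2 → MvPolynomial (Fin 2) ℝ := ![1 + X 0, 1 + X 1] with hg
  set a : MvPolynomial (Fin 2) ℝ := 1 + X 0 with ha
  set b : MvPolynomial (Fin 2) ℝ := 1 + X 1 with hb
  obtain ⟨f1, f2, f3⟩ := isSumSq_sos a b
  have f4 := (isSumSq_sos b a).2.1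
  obtain ⟨M, hM, hM0⟩ : ∃ M : ℕ, 0 < M ∧ (M : MvPolynomial (Fin 2) ℝ) * polyB (b - 1) (a - b) =
        sosFree a b + a * sosLeft a b + b * sosLeft b a + a * b * sosMixed a b :=
    ⟨_, Nat.succ_pos _, (congrArg (· * _) (Nat.cast_ofNat)).trans (polyB_eq_sos a b)⟩
  have hinv : (C ((M : ℝ)⁻¹) : MvPolynomial (Fin 2) ℝ) * (M : MvPolynomial (Fin 2) ℝ) = 1 := by
    rw [← map_natCast (C : ℝ →+* MvPolynomial (Fin 2) ℝ) M, ← C_mul,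
      inv_mul_cancel₀ (Nat.cast_ne_zero.mpr hM.ne'), C_1]
  have hsq : IsSumSq (C ((M : ℝ)⁻¹) : MvPolynomial (Fin 2) ℝ) := isSumSq_C (by positivity)
  have hd : discB = (a + b) * polyB (b - 1) (a - b) := by
    rw [discB_eq, show b - 1 = X 1 by rw [hb]; ring, show a - b = X 0 - X 1 by rw [ha, hb]; ring]
    rw [ha, hb]
    ring
  have e : discB = ((C ((M : ℝ)⁻¹) * (a^2*sosLeft a b + b^2*sosLeft b a))
          * ∏ i ∈ (∅ : Finset (Fin 2)), g i
        + (C ((M : ℝ)⁻¹) * (sosFree a b + b^2*sosMixed a b))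
          * ∏ i ∈ ({0} : Finset (Fin 2)), g i
        + (C ((M : ℝ)⁻¹) * (sosFree a b + a^2*sosMixed a b))
          * ∏ i ∈ ({1} : Finset (Fin 2)), g i)
        + (C ((M : ℝ)⁻¹) * (sosLeft a b + sosLeft b a))
          * ∏ i ∈ ({0, 1} : Finset (Fin 2)), g i := by
    rw [Finset.prod_empty, Finset.prod_singleton, Finset.prod_singleton,
      Finset.prod_pair (by decide)]
    simp only [hg, Matrix.cons_val_zero, Matrix.cons_val_one]
    rw [hd]
    linear_combination (-(a + b) * polyB (b - 1) (a - b)) * hinv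
      + (a + b) * C ((M : ℝ)⁻¹) * hM0
  rw [e]
  refine add_mem_preorder (add_mem_preorder (add_mem_preorder
    (mul_prod_mem_preorder g ?_ _) (mul_prod_mem_preorder g ?_ _))
    (mul_prod_mem_preorder g ?_ _)) (mul_prod_mem_preorder g ?_ _) <;>
  repeat' first
    | with_reducible assumption
    | with_reducible apply IsSumSq.add'
    | with_reducible apply isSumSq_sq
    | with_reducible apply IsSumSq.mul'

theorem discC_mem_nonneg : discC ∈ nonnegCombinations ![X 0, (1 - X 0^4)^2] := by
  change discC ∈ nonnegSubsemiring _
  set g : Fin 2 → MvPolynomial (Fin 1) ℝ := ![X 0, (1 - X 0^4)^2]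
  have h0 : X 0 ∈ nonnegSubsemiring g := generator_mem_nonneg g 0
  have h1 : (1 - X 0^4)^2 ∈ nonnegSubsemiring g := generator_mem_nonneg g 1
  simp only [discC, polyC]
  repeat' first
    | with_reducible exact h0
    | with_reducible exact h1
    | with_reducible apply add_mem
    | with_reducible apply mul_mem
    | with_reducible apply pow_mem
    | apply ofNat_mem

theorem discC_pos (s : ℝ) (hs : 0 < s) : 0 < eval ![s] discC := by
  simp only [discC, polyC, map_add, map_sub, map_mul, map_pow, map_one, eval_X, map_ofNat,
    Matrix.cons_val_fin_one]
  positivity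

/-- A sum of squares. -/
def sosEven {R : Type*} [CommRing R] (s : R) : R :=
  3515625 + 221792500*s^2 + 777678231*(s^2)^2 + 932192307*(s^3)^2 + 909742337*(s^5)^2
    + 867109112*(s^6)^2 + 114976512*(s^7)^2 + 648000*(s^8)^2 + 352158344*(s^2*(1 - s^4))^2

/-- A sum of squares. -/
def sosOdd {R : Type*} [CommRing R] (s : R) : R :=
  45243750 + 565872594*s^2 + 1273923370*(s^2)^2 + 1560886138*(s^5)^2 + 367416324*(s^6)^2
    + 13608000*(s^7)^2 + 42966406*(s*(1 - s^4))^2 + 135425340*(s^2*(1 - s^4))^2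

lemma polyC_eq_sos {R : Type*} [CommRing R] (s : R) : polyC s = sosEven s + sosOdd s * s := by
  simp only [polyC, sosEven, sosOdd]
  ring

lemma isSumSq_sosEven {R : Type*} [CommRing R] (s : R) : IsSumSq (sosEven s) := by
  simp only [sosEven]
  repeat' first
    | with_reducible apply IsSumSq.add'
    | with_reducible apply isSumSq_sq
    | with_reducible apply IsSumSq.mul'
    | with_reducible apply isSumSq_ofNat

lemma isSumSq_sosOdd {R : Type*} [CommRing R] (s : R) : IsSumSq (sosOdd s) := by
  simp only [sosOdd]
  repeat' first
    | with_reducible apply IsSumSq.add'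
    | with_reducible apply isSumSq_sq
    | with_reducible apply IsSumSq.mul'
    | with_reducible apply isSumSq_ofNat

theorem discC_mem_preorder : discC ∈ generatedPreorder ![X 0] := by
  have h := add_mem_preorder (mul_prod_mem_preorder ![X 0] (isSumSq_sosEven (X 0)) ∅)
    (mul_prod_mem_preorder ![X 0] (isSumSq_sosOdd (X 0 : MvPolynomial (Fin 1) ℝ)) {0})
  rwa [Finset.prod_empty, Finset.prod_singleton, mul_one, Matrix.cons_val_fin_one,
    ← polyC_eq_sos] at h

/-! ### Squarefreeness of the discriminants -/

theorem squarefree_discA : Squarefree discA := by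
  have hdeg : discA.totalDegree ≤ 8 := by
    simp only [discA, polyA]
    repeat' with_reducible apply totalDegree_add_le_of
    all_goals
      apply Nat.le_trans
      · repeat' first
          | with_reducible exact totalDegree_X_le _
          | with_reducible exact totalDegree_ofNat_le _
          | with_reducible apply totalDegree_mul_le_add
          | with_reducible apply totalDegree_pow_le_mul
      · norm_num
  have e : aeval ![2*Polynomial.X, Polynomial.X] discA =
      polyA (2*Polynomial.X) (Polynomial.X : Polynomial ℝ) := by
    simp only [discA, polyA, map_add, map_mul, map_pow, aeval_X, map_ofNat, Matrix.cons_val_zero,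
      Matrix.cons_val_one]
  refine squarefree_of_line ![2*Polynomial.X, Polynomial.X] ?_ ?_ ?_
  · intro i
    fin_cases i
    · exact Polynomial.natDegree_C_mul_le (2 : ℝ) Polynomial.X |>.trans Polynomial.natDegree_X_le
    · exact Polynomial.natDegree_X_le
  · rw [e, natDegree_line_A rfl]
    exact hdeg
  · rw [e]
    exact (separable_line_A Polynomial.derivative_X).squarefree

theorem squarefree_discB : Squarefree discB := by
  have h1 : (X 0 - X 1 : MvPolynomial (Fin 2) ℝ).totalDegree ≤ 1 :=
    totalDegree_sub_le_of (totalDegree_X_le _) (totalDegree_X_le _)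
  have hdeg : discB.totalDegree ≤ 10 := by
    rw [discB_eq]
    refine totalDegree_mul_le_of (n := 1) (m := 9) ?_ ?_ le_rfl
    · exact totalDegree_add_le_of (totalDegree_add_le_of (totalDegree_X_le _) (totalDegree_X_le _))
        ((totalDegree_ofNat_le _).trans (by norm_num))
    simp only [polyB]
    repeat' with_reducible apply totalDegree_add_le_of
    all_goals
      apply Nat.le_trans
      · repeat' first
          | with_reducible exact h1
          | with_reducible exact totalDegree_X_le _
          | with_reducible exact totalDegree_ofNat_le _
          | with_reducible apply totalDegree_mul_le_add
          | with_reducible apply totalDegree_pow_le_mul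
      · norm_num
  have e : aeval ![Polynomial.X - 1, Polynomial.X] discB = (Polynomial.X - 1 + Polynomial.X + 2) *
        polyB Polynomial.X (Polynomial.X - 1 - Polynomial.X : Polynomial ℝ) := by
    simp only [discB, polyB, map_add, map_sub, map_mul, map_pow, aeval_X, map_ofNat,
      Matrix.cons_val_zero, Matrix.cons_val_one]
  refine squarefree_of_line ![Polynomial.X - 1, Polynomial.X] ?_ ?_ ?_
  · intro i
    fin_cases i
    · exact (Polynomial.natDegree_X_sub_C (1 : ℝ)).le
    · exact Polynomial.natDegree_X_le
  · rw [e, natDegree_line_B rfl]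
    exact hdeg
  · rw [e]
    exact (separable_line_B Polynomial.derivative_X).squarefree

theorem squarefree_discC : Squarefree discC := by
  have hdeg : discC.totalDegree ≤ 16 := by
    have h4 : (1 - X 0^4 : MvPolynomial (Fin 1) ℝ).totalDegree ≤ 4 :=
      totalDegree_sub_le_of (by rw [totalDegree_one]; norm_num)
        (totalDegree_pow_le_of (totalDegree_X_le _) le_rfl)
    have h5 : (42966406*X 0^3 + 352158344*X 0^4 + 135425340*X 0^5 :
        MvPolynomial (Fin 1) ℝ).totalDegree ≤ 5 := by
      repeat' with_reducible apply totalDegree_add_le_of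
      all_goals
        apply Nat.le_trans
        · repeat' first
            | with_reducible exact totalDegree_X_le _
            | with_reducible exact totalDegree_ofNat_le _
            | with_reducible apply totalDegree_mul_le_add
            | with_reducible apply totalDegree_pow_le_mul
        · norm_num
    simp only [discC, polyC]
    repeat' with_reducible apply totalDegree_add_le_of
    all_goals
      apply Nat.le_trans
      · repeat' first
          | with_reducible exact h5
          | with_reducible exact h4
          | with_reducible exact totalDegree_X_le _
          | with_reducible exact totalDegree_ofNat_le _
          | with_reducible apply totalDegree_mul_le_add
          | with_reducible apply totalDegree_pow_le_mul
      · norm_num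
  have e : aeval ![Polynomial.X] discC = polyC (Polynomial.X : Polynomial ℝ) := by
    simp only [discC, polyC, map_add, map_sub, map_mul, map_pow, map_one, aeval_X, map_ofNat,
      Matrix.cons_val_fin_one]
  refine squarefree_of_line ![Polynomial.X] ?_ ?_ ?_
  · intro i
    fin_cases i
    exact Polynomial.natDegree_X_le
  · rw [e, natDegree_line_C rfl]
    exact hdeg
  · rw [e]
    exact separable_polyC.squarefree

/-! ### The discriminants do not vanish where points collide -/

/-- The points at which a polynomial in two variables is evaluated to see that it has no factor
in common with a difference of two of the points `∞, -1, 0, s, t`. -/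
structure NonvanishingOnCollisions (Δ : MvPolynomial (Fin 2) ℝ) : Prop where
  zero_left : ∃ y : ℝ, eval ![0, y] Δ ≠ 0
  zero_right : ∃ y : ℝ, eval ![y, 0] Δ ≠ 0
  neg_one_left : ∃ y : ℝ, eval ![-1, y] Δ ≠ 0
  neg_one_right : ∃ y : ℝ, eval ![y, -1] Δ ≠ 0
  diagonal : ∃ y : ℝ, eval ![y, y] Δ ≠ 0

lemma nonvanishing_discA : NonvanishingOnCollisions discA := by
  constructor <;> refine ⟨1, ?_⟩ <;>
  · simp only [discA, polyA, map_add, map_mul, map_pow, eval_X, map_ofNat, Matrix.cons_val_zero,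
      Matrix.cons_val_one]
    norm_num

lemma nonvanishing_discB : NonvanishingOnCollisions discB := by
  constructor <;> refine ⟨1, ?_⟩ <;>
  · simp only [discB, polyB, map_add, map_sub, map_mul, map_pow, eval_X, map_ofNat,
      Matrix.cons_val_zero, Matrix.cons_val_one]
    norm_num

/-- `-1`, `0`, `s` and `t`. -/
def IsFinitePoint (f : MvPolynomial (Fin 2) ℝ) : Prop := f = -1 ∨ f = 0 ∨ f = X 0 ∨ f = X 1

lemma NonvanishingOnCollisions.isRelPrime {Δ : MvPolynomial (Fin 2) ℝ}
    (h : NonvanishingOnCollisions Δ) {f g : MvPolynomial (Fin 2) ℝ} (hf : IsFinitePoint f)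
    (hg : IsFinitePoint g) (hfg : f ≠ g) : IsRelPrime Δ (f - g) := by
  have hX : ∀ i : Fin 2, (X i : MvPolynomial (Fin 2) ℝ).totalDegree ≤ 1 := totalDegree_X_le
  have h1 : (-1 : MvPolynomial (Fin 2) ℝ).totalDegree ≤ 1 := by
    rw [totalDegree_neg, totalDegree_one]; norm_num
  have h0 : (0 : MvPolynomial (Fin 2) ℝ).totalDegree ≤ 1 := by
    rw [totalDegree_zero]; norm_num
  have hd : (f - g).totalDegree ≤ 1 := by
    refine totalDegree_sub_le_of ?_ ?_
    · rcases hf with rfl | rfl | rfl | rfl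
      exacts [h1, h0, hX 0, hX 1]
    · rcases hg with rfl | rfl | rfl | rfl
      exacts [h1, h0, hX 0, hX 1]
  have key : ∀ y : Fin 2 → ℝ, eval y Δ ≠ 0 → eval y (f - g) = 0 → IsRelPrime Δ (f - g) :=
    fun y hy h' => isRelPrime_of_linear (sub_ne_zero.mpr hfg) hd y h' hy
  obtain ⟨y1, k1⟩ := h.zero_left
  obtain ⟨y2, k2⟩ := h.zero_right
  obtain ⟨y3, k3⟩ := h.neg_one_left
  obtain ⟨y4, k4⟩ := h.neg_one_right
  obtain ⟨y5, k5⟩ := h.diagonal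
  rcases hf with rfl | rfl | rfl | rfl <;> rcases hg with rfl | rfl | rfl | rfl <;>
    first
    | exact absurd rfl hfg
    | (refine key _ k1 ?_; simp; done)
    | (refine key _ k2 ?_; simp; done)
    | (refine key _ k3 ?_; simp; done)
    | (refine key _ k4 ?_; simp; done)
    | (refine key _ k5 ?_; simp; done)
    | (refine isRelPrime_one_right' _ _ (-1) (by norm_num) ?_; simp; done)
    | (refine isRelPrime_one_right' _ _ 1 (by norm_num) ?_; simp)

lemma X_zero_ne_X_one : (X 0 : MvPolynomial (Fin 2) ℝ) ≠ X 1 := fun h => by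
  have := congrArg (eval ![(0 : ℝ), 1]) h
  simp at this

lemma X_ne_neg_one {p : ℕ} (i : Fin p) : (X i : MvPolynomial (Fin p) ℝ) ≠ -1 := fun h => by
  have := congrArg (eval fun _ => (1 : ℝ)) h
  norm_num at this

lemma X_ne_one {p : ℕ} (i : Fin p) : (X i : MvPolynomial (Fin p) ℝ) ≠ 1 := fun h => by
  have := congrArg (eval fun _ => (0 : ℝ)) h
  norm_num at this

lemma pointsA_injective : Function.Injective pointsA := by
  unfold pointsA
  rw [injective_fin_five]
  simp [X_ne_neg_one, X_ne_zero, (X_ne_neg_one _).symm, (X_ne_zero _).symm, X_zero_ne_X_one.symm]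

lemma pointsB_injective : Function.Injective pointsB := by
  unfold pointsB
  rw [injective_fin_five]
  simp [(X_ne_neg_one _).symm, (X_ne_zero _).symm]

theorem isRelPrime_discA (l l' : Fin 5) (f g : MvPolynomial (Fin 2) ℝ) (hl : l ≠ l')
    (hf : pointsA l = f) (hg : pointsA l' = g) : IsRelPrime discA (f - g) := by
  have key : ∀ (l : Fin 5) (f : MvPolynomial (Fin 2) ℝ), pointsA l = f → IsFinitePoint f := by
    intro l f h
    fin_cases l <;> simp [pointsA] at h <;> simp [IsFinitePoint, ← h]
  refine nonvanishing_discA.isRelPrime (key l f hf) (key l' g hg) ?_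
  rintro rfl
  exact hl (pointsA_injective (hf.trans hg.symm))

theorem isRelPrime_discB (l l' : Fin 5) (f g : MvPolynomial (Fin 2) ℝ) (hl : l ≠ l')
    (hf : pointsB l = f) (hg : pointsB l' = g) : IsRelPrime discB (f - g) := by
  have key : ∀ (l : Fin 5) (f : MvPolynomial (Fin 2) ℝ), pointsB l = f → IsFinitePoint f := by
    intro l f h
    fin_cases l <;> simp [pointsB] at h <;> simp [IsFinitePoint, ← h]
  refine nonvanishing_discB.isRelPrime (key l f hf) (key l' g hg) ?_
  rintro rfl
  exact hl (pointsB_injective (hf.trans hg.symm))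

theorem isRelPrime_discC (l l' : Fin 4) (f g : MvPolynomial (Fin 1) ℝ) (hl : l ≠ l')
    (hf : pointsC l = f) (hg : pointsC l' = g) : IsRelPrime discC (f - g) := by
  have hinj : Function.Injective pointsC := by
    unfold pointsC
    rw [injective_fin_four]
    simp [(X_ne_zero _).symm, X_ne_one]
  have key : ∀ (l : Fin 4) (f : MvPolynomial (Fin 1) ℝ), pointsC l = f →
      f = 0 ∨ f = X 0 ∨ f = 1 := by
    intro l f h
    fin_cases l <;> simp [pointsC] at h <;> simp [← h]
  have hfg : f ≠ g := by
    rintro rfl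
    exact hl (hinj (hf.trans hg.symm))
  have h1 : (1 : MvPolynomial (Fin 1) ℝ).totalDegree ≤ 1 := by
    rw [totalDegree_one]; norm_num
  have h0 : (0 : MvPolynomial (Fin 1) ℝ).totalDegree ≤ 1 := by
    rw [totalDegree_zero]; norm_num
  have hd : (f - g).totalDegree ≤ 1 := by
    refine totalDegree_sub_le_of ?_ ?_
    · rcases key l f hf with rfl | rfl | rfl
      exacts [h0, totalDegree_X_le 0, h1]
    · rcases key l' g hg with rfl | rfl | rfl
      exacts [h0, totalDegree_X_le 0, h1]
  have k0 : eval ![(0 : ℝ)] discC ≠ 0 := by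
    simp [discC, polyC]
  have k1 : eval ![(1 : ℝ)] discC ≠ 0 := (discC_pos 1 one_pos).ne'
  rcases key l f hf with rfl | rfl | rfl <;> rcases key l' g hg with rfl | rfl | rfl <;>
    first
    | exact absurd rfl hfg
    | (refine isRelPrime_of_linear (sub_ne_zero.mpr hfg) hd _ ?_ k0; simp; done)
    | (refine isRelPrime_of_linear (sub_ne_zero.mpr hfg) hd _ ?_ k1; simp; done)
    | (refine isRelPrime_one_right' _ _ (-1) (by norm_num) ?_; simp; done)
    | (refine isRelPrime_one_right' _ _ 1 (by norm_num) ?_; simp)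

/-! ### Osculating spaces -/

lemma mem_osculatingSpace_infty {n j : ℕ} {v : Fin n → ℂ} :
    v ∈ osc n ∞ j ↔ ∀ i : Fin n, (i : ℕ) + j < n → v i = 0 := by
  change v ∈ Submodule.span ℂ {v | ∃ i : Fin n, n ≤ (i : ℕ) + j ∧ v = Pi.single i 1} ↔ _
  constructor
  · intro h i hi
    induction h using Submodule.span_induction with
    | mem x hx =>
      obtain ⟨k, hk, rfl⟩ := hx
      refine Pi.single_eq_of_ne ?_ _
      rintro rfl
      omega
    | zero => rfl
    | add x y _ _ hx hy => rw [Pi.add_apply, hx, hy, add_zero]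
    | smul a x _ hx => rw [Pi.smul_apply, hx, smul_zero]
  · intro h
    rw [pi_eq_sum_univ' v]
    refine Submodule.sum_mem _ fun i _ => ?_
    rcases lt_or_ge ((i : ℕ) + j) n with hi | hi
    · rw [h i hi, zero_smul]
      exact Submodule.zero_mem _
    · refine Submodule.smul_mem _ _ (Submodule.subset_span ⟨i, hi, ?_⟩)
      ext k
      simp [Pi.single_apply, eq_comm]

lemma sum_choose_mul_iteratedDeriv {n e i : ℕ} (z : ℂ) (hei : e < i) (hin : i < n) :
    ∑ d : Fin n, (i.choose d : ℂ) * (-z)^(i - d) * iteratedDeriv e (fun y : ℂ => y^(d : ℕ)) z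
      = 0 := by
  have h1 : ∀ d : ℕ, iteratedDeriv e (fun y : ℂ => y^d) z =
      (Polynomial.derivative^[e] (Polynomial.X^d)).eval z := by
    intro d
    rw [Polynomial.iterate_derivative_X_pow_eq_natCast_mul, iteratedDeriv_pow]
    simp
  have h2 : ((Polynomial.X - Polynomial.C z)^i : Polynomial ℂ) =
      ∑ d : Fin n, Polynomial.C ((i.choose d : ℂ) * (-z)^(i - d)) * Polynomial.X^(d : ℕ) := by
    rw [Finset.sum_fin_eq_sum_range, sub_eq_add_neg, ← Polynomial.C_neg, add_pow,
      ← Finset.sum_subset (Finset.range_subset_range.mpr (show i + 1 ≤ n by omega))]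
    · refine Finset.sum_congr rfl fun d hd => ?_
      rw [Finset.mem_range] at hd
      rw [dif_pos (by omega), Polynomial.C_mul, Polynomial.C_pow, Polynomial.C_eq_natCast]
      ring
    · intro d hd hd'
      rw [Finset.mem_range] at hd hd'
      rw [dif_pos hd, Nat.choose_eq_zero_of_lt (show i < d by omega)]
      simp
  have h3 := congrArg (fun q => (Polynomial.derivative^[e] q).eval z) h2
  simp only [Polynomial.iterate_derivative_X_sub_pow, Polynomial.iterate_derivative_sum,
    Polynomial.iterate_derivative_C_mul, Polynomial.eval_finsetSum, Polynomial.eval_mul,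
    Polynomial.eval_C] at h3
  rw [Finset.sum_congr rfl fun d _ => by rw [h1 d], ← h3]
  simp [show i - e ≠ 0 by omega]

/-- A vector lies in the osculating space exactly if it is orthogonal to the polynomials divisible
by the `j`-th power of `X - z`. -/
lemma mem_osculatingSpace_coe {n j : ℕ} {z : ℂ} {v : Fin n → ℂ} : v ∈ osc n z j ↔
      ∀ i, j ≤ i → i < n → ∑ d : Fin n, (i.choose d : ℂ) * (-z)^(i - d) * v d = 0 := by
  change v ∈ Submodule.span ℂ
    {v | ∃ d : ℕ, d < j ∧ v = fun i : Fin n => iteratedDeriv d (fun y : ℂ => y^(i : ℕ)) z} ↔ _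
  constructor
  · intro h i hi hin
    induction h using Submodule.span_induction with
    | mem x hx =>
      obtain ⟨k, hk, rfl⟩ := hx
      exact sum_choose_mul_iteratedDeriv z (by omega) hin
    | zero => simp
    | add x y _ _ hx hy =>
      simp only [Pi.add_apply, mul_add, Finset.sum_add_distrib, hx, hy, add_zero]
    | smul a x _ hx =>
      simp only [Pi.smul_apply, smul_eq_mul, mul_left_comm _ a, ← Finset.mul_sum, hx, mul_zero]
  · intro h
    set c : ℕ → ℂ := fun i => ∑ d : Fin n, (i.choose d : ℂ) * (-z)^(i - d) * v d with hc
    let L : Polynomial ℂ →ₗ[ℂ] ℂ := ∑ d : Fin n, v d • Polynomial.lcoeff ℂ (d : ℕ)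
    have hLX : ∀ m : Fin n, L (Polynomial.X^(m : ℕ)) = v m := by
      intro m
      simp [L, Polynomial.coeff_X_pow, Fin.val_inj]
    have hLc : ∀ i, L ((Polynomial.X - Polynomial.C z)^i) = c i := by
      intro i
      simp only [L, hc, LinearMap.sum_apply, LinearMap.smul_apply, Polynomial.lcoeff_apply,
        smul_eq_mul]
      refine Finset.sum_congr rfl fun d _ => ?_
      rw [sub_eq_add_neg, ← Polynomial.C_neg, Polynomial.coeff_X_add_C_pow]
      ring
    have hv : v = ∑ d ∈ Finset.range n, c d •
        fun m : Fin n => (((m : ℕ).choose d : ℂ) * z^((m : ℕ) - d)) := by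
      ext m
      rw [← hLX m, show (Polynomial.X : Polynomial ℂ)^(m : ℕ) =
        ((Polynomial.X - Polynomial.C z) + Polynomial.C z)^(m : ℕ) by rw [sub_add_cancel],
        add_pow, map_sum, Finset.sum_apply,
        ← Finset.sum_subset (Finset.range_subset_range.mpr (show (m : ℕ) + 1 ≤ n by omega))]
      · refine Finset.sum_congr rfl fun d _ => ?_
        rw [mul_assoc, mul_comm, ← Polynomial.C_pow, ← Polynomial.C_eq_natCast, ← Polynomial.C_mul,
          ← Polynomial.smul_eq_C_mul, _root_.map_smul, hLc, Pi.smul_apply, smul_eq_mul, smul_eq_mul]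
        ring
      · intro d hd hd'
        rw [Finset.mem_range] at hd hd'
        rw [Pi.smul_apply, Nat.choose_eq_zero_of_lt (by omega)]
        simp
    rw [hv]
    refine Submodule.sum_mem _ fun d hd => ?_
    rcases lt_or_ge d j with hdj | hdj
    · have : (fun m : Fin n => (((m : ℕ).choose d : ℂ) * z^((m : ℕ) - d))) =
          ((d.factorial : ℂ)⁻¹) • fun i : Fin n => iteratedDeriv d (fun y : ℂ => y^(i : ℕ)) z := by
        ext m
        have hd0 : (d.factorial : ℂ) ≠ 0 := Nat.cast_ne_zero.mpr d.factorial_ne_zero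
        rw [Pi.smul_apply, iteratedDeriv_pow, Nat.descFactorial_eq_factorial_mul_choose,
          smul_eq_mul]
        push_cast
        field_simp
      rw [this]
      exact Submodule.smul_mem _ _ (Submodule.smul_mem _ _
        (Submodule.subset_span ⟨d, hdj, rfl⟩))
    · rw [show c d = 0 from h d hdj (Finset.mem_range.mp hd), zero_smul]
      exact Submodule.zero_mem _

lemma osculatingSpace_mono (n : ℕ) (τ : OnePoint ℂ) {j k : ℕ} (h : j ≤ k) :
    osc n τ j ≤ osc n τ k := by
  intro v hv
  induction τ using OnePoint.rec with
  | infty =>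
    rw [mem_osculatingSpace_infty] at hv ⊢
    exact fun i hi => hv i (by omega)
  | coe z =>
    rw [mem_osculatingSpace_coe] at hv ⊢
    exact fun i hi => hv i (by omega)

lemma osculatingSpace_self (n : ℕ) (τ : OnePoint ℂ) : osc n τ n = ⊤ := by
  rw [Submodule.eq_top_iff']
  intro v
  induction τ using OnePoint.rec with
  | infty =>
    rw [mem_osculatingSpace_infty]
    exact fun i hi => by omega
  | coe z =>
    rw [mem_osculatingSpace_coe]
    exact fun i hi => by omega

lemma osculatingSpace_zero (n : ℕ) (τ : OnePoint ℂ) : osc n τ 0 = ⊥ := by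
  rw [Submodule.eq_bot_iff]
  intro v hv
  induction τ using OnePoint.rec with
  | infty =>
    rw [mem_osculatingSpace_infty] at hv
    ext i
    exact hv i (by omega)
  | coe z =>
    change v ∈ Submodule.span ℂ {v | ∃ d : ℕ, d < 0 ∧
      v = fun i : Fin n => iteratedDeriv d (fun y : ℂ => y^(i : ℕ)) z} at hv
    simpa using hv

/-- Consecutive osculating spaces are related by one linear equation. -/
lemma exists_osculatingSpace_step (n : ℕ) (τ : OnePoint ℂ) {j : ℕ} (hj : j < n) :
    ∃ f : (Fin n → ℂ) →ₗ[ℂ] ℂ, ∀ v ∈ osc n τ (j + 1), f v = 0 → v ∈ osc n τ j := by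
  induction τ using OnePoint.rec with
  | infty =>
    refine ⟨LinearMap.proj ⟨n - 1 - j, by omega⟩, fun v hv h => ?_⟩
    rw [mem_osculatingSpace_infty] at hv ⊢
    intro i hi
    rcases eq_or_ne ((i : ℕ) + j + 1) n with h1 | h1
    · rw [← h, LinearMap.proj_apply]
      congr 1
      ext
      simp only
      omega
    · exact hv i (by omega)
  | coe z =>
    refine ⟨∑ d : Fin n, ((j.choose d : ℂ) * (-z)^(j - d)) • LinearMap.proj d, fun v hv h => ?_⟩
    rw [mem_osculatingSpace_coe] at hv ⊢
    intro i hi hin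
    rcases eq_or_ne i j with rfl | h1
    · simpa using h
    · exact hv i (by omega) hin

/-! ### Dimensions of subspaces -/

lemma exists_ne_zero_of_lt_finrank {n k : ℕ} {S : Submodule ℂ (Fin n → ℂ)}
    (h : k < dim S) (f : (Fin n → ℂ) →ₗ[ℂ] (Fin k → ℂ)) : ∃ v ∈ S, v ≠ 0 ∧ f v = 0 := by
  have := LinearMap.ker_ne_bot_of_finrank_lt (f := f.domRestrict S) (by simpa using h)
  obtain ⟨w, hw, hw0⟩ := (Submodule.ne_bot_iff _).mp this
  exact ⟨w, w.2, fun h => hw0 (Subtype.ext h), hw⟩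

lemma exists_ne_zero_of_one_le_finrank {n : ℕ} {S : Submodule ℂ (Fin n → ℂ)}
    (h : 1 ≤ dim S) : ∃ v ∈ S, v ≠ 0 := by
  obtain ⟨v, hv, h0, -⟩ := exists_ne_zero_of_lt_finrank (k := 0) h 0
  exact ⟨v, hv, h0⟩

lemma one_le_finrank_of_mem {n : ℕ} {S : Submodule ℂ (Fin n → ℂ)} {v : Fin n → ℂ} (hv : v ∈ S)
    (h0 : v ≠ 0) : 1 ≤ dim S :=
  Submodule.one_le_finrank_iff.mpr ((Submodule.ne_bot_iff _).mpr ⟨v, hv, h0⟩)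

lemma finrank_le_add_of_equations {n k : ℕ} {S T : Submodule ℂ (Fin n → ℂ)}
    (f : (Fin n → ℂ) →ₗ[ℂ] (Fin k → ℂ)) (h : ∀ v ∈ S, f v = 0 → v ∈ T) : dim S ≤ dim T + k := by
  have h1 := LinearMap.finrank_range_add_finrank_ker (f.domRestrict S)
  have h2 : dim (LinearMap.range (f.domRestrict S)) ≤ k :=
    (Submodule.finrank_le _).trans (by simp)
  have h3 : dim (LinearMap.ker (f.domRestrict S)) ≤ dim T := by
    refine LinearMap.finrank_le_finrank_of_injective
      (f := (S.subtype.domRestrict (LinearMap.ker (f.domRestrict S))).codRestrict T ?_) ?_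
    · rintro ⟨v, hv⟩
      exact h v v.2 hv
    · intro v w hvw
      have := congrArg Subtype.val hvw
      exact Subtype.ext (Subtype.ext this)
  omega

/-- A subspace containing the zero set of `k` linear forms has codimension at most `k`. -/
lemma le_finrank_add_of_equations {n k : ℕ} {S : Submodule ℂ (Fin n → ℂ)}
    (f : (Fin n → ℂ) →ₗ[ℂ] (Fin k → ℂ)) (h : ∀ v, f v = 0 → v ∈ S) : n ≤ dim S + k := by
  have := finrank_le_add_of_equations (S := ⊤) f fun v _ hf => h v hf
  simpa using this

lemma le_finrank_of_injective {n k : ℕ} {S : Submodule ℂ (Fin n → ℂ)}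
    (f : (Fin k → ℂ) →ₗ[ℂ] (Fin n → ℂ)) (hf : ∀ c, f c = 0 → c = 0) (h : ∀ c, f c ∈ S) :
    k ≤ dim S := by
  have := LinearMap.finrank_le_finrank_of_injective (f := f.codRestrict S h) (by
    rw [injective_iff_map_eq_zero]
    intro c hc
    exact hf c (congrArg Subtype.val hc))
  simpa using this

lemma finrank_inf_osculatingSpace_succ {n : ℕ} (A : Submodule ℂ (Fin n → ℂ)) (τ : OnePoint ℂ)
    {j : ℕ} (hj : j < n) : dim ↥(A ⊓ osc n τ j) ≤ dim ↥(A ⊓ osc n τ (j + 1)) ∧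
      dim ↥(A ⊓ osc n τ (j + 1)) ≤ dim ↥(A ⊓ osc n τ j) + 1 := by
  refine ⟨Submodule.finrank_mono (inf_le_inf_left _ (osculatingSpace_mono n τ (Nat.le_succ j))), ?_⟩
  obtain ⟨f, hf⟩ := exists_osculatingSpace_step n τ hj
  refine finrank_le_add_of_equations (LinearMap.pi fun _ => f) fun v hv h => ⟨hv.1, ?_⟩
  exact hf v hv.2 (congrFun h 0)

lemma finrank_osculatingSpace {n : ℕ} (τ : OnePoint ℂ) {j : ℕ} (hj : j ≤ n) :
    dim (osc n τ j) = j := by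
  have step : ∀ k, k < n → dim (osc n τ (k + 1)) ≤ dim (osc n τ k) + 1 := by
    intro k hk
    have := (finrank_inf_osculatingSpace_succ ⊤ τ hk).2
    rwa [top_inf_eq, top_inf_eq] at this
  have up : ∀ k, k ≤ n → dim (osc n τ k) ≤ k := by
    intro k
    induction k with
    | zero => intro _; rw [osculatingSpace_zero, finrank_bot]
    | succ k ih => intro hk; have := ih (by omega); have := step k (by omega); omega
  have down : ∀ k, k ≤ n → n ≤ dim (osc n τ (n - k)) + k := by
    intro k
    induction k with
    | zero => intro _; rw [Nat.sub_zero, osculatingSpace_self, finrank_top]; simp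
    | succ k ih =>
      intro hk
      have h1 := ih (by omega)
      have h2 := step (n - (k + 1)) (by omega)
      rw [show n - (k + 1) + 1 = n - k by omega] at h2
      omega
  have h1 := up j hj
  have h2 := down (n - j) (by omega)
  rw [show n - (n - j) = j by omega] at h2
  omega

lemma finrank_inf_le_add {n : ℕ} {A B : Submodule ℂ (Fin n → ℂ)} (hAB : A ≤ B)
    (F : Submodule ℂ (Fin n → ℂ)) : dim ↥(A ⊓ F) ≤ dim ↥(B ⊓ F) ∧ dim ↥(B ⊓ F) + dim A ≤
        dim ↥(A ⊓ F) + dim B := by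
  refine ⟨Submodule.finrank_mono (inf_le_inf_right _ hAB), ?_⟩
  have h1 := Submodule.finrank_sup_add_finrank_inf_eq (B ⊓ F) A
  have h2 : B ⊓ F ⊓ A = A ⊓ F := by
    rw [inf_right_comm, inf_eq_right.mpr hAB]
  have h3 : dim ↥(B ⊓ F ⊔ A) ≤ dim B :=
    Submodule.finrank_mono (sup_le inf_le_left hAB)
  rw [h2] at h1
  omega

/-! ### Tangency at a rank condition -/

section Tangency

variable {n : ℕ} {A B A' B' : Submodule ℂ (Fin n → ℂ)} {ψ : Module.End ℂ (Fin n → ℂ)}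

lemma map_inf_le_sup_of_generic (τ : OnePoint ℂ) {j : ℕ} (hj : j ≤ n)
    (h : dim ↥(A ⊓ osc n τ j) = dim A + j - n) : (A ⊓ osc n τ j).map ψ ≤ A ⊔ osc n τ j := by
  rcases Nat.eq_zero_or_pos (dim A + j - n) with h0 | h0
  · rw [h0, Submodule.finrank_eq_zero] at h
    rw [h, Submodule.map_bot]
    exact bot_le
  · have h1 := Submodule.finrank_sup_add_finrank_inf_eq A (osc n τ j)
    rw [finrank_osculatingSpace τ hj] at h1
    rw [Submodule.eq_top_of_finrank_eq (S := A ⊔ osc n τ j) (by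
      rw [Module.finrank_fin_fun]; omega)]
    exact le_top

lemma map_inf_le_sup_mono (hA : A' ≤ A) (hB : B' ≤ B)
    (hfin : dim ↥(A ⊓ B) ≤ dim ↥(A' ⊓ B'))
    (h : (A' ⊓ B').map ψ ≤ A' ⊔ B') : (A ⊓ B).map ψ ≤ A ⊔ B := by
  rw [← Submodule.eq_of_le_of_finrank_le (inf_le_inf hA hB) hfin]
  exact h.trans (sup_le_sup hA hB)

lemma map_inf_le_sup_anti (hA : A ≤ A') (hB : B ≤ B')
    (hfin : dim ↥(A' ⊔ B') ≤ dim ↥(A ⊔ B))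
    (h : (A' ⊓ B').map ψ ≤ A' ⊔ B') : (A ⊓ B).map ψ ≤ A ⊔ B := by
  rw [Submodule.eq_of_le_of_finrank_le (sup_le_sup hA hB) hfin]
  exact (Submodule.map_mono (inf_le_inf hA hB)).trans h

lemma map_inf_le_sup_of_le (hAB : A ≤ B) (h : A.map ψ ≤ B) : (A ⊓ B).map ψ ≤ A ⊔ B := by
  rw [inf_eq_left.mpr hAB, sup_eq_right.mpr hAB]
  exact h

end Tangency

/-! ### Flags -/

lemma PartialFlag.ext_space {k n : ℕ} {α : Fin k → ℕ} {E E' : PartialFlag α n}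
    (h : ∀ i, E.space i = E'.space i) : E = E' := by
  cases E
  cases E'
  simp only [PartialFlag.mk.injEq]
  exact funext h

lemma encard_eq_of_correspondence {X : Type*} {d : ℕ} {S : Set X} (R : X → Fin d → Prop)
    (h1 : ∀ k, ∃ x ∈ S, R x k) (h2 : ∀ x ∈ S, ∃ k, R x k)
    (h3 : ∀ x ∈ S, ∀ y ∈ S, ∀ k, R x k → R y k → x = y)
    (h4 : ∀ x ∈ S, ∀ k l, R x k → R x l → k = l) : S.encard = d := by
  choose Φ hS hR using h1
  have hinj : Function.Injective Φ := fun k l hkl =>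
    h4 _ (hS k) k l (hR k) (hkl ▸ hR l)
  have hrange : Set.range Φ = S := by
    ext x
    constructor
    · rintro ⟨k, rfl⟩
      exact hS k
    · intro hx
      obtain ⟨k, hk⟩ := h2 x hx
      exact ⟨k, h3 _ (hS k) _ hx k (hR k) hk⟩
  rw [← hrange, ← Set.image_univ, hinj.encard_image, Set.encard_univ]
  simp

/-! ### Kernels of families of `3 × 3` matrices -/

/-- The bilinear dot product. -/
def dot3 (u r : Fin 3 → ℂ) : ℂ := u 0*r 0 + u 1*r 1 + u 2*r 2

/-- The determinant with given rows. -/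
def det3 (u v w : Fin 3 → ℂ) : ℂ :=
  u 0*(v 1*w 2 - v 2*w 1) + u 1*(v 2*w 0 - v 0*w 2) + u 2*(v 0*w 1 - v 1*w 0)

/-- The derivative of the determinant. -/
def det3' (u v w u' v' w' : Fin 3 → ℂ) : ℂ := det3 u' v w + det3 u v' w + det3 u v w'

/-- The coordinates of `r` permuted cyclically. -/
def rot (r : Fin 3 → ℂ) : Fin 3 → ℂ := ![r 1, r 2, r 0]

lemma dot3_rot (u r : Fin 3 → ℂ) : dot3 (rot u) (rot r) = dot3 u r := by
  simp [dot3, rot]; ring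

lemma det3_rot (u v w : Fin 3 → ℂ) : det3 (rot u) (rot v) (rot w) = det3 u v w := by
  simp [det3, rot]; ring

lemma det3'_rot (u v w u' v' w' : Fin 3 → ℂ) :
    det3' (rot u) (rot v) (rot w) (rot u') (rot v') (rot w') = det3' u v w u' v' w' := by
  simp only [det3', det3_rot]

lemma det3_cycle (u v w : Fin 3 → ℂ) : det3 v w u = det3 u v w := by
  simp only [det3]; ring

lemma det3'_cycle (u v w u' v' w' : Fin 3 → ℂ) : det3' v w u v' w' u' = det3' u v w u' v' w' := by
  simp only [det3', det3]; ring

lemma exists_ne_zero_fin_three {r : Fin 3 → ℂ} (h : r ≠ 0) : r 0 ≠ 0 ∨ r 1 ≠ 0 ∨ r 2 ≠ 0 := by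
  by_contra! hc
  refine h (funext fun i => ?_)
  fin_cases i
  exacts [hc.1, hc.2.1, hc.2.2]

lemma det3_eq_zero_of_kernel {u v w r : Fin 3 → ℂ} (hr : r ≠ 0) (hu : dot3 u r = 0)
    (hv : dot3 v r = 0) (hw : dot3 w r = 0) : det3 u v w = 0 := by
  simp only [dot3] at hu hv hw
  simp only [det3]
  rcases exists_ne_zero_fin_three hr with h | h | h <;> refine mul_left_cancel₀ h ?_
  · linear_combination (v 1*w 2 - v 2*w 1) * hu + (w 1*u 2 - w 2*u 1) * hv
      + (u 1*v 2 - u 2*v 1) * hw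
  · linear_combination (v 2*w 0 - v 0*w 2) * hu + (w 2*u 0 - w 0*u 2) * hv
      + (u 2*v 0 - u 0*v 2) * hw
  · linear_combination (v 0*w 1 - v 1*w 0) * hu + (w 0*u 1 - w 1*u 0) * hv
      + (u 0*v 1 - u 1*v 0) * hw

lemma det3'_eq_zero_of_kernel_zero {u v w u' v' w' r r' : Fin 3 → ℂ} (hr : r 0 ≠ 0)
    (hu : dot3 u r = 0) (hv : dot3 v r = 0) (hw : dot3 w r = 0)
    (hu' : dot3 u' r + dot3 u r' = 0) (hv' : dot3 v' r + dot3 v r' = 0)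
    (hw' : dot3 w' r + dot3 w r' = 0) : det3' u v w u' v' w' = 0 := by
  have hd : det3 u v w = 0 := det3_eq_zero_of_kernel (fun h => hr (congrFun h 0)) hu hv hw
  simp only [dot3] at hu hv hw hu' hv' hw'
  simp only [det3] at hd
  simp only [det3', det3]
  refine mul_left_cancel₀ hr ?_
  linear_combination (v 1*w 2 - v 2*w 1) * hu' + (w 1*u 2 - w 2*u 1) * hv'
      + (u 1*v 2 - u 2*v 1) * hw' - r' 0*hd
      + u' 1*(v 2*hw - w 2*hv) + u' 2*(w 1*hv - v 1*hw)
      + v' 1*(w 2*hu - u 2*hw) + v' 2*(u 1*hw - w 1*hu)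
      + w' 1*(u 2*hv - v 2*hu) + w' 2*(v 1*hu - u 1*hv)

/-- If the kernel vector of a singular matrix can be deformed along a deformation of the matrix,
then the derivative of the determinant vanishes. -/
lemma det3'_eq_zero_of_kernel {u v w u' v' w' r r' : Fin 3 → ℂ} (hr : r ≠ 0)
    (hu : dot3 u r = 0) (hv : dot3 v r = 0) (hw : dot3 w r = 0)
    (hu' : dot3 u' r + dot3 u r' = 0) (hv' : dot3 v' r + dot3 v r' = 0)
    (hw' : dot3 w' r + dot3 w r' = 0) : det3' u v w u' v' w' = 0 := by
  rcases exists_ne_zero_fin_three hr with h | h | h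
  · exact det3'_eq_zero_of_kernel_zero h hu hv hw hu' hv' hw'
  · rw [← det3'_rot]
    refine det3'_eq_zero_of_kernel_zero (r := rot r) (r' := rot r') h ?_ ?_ ?_ ?_ ?_ ?_ <;>
      simpa only [dot3_rot]
  · rw [← det3'_rot, ← det3'_rot]
    refine det3'_eq_zero_of_kernel_zero (r := rot (rot r)) (r' := rot (rot r')) h ?_ ?_ ?_ ?_ ?_ ?_
      <;> simpa only [dot3_rot]

/-- The cross product. -/
def cross3 (u v : Fin 3 → ℂ) : Fin 3 → ℂ :=
  ![u 1*v 2 - u 2*v 1, u 2*v 0 - u 0*v 2, u 0*v 1 - u 1*v 0]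

lemma det3_eq_dot3_cross3 (u v w : Fin 3 → ℂ) : det3 u v w = dot3 (cross3 v w) u := by
  simp [det3, dot3, cross3]; ring

lemma dot3_cross3_left (u v : Fin 3 → ℂ) : dot3 u (cross3 u v) = 0 := by
  simp [dot3, cross3]; ring

lemma dot3_cross3_right (u v : Fin 3 → ℂ) : dot3 v (cross3 u v) = 0 := by
  simp [dot3, cross3]; ring

lemma cross3_parallel {u v r : Fin 3 → ℂ} (hu : dot3 u r = 0) (hv : dot3 v r = 0) (i j : Fin 3) :
    r i * cross3 u v j = r j * cross3 u v i := by
  simp only [dot3] at hu hv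
  fin_cases i <;> fin_cases j <;> simp only [cross3, Fin.zero_eta, Fin.mk_one, Fin.reduceFinMk,
    Matrix.cons_val]
  · linear_combination u 2*hv - v 2*hu
  · linear_combination v 1*hu - u 1*hv
  · linear_combination v 2*hu - u 2*hv
  · linear_combination u 0*hv - v 0*hu
  · linear_combination u 1*hv - v 1*hu
  · linear_combination v 0*hu - u 0*hv

lemma eq_smul_of_cross3_ne_zero {u v r r' : Fin 3 → ℂ} (h : cross3 u v ≠ 0) (hr : r ≠ 0)
    (hu : dot3 u r = 0) (hv : dot3 v r = 0) (hu' : dot3 u r' = 0) (hv' : dot3 v r' = 0) :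
    ∃ c : ℂ, r' = c • r := by
  obtain ⟨k, hk⟩ : ∃ k, cross3 u v k ≠ 0 := Function.ne_iff.mp h
  have e := fun j => cross3_parallel hu hv j k
  have e' := fun j => cross3_parallel hu' hv' j k
  have hrk : r k ≠ 0 := by
    intro h0
    refine hr (funext fun j => ?_)
    have := e j
    rw [h0, zero_mul] at this
    exact (mul_eq_zero.mp this).resolve_right hk
  refine ⟨r' k / r k, funext fun j => ?_⟩
  rw [Pi.smul_apply, smul_eq_mul]
  field_simp
  refine mul_right_cancel₀ hk ?_
  linear_combination r k * e' j - r' k * e j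

/-- Where the derivative of the determinant does not vanish the kernel is a line. -/
lemma eq_smul_of_det3'_ne_zero {u v w u' v' w' r r' : Fin 3 → ℂ}
    (hD : det3' u v w u' v' w' ≠ 0) (hr : r ≠ 0)
    (hu : dot3 u r = 0) (hv : dot3 v r = 0) (hw : dot3 w r = 0)
    (hu' : dot3 u r' = 0) (hv' : dot3 v r' = 0) (hw' : dot3 w r' = 0) : ∃ c : ℂ, r' = c • r := by
  by_cases h1 : cross3 v w = 0
  · by_cases h2 : cross3 w u = 0
    · by_cases h3 : cross3 u v = 0
      · refine absurd ?_ hD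
        rw [det3', ← det3_cycle u v', ← det3_cycle u v w', ← det3_cycle v w' u]
        simp [det3_eq_dot3_cross3, h1, h2, h3, dot3]
      · exact eq_smul_of_cross3_ne_zero h3 hr hu hv hu' hv'
    · exact eq_smul_of_cross3_ne_zero h2 hr hw hu hw' hu'
  · exact eq_smul_of_cross3_ne_zero h1 hr hv hw hv' hw'

/-- Two vectors that are not proportional, or a kernel vector that deforms. -/
def DeformableKernel (u v w u' v' w' : Fin 3 → ℂ) : Prop :=
  ∃ r : Fin 3 → ℂ, r ≠ 0 ∧ (dot3 u r = 0 ∧ dot3 v r = 0 ∧ dot3 w r = 0) ∧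
    ((∃ r', dot3 u' r + dot3 u r' = 0 ∧ dot3 v' r + dot3 v r' = 0 ∧ dot3 w' r + dot3 w r' = 0) ∨
      ∃ r', (∀ c : ℂ, r' ≠ c • r) ∧ dot3 u r' = 0 ∧ dot3 v r' = 0 ∧ dot3 w r' = 0)

lemma DeformableKernel.cycle {u v w u' v' w' : Fin 3 → ℂ}
    (h : DeformableKernel u v w u' v' w') : DeformableKernel v w u v' w' u' := by
  obtain ⟨r, hr, ⟨h1, h2, h3⟩, h⟩ := h
  refine ⟨r, hr, ⟨h2, h3, h1⟩, ?_⟩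
  rcases h with ⟨r', k1, k2, k3⟩ | ⟨r', hr', k1, k2, k3⟩
  · exact Or.inl ⟨r', k2, k3, k1⟩
  · exact Or.inr ⟨r', hr', k2, k3, k1⟩

lemma exists_dot3_ne_zero {r : Fin 3 → ℂ} (hr : r ≠ 0) : ∃ x, dot3 x r ≠ 0 := by
  rcases exists_ne_zero_fin_three hr with h | h | h
  exacts [⟨![1, 0, 0], by simpa [dot3]⟩, ⟨![0, 1, 0], by simpa [dot3]⟩, ⟨![0, 0, 1], by simpa [dot3]⟩]

lemma deformableKernel_of_cross3 {u v w u' v' w' : Fin 3 → ℂ} (hd : det3 u v w = 0)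
    (hD : det3' u v w u' v' w' = 0) (hc : cross3 u v ≠ 0) : DeformableKernel u v w u' v' w' := by
  have hw : dot3 w (cross3 u v) = 0 := by
    rw [← hd]; simp [det3, dot3, cross3]; ring
  refine ⟨cross3 u v, hc, ⟨dot3_cross3_left u v, dot3_cross3_right u v, hw⟩, Or.inl ?_⟩
  obtain ⟨x, hx⟩ := exists_dot3_ne_zero hc
  have hx' : dot3 x (cross3 u v) = det3 u v x := by simp [det3, dot3, cross3]; ring
  rw [hx'] at hx
  set y1 := dot3 u' (cross3 u v) with hy1
  set y2 := dot3 v' (cross3 u v) with hy2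
  have hdot : ∀ z : Fin 3 → ℂ,
      dot3 z (fun i => -(y1 * cross3 v x i + y2 * cross3 x u i) / det3 u v x) =
      -(y1 * dot3 z (cross3 v x) + y2 * dot3 z (cross3 x u)) / det3 u v x := by
    intro z
    simp only [dot3]
    ring
  simp only [det3', det3] at hd hD
  refine ⟨fun i => -(y1 * cross3 v x i + y2 * cross3 x u i) / det3 u v x, ?_, ?_, ?_⟩ <;>
    refine mul_right_cancel₀ hx ?_ <;>
    rw [hdot, add_mul, div_mul_cancel₀ _ hx, zero_mul] <;>
    simp only [hy1, hy2, dot3, cross3, det3, Matrix.cons_val]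
  · ring
  · ring
  · linear_combination (u 0*(v 1*x 2 - v 2*x 1) + u 1*(v 2*x 0 - v 0*x 2) +
      u 2*(v 0*x 1 - v 1*x 0)) * hD
      - (u' 0*(v 1*x 2 - v 2*x 1) + u' 1*(v 2*x 0 - v 0*x 2) +
      u' 2*(v 0*x 1 - v 1*x 0) + u 0*(v' 1*x 2 - v' 2*x 1)
      + u 1*(v' 2*x 0 - v' 0*x 2) + u 2*(v' 0*x 1 - v' 1*x 0)) * hd

lemma exists_orthogonal_pair (u : Fin 3 → ℂ) :
    ∃ r r' : Fin 3 → ℂ, r ≠ 0 ∧ (∀ c : ℂ, r' ≠ c • r) ∧ dot3 u r = 0 ∧ dot3 u r' = 0 := by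
  have key : ∀ r r' : Fin 3 → ℂ, ∀ i j, r i ≠ 0 → r j = 0 → r' j ≠ 0 →
      r ≠ 0 ∧ ∀ c : ℂ, r' ≠ c • r := by
    intro r r' i j hi hj hj'
    refine ⟨fun h => hi (congrFun h i), fun c h => hj' ?_⟩
    rw [h, Pi.smul_apply, hj, smul_zero]
  by_cases h0 : u 0 = 0
  · by_cases h1 : u 1 = 0
    · obtain ⟨k1, k2⟩ := key ![1, 0, 0] ![0, 1, 0] 0 1 (by simp) (by simp) (by simp)
      exact ⟨_, _, k1, k2, by simp [dot3, h0], by simp [dot3, h1]⟩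
    · obtain ⟨k1, k2⟩ := key ![1, 0, 0] ![0, -u 2, u 1] 0 2 (by simp) (by simp) (by simpa)
      exact ⟨_, _, k1, k2, by simp [dot3, h0], by simp [dot3]; ring⟩
  · obtain ⟨k1, k2⟩ := key ![-u 1, u 0, 0] ![-u 2, 0, u 0] 1 2 (by simpa) (by simp) (by simpa)
    exact ⟨_, _, k1, k2, by simp [dot3]; ring, by simp [dot3]; ring⟩

/-- If a matrix is singular to first order along a deformation, then its kernel has dimension at
least two or a kernel vector deforms. -/
lemma deformableKernel_of_det3 {u v w u' v' w' : Fin 3 → ℂ} (hd : det3 u v w = 0)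
    (hD : det3' u v w u' v' w' = 0) : DeformableKernel u v w u' v' w' := by
  by_cases h3 : cross3 u v = 0
  · by_cases h1 : cross3 v w = 0
    · by_cases h2 : cross3 w u = 0
      · have aux : ∀ x z : Fin 3 → ℂ, x ≠ 0 → cross3 x z = 0 → ∀ r, dot3 x r = 0 → dot3 z r = 0 := by
          intro x z hx hxz r hr
          have e0 := congrFun hxz 0
          have e1 := congrFun hxz 1
          have e2 := congrFun hxz 2
          simp only [cross3, Matrix.cons_val, Pi.zero_apply] at e0 e1 e2
          simp only [dot3] at hr ⊢
          rcases exists_ne_zero_fin_three hx with h | h | h <;> refine mul_left_cancel₀ h ?_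
          · linear_combination z 0*hr + r 1*e2 - r 2*e1
          · linear_combination z 1*hr + r 2*e0 - r 0*e2
          · linear_combination z 2*hr + r 0*e1 - r 1*e0
        have anti : ∀ x z : Fin 3 → ℂ, cross3 x z = 0 → cross3 z x = 0 := by
          intro x z h
          have : cross3 z x = -cross3 x z := by
            ext i; fin_cases i <;> simp [cross3] <;> ring
          rw [this, h, neg_zero]
        have zero_dot : ∀ r : Fin 3 → ℂ, dot3 0 r = 0 := fun r => by simp [dot3]
        suffices ∃ y : Fin 3 → ℂ, ∀ r, dot3 y r = 0 → dot3 u r = 0 ∧ dot3 v r = 0 ∧ dot3 w r = 0 by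
          obtain ⟨y, hy⟩ := this
          obtain ⟨r, r', hr, hr', k, k'⟩ := exists_orthogonal_pair y
          exact ⟨r, hr, hy r k, Or.inr ⟨r', hr', hy r' k'⟩⟩
        by_cases hu : u = 0
        · by_cases hv : v = 0
          · exact ⟨w, fun r hr => ⟨hu ▸ zero_dot r, hv ▸ zero_dot r, hr⟩⟩
          · exact ⟨v, fun r hr => ⟨hu ▸ zero_dot r, hr, aux v w hv h1 r hr⟩⟩
        · exact ⟨u, fun r hr => ⟨hr, aux u v hu h3 r hr, aux u w hu (anti _ _ h2) r hr⟩⟩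
      · refine (deformableKernel_of_cross3 ?_ ?_ h2).cycle
        · exact (det3_cycle v w u).trans ((det3_cycle u v w).trans hd)
        · exact (det3'_cycle v w u v' w' u').trans ((det3'_cycle u v w u' v' w').trans hD)
    · exact (deformableKernel_of_cross3 ((det3_cycle u v w).trans hd)
        ((det3'_cycle u v w u' v' w').trans hD) h1).cycle.cycle
  · exact deformableKernel_of_cross3 hd hD h3

/-! ### Binary forms -/

/-- A linear form in two variables vanishing at two points. -/
lemma cross_eq_zero_of_linear {u v x y x' y' : ℂ} (huv : u ≠ 0 ∨ v ≠ 0) (h : u * x + v * y = 0)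
    (h' : u * x' + v * y' = 0) : x * y' - y * x' = 0 := by
  rcases huv with hu | hv
  · refine mul_left_cancel₀ hu ?_
    linear_combination y' * h - y * h'
  · refine mul_left_cancel₀ hv ?_
    linear_combination x * h' - x' * h

lemma exists_root_of_linear (u v : ℂ) : ∃ x y : ℂ, (x ≠ 0 ∨ y ≠ 0) ∧ u * x + v * y = 0 := by
  by_cases h : u = 0 ∧ v = 0
  · exact ⟨1, 0, by simp, by simp [h.1]⟩
  · refine ⟨v, -u, ?_, by ring⟩
    rw [neg_ne_zero]
    tauto

/-- Two linear forms with vanishing determinant have a common zero. -/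
lemma exists_common_root {u v u' v' : ℂ} (h : u * v' - v * u' = 0) :
    ∃ x y : ℂ, (x ≠ 0 ∨ y ≠ 0) ∧ u * x + v * y = 0 ∧ u' * x + v' * y = 0 := by
  by_cases h0 : u = 0 ∧ v = 0
  · obtain ⟨x, y, hxy, e⟩ := exists_root_of_linear u' v'
    exact ⟨x, y, hxy, by simp [h0.1, h0.2], e⟩
  · refine ⟨v, -u, ?_, by ring, by linear_combination -h⟩
    rw [neg_ne_zero]
    tauto

lemma linear_ne_zero {u v u' v' x y : ℂ} (h : u * v' - v * u' ≠ 0) (hxy : x ≠ 0 ∨ y ≠ 0)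
    (h0 : u * x + v * y = 0) : u' * x + v' * y ≠ 0 := by
  intro h1
  rcases hxy with hx | hy
  · exact h ((mul_eq_zero.mp (show x * (u * v' - v * u') = 0 by
      linear_combination v' * h0 - v * h1)).resolve_left hx)
  · exact h ((mul_eq_zero.mp (show y * (u * v' - v * u') = 0 by
      linear_combination u * h1 - u' * h0)).resolve_left hy)

lemma quadratic_factor (c₀ c₁ c₂ : ℂ) : ∃ u v e f : ℂ,
    c₀ = u * e ∧ c₁ = u * f + v * e ∧ c₂ = v * f := by
  by_cases h : c₀ = 0
  · exact ⟨0, 1, c₁, c₂, by simp [h], by ring, by ring⟩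
  · have hd : (Polynomial.C c₀ * Polynomial.X^2 + Polynomial.C c₁ * Polynomial.X
        + Polynomial.C c₂).degree ≠ 0 := by
      rw [Polynomial.degree_quadratic h]; decide
    obtain ⟨r, hr⟩ := IsAlgClosed.exists_root _ hd
    simp only [Polynomial.IsRoot, Polynomial.eval_add, Polynomial.eval_mul, Polynomial.eval_pow,
      Polynomial.eval_X, Polynomial.eval_C] at hr
    exact ⟨1, -r, c₀, c₁ + r * c₀, by ring, by ring, by linear_combination hr⟩

lemma cubic_factor (c₀ c₁ c₂ c₃ : ℂ) : ∃ u v e₀ e₁ e₂ : ℂ,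
    c₀ = u * e₀ ∧ c₁ = u * e₁ + v * e₀ ∧ c₂ = u * e₂ + v * e₁ ∧ c₃ = v * e₂ := by
  by_cases h : c₀ = 0
  · exact ⟨0, 1, c₁, c₂, c₃, by simp [h], by ring, by ring, by ring⟩
  · have hd : (Polynomial.C c₀ * Polynomial.X^3 + Polynomial.C c₁ * Polynomial.X^2
        + Polynomial.C c₂ * Polynomial.X + Polynomial.C c₃).degree ≠ 0 := by
      rw [Polynomial.degree_cubic h]; decide
    obtain ⟨r, hr⟩ := IsAlgClosed.exists_root _ hd
    simp only [Polynomial.IsRoot, Polynomial.eval_add, Polynomial.eval_mul, Polynomial.eval_pow,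
      Polynomial.eval_X, Polynomial.eval_C] at hr
    exact ⟨1, -r, c₀, c₁ + r * c₀, c₂ + r * (c₁ + r * c₀), by ring, by ring, by ring,
      by linear_combination hr⟩

lemma quartic_factor (c₀ c₁ c₂ c₃ c₄ : ℂ) : ∃ u v e₀ e₁ e₂ e₃ : ℂ,
    c₀ = u * e₀ ∧ c₁ = u * e₁ + v * e₀ ∧ c₂ = u * e₂ + v * e₁ ∧ c₃ = u * e₃ + v * e₂ ∧
      c₄ = v * e₃ := by
  by_cases h : c₀ = 0
  · exact ⟨0, 1, c₁, c₂, c₃, c₄, by simp [h], by ring, by ring, by ring, by ring⟩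
  · have hd : (Polynomial.C c₀ * Polynomial.X^4 + (Polynomial.C c₁ * Polynomial.X^3
        + Polynomial.C c₂ * Polynomial.X^2 + Polynomial.C c₃ * Polynomial.X
        + Polynomial.C c₄)).degree ≠ 0 := by
      rw [Polynomial.degree_add_eq_left_of_degree_lt]
      · rw [Polynomial.degree_C_mul_X_pow 4 h]; decide
      · rw [Polynomial.degree_C_mul_X_pow 4 h]
        exact Polynomial.degree_cubic_le.trans_lt (by decide)
    obtain ⟨r, hr⟩ := IsAlgClosed.exists_root _ hd
    simp only [Polynomial.IsRoot, Polynomial.eval_add, Polynomial.eval_mul, Polynomial.eval_pow,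
      Polynomial.eval_X, Polynomial.eval_C] at hr
    exact ⟨1, -r, c₀, c₁ + r * c₀, c₂ + r * (c₁ + r * c₀), c₃ + r * (c₂ + r * (c₁ + r * c₀)),
      by ring, by ring, by ring, by ring, by linear_combination hr⟩

/-- The binary form with coefficients `c`, together with its differential, has `d` simple roots. -/
structure HasSimpleRoots (d : ℕ) (f : ℂ → ℂ → ℂ) (f' : ℂ → ℂ → ℂ → ℂ → ℂ) : Prop where
  exists_roots : ∃ a b : Fin d → ℂ, (∀ k, (a k ≠ 0 ∨ b k ≠ 0) ∧ f (a k) (b k) = 0) ∧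
    (∀ k l, k ≠ l → a k * b l - b k * a l ≠ 0) ∧ ∀ x y, f x y = 0 → ∃ k, a k * y - b k * x = 0
  simple : ∀ x y x' y', (x ≠ 0 ∨ y ≠ 0) → f x y = 0 → f' x y x' y' = 0 → x * y' - y * x' = 0

/-- A root at which the differential vanishes. -/
def HasDoubleRoot (f : ℂ → ℂ → ℂ) (f' : ℂ → ℂ → ℂ → ℂ → ℂ) : Prop :=
  ∃ x y, (x ≠ 0 ∨ y ≠ 0) ∧ f x y = 0 ∧ ∀ x' y', f' x y x' y' = 0

section Forms

variable (c₀ c₁ c₂ c₃ c₄ : ℂ)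

def quadraticForm (x y : ℂ) : ℂ := c₀ * x^2 + c₁ * x * y + c₂ * y^2

def quadraticForm' (x y x' y' : ℂ) : ℂ :=
  (2*c₀ * x + c₁ * y) * x' + (c₁ * x + 2*c₂ * y) * y'

def cubicForm (x y : ℂ) : ℂ := c₀ * x^3 + c₁ * x^2*y + c₂ * x * y^2 + c₃ * y^3

def cubicForm' (x y x' y' : ℂ) : ℂ :=
  (3*c₀ * x^2 + 2*c₁ * x * y + c₂ * y^2) * x' + (c₁ * x^2 + 2*c₂ * x * y + 3*c₃ * y^2) * y'

def quarticForm (x y : ℂ) : ℂ :=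
  c₀ * x^4 + c₁ * x^3*y + c₂ * x^2*y^2 + c₃ * x * y^3 + c₄ * y^4

def quarticForm' (x y x' y' : ℂ) : ℂ :=
  (4*c₀ * x^3 + 3*c₁ * x^2*y + 2*c₂ * x * y^2 + c₃ * y^3) * x' +
    (c₁ * x^3 + 2*c₂ * x^2*y + 3*c₃ * x * y^2 + 4*c₄ * y^3) * y'

end Forms

/-- The product of the linear forms `u i * x + v i * y`. -/
def linearProd {d : ℕ} (u v : Fin d → ℂ) (x y : ℂ) : ℂ := ∏ i, (u i * x + v i * y)

/-- The differential of `linearProd`. -/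
def linearProd' {d : ℕ} (u v : Fin d → ℂ) (x y x' y' : ℂ) : ℂ :=
  ∑ i, ∏ j, if j = i then u j * x' + v j * y' else u j * x + v j * y

lemma linearProd'_eq_zero_iff {d : ℕ} {u v : Fin d → ℂ} {x y x' y' : ℂ} {k : Fin d}
    (hk : u k * x + v k * y = 0) : linearProd' u v x y x' y' = 0 ↔
      (u k * x' + v k * y' = 0 ∨ ∃ j, j ≠ k ∧ u j * x + v j * y = 0) := by
  rw [linearProd', Finset.sum_eq_single k, Finset.prod_eq_zero_iff]
  · constructor
    · rintro ⟨j, -, hj⟩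
      split_ifs at hj with h
      · exact Or.inl (h ▸ hj)
      · exact Or.inr ⟨j, h, hj⟩
    · rintro (h | ⟨j, hj, h⟩)
      · exact ⟨k, Finset.mem_univ _, by rw [if_pos rfl, h]⟩
      · exact ⟨j, Finset.mem_univ _, by rw [if_neg hj, h]⟩
  · intro i _ hi
    exact Finset.prod_eq_zero (Finset.mem_univ k) (by rw [if_neg hi.symm, hk])
  · intro h
    exact absurd (Finset.mem_univ k) h

lemma hasSimpleRoots_linearProd {d : ℕ} {u v : Fin d → ℂ} (hn : ∀ k, u k ≠ 0 ∨ v k ≠ 0)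
    (h : ∀ k l, k ≠ l → u k * v l - v k * u l ≠ 0) :
    HasSimpleRoots d (linearProd u v) (linearProd' u v) where
  exists_roots := by
    refine ⟨v, fun k => -u k, fun k => ⟨?_, ?_⟩, fun k l hkl h0 => ?_, fun x y hxy => ?_⟩
    · rw [neg_ne_zero]
      exact (hn k).symm
    · exact Finset.prod_eq_zero (Finset.mem_univ k) (by ring)
    · exact h k l hkl (by linear_combination h0)
    · obtain ⟨k, -, hk⟩ := Finset.prod_eq_zero_iff.mp hxy
      exact ⟨k, by linear_combination hk⟩
  simple x y x' y' hxy h0 h1 := by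
    obtain ⟨k, -, hk⟩ := Finset.prod_eq_zero_iff.mp h0
    rcases (linearProd'_eq_zero_iff hk).mp h1 with h2 | ⟨j, hj, h2⟩
    · exact cross_eq_zero_of_linear (hn k) hk h2
    · exact absurd h2 (linear_ne_zero (h k j hj.symm) hxy hk)

lemma hasDoubleRoot_linearProd {d : ℕ} {u v : Fin d → ℂ} {k l : Fin d} (hkl : k ≠ l)
    (h : u k * v l - v k * u l = 0) : HasDoubleRoot (linearProd u v) (linearProd' u v) := by
  obtain ⟨x, y, hxy, e1, e2⟩ := exists_common_root h
  exact ⟨x, y, hxy, Finset.prod_eq_zero (Finset.mem_univ k) e1, fun x' y' =>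
    (linearProd'_eq_zero_iff e1).mpr (Or.inr ⟨l, hkl.symm, e2⟩)⟩

lemma ne_zero_of_pairwise {d : ℕ} {u v : Fin d → ℂ} (hd : 2 ≤ d)
    (h : ∀ k l, k < l → u k * v l - v k * u l ≠ 0) :
    (∀ k, u k ≠ 0 ∨ v k ≠ 0) ∧ ∀ k l, k ≠ l → u k * v l - v k * u l ≠ 0 := by
  have h' : ∀ k l, k ≠ l → u k * v l - v k * u l ≠ 0 := by
    intro k l hkl
    rcases lt_or_gt_of_ne hkl with h1 | h1
    · exact h k l h1
    · exact fun h0 => h l k h1 (by linear_combination -h0)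
  refine ⟨fun k => ?_, h'⟩
  have : Nontrivial (Fin d) := Fin.nontrivial_iff_two_le.mpr hd
  obtain ⟨l, hl⟩ := exists_ne k
  by_contra! hc
  exact h' k l hl.symm (by rw [hc.1, hc.2]; ring)

lemma roots_of_disc {d : ℕ} (hd : 2 ≤ d) {u v : Fin d → ℂ} {f : ℂ → ℂ → ℂ}
    {f' : ℂ → ℂ → ℂ → ℂ → ℂ} {δ : ℂ} (hf : f = linearProd u v) (hf' : f' = linearProd' u v)
    (h0 : δ = 0 → ∃ k l, k ≠ l ∧ u k * v l - v k * u l = 0)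
    (h1 : ∀ k l, k < l → u k * v l - v k * u l = 0 → δ = 0) :
    (δ ≠ 0 → HasSimpleRoots d f f') ∧ (δ = 0 → HasDoubleRoot f f') := by
  subst hf hf'
  constructor
  · intro h
    obtain ⟨k1, k2⟩ := ne_zero_of_pairwise hd fun k l hkl h' => h (h1 k l hkl h')
    exact hasSimpleRoots_linearProd k1 k2
  · intro h
    obtain ⟨k, l, hkl, e⟩ := h0 h
    exact hasDoubleRoot_linearProd hkl e

lemma quadratic_roots (c₀ c₁ c₂ : ℂ) : (c₁^2 - 4*c₀ * c₂ ≠ 0 →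
      HasSimpleRoots 2 (quadraticForm c₀ c₁ c₂) (quadraticForm' c₀ c₁ c₂)) ∧ (c₁^2 - 4*c₀ * c₂ = 0 →
      HasDoubleRoot (quadraticForm c₀ c₁ c₂) (quadraticForm' c₀ c₁ c₂)) := by
  obtain ⟨u₁, v₁, u₂, v₂, rfl, rfl, rfl⟩ := quadratic_factor c₀ c₁ c₂
  have e : (u₁ * v₂ + v₁ * u₂)^2 - 4*(u₁ * u₂) * (v₁ * v₂) = (u₁ * v₂ - v₁ * u₂)^2 := by
    ring
  rw [e]
  refine roots_of_disc le_rfl (u := ![u₁, u₂]) (v := ![v₁, v₂]) ?_ ?_ ?_ ?_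
  · funext x y
    simp [quadraticForm, linearProd, Fin.prod_univ_two]
    ring
  · funext x y x' y'
    simp [quadraticForm', linearProd', Fin.prod_univ_two, Fin.sum_univ_two]
    ring
  · intro h
    exact ⟨0, 1, by decide, by simpa using h⟩
  · intro k l hkl h
    fin_cases k <;> fin_cases l <;> simp at hkl h <;> simp [h]

lemma cubic_roots (c₀ c₁ c₂ c₃ : ℂ) {δ : ℂ} (hδ : δ = c₁^2*c₂^2 - 4*c₀ * c₂^3
      - 4*c₁^3*c₃ - 27*c₀^2*c₃^2 + 18*c₀ * c₁ * c₂ * c₃) :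
    (δ ≠ 0 → HasSimpleRoots 3 (cubicForm c₀ c₁ c₂ c₃) (cubicForm' c₀ c₁ c₂ c₃)) ∧
    (δ = 0 → HasDoubleRoot (cubicForm c₀ c₁ c₂ c₃) (cubicForm' c₀ c₁ c₂ c₃)) := by
  obtain ⟨u₁, v₁, e₀, e₁, e₂, rfl, rfl, rfl, rfl⟩ := cubic_factor c₀ c₁ c₂ c₃
  obtain ⟨u₂, v₂, u₃, v₃, rfl, rfl, rfl⟩ := quadratic_factor e₀ e₁ e₂
  have e : δ = ((u₁ * v₂ - v₁ * u₂) * (u₁ * v₃ - v₁ * u₃) * (u₂ * v₃ - v₂ * u₃))^2 := by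
    rw [hδ]; ring
  refine roots_of_disc (by norm_num) (u := ![u₁, u₂, u₃]) (v := ![v₁, v₂, v₃]) ?_ ?_ ?_ ?_
  · funext x y
    simp [cubicForm, linearProd, Fin.prod_univ_three]
    ring
  · funext x y x' y'
    simp [cubicForm', linearProd', Fin.prod_univ_three, Fin.sum_univ_three]
    ring
  · intro h
    rw [e, pow_eq_zero_iff two_ne_zero, mul_eq_zero, mul_eq_zero] at h
    rcases h with (h | h) | h
    · exact ⟨0, 1, by decide, by simpa using h⟩
    · exact ⟨0, 2, by decide, by simpa using h⟩
    · exact ⟨1, 2, by decide, by simpa using h⟩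
  · intro k l hkl h
    rw [e]
    fin_cases k <;> fin_cases l <;> simp at hkl h <;> simp [h]

/-- The discriminant of a binary quartic, up to the factor `27`. -/
def quarticDisc {R : Type*} [CommRing R] (c₀ c₁ c₂ c₃ c₄ : R) : R :=
  4*(12*c₀ * c₄ - 3*c₁ * c₃ + c₂^2)^3 -
    (72*c₀ * c₂ * c₄ + 9*c₁ * c₂ * c₃ - 27*c₀ * c₃^2 - 27*c₄ * c₁^2 - 2*c₂^3)^2

lemma quarticDisc_prod {R : Type*} [CommRing R] (u₁ v₁ u₂ v₂ u₃ v₃ u₄ v₄ : R) :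
    quarticDisc (u₁ * (u₂ * (u₃ * u₄)))
      (u₁ * (u₂ * (u₃ * v₄ + v₃ * u₄) + v₂ * (u₃ * u₄)) + v₁ * (u₂ * (u₃ * u₄)))
      (u₁ * (u₂ * (v₃ * v₄) + v₂ * (u₃ * v₄ + v₃ * u₄)) +
        v₁ * (u₂ * (u₃ * v₄ + v₃ * u₄) + v₂ * (u₃ * u₄)))
      (u₁ * (v₂ * (v₃ * v₄)) + v₁ * (u₂ * (v₃ * v₄) + v₂ * (u₃ * v₄ + v₃ * u₄)))
      (v₁ * (v₂ * (v₃ * v₄))) =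
      27*(((u₁ * v₂ - v₁ * u₂) * (u₁ * v₃ - v₁ * u₃) * (u₁ * v₄ - v₁ * u₄)) *
        ((u₂ * v₃ - v₂ * u₃) * (u₂ * v₄ - v₂ * u₄) * (u₃ * v₄ - v₃ * u₄)))^2 := by
  obtain ⟨U, hU⟩ : ∃ U, U = (u₁ * v₂ - v₁ * u₂) * (u₃ * v₄ - v₃ * u₄) := ⟨_, rfl⟩
  obtain ⟨V, hV⟩ : ∃ V, V = (u₁ * v₃ - v₁ * u₃) * (u₄ * v₂ - v₄ * u₂) := ⟨_, rfl⟩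
  have hprod : (((u₁ * v₂ - v₁ * u₂) * (u₁ * v₃ - v₁ * u₃) * (u₁ * v₄ - v₁ * u₄)) *
      ((u₂ * v₃ - v₂ * u₃) * (u₂ * v₄ - v₂ * u₄) * (u₃ * v₄ - v₃ * u₄))) = U * V * (U + V) := by
    rw [hU, hV]; ring
  rw [hprod, quarticDisc]
  have hI : 12*(u₁ * (u₂ * (u₃ * u₄))) * (v₁ * (v₂ * (v₃ * v₄))) -
      3*(u₁ * (u₂ * (u₃ * v₄ + v₃ * u₄) + v₂ * (u₃ * u₄)) + v₁ * (u₂ * (u₃ * u₄))) *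
        (u₁ * (v₂ * (v₃ * v₄)) + v₁ * (u₂ * (v₃ * v₄) + v₂ * (u₃ * v₄ + v₃ * u₄))) +
      (u₁ * (u₂ * (v₃ * v₄) + v₂ * (u₃ * v₄ + v₃ * u₄)) +
        v₁ * (u₂ * (u₃ * v₄ + v₃ * u₄) + v₂ * (u₃ * u₄)))^2 = U^2 + U * V + V^2 := by
    rw [hU, hV]; ring
  have hJ : 72*(u₁ * (u₂ * (u₃ * u₄))) * (u₁ * (u₂ * (v₃ * v₄) + v₂ * (u₃ * v₄ + v₃ * u₄)) +
          v₁ * (u₂ * (u₃ * v₄ + v₃ * u₄) + v₂ * (u₃ * u₄))) * (v₁ * (v₂ * (v₃ * v₄))) +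
      9*(u₁ * (u₂ * (u₃ * v₄ + v₃ * u₄) + v₂ * (u₃ * u₄)) + v₁ * (u₂ * (u₃ * u₄))) *
        (u₁ * (u₂ * (v₃ * v₄) + v₂ * (u₃ * v₄ + v₃ * u₄)) +
          v₁ * (u₂ * (u₃ * v₄ + v₃ * u₄) + v₂ * (u₃ * u₄))) *
        (u₁ * (v₂ * (v₃ * v₄)) + v₁ * (u₂ * (v₃ * v₄) + v₂ * (u₃ * v₄ + v₃ * u₄))) -
      27*(u₁ * (u₂ * (u₃ * u₄))) *
        (u₁ * (v₂ * (v₃ * v₄)) + v₁ * (u₂ * (v₃ * v₄) + v₂ * (u₃ * v₄ + v₃ * u₄)))^2 -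
      27*(v₁ * (v₂ * (v₃ * v₄))) *
        (u₁ * (u₂ * (u₃ * v₄ + v₃ * u₄) + v₂ * (u₃ * u₄)) + v₁ * (u₂ * (u₃ * u₄)))^2 -
      2*(u₁ * (u₂ * (v₃ * v₄) + v₂ * (u₃ * v₄ + v₃ * u₄)) +
        v₁ * (u₂ * (u₃ * v₄ + v₃ * u₄) + v₂ * (u₃ * u₄)))^3 =
      (U - V) * (U + 2*V) * (-(2*U + V)) := by
    rw [hU, hV]; ring
  rw [hI, hJ]
  ring

lemma quartic_roots (c₀ c₁ c₂ c₃ c₄ : ℂ) : (quarticDisc c₀ c₁ c₂ c₃ c₄ ≠ 0 →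
      HasSimpleRoots 4 (quarticForm c₀ c₁ c₂ c₃ c₄) (quarticForm' c₀ c₁ c₂ c₃ c₄)) ∧
    (quarticDisc c₀ c₁ c₂ c₃ c₄ = 0 →
      HasDoubleRoot (quarticForm c₀ c₁ c₂ c₃ c₄) (quarticForm' c₀ c₁ c₂ c₃ c₄)) := by
  obtain ⟨u₁, v₁, e₀, e₁, e₂, e₃, rfl, rfl, rfl, rfl, rfl⟩ := quartic_factor c₀ c₁ c₂ c₃ c₄
  obtain ⟨u₂, v₂, g₀, g₁, g₂, rfl, rfl, rfl, rfl⟩ := cubic_factor e₀ e₁ e₂ e₃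
  obtain ⟨u₃, v₃, u₄, v₄, rfl, rfl, rfl⟩ := quadratic_factor g₀ g₁ g₂
  have e : quarticDisc (u₁ * (u₂ * (u₃ * u₄)))
      (u₁ * (u₂ * (u₃ * v₄ + v₃ * u₄) + v₂ * (u₃ * u₄)) + v₁ * (u₂ * (u₃ * u₄)))
      (u₁ * (u₂ * (v₃ * v₄) + v₂ * (u₃ * v₄ + v₃ * u₄)) +
        v₁ * (u₂ * (u₃ * v₄ + v₃ * u₄) + v₂ * (u₃ * u₄)))
      (u₁ * (v₂ * (v₃ * v₄)) + v₁ * (u₂ * (v₃ * v₄) + v₂ * (u₃ * v₄ + v₃ * u₄)))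
      (v₁ * (v₂ * (v₃ * v₄))) =
      27*(((u₁ * v₂ - v₁ * u₂) * (u₁ * v₃ - v₁ * u₃) * (u₁ * v₄ - v₁ * u₄)) *
        ((u₂ * v₃ - v₂ * u₃) * (u₂ * v₄ - v₂ * u₄) * (u₃ * v₄ - v₃ * u₄)))^2 :=
    quarticDisc_prod ..
  refine roots_of_disc (by norm_num) (u := ![u₁, u₂, u₃, u₄]) (v := ![v₁, v₂, v₃, v₄]) ?_ ?_ ?_ ?_
  · funext x y
    simp [quarticForm, linearProd, Fin.prod_univ_four]
    ring
  · funext x y x' y'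
    simp [quarticForm', linearProd', Fin.prod_univ_four, Fin.sum_univ_four]
    ring
  · intro h
    rw [e, mul_eq_zero, or_iff_right (by norm_num), pow_eq_zero_iff two_ne_zero, mul_eq_zero,
      mul_eq_zero, mul_eq_zero, mul_eq_zero, mul_eq_zero] at h
    rcases h with ((h | h) | h) | ((h | h) | h)
    · exact ⟨0, 1, by decide, by simpa using h⟩
    · exact ⟨0, 2, by decide, by simpa using h⟩
    · exact ⟨0, 3, by decide, by simpa using h⟩
    · exact ⟨1, 2, by decide, by simpa using h⟩
    · exact ⟨1, 3, by decide, by simpa using h⟩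
    · exact ⟨2, 3, by decide, by simpa using h⟩
  · intro k l hkl h
    rw [e]
    fin_cases k <;> fin_cases l <;> simp at hkl h <;> simp [h]

/-! ### Rank conditions in coordinates -/

/-- The rank numbers of the permutation with one-line notation `v`. -/
def rankTable {n : ℕ} (v : Fin n → ℕ) (i j : ℕ) : ℕ :=
  (Finset.univ.filter fun l : Fin n => (l : ℕ) < i ∧ n < j + v l).card

section Flags

variable {k n : ℕ} {α : Fin k → ℕ} {v : Fin n → ℕ} {hv : ∀ i, 1 ≤ v i ∧ v i ≤ n}
  {hinj : Function.Injective v} {τ : OnePoint ℂ} {E : PartialFlag α n}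

lemma mem_schubertVariety_oneLine : E ∈ schubertVariety α (oneLine v hv hinj) τ ↔
    ∀ i : Fin k, ∀ j ≤ n, rankTable v (α i) j ≤ dim ↥(E.space i ⊓ osc n τ j) := by
  change (∀ i : Fin k, ∀ j : ℕ, j ≤ n → _) ↔ _
  simp only [rankNumber_oneLine, rankTable]

lemma le_finrank_inf_osculatingSpace (A : Submodule ℂ (Fin n → ℂ)) (τ : OnePoint ℂ) {j : ℕ}
    (hj : j ≤ n) : dim A + j - n ≤ dim ↥(A ⊓ osc n τ j) := by
  have h1 := Submodule.finrank_sup_add_finrank_inf_eq A (osc n τ j)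
  have h2 := Submodule.finrank_le (A ⊔ osc n τ j)
  rw [finrank_osculatingSpace τ hj] at h1
  rw [Module.finrank_fin_fun] at h2
  omega

lemma mem_schubertVariety_of_essential
    (h : ∀ i : Fin k, ∀ j ≤ n, rankTable v (α i) j ≠ α i + j - n → rankTable v (α i) j ≤
      dim ↥(E.space i ⊓ osc n τ j)) : E ∈ schubertVariety α (oneLine v hv hinj) τ := by
  rw [mem_schubertVariety_oneLine]
  intro i j hj
  by_cases hg : rankTable v (α i) j = α i + j - n
  · rw [hg, ← E.finrank_eq i]
    exact le_finrank_inf_osculatingSpace _ τ hj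
  · exact h i j hj hg

lemma IsTangent.map_le {ψ : Module.End ℂ (Fin n → ℂ)}
    (h : IsTangent α (oneLine v hv hinj) τ E ψ) (i : Fin k) {j : ℕ} (hj : j ≤ n)
    (hfin : dim ↥(E.space i ⊓ osc n τ j) = rankTable v (α i) j)
    {x : Fin n → ℂ} (hx : x ∈ E.space i) (hx' : x ∈ osc n τ j) : ψ x ∈ E.space i ⊔ osc n τ j :=
  h i j hj (by rw [rankNumber_oneLine, hfin, rankTable]) ⟨x, ⟨hx, hx'⟩, rfl⟩

lemma isTangent_oneLine {ψ : Module.End ℂ (Fin n → ℂ)}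
    (h : ∀ i : Fin k, ∀ j ≤ n, rankTable v (α i) j ≠ α i + j - n →
      dim ↥(E.space i ⊓ osc n τ j) = rankTable v (α i) j →
      (E.space i ⊓ osc n τ j).map ψ ≤ E.space i ⊔ osc n τ j) :
    IsTangent α (oneLine v hv hinj) τ E ψ := by
  intro i j hj hfin
  rw [rankNumber_oneLine] at hfin
  by_cases hg : rankTable v (α i) j = α i + j - n
  · refine map_inf_le_sup_of_generic τ hj ?_
    rw [hfin, E.finrank_eq, ← hg, rankTable]
  · exact h i j hj hg hfin

end Flags

/-- The linear form with given coefficients. -/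
noncomputable def form {n : ℕ} (c : Fin n → ℂ) : (Fin n → ℂ) →ₗ[ℂ] ℂ :=
  ∑ i, c i • LinearMap.proj i

lemma form_apply {n : ℕ} (c v : Fin n → ℂ) : form c v = ∑ i, c i * v i := by
  simp [form]

lemma finrank_inf_ker {n : ℕ} {S : Submodule ℂ (Fin n → ℂ)} {f : (Fin n → ℂ) →ₗ[ℂ] ℂ}
    {x : Fin n → ℂ} (hx : x ∈ S) (hfx : f x ≠ 0) : dim ↥(S ⊓ LinearMap.ker f) + 1 = dim S := by
  have h1 : dim S ≤ dim ↥(S ⊓ LinearMap.ker f) + 1 :=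
    finrank_le_add_of_equations (LinearMap.pi fun _ => f) fun v hv h =>
      ⟨hv, congrFun h 0⟩
  have h2 : dim ↥(S ⊓ LinearMap.ker f) < dim S :=
    Submodule.finrank_lt_finrank_of_lt
      (lt_of_le_of_ne inf_le_left fun h => hfx ((inf_eq_left.mp h) hx))
  omega

/-- Two subspaces whose sum is proper are annihilated by a linear form. -/
lemma exists_form {n : ℕ} {A B : Submodule ℂ (Fin n → ℂ)}
    (h : dim A + dim B < n + dim ↥(A ⊓ B)) :
    ∃ c : Fin n → ℂ, c ≠ 0 ∧ (∀ v ∈ A, ∑ i, c i * v i = 0) ∧ ∀ v ∈ B, ∑ i, c i * v i = 0 := by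
  have h1 := Submodule.finrank_sup_add_finrank_inf_eq A B
  have h2 : A ⊔ B < ⊤ := by
    rw [lt_top_iff_ne_top]
    intro h3
    rw [h3, finrank_top, Module.finrank_fin_fun] at h1
    omega
  obtain ⟨f, hf, hle⟩ := Submodule.exists_le_ker_of_lt_top _ h2
  have hfe : ∀ v, f v = ∑ i, f (Pi.single i 1) * v i := by
    intro v
    conv_lhs => rw [pi_eq_sum_univ' v]
    simp [_root_.map_sum, mul_comm]
  refine ⟨fun i => f (Pi.single i 1), fun h0 => hf ?_, fun v hv => ?_, fun v hv => ?_⟩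
  · ext i
    simpa using congrFun h0 i
  · rw [← hfe]
    exact hle (Submodule.mem_sup_left hv)
  · rw [← hfe]
    exact hle (Submodule.mem_sup_right hv)

lemma finrank_le_one_of_smul {n : ℕ} {S : Submodule ℂ (Fin n → ℂ)} (p : Fin n → ℂ)
    (h : ∀ v ∈ S, ∃ c : ℂ, v = c • p) : dim S ≤ 1 := by
  refine (Submodule.finrank_mono (t := Submodule.span ℂ {p}) fun v hv => ?_).trans
    (finrank_span_le_card {p} |>.trans (by simp))
  obtain ⟨c, rfl⟩ := h v hv
  exact Submodule.mem_span_singleton.mpr ⟨c, rfl⟩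

lemma le_of_finrank_le_finrank_inf {n : ℕ} {A B : Submodule ℂ (Fin n → ℂ)}
    (h : dim A ≤ dim ↥(A ⊓ B)) : A ≤ B :=
  inf_eq_left.mp (Submodule.eq_of_le_of_finrank_le inf_le_left h)

lemma exists_mul_of_cross {a b x y : ℂ} (hab : a ≠ 0 ∨ b ≠ 0) (h : b * x = a * y) :
    ∃ c, x = c * a ∧ y = c * b := by
  rcases hab with ha | hb
  · exact ⟨x / a, by field_simp, by field_simp; linear_combination -h⟩
  · exact ⟨y / b, by field_simp; linear_combination h, by field_simp⟩

lemma exists_dual {a b : ℂ} (hab : a ≠ 0 ∨ b ≠ 0) : ∃ x y : ℂ, x * a + y * b = 1 := by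
  rcases hab with ha | hb
  · exact ⟨a⁻¹, 0, by field_simp; ring⟩
  · exact ⟨0, b⁻¹, by field_simp; ring⟩

lemma exists_dot3_of_not_smul {r r' : Fin 3 → ℂ} (hr : r ≠ 0) (h : ∀ c : ℂ, r' ≠ c • r) :
    ∃ u, dot3 r u = 0 ∧ dot3 r' u ≠ 0 := by
  by_contra! hc
  have e0 := hc ![0, r 2, -r 1] (by simp [dot3]; ring)
  have e1 := hc ![-r 2, 0, r 0] (by simp [dot3]; ring)
  have e2 := hc ![r 1, -r 0, 0] (by simp [dot3]; ring)
  simp only [dot3, Matrix.cons_val] at e0 e1 e2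
  rcases exists_ne_zero_fin_three hr with h0 | h0 | h0
  · refine h (r' 0 / r 0) (funext fun i => ?_)
    rw [Pi.smul_apply, smul_eq_mul]
    field_simp
    fin_cases i <;> simp only [Fin.zero_eta, Fin.mk_one, Fin.reduceFinMk]
    · linear_combination -e2
    · linear_combination e1
  · refine h (r' 1 / r 1) (funext fun i => ?_)
    rw [Pi.smul_apply, smul_eq_mul]
    field_simp
    fin_cases i <;> simp only [Fin.zero_eta, Fin.mk_one, Fin.reduceFinMk]
    · linear_combination e2
    · linear_combination -e0
  · refine h (r' 2 / r 2) (funext fun i => ?_)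
    rw [Pi.smul_apply, smul_eq_mul]
    field_simp
    fin_cases i <;> simp only [Fin.zero_eta, Fin.mk_one, Fin.reduceFinMk]
    · linear_combination -e1
    · linear_combination e0

/-! ### Flags of type `(2,3)` in 5-space -/

section OsculatingFive

variable {v : Fin 5 → ℂ}

lemma mem_osc_five_infty_four : v ∈ osc 5 ∞ 4 ↔ v 0 = 0 := by
  rw [mem_osculatingSpace_infty, Fin.forall_fin_succ]
  simp

lemma mem_osc_five_infty_two : v ∈ osc 5 ∞ 2 ↔ v 0 = 0 ∧ v 1 = 0 ∧ v 2 = 0 := by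
  rw [mem_osculatingSpace_infty]
  simp [Fin.forall_fin_succ]

lemma mem_osc_five_three {z : ℂ} : v ∈ osc 5 z 3 ↔ (-z^3*v 0 + 3*z^2*v 1 - 3*z * v 2 + v 3 = 0 ∧
      z^4*v 0 - 4*z^3*v 1 + 6*z^2*v 2 - 4*z * v 3 + v 4 = 0) := by
  rw [mem_osculatingSpace_coe]
  constructor
  · intro h
    have h3 := h 3 le_rfl (by norm_num)
    have h4 := h 4 (by norm_num) (by norm_num)
    simp [Fin.sum_univ_five, Nat.choose] at h3 h4
    exact ⟨by linear_combination h3, by linear_combination h4⟩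
  · rintro ⟨h3, h4⟩ i hi hi'
    interval_cases i <;> simp [Fin.sum_univ_five, Nat.choose]
    · linear_combination h3
    · linear_combination h4

lemma mem_osc_five_two {z : ℂ} : v ∈ osc 5 z 2 ↔ (z^2*v 0 - 2*z * v 1 + v 2 = 0 ∧
      -z^3*v 0 + 3*z^2*v 1 - 3*z * v 2 + v 3 = 0 ∧
      z^4*v 0 - 4*z^3*v 1 + 6*z^2*v 2 - 4*z * v 3 + v 4 = 0) := by
  rw [mem_osculatingSpace_coe]
  constructor
  · intro h
    have h2 := h 2 le_rfl (by norm_num)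
    have h3 := h 3 (by norm_num) (by norm_num)
    have h4 := h 4 (by norm_num) (by norm_num)
    simp [Fin.sum_univ_five, Nat.choose] at h2 h3 h4
    exact ⟨by linear_combination h2, by linear_combination h3, by linear_combination h4⟩
  · rintro ⟨h2, h3, h4⟩ i hi hi'
    interval_cases i <;> simp [Fin.sum_univ_five, Nat.choose]
    · linear_combination h2
    · linear_combination h3
    · linear_combination h4

end OsculatingFive

section FlagsB

lemma flagB_le (E : PartialFlag typeB 5) (F : Submodule ℂ (Fin 5 → ℂ)) :
    dim ↥(E.space 0 ⊓ F) ≤ dim ↥(E.space 1 ⊓ F) ∧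
      dim ↥(E.space 1 ⊓ F) ≤ dim ↥(E.space 0 ⊓ F) + 1 := by
  have h := finrank_inf_le_add (E.monotone (show (0 : Fin 2) ≤ 1 by decide)) F
  rw [E.finrank_eq, E.finrank_eq] at h
  simp only [typeB, Matrix.cons_val] at h
  omega

variable {E : PartialFlag typeB 5} {τ : OnePoint ℂ}

lemma mem_schubertVariety_B_zero : E ∈ schubertVariety typeB (condB 0) τ ↔
    2 ≤ dim ↥(E.space 0 ⊓ osc 5 τ 4) ∧ 1 ≤ dim ↥(E.space 0 ⊓ osc 5 τ 2) := by
  constructor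
  · intro h
    have h := (mem_schubertVariety_oneLine (hv := by decide) (hinj := by decide)).mp h
    exact ⟨h 0 4 (by norm_num), h 0 2 (by norm_num)⟩
  · rintro ⟨h1, h2⟩
    refine mem_schubertVariety_of_essential (hv := by decide) (hinj := by decide)
      fun i j hj hg => ?_
    have h3 := h2.trans (flagB_le E (osc 5 τ 2)).1
    have h4 := h2.trans
      (finrank_inf_osculatingSpace_succ (E.space 0) τ (show 2 < 5 by norm_num)).1
    fin_cases i <;> interval_cases j <;>
      first
      | exact absurd (by decide) hg
      | (refine le_trans ?_ (by assumption); decide)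

lemma mem_schubertVariety_B_one : E ∈ schubertVariety typeB (condB 1) τ ↔
    1 ≤ dim ↥(E.space 0 ⊓ osc 5 τ 3) := by
  constructor
  · intro h
    have h := (mem_schubertVariety_oneLine (hv := by decide) (hinj := by decide)).mp h
    exact h 0 3 (by norm_num)
  · intro h1
    refine mem_schubertVariety_of_essential (hv := by decide) (hinj := by decide)
      fun i j hj hg => ?_
    fin_cases i <;> interval_cases j <;>
      first
      | exact absurd (by decide) hg
      | exact le_trans (by decide) h1

lemma mem_schubertVariety_B_two : E ∈ schubertVariety typeB (condB 2) τ ↔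
    2 ≤ dim ↥(E.space 1 ⊓ osc 5 τ 3) := by
  constructor
  · intro h
    have h := (mem_schubertVariety_oneLine (hv := by decide) (hinj := by decide)).mp h
    exact h 1 3 (by norm_num)
  · intro h1
    refine mem_schubertVariety_of_essential (hv := by decide) (hinj := by decide)
      fun i j hj hg => ?_
    have h3 : 1 ≤ dim ↥(E.space 0 ⊓ osc 5 τ 3) := by
      have := flagB_le E (osc 5 τ 3)
      omega
    have h4 : 1 ≤ dim ↥(E.space 1 ⊓ osc 5 τ 2) := by
      have := h1.trans (finrank_inf_osculatingSpace_succ (E.space 1) τ (show 2 < 5 by norm_num)).2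
      omega
    fin_cases i <;> interval_cases j <;>
      first
      | exact absurd (by decide) hg
      | (refine le_trans ?_ (by assumption); decide)

lemma mem_schubertVariety_B_three : E ∈ schubertVariety typeB (condB 3) τ ↔
    1 ≤ dim ↥(E.space 1 ⊓ osc 5 τ 2) := by
  constructor
  · intro h
    have h := (mem_schubertVariety_oneLine (hv := by decide) (hinj := by decide)).mp h
    exact h 1 2 (by norm_num)
  · intro h1
    refine mem_schubertVariety_of_essential (hv := by decide) (hinj := by decide)
      fun i j hj hg => ?_
    fin_cases i <;> interval_cases j <;>
      first
      | exact absurd (by decide) hg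
      | exact le_trans (by decide) h1

variable {ψ : Module.End ℂ (Fin 5 → ℂ)}

lemma isTangent_B_zero (hE : E.space 0 ≤ osc 5 τ 4)
    (h2 : 1 ≤ dim ↥(E.space 0 ⊓ osc 5 τ 2))
    (k4 : (E.space 0).map ψ ≤ osc 5 τ 4)
    (k2 : (E.space 0 ⊓ osc 5 τ 2).map ψ ≤ E.space 0 ⊔ osc 5 τ 2) :
    IsTangent typeB (condB 0) τ E ψ := by
  refine isTangent_oneLine (hv := by decide) (hinj := by decide) fun i j hj hg hfin => ?_
  have hE01 := E.monotone (show (0 : Fin 2) ≤ 1 by decide)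
  fin_cases i <;> interval_cases j <;>
    first
    | exact absurd (by decide) hg
    | exact k2
    | exact map_inf_le_sup_of_le hE k4
    | exact map_inf_le_sup_mono le_rfl (osculatingSpace_mono _ _ (by norm_num))
        ((hfin.trans (by decide)).trans_le h2) k2
    | exact map_inf_le_sup_mono hE01 le_rfl ((hfin.trans (by decide)).trans_le h2) k2

lemma isTangent_B_one
    (k : (E.space 0 ⊓ osc 5 τ 3).map ψ ≤ E.space 0 ⊔ osc 5 τ 3) :
    IsTangent typeB (condB 1) τ E ψ := by
  refine isTangent_oneLine (hv := by decide) (hinj := by decide) fun i j hj hg hfin => ?_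
  fin_cases i <;> interval_cases j <;>
    first
    | exact absurd (by decide) hg
    | exact k

lemma isTangent_B_two
    (h3 : 2 ≤ dim ↥(E.space 1 ⊓ osc 5 τ 3))
    (k : (osc 5 τ 3).map ψ ≤ osc 5 τ 3) : IsTangent typeB (condB 2) τ E ψ := by
  refine isTangent_oneLine (hv := by decide) (hinj := by decide) fun i j hj hg hfin => ?_
  have k3 : ∀ A : Submodule ℂ (Fin 5 → ℂ), (A ⊓ osc 5 τ 3).map ψ ≤ A ⊔ osc 5 τ 3 := fun A =>
    (Submodule.map_mono inf_le_right).trans (k.trans le_sup_right)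
  have k2 : dim ↥(E.space 1 ⊓ osc 5 τ 2) = 1 → dim ↥(E.space 1 ⊔ osc 5 τ 3) ≤
      dim ↥(E.space 1 ⊔ osc 5 τ 2) := fun h => by
    have e2 := Submodule.finrank_sup_add_finrank_inf_eq (E.space 1) (osc 5 τ 2)
    have e3 := Submodule.finrank_sup_add_finrank_inf_eq (E.space 1) (osc 5 τ 3)
    rw [finrank_osculatingSpace τ (by norm_num)] at e2 e3
    omega
  fin_cases i <;> interval_cases j <;>
    first
    | exact absurd (by decide) hg
    | exact k3 _
    | exact map_inf_le_sup_anti le_rfl (osculatingSpace_mono _ _ (by norm_num))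
        (k2 (hfin.trans (by decide))) (k3 _)

lemma isTangent_B_three
    (k : (E.space 1 ⊓ osc 5 τ 2).map ψ ≤ E.space 1 ⊔ osc 5 τ 2) :
    IsTangent typeB (condB 3) τ E ψ := by
  refine isTangent_oneLine (hv := by decide) (hinj := by decide) fun i j hj hg hfin => ?_
  fin_cases i <;> interval_cases j <;>
    first
    | exact absurd (by decide) hg
    | exact k

end FlagsB

section ProblemB

/-- The vector of `⟨e₂,e₃⟩` whose sum with six times `(0,0,0,a,b)` lies in the osculating
3-space at `-1`. -/
def rowB₀ (a b : ℂ) : Fin 3 → ℂ := ![0, 6*a + 3*b, -8*a - 3*b]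

/-- The vector of `⟨e₁,e₂,e₃⟩` whose sum with `s^4` times `(0,0,0,a,b)` lies in the osculating
2-space at `s`. -/
def rowB (s a b : ℂ) : Fin 3 → ℂ :=
  ![4*s * a - 3*b, 3*s^2*a - 2*s * b, 2*s^3*a - s^2*b]

/-- The vector with the first three coordinates `u`. -/
def head5 (u : Fin 3 → ℂ) : Fin 5 → ℂ := ![u 0, u 1, u 2, 0, 0]

/-- The vector with the last two coordinates `a`, `b`. -/
def tail5 (a b : ℂ) : Fin 5 → ℂ := ![0, 0, 0, a, b]

/-- The first three coordinates. -/
def fst5 (v : Fin 5 → ℂ) : Fin 3 → ℂ := ![v 0, v 1, v 2]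

/-- The flag `E` is given by `(a,b)` and `r`. -/
structure IsFlagB (E : PartialFlag typeB 5) (a b : ℂ) (r : Fin 3 → ℂ) : Prop where
  ab : a ≠ 0 ∨ b ≠ 0
  r_ne : r ≠ 0
  mem_one : ∀ v, v ∈ E.space 1 ↔ dot3 r (fst5 v) = 0 ∧ b * v 3 = a * v 4
  mem_zero : ∀ v, v ∈ E.space 0 ↔ v ∈ E.space 1 ∧ v 0 = 0

/-- The equations of the intersection. -/
def EquationsB (s t a b : ℂ) (r : Fin 3 → ℂ) : Prop :=
  dot3 (rowB₀ a b) r = 0 ∧ dot3 (rowB s a b) r = 0 ∧ dot3 (rowB t a b) r = 0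

lemma eq_of_mem_osc_neg_one {v : Fin 5 → ℂ}
    (hv : v ∈ osc 5 (-1 : ℂ) 3) (h0 : v 0 = 0) :
    6*v 1 = 6*v 3 + 3*v 4 ∧ 6*v 2 = -8*v 3 - 3*v 4 := by
  rw [mem_osc_five_three, h0] at hv
  obtain ⟨h1, h2⟩ := hv
  exact ⟨by linear_combination 6*h1 - 3*h2, by linear_combination -4*h1 + 3*h2⟩

lemma eq_of_mem_osc_two {s : ℂ} {v : Fin 5 → ℂ} (hv : v ∈ osc 5 s 2) :
    s^4*v 0 = 4*s * v 3 - 3*v 4 ∧ s^4*v 1 = 3*s^2*v 3 - 2*s * v 4 ∧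
      s^4*v 2 = 2*s^3*v 3 - s^2*v 4 := by
  rw [mem_osc_five_two] at hv
  obtain ⟨h2, h3, h4⟩ := hv
  refine ⟨?_, ?_, ?_⟩
  · linear_combination 6*s^2*h2 + 8*s * h3 + 3*h4
  · linear_combination 3*s^3*h2 + 5*s^2*h3 + 2*s * h4
  · linear_combination s^4*h2 + 2*s^3*h3 + s^2*h4

lemma mem_intersection_B {E : PartialFlag typeB 5} {x : Fin 2 → ℂ} :
    E ∈ intersection typeB condB (pointsAt pointsB x) ↔ (2 ≤ dim ↥(E.space 0 ⊓ osc 5 ∞ 4) ∧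
        1 ≤ dim ↥(E.space 0 ⊓ osc 5 ∞ 2)) ∧ 1 ≤ dim ↥(E.space 0 ⊓ osc 5 (-1 : ℂ) 3) ∧
      2 ≤ dim ↥(E.space 1 ⊓ osc 5 (0 : ℂ) 3) ∧ 1 ≤ dim ↥(E.space 1 ⊓ osc 5 (x 0) 2) ∧
      1 ≤ dim ↥(E.space 1 ⊓ osc 5 (x 1) 2) := by
  rw [← mem_schubertVariety_B_zero, ← mem_schubertVariety_B_one, ← mem_schubertVariety_B_two,
    ← mem_schubertVariety_B_three, ← mem_schubertVariety_B_three, pointsAt_B]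
  exact ⟨fun h => ⟨h 0, h 1, h 2, h 3, h 4⟩, fun ⟨h0, h1, h2, h3, h4⟩ l => by
    fin_cases l
    exacts [h0, h1, h2, h3, h4]⟩

lemma osc_zero_B {v : Fin 5 → ℂ} : v ∈ osc 5 (0 : ℂ) 3 ↔ v 3 = 0 ∧ v 4 = 0 := by
  rw [mem_osc_five_three]
  simp

lemma finrank_coordinatesB {a b : ℂ} {r : Fin 3 → ℂ} (hab : a ≠ 0 ∨ b ≠ 0) (hr : r ≠ 0) :
    dim ↥(LinearMap.ker (form ![r 0, r 1, r 2, 0, 0]) ⊓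
      LinearMap.ker (form ![0, 0, 0, b, -a])) = 3 := by
  obtain ⟨y, hy⟩ := exists_dot3_ne_zero hr
  obtain ⟨c, d, hcd⟩ := exists_dual hab
  have h1 := finrank_inf_ker (S := ⊤) (f := form ![r 0, r 1, r 2, 0, 0]) (x := head5 y)
    Submodule.mem_top (by
      simp only [dot3] at hy
      simp [form_apply, head5, Fin.sum_univ_five]
      exact fun h => hy (by linear_combination h))
  rw [top_inf_eq, finrank_top, Module.finrank_fin_fun] at h1
  have h2 := finrank_inf_ker (S := LinearMap.ker (form ![r 0, r 1, r 2, 0, 0]))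
    (f := form ![0, 0, 0, b, -a]) (x := tail5 d (-c))
    (by simp [form_apply, tail5, Fin.sum_univ_five]) (by
      have e : form ![0, 0, 0, b, -a] (tail5 d (-c)) = 1 := by
        simp [form_apply, tail5, Fin.sum_univ_five]
        linear_combination hcd
      rw [e]
      exact one_ne_zero)
  omega

lemma mem_coordinatesB {a b : ℂ} {r : Fin 3 → ℂ} {v : Fin 5 → ℂ} :
    v ∈ LinearMap.ker (form ![r 0, r 1, r 2, 0, 0]) ⊓ LinearMap.ker (form ![0, 0, 0, b, -a]) ↔
      dot3 r (fst5 v) = 0 ∧ b * v 3 = a * v 4 := by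
  rw [Submodule.mem_inf, LinearMap.mem_ker, LinearMap.mem_ker, form_apply, form_apply]
  simp [Fin.sum_univ_five, dot3, fst5]
  intro _
  constructor <;> intro h <;> linear_combination h

lemma EquationsB.ne_zero {s t a b : ℂ} {r : Fin 3 → ℂ} (hst : s ≠ t) (hab : a ≠ 0 ∨ b ≠ 0)
    (hr : r ≠ 0) (h : EquationsB s t a b r) : r 1 ≠ 0 ∨ r 2 ≠ 0 := by
  by_contra! hc
  obtain ⟨-, h1, h2⟩ := h
  have hr0 : r 0 ≠ 0 := by
    rcases exists_ne_zero_fin_three hr with h | h | h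
    exacts [h, absurd hc.1 h, absurd hc.2 h]
  simp [dot3, rowB, hc.1, hc.2, hr0] at h1 h2
  have ha : a = 0 := by
    have : (s - t) * a = 0 := by linear_combination (h1 - h2) / 4
    exact (mul_eq_zero.mp this).resolve_left (sub_ne_zero.mpr hst)
  have hb : b = 0 := by linear_combination -h1 / 3 + 4 / 3*s * ha
  exact hab.elim (fun h => h ha) fun h => h hb

/-- Every flag in the intersection is given by a solution of the equations. -/
lemma exists_isFlagB {E : PartialFlag typeB 5} {x : Fin 2 → ℂ} (hs : x 0 ≠ 0) (ht : x 1 ≠ 0)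
    (hst : x 0 ≠ x 1) (hE : E ∈ intersection typeB condB (pointsAt pointsB x)) :
    ∃ a b r, IsFlagB E a b r ∧ EquationsB (x 0) (x 1) a b r := by
  obtain ⟨⟨k1, k2⟩, k3, k4, k5, k6⟩ := mem_intersection_B.mp hE
  have f0 : dim (E.space 0) = 2 := E.finrank_eq 0
  have f1 : dim (E.space 1) = 3 := E.finrank_eq 1
  have hE01 : E.space 0 ≤ E.space 1 := E.monotone (by decide)
  have hE0 : ∀ v ∈ E.space 0, v 0 = 0 := fun v hv =>
    mem_osc_five_infty_four.mp (le_of_finrank_le_finrank_inf (by rw [f0]; exact k1) hv)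
  obtain ⟨p, hp, hp0⟩ := exists_ne_zero_of_one_le_finrank k2
  obtain ⟨p0, p1, p2⟩ := mem_osc_five_infty_two.mp hp.2
  have hab : p 3 ≠ 0 ∨ p 4 ≠ 0 := by
    by_contra! hc
    refine hp0 (funext fun i => ?_)
    fin_cases i
    exacts [p0, p1, p2, hc.1, hc.2]
  obtain ⟨c, hc0, hc, hc'⟩ := exists_form (A := E.space 1)
    (B := osc 5 (0 : ℂ) 3) (by
      rw [f1, finrank_osculatingSpace _ (by norm_num)]; omega)
  have c0 := hc' (Pi.single 0 1) (osc_zero_B.mpr (by simp))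
  have c1 := hc' (Pi.single 1 1) (osc_zero_B.mpr (by simp))
  have c2 := hc' (Pi.single 2 1) (osc_zero_B.mpr (by simp))
  simp [Fin.sum_univ_five] at c0 c1 c2
  have cp := hc p (hE01 hp.1)
  simp [Fin.sum_univ_five, c0, c1, c2] at cp
  have hcc : c 3 ≠ 0 ∨ c 4 ≠ 0 := by
    by_contra! h
    refine hc0 (funext fun i => ?_)
    fin_cases i
    exacts [c0, c1, c2, h.1, h.2]
  have hπ : ∀ v ∈ E.space 1, p 4*v 3 = p 3*v 4 := by
    intro v hv
    have cv := hc v hv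
    simp [Fin.sum_univ_five, c0, c1, c2] at cv
    have := cross_eq_zero_of_linear hcc cp cv
    linear_combination -this
  have hp2 : 1 ≤ dim ↥(E.space 1 ⊓ osc 5 ∞ 2) :=
    one_le_finrank_of_mem ⟨hE01 hp.1, hp.2⟩ hp0
  obtain ⟨d, hd0, hd, hd'⟩ := exists_form (A := E.space 1) (B := osc 5 ∞ 2) (by
      rw [f1, finrank_osculatingSpace _ (by norm_num)]; omega)
  have d3 := hd' (Pi.single 3 1) (mem_osc_five_infty_two.mpr (by simp))
  have d4 := hd' (Pi.single 4 1) (mem_osc_five_infty_two.mpr (by simp))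
  simp [Fin.sum_univ_five] at d3 d4
  set r : Fin 3 → ℂ := ![d 0, d 1, d 2] with hr
  have hrv : ∀ v ∈ E.space 1, dot3 r (fst5 v) = 0 := by
    intro v hv
    have := hd v hv
    simp [Fin.sum_univ_five, d3, d4] at this
    simpa [dot3, hr, fst5] using this
  have hr0 : r ≠ 0 := by
    intro h
    refine hd0 (funext fun i => ?_)
    fin_cases i
    exacts [congrFun h 0, congrFun h 1, congrFun h 2, d3, d4]
  have hmem1 : ∀ v, v ∈ E.space 1 ↔ dot3 r (fst5 v) = 0 ∧ p 4*v 3 = p 3*v 4 := by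
    have := Submodule.eq_of_le_of_finrank_le (S₁ := E.space 1)
      (fun v hv => mem_coordinatesB.mpr ⟨hrv v hv, hπ v hv⟩)
      (by rw [f1, finrank_coordinatesB hab hr0])
    intro v
    rw [this, mem_coordinatesB]
  have hrow : ∀ s : ℂ, s ≠ 0 → 1 ≤ dim ↥(E.space 1 ⊓ osc 5 s 2) →
      dot3 (rowB s (p 3) (p 4)) r = 0 := by
    intro s hs h
    obtain ⟨v, hv, hv0⟩ := exists_ne_zero_of_one_le_finrank h
    obtain ⟨e0, e1, e2⟩ := eq_of_mem_osc_two hv.2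
    obtain ⟨g1, g2⟩ := (hmem1 v).mp hv.1
    obtain ⟨l, l3, l4⟩ := exists_mul_of_cross hab g2
    have hl : l ≠ 0 := by
      rintro rfl
      rw [zero_mul] at l3 l4
      rw [l3, l4] at e0 e1 e2
      refine hv0 (funext fun i => ?_)
      fin_cases i <;> simp_all
    refine mul_left_cancel₀ hl ?_
    rw [l3, l4] at e0 e1 e2
    simp only [dot3, fst5, rowB, Matrix.cons_val] at g1 ⊢
    linear_combination s^4*g1 - r 0*e0 - r 1*e1 - r 2*e2
  have hrow0 : dot3 (rowB₀ (p 3) (p 4)) r = 0 := by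
    obtain ⟨v, hv, hv0⟩ := exists_ne_zero_of_one_le_finrank k3
    have v0 := hE0 v hv.1
    obtain ⟨e1, e2⟩ := eq_of_mem_osc_neg_one hv.2 v0
    obtain ⟨g1, g2⟩ := (hmem1 v).mp (hE01 hv.1)
    obtain ⟨l, l3, l4⟩ := exists_mul_of_cross hab g2
    have hl : l ≠ 0 := by
      rintro rfl
      rw [zero_mul] at l3 l4
      rw [l3, l4] at e1 e2
      refine hv0 (funext fun i => ?_)
      fin_cases i <;> simp_all
    refine mul_left_cancel₀ hl ?_
    rw [l3, l4] at e1 e2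
    simp only [dot3, fst5, rowB₀, Matrix.cons_val] at g1 ⊢
    linear_combination 6*g1 - 6*r 0*v0 - r 1*e1 - r 2*e2
  have heq : EquationsB (x 0) (x 1) (p 3) (p 4) r := ⟨hrow0, hrow _ hs k5, hrow _ ht k6⟩
  refine ⟨p 3, p 4, r, ⟨hab, hr0, hmem1, ?_⟩, heq⟩
  obtain ⟨y, z, hyz⟩ : ∃ y z, y * r 1 + z * r 2 = 1 := exists_dual (heq.ne_zero hst hab hr0)
  have h3 := finrank_inf_ker (S := E.space 1) (f := form ![1, 0, 0, 0, 0])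
    (x := head5 ![1, -r 0*y, -r 0*z])
    ((hmem1 _).mpr ⟨by simp [dot3, fst5, head5]; linear_combination -r 0*hyz, by simp [head5]⟩)
    (by simp [form_apply, Fin.sum_univ_five, head5])
  have h4 := Submodule.eq_of_le_of_finrank_le (S₁ := E.space 0)
    (S₂ := E.space 1 ⊓ LinearMap.ker (form ![1, 0, 0, 0, 0]))
    (fun v hv => ⟨hE01 hv, by simp [form_apply, Fin.sum_univ_five, hE0 v hv]⟩) (by omega)
  intro v
  rw [h4, Submodule.mem_inf, LinearMap.mem_ker, form_apply]
  simp [Fin.sum_univ_five]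

/-- Every solution of the equations defines a flag in the intersection. -/
lemma exists_flag_of_equationsB {x : Fin 2 → ℂ} (hst : x 0 ≠ x 1) (hs : x 0 ≠ 0) (ht : x 1 ≠ 0)
    {a b : ℂ} {r : Fin 3 → ℂ}
    (hab : a ≠ 0 ∨ b ≠ 0) (hr : r ≠ 0) (heq : EquationsB (x 0) (x 1) a b r) :
    ∃ E ∈ intersection typeB condB (pointsAt pointsB x), IsFlagB E a b r := by
  obtain ⟨y, z, hyz⟩ : ∃ y z, y * r 1 + z * r 2 = 1 := exists_dual (heq.ne_zero hst hab hr)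
  set S := LinearMap.ker (form ![r 0, r 1, r 2, 0, 0]) ⊓ LinearMap.ker (form ![0, 0, 0, b, -a])
    with hS
  have hS3 : dim S = 3 := finrank_coordinatesB hab hr
  have h3 := finrank_inf_ker (S := S) (f := form ![1, 0, 0, 0, 0])
    (x := head5 ![1, -r 0*y, -r 0*z])
    (mem_coordinatesB.mpr
      ⟨by simp [dot3, fst5, head5]; linear_combination -r 0*hyz, by simp [head5]⟩)
    (by simp [form_apply, Fin.sum_univ_five, head5])
  set T := S ⊓ LinearMap.ker (form ![1, 0, 0, 0, 0]) with hT
  have hmemT : ∀ v, v ∈ T ↔ v ∈ S ∧ v 0 = 0 := by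
    intro v
    rw [hT, Submodule.mem_inf, LinearMap.mem_ker, form_apply]
    simp [Fin.sum_univ_five]
  let E : PartialFlag typeB 5 :=
    { space := ![T, S]
      monotone := by
        intro i j hij
        fin_cases i <;> fin_cases j
        · exact le_rfl
        · exact inf_le_left
        · exact absurd hij (by decide)
        · exact le_rfl
      finrank_eq := by
        intro i
        fin_cases i
        · change dim T = 2
          omega
        · exact hS3 }
  have hp : tail5 a b ∈ T := (hmemT _).mpr ⟨mem_coordinatesB.mpr
    ⟨by simp [dot3, fst5, tail5], by simp [tail5]; ring⟩, by simp [tail5]⟩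
  have hp0 : tail5 a b ≠ 0 := fun h => hab.elim (fun h' => h' (by simpa [tail5] using congrFun h 3))
    fun h' => h' (by simpa [tail5] using congrFun h 4)
  have hq : (6 : ℂ) • tail5 a b + head5 (rowB₀ a b) ∈ T := by
    refine T.add_mem (T.smul_mem _ hp) ((hmemT _).mpr ⟨mem_coordinatesB.mpr ⟨?_, ?_⟩, ?_⟩)
    · have := heq.1
      simp only [dot3] at this
      simp [dot3, fst5, head5]
      linear_combination this
    · simp [head5]
    · simp [head5, rowB₀]
  have hrow : ∀ s : ℂ, s ≠ 0 → dot3 (rowB s a b) r = 0 → 1 ≤ dim ↥(S ⊓ osc 5 s 2) := by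
    intro s hs h
    refine one_le_finrank_of_mem (v := s^4 • tail5 a b + head5 (rowB s a b)) ⟨?_, ?_⟩ ?_
    · refine mem_coordinatesB.mpr ⟨?_, ?_⟩
      · simp only [dot3] at h
        simp [dot3, fst5, head5, tail5]
        linear_combination h
      · simp [tail5, head5]; ring
    · change _ ∈ osc 5 s 2
      rw [mem_osc_five_two]
      simp [tail5, head5, rowB]
      refine ⟨?_, ?_, ?_⟩ <;> ring
    · intro h0
      refine hab.elim (fun h' => h' ?_) fun h' => h' ?_
      · simpa [tail5, head5, hs] using congrFun h0 3
      · simpa [tail5, head5, hs] using congrFun h0 4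
  refine ⟨E, mem_intersection_B.mpr ⟨⟨?_, ?_⟩, ?_, ?_, hrow _ hs heq.2.1, hrow _ ht heq.2.2⟩,
    hab, hr, fun v => mem_coordinatesB, hmemT⟩
  · have : T ⊓ osc 5 ∞ 4 = T :=
      inf_eq_left.mpr fun v hv => mem_osc_five_infty_four.mpr ((hmemT v).mp hv).2
    change 2 ≤ dim ↥(T ⊓ osc 5 ∞ 4)
    rw [this]
    omega
  · exact one_le_finrank_of_mem ⟨hp, mem_osc_five_infty_two.mpr (by simp [tail5])⟩ hp0
  · refine one_le_finrank_of_mem (v := (6 : ℂ) • tail5 a b + head5 (rowB₀ a b)) ⟨hq, ?_⟩ ?_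
    · change _ ∈ osc 5 (-1 : ℂ) 3
      rw [mem_osc_five_three]
      simp [tail5, head5, rowB₀]
      refine ⟨?_, ?_⟩ <;> ring
    · intro h0
      refine hab.elim (fun h' => h' ?_) fun h' => h' ?_
      · simpa [tail5, head5] using congrFun h0 3
      · simpa [tail5, head5] using congrFun h0 4
  · change 2 ≤ dim ↥(S ⊓ osc 5 (0 : ℂ) 3)
    have := le_finrank_add_of_equations (S := S ⊓ osc 5 (0 : ℂ) 3)
      (LinearMap.pi ![form ![r 0, r 1, r 2, 0, 0], form ![0, 0, 0, 1, 0], form ![0, 0, 0, 0, 1]])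
      fun v hv => by
        have e0 := congrFun hv 0
        have e1 := congrFun hv 1
        have e2 := congrFun hv 2
        simp [form_apply, Fin.sum_univ_five] at e0 e1 e2
        exact ⟨mem_coordinatesB.mpr ⟨by simp [dot3, fst5]; exact e0, by rw [e1, e2]; ring⟩,
          osc_zero_B.mpr ⟨e1, e2⟩⟩
    omega

end ProblemB

section TangentB

/-- The linearised equations. -/
def LinearisedB (s t a b : ℂ) (r : Fin 3 → ℂ) (a' b' : ℂ) (r' : Fin 3 → ℂ) : Prop :=
  dot3 (rowB₀ a' b') r + dot3 (rowB₀ a b) r' = 0 ∧ dot3 (rowB s a' b') r + dot3 (rowB s a b) r' = 0 ∧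
    dot3 (rowB t a' b') r + dot3 (rowB t a b) r' = 0

lemma fst5_head5 (u : Fin 3 → ℂ) : fst5 (head5 u) = u := by
  ext i; fin_cases i <;> rfl

lemma head5_mem (u : Fin 3 → ℂ) : head5 u ∈ osc 5 (0 : ℂ) 3 :=
  osc_zero_B.mpr ⟨rfl, rfl⟩

lemma eq_head5_add_tail5 (v : Fin 5 → ℂ) : v = head5 (fst5 v) + tail5 (v 3) (v 4) := by
  ext i; fin_cases i <;> simp [head5, fst5, tail5]

lemma tail5_smul (c a b : ℂ) : tail5 (c * a) (c * b) = c • tail5 a b := by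
  ext i; fin_cases i <;> simp [tail5]

lemma dot3_fst5_add (r : Fin 3 → ℂ) (v w : Fin 5 → ℂ) :
    dot3 r (fst5 (v + w)) = dot3 r (fst5 v) + dot3 r (fst5 w) := by
  simp [dot3, fst5]; ring

lemma dot3_fst5_smul (r : Fin 3 → ℂ) (c : ℂ) (v : Fin 5 → ℂ) :
    dot3 r (fst5 (c • v)) = c * dot3 r (fst5 v) := by
  simp [dot3, fst5]; ring

lemma dot3_comm (u v : Fin 3 → ℂ) : dot3 u v = dot3 v u := by
  simp only [dot3]; ring

namespace IsFlagB

variable {E : PartialFlag typeB 5} {a b : ℂ} {r : Fin 3 → ℂ}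

lemma tail_mem (h : IsFlagB E a b r) : tail5 a b ∈ E.space 0 :=
  (h.mem_zero _).mpr ⟨(h.mem_one _).mpr ⟨by simp [dot3, fst5, tail5], by simp [tail5]; ring⟩, rfl⟩

lemma head_mem (h : IsFlagB E a b r) {u : Fin 3 → ℂ} (hu : dot3 r u = 0) : head5 u ∈ E.space 1 :=
  (h.mem_one _).mpr ⟨by rwa [fst5_head5], by simp [head5]⟩

/-- Elements of the space meeting a complement of `⟨e₁,e₂,e₃⟩` are determined by their
last coordinates. -/
lemma exists_eq (h : IsFlagB E a b r) {v : Fin 5 → ℂ} (hv : v ∈ E.space 1) :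
    ∃ (c : ℂ) (u : Fin 3 → ℂ), dot3 r u = 0 ∧ v = c • tail5 a b + head5 u := by
  obtain ⟨h1, h2⟩ := (h.mem_one v).mp hv
  obtain ⟨c, h3, h4⟩ := exists_mul_of_cross h.ab h2
  refine ⟨c, fst5 v, h1, ?_⟩
  conv_lhs => rw [eq_head5_add_tail5 v, h3, h4, tail5_smul, add_comm]

lemma finrank_inf_infty_two (h : IsFlagB E a b r) : dim ↥(E.space 0 ⊓ osc 5 ∞ 2) ≤ 1 := by
  refine finrank_le_one_of_smul (tail5 a b) fun v hv => ?_
  obtain ⟨c, u, -, rfl⟩ := h.exists_eq ((h.mem_zero v).mp hv.1).1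
  obtain ⟨k0, k1, k2⟩ := mem_osc_five_infty_two.mp hv.2
  refine ⟨c, ?_⟩
  simp [tail5, head5] at k0 k1 k2
  ext i
  fin_cases i <;> simp [tail5, head5, k0, k1, k2]

lemma finrank_inf_neg_one (h : IsFlagB E a b r) : dim ↥(E.space 0 ⊓ osc 5 (-1 : ℂ) 3) ≤ 1 := by
  refine finrank_le_one_of_smul ((6 : ℂ) • tail5 a b + head5 (rowB₀ a b)) fun v hv => ?_
  obtain ⟨k0, k1⟩ := (h.mem_zero v).mp hv.1
  obtain ⟨e1, e2⟩ := eq_of_mem_osc_neg_one hv.2 k1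
  obtain ⟨c, l3, l4⟩ := exists_mul_of_cross h.ab ((h.mem_one v).mp k0).2
  rw [l3, l4] at e1 e2
  refine ⟨c / 6, ?_⟩
  ext i
  fin_cases i <;> simp [tail5, head5, rowB₀, k1, l3, l4]
  · linear_combination e1 / 6
  · linear_combination e2 / 6
  · ring
  · ring

lemma finrank_inf_two (h : IsFlagB E a b r) {s : ℂ} (hs : s ≠ 0) :
    dim ↥(E.space 1 ⊓ osc 5 s 2) ≤ 1 := by
  refine finrank_le_one_of_smul (s^4 • tail5 a b + head5 (rowB s a b)) fun v hv => ?_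
  obtain ⟨e0, e1, e2⟩ := eq_of_mem_osc_two hv.2
  obtain ⟨c, l3, l4⟩ := exists_mul_of_cross h.ab ((h.mem_one v).mp hv.1).2
  rw [l3, l4] at e0 e1 e2
  refine ⟨c / s^4, ?_⟩
  ext i
  have hs4 : s^4 ≠ 0 := pow_ne_zero 4 hs
  fin_cases i <;> simp [tail5, head5, rowB, l3, l4] <;>
    rw [div_mul_eq_mul_div, eq_div_iff hs4]
  · linear_combination e0
  · linear_combination e1
  · linear_combination e2
  · ring
  · ring

lemma finrank_inf_zero (h : IsFlagB E a b r) : dim ↥(E.space 1 ⊓ osc 5 (0 : ℂ) 3) ≤ 2 := by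
  have h1 : dim (E.space 1) = 3 := E.finrank_eq 1
  have h2 : dim ↥(E.space 1 ⊓ osc 5 (0 : ℂ) 3) <
      dim (E.space 1) := by
    refine Submodule.finrank_lt_finrank_of_lt (lt_of_le_of_ne inf_le_left fun he => ?_)
    have := inf_eq_left.mp he ((h.mem_zero _).mp h.tail_mem).1
    obtain ⟨k3, k4⟩ := osc_zero_B.mp this
    exact h.ab.elim (fun h => h k3) fun h => h k4
  omega

end IsFlagB

/-- The linear form `v ↦ dot3 r (v₀,v₁,v₂)` applied to the values of an endomorphism on
`⟨e₁,e₂,e₃⟩`. -/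
def pullback5 (ψ : Module.End ℂ (Fin 5 → ℂ)) (r : Fin 3 → ℂ) : Fin 3 → ℂ :=
  fun i => dot3 r (fst5 (ψ (head5 (Pi.single i 1))))

lemma dot3_pullback5 (ψ : Module.End ℂ (Fin 5 → ℂ)) (r u : Fin 3 → ℂ) :
    dot3 (pullback5 ψ r) u = dot3 r (fst5 (ψ (head5 u))) := by
  have : head5 u = u 0 • head5 (Pi.single 0 1) + u 1 • head5 (Pi.single 1 1) +
      u 2 • head5 (Pi.single 2 1) := by
    ext i; fin_cases i <;> simp [head5]
  rw [this]
  simp only [_root_.map_add, _root_.map_smul, dot3_fst5_add, dot3_fst5_smul]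
  simp only [dot3, pullback5]
  ring

variable {E : PartialFlag typeB 5} {x : Fin 2 → ℂ} {a b : ℂ} {r : Fin 3 → ℂ}
  {ψ : Module.End ℂ (Fin 5 → ℂ)}

/-- A tangent vector yields a solution of the linearised equations, and is zero if this solution
is trivial. -/
lemma exists_linearisedB (hs : x 0 ≠ 0) (ht : x 1 ≠ 0)
    (hE : E ∈ intersection typeB condB (pointsAt pointsB x)) (h : IsFlagB E a b r)
    (heq : EquationsB (x 0) (x 1) a b r)
    (hψ : ∀ l, IsTangent typeB (condB l) (pointsAt pointsB x l) E ψ) :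
    ∃ a' b' r', LinearisedB (x 0) (x 1) a b r a' b' r' ∧
      (b * a' = a * b' → (∀ u, dot3 r u = 0 → dot3 r' u = 0) →
        ∀ i, (E.space i).map ψ ≤ E.space i) := by
  obtain ⟨⟨k1, k2⟩, k3, k4, k5, k6⟩ := mem_intersection_B.mp hE
  rw [pointsAt_B] at hψ
  have t0 : IsTangent typeB (condB 0) ∞ E ψ := hψ 0
  have t1 : IsTangent typeB (condB 1) (-1 : ℂ) E ψ := hψ 1
  have t2 : IsTangent typeB (condB 2) (0 : ℂ) E ψ := hψ 2
  have t3 : IsTangent typeB (condB 3) (x 0 : OnePoint ℂ) E ψ := hψ 3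
  have t4 : IsTangent typeB (condB 4) (x 1 : OnePoint ℂ) E ψ := hψ 4
  have hp := h.tail_mem
  have hp1 := ((h.mem_zero _).mp hp).1
  have hE0 : E.space 0 ≤ osc 5 ∞ 4 :=
    fun v hv => mem_osc_five_infty_four.mpr ((h.mem_zero v).mp hv).2
  have m0 : ∀ v ∈ E.space 0, ψ v 0 = 0 := by
    intro v hv
    have := IsTangent.map_le (hv := by decide) (hinj := by decide) t0 0 (j := 4) (by norm_num)
      (le_antisymm ((Submodule.finrank_mono inf_le_left).trans (E.finrank_eq 0).le) k1) hv (hE0 hv)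
    rw [sup_eq_right.mpr hE0] at this
    exact mem_osc_five_infty_four.mp this
  have mp := IsTangent.map_le (hv := by decide) (hinj := by decide) t0 0 (j := 2) (by norm_num)
      (le_antisymm h.finrank_inf_infty_two k2) hp (mem_osc_five_infty_two.mpr ⟨rfl, rfl, rfl⟩)
  obtain ⟨e, he, f, hf, hef⟩ := Submodule.mem_sup.mp mp
  have he1 := (h.mem_one e).mp ((h.mem_zero e).mp he).1
  obtain ⟨f0, f1, f2⟩ := mem_osc_five_infty_two.mp hf
  have rψp : dot3 r (fst5 (ψ (tail5 a b))) = 0 := by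
    rw [← hef, dot3_fst5_add, he1.1]
    simp [dot3, fst5, f0, f1, f2]
  have πψp : b * ψ (tail5 a b) 3 - a * ψ (tail5 a b) 4 = b * f 3 - a * f 4 := by
    rw [← hef, Pi.add_apply, Pi.add_apply]
    linear_combination he1.2
  have mu : ∀ u, dot3 r u = 0 → b * ψ (head5 u) 3 = a * ψ (head5 u) 4 := by
    intro u hu
    have := IsTangent.map_le (hv := by decide) (hinj := by decide) t2 1 (j := 3) (by norm_num)
      (le_antisymm h.finrank_inf_zero k4) (h.head_mem hu) (head5_mem u)
    obtain ⟨e, he, f, hf, hef⟩ := Submodule.mem_sup.mp this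
    obtain ⟨f3, f4⟩ := osc_zero_B.mp hf
    have := ((h.mem_one e).mp he).2
    rw [← hef, Pi.add_apply, Pi.add_apply, f3, f4]
    linear_combination this
  have row : ∀ s : ℂ, s ≠ 0 → dot3 (rowB s a b) r = 0 → ψ (s^4 • tail5 a b + head5 (rowB s a b)) ∈
        E.space 1 ⊔ osc 5 s 2 →
      dot3 (rowB s (f 3) (f 4)) r - dot3 (rowB s a b) (pullback5 ψ r) = 0 := by
    intro s hs hr hm
    obtain ⟨e, he, g, hg, heg⟩ := Submodule.mem_sup.mp hm
    obtain ⟨g0, g1, g2⟩ := eq_of_mem_osc_two hg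
    have he := (h.mem_one e).mp he
    have hr' : dot3 r (rowB s a b) = 0 := by rwa [dot3_comm]
    have e1 : dot3 r (fst5 g) = dot3 (rowB s a b) (pullback5 ψ r) := by
      have := congrArg (fun v => dot3 r (fst5 v)) heg
      simp only [_root_.map_add, _root_.map_smul, dot3_fst5_add, dot3_fst5_smul, rψp, he.1] at this
      rw [dot3_comm (rowB s a b), dot3_pullback5]
      linear_combination this
    have e2 : b * (g 3 - s^4*f 3) = a * (g 4 - s^4*f 4) := by
      have h3 := congrFun heg 3
      have h4 := congrFun heg 4
      simp only [_root_.map_add, _root_.map_smul, Pi.add_apply, Pi.smul_apply, smul_eq_mul]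
        at h3 h4
      linear_combination b * h3 - a * h4 - he.2 + s^4 * πψp + mu _ hr'
    obtain ⟨c, c3, c4⟩ := exists_mul_of_cross h.ab e2
    rw [← e1]
    refine mul_left_cancel₀ (pow_ne_zero 4 hs) ?_
    simp only [dot3, rowB, fst5, Matrix.cons_val] at hr ⊢
    have k3 : g 3 = s^4*f 3 + c * a := by linear_combination c3
    have k4 : g 4 = s^4*f 4 + c * b := by linear_combination c4
    rw [k3, k4] at g0 g1 g2
    linear_combination -r 0*g0 - r 1*g1 - r 2*g2 - c * hr
  have row₀ : dot3 (rowB₀ (f 3) (f 4)) r - dot3 (rowB₀ a b) (pullback5 ψ r) = 0 := by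
    have hr := heq.1
    have hr' : dot3 r (rowB₀ a b) = 0 := by rwa [dot3_comm]
    have hq : head5 (rowB₀ a b) ∈ E.space 0 :=
      (h.mem_zero _).mpr ⟨h.head_mem hr', by simp [head5, rowB₀]⟩
    have hm := IsTangent.map_le (hv := by decide) (hinj := by decide) t1 0 (j := 3) (by norm_num)
      (le_antisymm h.finrank_inf_neg_one k3)
      (x := (6 : ℂ) • tail5 a b + head5 (rowB₀ a b))
      ((E.space 0).add_mem ((E.space 0).smul_mem _ hp) hq) (by
        rw [mem_osc_five_three]
        simp [tail5, head5, rowB₀]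
        refine ⟨?_, ?_⟩ <;> ring)
    obtain ⟨e, he, g, hg, heg⟩ := Submodule.mem_sup.mp hm
    obtain ⟨he', e0⟩ := (h.mem_zero e).mp he
    have he := (h.mem_one e).mp he'
    have g00 : g 0 = 0 := by
      have h0 := congrFun heg 0
      simp only [_root_.map_add, _root_.map_smul, Pi.add_apply, Pi.smul_apply, smul_eq_mul, e0,
        m0 _ hp, m0 _ hq] at h0
      linear_combination h0
    obtain ⟨g1, g2⟩ := eq_of_mem_osc_neg_one hg g00
    have e1 : dot3 r (fst5 g) = dot3 (rowB₀ a b) (pullback5 ψ r) := by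
      have := congrArg (fun v => dot3 r (fst5 v)) heg
      simp only [_root_.map_add, _root_.map_smul, dot3_fst5_add, dot3_fst5_smul, rψp, he.1] at this
      rw [dot3_comm (rowB₀ a b), dot3_pullback5]
      linear_combination this
    have e2 : b * (g 3 - 6*f 3) = a * (g 4 - 6*f 4) := by
      have h3 := congrFun heg 3
      have h4 := congrFun heg 4
      simp only [_root_.map_add, _root_.map_smul, Pi.add_apply, Pi.smul_apply, smul_eq_mul]
        at h3 h4
      linear_combination b * h3 - a * h4 - he.2 + 6 * πψp + mu _ hr'
    obtain ⟨c, c3, c4⟩ := exists_mul_of_cross h.ab e2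
    rw [← e1]
    simp only [dot3, rowB₀, fst5, Matrix.cons_val] at hr ⊢
    have k3 : g 3 = 6*f 3 + c * a := by linear_combination c3
    have k4 : g 4 = 6*f 4 + c * b := by linear_combination c4
    rw [k3, k4] at g1 g2
    linear_combination -r 0*g00 - r 1*g1 / 6 - r 2*g2 / 6 - c * hr / 6
  have tangent_row : ∀ s : ℂ, s ≠ 0 → dot3 (rowB s a b) r = 0 → 1 ≤ dim ↥(E.space 1 ⊓ osc 5 s 2) →
      IsTangent typeB (condB 3) (s : OnePoint ℂ) E ψ →
      dot3 (rowB s (f 3) (f 4)) r - dot3 (rowB s a b) (pullback5 ψ r) = 0 := by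
    intro s hs hr k t
    refine row s hs hr (IsTangent.map_le (hv := by decide) (hinj := by decide) t 1 (j := 2)
      (by norm_num) (le_antisymm (h.finrank_inf_two hs) k)
      ((E.space 1).add_mem ((E.space 1).smul_mem _ hp1) (h.head_mem (by rwa [dot3_comm]))) ?_)
    rw [mem_osc_five_two]
    simp [tail5, head5, rowB]
    refine ⟨?_, ?_, ?_⟩ <;> ring
  have r3 := tangent_row _ hs heq.2.1 k5 t3
  have r4 := tangent_row _ ht heq.2.2 k6 t4
  refine ⟨f 3, f 4, fun i => -pullback5 ψ r i, ⟨?_, ?_, ?_⟩, fun hf hr => ?_⟩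
  · simp only [dot3] at row₀ ⊢
    linear_combination row₀
  · simp only [dot3] at r3 ⊢
    linear_combination r3
  · simp only [dot3] at r4 ⊢
    linear_combination r4
  · have hpres : ∀ v ∈ E.space 1, ψ v ∈ E.space 1 := by
      intro v hv
      obtain ⟨c, u, hu, rfl⟩ := h.exists_eq hv
      have h1 : dot3 r (fst5 (ψ (head5 u))) = 0 := by
        have := hr u hu
        rw [← dot3_pullback5]
        simp only [dot3] at this ⊢
        linear_combination -this
      refine (h.mem_one _).mpr ⟨?_, ?_⟩
      · rw [_root_.map_add, _root_.map_smul, dot3_fst5_add, dot3_fst5_smul, rψp, h1]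
        ring
      · rw [_root_.map_add, _root_.map_smul]
        simp only [Pi.add_apply, Pi.smul_apply, smul_eq_mul]
        linear_combination c * πψp + mu u hu + c * hf
    have hpres' : ∀ v ∈ E.space 0, ψ v ∈ E.space 0 := fun v hv =>
      (h.mem_zero _).mpr ⟨hpres v ((h.mem_zero _).mp hv).1, m0 v hv⟩
    intro i
    fin_cases i
    · exact Submodule.map_le_iff_le_comap.mpr hpres'
    · exact Submodule.map_le_iff_le_comap.mpr hpres

lemma not_isTransverse_of_linearisedB {a' b' : ℂ} {r' : Fin 3 → ℂ}
    (hst : x 0 ≠ x 1) (hs : x 0 ≠ 0) (ht : x 1 ≠ 0)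
    (hE : E ∈ intersection typeB condB (pointsAt pointsB x)) (h : IsFlagB E a b r)
    (heq : EquationsB (x 0) (x 1) a b r) (hlin : LinearisedB (x 0) (x 1) a b r a' b' r')
    (hne : b * a' ≠ a * b' ∨ ∃ u, dot3 r u = 0 ∧ dot3 r' u ≠ 0) :
    ¬ IsTransverse typeB condB (pointsAt pointsB x) := by
  obtain ⟨⟨k1, k2⟩, k3, k4, k5, k6⟩ := mem_intersection_B.mp hE
  obtain ⟨y, z, hyz⟩ : ∃ y z, y * r 1 + z * r 2 = 1 := exists_dual (heq.ne_zero hst h.ab h.r_ne)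
  obtain ⟨c, d, hcd⟩ := exists_dual h.ab
  let ψ : Module.End ℂ (Fin 5 → ℂ) :=
    (form ![0, 0, 0, c, d]).smulRight (tail5 a' b') -
      (form ![r' 0, r' 1, r' 2, 0, 0]).smulRight (head5 ![0, y, z])
  have hψ : ∀ v, ψ v = (c * v 3 + d * v 4) • tail5 a' b' - dot3 r' (fst5 v) • head5 ![0, y, z] := by
    intro v
    simp [ψ, form_apply, Fin.sum_univ_five, dot3, fst5]
  have hψt : ψ (tail5 a b) = tail5 a' b' := by
    rw [hψ, show c * tail5 a b 3 + d * tail5 a b 4 = 1 from hcd,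
      show dot3 r' (fst5 (tail5 a b)) = 0 by simp [dot3, fst5, tail5], one_smul, zero_smul, sub_zero]
  have hψh : ∀ u, ψ (head5 u) = -dot3 r' u • head5 ![0, y, z] := by
    intro u
    rw [hψ, show c * head5 u 3 + d * head5 u 4 = 0 by simp [head5], fst5_head5, zero_smul, zero_sub,
      neg_smul]
  have hp := h.tail_mem
  have hp1 := ((h.mem_zero _).mp hp).1
  intro htr
  have tangent_row : ∀ s : ℂ, s ≠ 0 → dot3 (rowB s a' b') r + dot3 (rowB s a b) r' = 0 →
      IsTangent typeB (condB 3) (s : OnePoint ℂ) E ψ := by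
    intro s hs hl
    refine isTangent_B_three (Submodule.map_le_iff_le_comap.mpr fun v hv => ?_)
    obtain ⟨e0, e1, e2⟩ := eq_of_mem_osc_two hv.2
    obtain ⟨l, l3, l4⟩ := exists_mul_of_cross h.ab ((h.mem_one v).mp hv.1).2
    rw [l3, l4] at e0 e1 e2
    have hv' : v = (l / s^4) • (s^4 • tail5 a b + head5 (rowB s a b)) := by
      have hs4 : s^4 ≠ 0 := pow_ne_zero 4 hs
      ext i
      fin_cases i <;> simp [tail5, head5, rowB, l3, l4] <;>
        rw [div_mul_eq_mul_div, eq_div_iff hs4]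
      · linear_combination e0
      · linear_combination e1
      · linear_combination e2
      · ring
      · ring
    rw [Submodule.mem_comap, hv', _root_.map_smul, _root_.map_add, _root_.map_smul, hψt, hψh]
    refine Submodule.smul_mem _ _ (Submodule.mem_sup.mpr
      ⟨-head5 (rowB s a' b') + -dot3 r' (rowB s a b) • head5 ![0, y, z], ?_,
        s^4 • tail5 a' b' + head5 (rowB s a' b'), ?_, ?_⟩)
    · refine (h.mem_one _).mpr ⟨?_, by simp [head5]⟩
      rw [dot3_fst5_add, dot3_fst5_smul, fst5_head5, ← neg_one_smul ℂ, dot3_fst5_smul, fst5_head5,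
        dot3_comm r, dot3_comm r', show dot3 r ![0, y, z] = 1 by
          simp [dot3]; linear_combination hyz]
      linear_combination -hl
    · rw [mem_osc_five_two]
      simp [tail5, head5, rowB]
      refine ⟨?_, ?_, ?_⟩ <;> ring
    · abel
  have hpres := htr E hE ψ (by
    rw [pointsAt_B]
    intro l
    fin_cases l
    · refine isTangent_B_zero
        (fun v hv => mem_osc_five_infty_four.mpr ((h.mem_zero v).mp hv).2) k2 ?_ ?_
      · refine Submodule.map_le_iff_le_comap.mpr fun v hv => mem_osc_five_infty_four.mpr ?_
        rw [hψ]
        simp [tail5, head5]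
      · refine Submodule.map_le_iff_le_comap.mpr fun v hv => ?_
        refine Submodule.mem_sup_right (mem_osc_five_infty_two.mpr ?_)
        obtain ⟨c0, u, hu, rfl⟩ := h.exists_eq ((h.mem_zero v).mp hv.1).1
        obtain ⟨f0, f1, f2⟩ := mem_osc_five_infty_two.mp hv.2
        simp [tail5, head5] at f0 f1 f2
        rw [_root_.map_add, _root_.map_smul, hψt, hψh,
          show dot3 r' u = 0 by simp [dot3, f0, f1, f2]]
        simp [tail5]
    · refine isTangent_B_one (Submodule.map_le_iff_le_comap.mpr fun v hv => ?_)
      obtain ⟨g0, g1⟩ := (h.mem_zero v).mp hv.1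
      obtain ⟨e1, e2⟩ := eq_of_mem_osc_neg_one hv.2 g1
      obtain ⟨l, l3, l4⟩ := exists_mul_of_cross h.ab ((h.mem_one v).mp g0).2
      rw [l3, l4] at e1 e2
      have hv' : v = (l / 6) • ((6 : ℂ) • tail5 a b + head5 (rowB₀ a b)) := by
        ext i
        fin_cases i <;> simp [tail5, head5, rowB₀, g1, l3, l4]
        · linear_combination e1 / 6
        · linear_combination e2 / 6
        · ring
        · ring
      rw [Submodule.mem_comap, hv', _root_.map_smul, _root_.map_add, _root_.map_smul, hψt, hψh]
      refine Submodule.smul_mem _ _ (Submodule.mem_sup.mpr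
        ⟨-head5 (rowB₀ a' b') + -dot3 r' (rowB₀ a b) • head5 ![0, y, z], ?_,
          (6 : ℂ) • tail5 a' b' + head5 (rowB₀ a' b'), ?_, ?_⟩)
      · refine (h.mem_zero _).mpr ⟨(h.mem_one _).mpr ⟨?_, by simp [head5]⟩, by simp [head5, rowB₀]⟩
        rw [dot3_fst5_add, dot3_fst5_smul, fst5_head5, ← neg_one_smul ℂ, dot3_fst5_smul, fst5_head5,
          dot3_comm r, dot3_comm r', show dot3 r ![0, y, z] = 1 by
            simp [dot3]; linear_combination hyz]
        linear_combination -hlin.1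
      · change _ ∈ osc 5 (-1 : ℂ) 3
        rw [mem_osc_five_three]
        simp [tail5, head5, rowB₀]
        refine ⟨?_, ?_⟩ <;> ring
      · abel
    · refine isTangent_B_two k4 (Submodule.map_le_iff_le_comap.mpr fun v hv => osc_zero_B.mpr ?_)
      obtain ⟨f3, f4⟩ := osc_zero_B.mp hv
      rw [hψ, f3, f4]
      simp [tail5, head5]
    · exact tangent_row _ hs hlin.2.1
    · exact tangent_row _ ht hlin.2.2)
  have hpres1 : ∀ v ∈ E.space 1, ψ v ∈ E.space 1 := fun v hv => hpres 1 ⟨v, hv, rfl⟩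
  rcases hne with hne | ⟨u, hu, hu'⟩
  · have := ((h.mem_one _).mp (hpres1 _ hp1)).2
    rw [hψt] at this
    exact hne this
  · have := ((h.mem_one _).mp (hpres1 _ (h.head_mem hu))).1
    rw [hψh, dot3_fst5_smul, fst5_head5, show dot3 r ![0, y, z] = 1 by
      simp [dot3]; linear_combination hyz, mul_one, neg_eq_zero] at this
    exact hu' this

/-- A coefficient of the cubic form whose zeros parametrise the intersection. -/
def coefB₀ (s t : ℂ) : ℂ := 48*s^3*t + 96*s^2*t - 48*s * t^3 - 96*s * t^2

/-- A coefficient of the cubic form whose zeros parametrise the intersection. -/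
def coefB₁ (s t : ℂ) : ℂ :=
  24*s^3*t - 36*s^3 + 12*s^2*t - 72*s^2 - 24*s * t^3 - 12*s * t^2
    + 36*t^3 + 72*t^2

/-- A coefficient of the cubic form whose zeros parametrise the intersection. -/
def coefB₂ (s t : ℂ) : ℂ :=
  -18*s^3 - 12*s^2*t - 9*s^2 + 12*s * t^2 + 48*s + 18*t^3 + 9*t^2
    - 48*t

/-- A coefficient of the cubic form whose zeros parametrise the intersection. -/
def coefB₃ (s t : ℂ) : ℂ := 9*s^2 + 18*s - 9*t^2 - 18*t

lemma disc_coefB (s t : ℂ) : 1296*(s - t)^4*((s + t + 2) * polyB t (s - t)) =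
    coefB₁ s t^2*coefB₂ s t^2 - 4*coefB₀ s t * coefB₂ s t^3
      - 4*coefB₁ s t^3*coefB₃ s t - 27*coefB₀ s t^2*coefB₃ s t^2
      + 18*coefB₀ s t * coefB₁ s t * coefB₂ s t * coefB₃ s t := by
  simp only [coefB₀, coefB₁, coefB₂, coefB₃, polyB]
  ring

/-- The determinant whose zeros parametrise the intersection. -/
def detB (s t a b : ℂ) : ℂ := det3 (rowB₀ a b) (rowB s a b) (rowB t a b)

/-- The differential of `detB`. -/
def detB' (s t a b a' b' : ℂ) : ℂ :=
  det3' (rowB₀ a b) (rowB s a b) (rowB t a b) (rowB₀ a' b') (rowB s a' b') (rowB t a' b')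

lemma detB_eq (s t : ℂ) :
    detB s t = cubicForm (coefB₀ s t) (coefB₁ s t) (coefB₂ s t) (coefB₃ s t) := by
  funext a b
  simp only [detB, det3, rowB₀, rowB, cubicForm, Matrix.cons_val, coefB₀, coefB₁, coefB₂, coefB₃]
  ring

lemma detB'_eq (s t : ℂ) :
    detB' s t = cubicForm' (coefB₀ s t) (coefB₁ s t) (coefB₂ s t) (coefB₃ s t) := by
  funext a b a' b'
  simp only [detB', det3', det3, rowB₀, rowB, cubicForm', Matrix.cons_val, coefB₀, coefB₁, coefB₂,
    coefB₃]
  ring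

lemma detB_roots {s t : ℂ} (hst : s ≠ t) :
    ((s + t + 2) * polyB t (s - t) ≠ 0 → HasSimpleRoots 3 (detB s t) (detB' s t)) ∧
    ((s + t + 2) * polyB t (s - t) = 0 → HasDoubleRoot (detB s t) (detB' s t)) := by
  rw [detB_eq, detB'_eq]
  obtain ⟨h1, h2⟩ := cubic_roots _ _ _ _ (disc_coefB s t)
  have h3 : 1296*(s - t)^4 ≠ 0 :=
    mul_ne_zero (by norm_num) (pow_ne_zero 4 (sub_ne_zero.mpr hst))
  exact ⟨fun h => h1 (mul_ne_zero h3 h), fun h => h2 (by rw [h, mul_zero])⟩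

lemma rowB₀_smul (c a b : ℂ) : rowB₀ (c * a) (c * b) = c • rowB₀ a b := by
  ext i; fin_cases i <;> simp [rowB₀] <;> ring

lemma rowB_smul (s c a b : ℂ) : rowB s (c * a) (c * b) = c • rowB s a b := by
  ext i; fin_cases i <;> simp [rowB] <;> ring

lemma dot3_smul_left (c : ℂ) (u v : Fin 3 → ℂ) : dot3 (c • u) v = c * dot3 u v := by
  simp [dot3]; ring

/-- At a simple root the kernel is a line. -/
lemma kernel_unique_B {s t : ℂ} (hsimple : HasSimpleRoots 3 (detB s t) (detB' s t)) {r r' : Fin 3 → ℂ}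
    (hab : a ≠ 0 ∨ b ≠ 0) (hr : r ≠ 0) (h : EquationsB s t a b r) (h' : EquationsB s t a b r') :
    ∃ c : ℂ, r' = c • r := by
  obtain ⟨y, z, hyz⟩ := exists_dual hab
  refine eq_smul_of_det3'_ne_zero (u' := rowB₀ (-z) y) (v' := rowB s (-z) y)
    (w' := rowB t (-z) y) (fun h0 => ?_) hr h.1 h.2.1 h.2.2 h'.1 h'.2.1 h'.2.2
  have := hsimple.simple a b (-z) y hab (det3_eq_zero_of_kernel hr h.1 h.2.1 h.2.2) h0
  exact one_ne_zero (hyz.symm.trans (by linear_combination this))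

lemma IsFlagB.congr (h : IsFlagB E a b r) {a₁ b₁ : ℂ} {r₁ : Fin 3 → ℂ} (hab : a₁ ≠ 0 ∨ b₁ ≠ 0)
    (hr : r₁ ≠ 0) {c d : ℂ} (ha : a = c * a₁) (hb : b = c * b₁) (hd : r = d • r₁) :
    IsFlagB E a₁ b₁ r₁ := by
  have hc : c ≠ 0 := by
    rintro rfl
    exact h.ab.elim (fun h => h (by rw [ha, zero_mul])) fun h => h (by rw [hb, zero_mul])
  have hd0 : d ≠ 0 := by
    rintro rfl
    exact h.r_ne (by rw [hd, zero_smul])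
  refine ⟨hab, hr, fun v => ?_, h.mem_zero⟩
  rw [h.mem_one, hd, dot3_smul_left, mul_eq_zero, or_iff_right hd0, ha, hb, mul_assoc, mul_assoc,
    mul_right_inj' hc]

lemma IsFlagB.ext {E' : PartialFlag typeB 5} (h : IsFlagB E a b r) (h' : IsFlagB E' a b r) :
    E = E' := by
  have h1 : E.space 1 = E'.space 1 := by
    ext v
    rw [h.mem_one, h'.mem_one]
  refine PartialFlag.ext_space fun i => ?_
  fin_cases i
  · ext v
    change v ∈ E.space 0 ↔ v ∈ E'.space 0
    rw [h.mem_zero, h'.mem_zero, h1]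
  · exact h1

theorem isTransverse_B_iff (x : Fin 2 → ℂ) (hx : Function.Injective (pointsAt pointsB x)) :
    IsTransverse typeB condB (pointsAt pointsB x) ↔
      (x 0 + x 1 + 2) * polyB (x 1) (x 0 - x 1) ≠ 0 := by
  obtain ⟨hs, ht, -, -, hst⟩ := (injective_pointsAt_B x).mp hx
  constructor
  · intro htr h0
    obtain ⟨a, b, hab, h1, h2⟩ := (detB_roots hst).2 h0
    obtain ⟨y, z, hyz⟩ := exists_dual hab
    obtain ⟨r, hr, heq, hdef⟩ := deformableKernel_of_det3 h1 (h2 (-z) y)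
    obtain ⟨E, hE, hEr⟩ := exists_flag_of_equationsB hst hs ht hab hr heq
    rcases hdef with ⟨r', hlin⟩ | ⟨r', hne, k1, k2, k3⟩
    · refine not_isTransverse_of_linearisedB (a' := -z) (b' := y) (r' := r') hst hs ht hE hEr heq hlin (Or.inl fun h => ?_) htr
      exact one_ne_zero (hyz.symm.trans (by linear_combination -h))
    · refine not_isTransverse_of_linearisedB (a' := 0) (b' := 0) (r' := r') hst hs ht hE hEr heq
        ⟨?_, ?_, ?_⟩ (Or.inr (exists_dot3_of_not_smul hr hne)) htr
      · rw [k1]; simp [dot3, rowB₀]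
      · rw [k2]; simp [dot3, rowB]
      · rw [k3]; simp [dot3, rowB]
  · intro h0 E hE ψ hψ
    have hsimple := (detB_roots hst).1 h0
    obtain ⟨a, b, r, hEr, heq⟩ := exists_isFlagB hs ht hst hE
    obtain ⟨a', b', r', hlin, hpres⟩ := exists_linearisedB hs ht hE hEr heq hψ
    have hpar := hsimple.simple a b a' b' hEr.ab
      (det3_eq_zero_of_kernel hEr.r_ne heq.1 heq.2.1 heq.2.2)
      (det3'_eq_zero_of_kernel hEr.r_ne heq.1 heq.2.1 heq.2.2 hlin.1 hlin.2.1 hlin.2.2)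
    have hpar' : b * a' = a * b' := by linear_combination -hpar
    obtain ⟨c, rfl, rfl⟩ := exists_mul_of_cross hEr.ab hpar'
    obtain ⟨d, rfl⟩ : ∃ d : ℂ, r' = d • r := by
      refine kernel_unique_B hsimple hEr.ab hEr.r_ne heq ⟨?_, ?_, ?_⟩
      · have := hlin.1
        rwa [rowB₀_smul, dot3_smul_left, heq.1, mul_zero, zero_add] at this
      · have := hlin.2.1
        rwa [rowB_smul, dot3_smul_left, heq.2.1, mul_zero, zero_add] at this
      · have := hlin.2.2
        rwa [rowB_smul, dot3_smul_left, heq.2.2, mul_zero, zero_add] at this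
    exact hpres hpar' fun u hu => by rw [dot3_smul_left, hu, mul_zero]

theorem encard_B (x : Fin 2 → ℂ) (hx : Function.Injective (pointsAt pointsB x))
    (h : (x 0 + x 1 + 2) * polyB (x 1) (x 0 - x 1) ≠ 0) :
    (intersection typeB condB (pointsAt pointsB x)).encard = 3 := by
  obtain ⟨hs, ht, -, -, hst⟩ := (injective_pointsAt_B x).mp hx
  have hsimple := (detB_roots hst).1 h
  obtain ⟨a, b, hroot, hdist, hall⟩ := hsimple.exists_roots
  refine encard_eq_of_correspondence (d := 3)
    (fun E k => ∃ r, IsFlagB E (a k) (b k) r ∧ EquationsB (x 0) (x 1) (a k) (b k) r) ?_ ?_ ?_ ?_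
  · intro k
    obtain ⟨r, hr, heq, -⟩ := deformableKernel_of_det3 (u' := 0) (v' := 0) (w' := 0) (hroot k).2
      (by simp [det3', det3])
    obtain ⟨E, hE, hEr⟩ := exists_flag_of_equationsB hst hs ht (hroot k).1 hr heq
    exact ⟨E, hE, r, hEr, heq⟩
  · intro E hE
    obtain ⟨a', b', r, hEr, heq⟩ := exists_isFlagB hs ht hst hE
    obtain ⟨k, hk⟩ := hall a' b' (det3_eq_zero_of_kernel hEr.r_ne heq.1 heq.2.1 heq.2.2)
    obtain ⟨c, rfl, rfl⟩ := exists_mul_of_cross (hroot k).1 (x := a') (y := b')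
      (by linear_combination -hk)
    have hc : c ≠ 0 := by
      rintro rfl
      simpa using hEr.ab
    refine ⟨k, r, hEr.congr (hroot k).1 hEr.r_ne rfl rfl (one_smul ℂ r).symm, ?_⟩
    obtain ⟨e1, e2, e3⟩ := heq
    rw [rowB₀_smul, dot3_smul_left] at e1
    rw [rowB_smul, dot3_smul_left] at e2 e3
    exact ⟨(mul_eq_zero.mp e1).resolve_left hc, (mul_eq_zero.mp e2).resolve_left hc,
      (mul_eq_zero.mp e3).resolve_left hc⟩
  · rintro E - E' - k ⟨r, hEr, heq⟩ ⟨r', hEr', heq'⟩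
    obtain ⟨d, hd⟩ := kernel_unique_B hsimple hEr.ab hEr.r_ne heq heq'
    exact hEr.ext (hEr'.congr hEr'.ab hEr.r_ne (one_mul _).symm (one_mul _).symm hd)
  · rintro E - k l ⟨r, hEr, -⟩ ⟨r', hEr', -⟩
    by_contra hkl
    have := ((hEr'.mem_one _).mp ((hEr.mem_zero _).mp hEr.tail_mem).1).2
    simp only [tail5, Matrix.cons_val] at this
    exact hdist k l hkl (by linear_combination this)

end TangentB

/-! ### Flags of type `(1,2,4,5)` in 6-space -/

lemma mem_osculatingSpace_coe_zero {n j : ℕ} {v : Fin n → ℂ} :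
    v ∈ osc n (0 : ℂ) j ↔ ∀ i : Fin n, j ≤ i → v i = 0 := by
  have key : ∀ i : Fin n, ∑ d : Fin n, ((i : ℕ).choose d : ℂ) * (-0)^((i : ℕ) - d) * v d = v i := by
    intro i
    rw [Finset.sum_eq_single i]
    · simp
    · intro d _ hd
      rcases lt_trichotomy (d : ℕ) i with h | h | h
      · rw [neg_zero, zero_pow (Nat.sub_ne_zero_of_lt h), mul_zero, zero_mul]
      · exact absurd (Fin.ext h) hd
      · rw [Nat.choose_eq_zero_of_lt h, Nat.cast_zero, zero_mul, zero_mul]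
    · simp
  rw [mem_osculatingSpace_coe]
  exact ⟨fun h i hi => (key i).symm.trans (h i hi i.2),
    fun h i hi hin => (key ⟨i, hin⟩).trans (h ⟨i, hin⟩ hi)⟩

section OsculatingSix

variable {v : Fin 6 → ℂ}

lemma mem_osc_six_infty_three : v ∈ osc 6 ∞ 3 ↔ v 0 = 0 ∧ v 1 = 0 ∧ v 2 = 0 := by
  rw [mem_osculatingSpace_infty]
  simp [Fin.forall_fin_succ]

lemma mem_osc_six_infty_four : v ∈ osc 6 ∞ 4 ↔ v 0 = 0 ∧ v 1 = 0 := by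
  rw [mem_osculatingSpace_infty]
  simp [Fin.forall_fin_succ]

lemma mem_osc_six_five {z : ℂ} : v ∈ osc 6 z 5 ↔
    -z^5*v 0 + 5*z^4*v 1 - 10*z^3*v 2 + 10*z^2*v 3 - 5*z * v 4 + v 5
      = 0 := by
  rw [mem_osculatingSpace_coe]
  constructor
  · intro h
    have h5 := h 5 le_rfl (by norm_num)
    simp [Fin.sum_univ_six, Nat.choose] at h5
    linear_combination h5
  · intro h i hi hi'
    interval_cases i
    simp [Fin.sum_univ_six, Nat.choose]
    linear_combination h

lemma mem_osc_six_neg_one_four : v ∈ osc 6 (-1 : ℂ) 4 ↔ v 0 + 4*v 1 + 6*v 2 + 4*v 3 + v 4 = 0 ∧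
      v 0 + 5*v 1 + 10*v 2 + 10*v 3 + 5*v 4 + v 5 = 0 := by
  rw [mem_osculatingSpace_coe]
  constructor
  · intro h
    have h4 := h 4 le_rfl (by norm_num)
    have h5 := h 5 (by norm_num) (by norm_num)
    simp [Fin.sum_univ_six, Nat.choose] at h4 h5
    exact ⟨by linear_combination h4, by linear_combination h5⟩
  · rintro ⟨h4, h5⟩ i hi hi'
    interval_cases i <;> simp [Fin.sum_univ_six, Nat.choose]
    · linear_combination h4
    · linear_combination h5

lemma mem_osc_six_neg_one_two : v ∈ osc 6 (-1 : ℂ) 2 ↔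
    v 2 = -v 0 - 2*v 1 ∧ v 3 = 2*v 0 + 3*v 1 ∧ v 4 = -3*v 0 - 4*v 1 ∧ v 5 = 4*v 0 + 5*v 1 := by
  rw [mem_osculatingSpace_coe]
  constructor
  · intro h
    have h2 := h 2 le_rfl (by norm_num)
    have h3 := h 3 (by norm_num) (by norm_num)
    have h4 := h 4 (by norm_num) (by norm_num)
    have h5 := h 5 (by norm_num) (by norm_num)
    simp [Fin.sum_univ_six, Nat.choose] at h2 h3 h4 h5
    refine ⟨?_, ?_, ?_, ?_⟩
    · linear_combination h2
    · linear_combination h3 - 3*h2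
    · linear_combination h4 - 4*h3 + 6*h2
    · linear_combination h5 - 5*h4 + 10*h3 - 10*h2
  · rintro ⟨h2, h3, h4, h5⟩ i hi hi'
    interval_cases i <;> simp [Fin.sum_univ_six, Nat.choose, h2, h3, h4, h5] <;> ring

lemma mem_osc_six_zero_two : v ∈ osc 6 (0 : ℂ) 2 ↔ v 2 = 0 ∧ v 3 = 0 ∧ v 4 = 0 ∧ v 5 = 0 := by
  rw [mem_osculatingSpace_coe_zero]
  simp [Fin.forall_fin_succ]

lemma mem_osc_six_zero_three : v ∈ osc 6 (0 : ℂ) 3 ↔ v 3 = 0 ∧ v 4 = 0 ∧ v 5 = 0 := by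
  rw [mem_osculatingSpace_coe_zero]
  simp [Fin.forall_fin_succ]

lemma mem_osc_six_one {z : ℂ} : v ∈ osc 6 z 1 ↔
    v 1 = z * v 0 ∧ v 2 = z^2*v 0 ∧ v 3 = z^3*v 0 ∧ v 4 = z^4*v 0 ∧ v 5 = z^5*v 0 := by
  rw [mem_osculatingSpace_coe]
  constructor
  · intro h
    have h1 := h 1 le_rfl (by norm_num)
    have h2 := h 2 (by norm_num) (by norm_num)
    have h3 := h 3 (by norm_num) (by norm_num)
    have h4 := h 4 (by norm_num) (by norm_num)
    have h5 := h 5 (by norm_num) (by norm_num)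
    simp [Fin.sum_univ_six, Nat.choose] at h1 h2 h3 h4 h5
    have k1 : v 1 = z * v 0 := by linear_combination h1
    have k2 : v 2 = z^2*v 0 := by linear_combination h2 + 2*z * k1
    have k3 : v 3 = z^3*v 0 := by linear_combination h3 + 3*z * k2 - 3*z^2*k1
    have k4 : v 4 = z^4*v 0 := by
      linear_combination h4 + 4*z * k3 - 6*z^2*k2 + 4*z^3*k1
    exact ⟨k1, k2, k3, k4, by
      linear_combination h5 + 5*z * k4 - 10*z^2*k3 + 10*z^3*k2 - 5*z^4*k1⟩
  · rintro ⟨h1, h2, h3, h4, h5⟩ i hi hi'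
    interval_cases i <;> simp [Fin.sum_univ_six, Nat.choose, h1, h2, h3, h4, h5] <;> ring

end OsculatingSix

section FlagsA

variable {E : PartialFlag typeA 6} {τ : OnePoint ℂ} {ψ : Module.End ℂ (Fin 6 → ℂ)}

lemma mem_schubertVariety_A_zero : E ∈ schubertVariety typeA (condA 0) τ ↔
    1 ≤ dim ↥(E.space 0 ⊓ osc 6 τ 5) := by
  constructor
  · intro h
    have h := (mem_schubertVariety_oneLine (hv := by decide) (hinj := by decide)).mp h
    exact h 0 5 (by norm_num)
  · intro h1
    refine mem_schubertVariety_of_essential (hv := by decide) (hinj := by decide)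
      fun i j hj hg => ?_
    fin_cases i <;> interval_cases j <;>
      first
      | exact absurd (by decide) hg
      | exact le_trans (by decide) h1

lemma mem_schubertVariety_A_one : E ∈ schubertVariety typeA (condA 1) τ ↔
    1 ≤ dim ↥(E.space 0 ⊓ osc 6 τ 3) ∧ 2 ≤ dim ↥(E.space 1 ⊓ osc 6 τ 4) := by
  constructor
  · intro h
    have h := (mem_schubertVariety_oneLine (hv := by decide) (hinj := by decide)).mp h
    exact ⟨h 0 3 (by norm_num), h 1 4 (by norm_num)⟩
  · rintro ⟨h1, h2⟩
    refine mem_schubertVariety_of_essential (hv := by decide) (hinj := by decide)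
      fun i j hj hg => ?_
    have h3 := h1.trans (finrank_inf_osculatingSpace_succ (E.space 0) τ (by norm_num)).1
    have h4 := h3.trans (finrank_inf_osculatingSpace_succ (E.space 0) τ (by norm_num)).1
    have h5 := h2.trans (finrank_inf_osculatingSpace_succ (E.space 1) τ (by norm_num)).1
    have h6 := h1.trans (finrank_inf_le_add (E.monotone (show (0 : Fin 4) ≤ 1 by decide))
      (osc 6 τ 3)).1
    fin_cases i <;> interval_cases j <;>
      first
      | exact absurd (by decide) hg
      | (refine le_trans ?_ (by assumption); decide)

lemma mem_schubertVariety_A_two : E ∈ schubertVariety typeA (condA 2) τ ↔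
    1 ≤ dim ↥(E.space 1 ⊓ osc 6 τ 4) ∧ 1 ≤ dim ↥(E.space 2 ⊓ osc 6 τ 2) := by
  constructor
  · intro h
    have h := (mem_schubertVariety_oneLine (hv := by decide) (hinj := by decide)).mp h
    exact ⟨h 1 4 (by norm_num), h 2 2 (by norm_num)⟩
  · rintro ⟨h1, h2⟩
    refine mem_schubertVariety_of_essential (hv := by decide) (hinj := by decide)
      fun i j hj hg => ?_
    fin_cases i <;> interval_cases j <;>
      first
      | exact absurd (by decide) hg
      | (refine le_trans ?_ (by assumption); decide)

lemma mem_schubertVariety_A_three : E ∈ schubertVariety typeA (condA 3) τ ↔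
    osc 6 τ 2 ≤ E.space 2 ∧ osc 6 τ 3 ≤ E.space 3 := by
  constructor
  · intro h
    have h := (mem_schubertVariety_oneLine (hv := by decide) (hinj := by decide)).mp h
    have h2 := h 2 2 (by norm_num)
    have h3 := h 3 3 (by norm_num)
    rw [inf_comm] at h2 h3
    exact ⟨le_of_finrank_le_finrank_inf (by
        rw [finrank_osculatingSpace τ (by norm_num)]; exact le_trans (by decide) h2),
      le_of_finrank_le_finrank_inf (by
        rw [finrank_osculatingSpace τ (by norm_num)]; exact le_trans (by decide) h3)⟩
  · rintro ⟨h1, h2⟩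
    refine mem_schubertVariety_of_essential (hv := by decide) (hinj := by decide)
      fun i j hj hg => ?_
    have e1 : ∀ j, j ≤ 2 → j ≤ dim ↥(E.space 2 ⊓ osc 6 τ j) := by
      intro j hj
      rw [inf_eq_right.mpr ((osculatingSpace_mono 6 τ hj).trans h1),
        finrank_osculatingSpace τ (by omega)]
    have e2 : ∀ j, j ≤ 3 → j ≤ dim ↥(E.space 3 ⊓ osc 6 τ j) := by
      intro j hj
      rw [inf_eq_right.mpr ((osculatingSpace_mono 6 τ hj).trans h2),
        finrank_osculatingSpace τ (by omega)]
    have e3 := (e1 2 le_rfl).trans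
      (finrank_inf_osculatingSpace_succ (E.space 2) τ (by norm_num)).1
    fin_cases i <;> interval_cases j <;>
      first
      | exact absurd (by decide) hg
      | exact le_trans (by decide) (e1 1 (by norm_num))
      | exact le_trans (by decide) (e1 2 (by norm_num))
      | exact le_trans (by decide) (e2 1 (by norm_num))
      | exact le_trans (by decide) (e2 2 (by norm_num))
      | exact le_trans (by decide) (e2 3 (by norm_num))
      | exact le_trans (by decide) e3

lemma mem_schubertVariety_A_four : E ∈ schubertVariety typeA (condA 4) τ ↔
    osc 6 τ 1 ≤ E.space 3 := by
  constructor
  · intro h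
    have h := (mem_schubertVariety_oneLine (hv := by decide) (hinj := by decide)).mp h
    have h2 := h 3 1 (by norm_num)
    rw [inf_comm] at h2
    exact le_of_finrank_le_finrank_inf (by
        rw [finrank_osculatingSpace τ (by norm_num)]; exact le_trans (by decide) h2)
  · intro h
    refine mem_schubertVariety_of_essential (hv := by decide) (hinj := by decide)
      fun i j hj hg => ?_
    have h1 : 1 ≤ dim ↥(E.space 3 ⊓ osc 6 τ 1) := by
      rw [inf_eq_right.mpr h, finrank_osculatingSpace τ (by omega)]
    fin_cases i <;> interval_cases j <;>
      first
      | exact absurd (by decide) hg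
      | exact le_trans (by decide) h1

lemma isTangent_A_zero (hE : E.space 0 ≤ osc 6 τ 5)
    (h : (E.space 0).map ψ ≤ osc 6 τ 5) : IsTangent typeA (condA 0) τ E ψ := by
  refine isTangent_oneLine (hv := by decide) (hinj := by decide) fun i j hj hg hfin => ?_
  fin_cases i <;> interval_cases j <;>
    first
    | exact absurd (by decide) hg
    | exact map_inf_le_sup_of_le hE h

lemma isTangent_A_one (h0 : E.space 0 ≤ osc 6 τ 3)
    (h1 : E.space 1 ≤ osc 6 τ 4) (k0 : (E.space 0).map ψ ≤ osc 6 τ 3)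
    (k1 : (E.space 1).map ψ ≤ osc 6 τ 4) : IsTangent typeA (condA 1) τ E ψ := by
  refine isTangent_oneLine (hv := by decide) (hinj := by decide) fun i j hj hg hfin => ?_
  have e0 : ∀ j, 3 ≤ j → (E.space 0 ⊓ osc 6 τ j).map ψ ≤ E.space 0 ⊔ osc 6 τ j := fun j hj =>
    map_inf_le_sup_of_le (h0.trans (osculatingSpace_mono 6 τ hj))
      (k0.trans (osculatingSpace_mono 6 τ hj))
  have e1 : ∀ j, 4 ≤ j → (E.space 1 ⊓ osc 6 τ j).map ψ ≤ E.space 1 ⊔ osc 6 τ j := fun j hj =>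
    map_inf_le_sup_of_le (h1.trans (osculatingSpace_mono 6 τ hj))
      (k1.trans (osculatingSpace_mono 6 τ hj))
  have f0 : 1 ≤ dim ↥(E.space 0 ⊓ osc 6 τ 3) := by
    rw [inf_eq_left.mpr h0]
    exact (E.finrank_eq 0).ge
  have e2 := E.monotone (show (0 : Fin 4) ≤ 1 by decide)
  fin_cases i <;> interval_cases j <;>
    first
    | exact absurd (by decide) hg
    | exact e0 3 le_rfl
    | exact e0 4 (by norm_num)
    | exact e0 5 (by norm_num)
    | exact e1 4 le_rfl
    | exact e1 5 (by norm_num)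
    | exact map_inf_le_sup_mono e2 le_rfl ((hfin.trans (by decide)).trans_le f0) (e0 3 le_rfl)

lemma isTangent_A_two
    (k1 : (E.space 1 ⊓ osc 6 τ 4).map ψ ≤ E.space 1 ⊔ osc 6 τ 4)
    (k2 : (E.space 2 ⊓ osc 6 τ 2).map ψ ≤ E.space 2 ⊔ osc 6 τ 2) :
    IsTangent typeA (condA 2) τ E ψ := by
  refine isTangent_oneLine (hv := by decide) (hinj := by decide) fun i j hj hg hfin => ?_
  fin_cases i <;> interval_cases j <;>
    first
    | exact absurd (by decide) hg
    | assumption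

lemma isTangent_A_three (h2 : osc 6 τ 2 ≤ E.space 2)
    (k2 : (osc 6 τ 2).map ψ ≤ E.space 2)
    (k3 : (osc 6 τ 3).map ψ ≤ E.space 3) : IsTangent typeA (condA 3) τ E ψ := by
  refine isTangent_oneLine (hv := by decide) (hinj := by decide) fun i j hj hg hfin => ?_
  have e2 : ∀ j, j ≤ 2 → (E.space 2 ⊓ osc 6 τ j).map ψ ≤ E.space 2 ⊔ osc 6 τ j := fun j hj =>
    (Submodule.map_mono (inf_le_right.trans (osculatingSpace_mono 6 τ hj))).trans
      (k2.trans le_sup_left)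
  have e3 : ∀ j, j ≤ 3 → (E.space 3 ⊓ osc 6 τ j).map ψ ≤ E.space 3 ⊔ osc 6 τ j := fun j hj =>
    (Submodule.map_mono (inf_le_right.trans (osculatingSpace_mono 6 τ hj))).trans
      (k3.trans le_sup_left)
  have f2 : 2 ≤ dim ↥(E.space 2 ⊓ osc 6 τ 2) := by
    rw [inf_eq_right.mpr h2, finrank_osculatingSpace τ (by omega)]
  fin_cases i <;> interval_cases j <;>
    first
    | exact absurd (by decide) hg
    | exact e2 1 (by norm_num)
    | exact e2 2 le_rfl
    | exact e3 1 (by norm_num)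
    | exact e3 2 (by norm_num)
    | exact e3 3 le_rfl
    | exact map_inf_le_sup_mono le_rfl (osculatingSpace_mono 6 τ (by norm_num))
        ((hfin.trans (by decide)).trans_le f2) (e2 2 le_rfl)

lemma isTangent_A_four (k : (osc 6 τ 1).map ψ ≤ E.space 3) : IsTangent typeA (condA 4) τ E ψ := by
  refine isTangent_oneLine (hv := by decide) (hinj := by decide) fun i j hj hg hfin => ?_
  fin_cases i <;> interval_cases j <;>
    first
    | exact absurd (by decide) hg
    | exact (Submodule.map_mono inf_le_right).trans (k.trans le_sup_left)

lemma mem_intersection_A {x : Fin 2 → ℂ} : E ∈ intersection typeA condA (pointsAt pointsA x) ↔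
      1 ≤ dim ↥(E.space 0 ⊓ osc 6 (x 1) 5) ∧ (1 ≤ dim ↥(E.space 0 ⊓ osc 6 ∞ 3) ∧
        2 ≤ dim ↥(E.space 1 ⊓ osc 6 ∞ 4)) ∧ (1 ≤ dim ↥(E.space 1 ⊓ osc 6 (-1 : ℂ) 4) ∧
        1 ≤ dim ↥(E.space 2 ⊓ osc 6 (-1 : ℂ) 2)) ∧ (osc 6 (0 : ℂ) 2 ≤ E.space 2 ∧
        osc 6 (0 : ℂ) 3 ≤ E.space 3) ∧ osc 6 (x 0) 1 ≤ E.space 3 := by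
  rw [← mem_schubertVariety_A_zero, ← mem_schubertVariety_A_one, ← mem_schubertVariety_A_two,
    ← mem_schubertVariety_A_three, ← mem_schubertVariety_A_four, pointsAt_A]
  exact ⟨fun h => ⟨h 0, h 1, h 2, h 3, h 4⟩, fun ⟨h0, h1, h2, h3, h4⟩ l => by
    fin_cases l
    exacts [h0, h1, h2, h3, h4]⟩

end FlagsA

section ProblemA

/-- The first coordinate along the projection of `F₂(-1)` to `⟨e₃,…,e₆⟩`. -/
noncomputable def xi₁ : (Fin 6 → ℂ) →ₗ[ℂ] ℂ := form ![0, 0, 10, 20, 15, 4]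

/-- The second coordinate along the projection of `F₂(-1)` to `⟨e₃,…,e₆⟩`. -/
noncomputable def xi₂ : (Fin 6 → ℂ) →ₗ[ℂ] ℂ := form ![0, 0, 6, 14, 11, 3]

/-- The first coordinate along `F₄(-1) ∩ ⟨e₃,…,e₆⟩`. -/
noncomputable def eta₁ : (Fin 6 → ℂ) →ₗ[ℂ] ℂ := form ![0, 0, 3, 8, 7, 2]

/-- The second coordinate along `F₄(-1) ∩ ⟨e₃,…,e₆⟩`. -/
noncomputable def eta₂ : (Fin 6 → ℂ) →ₗ[ℂ] ℂ := form ![0, 0, -8, -21, -18, -5]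

/-- On `⟨e₄,e₅,e₆⟩`, the equation of `F₅(t)`. -/
noncomputable def lam (t : ℂ) : (Fin 6 → ℂ) →ₗ[ℂ] ℂ :=
  form ![0, 0, -10*t^3, 10*t^2, -5*t, 1]

/-- An equation of `⟨e₁,e₂,e₃⟩ + F₁(s)`. -/
noncomputable def kap₁ (s : ℂ) : (Fin 6 → ℂ) →ₗ[ℂ] ℂ := form ![0, 0, 0, -s, 1, 0]

/-- An equation of `⟨e₁,e₂,e₃⟩ + F₁(s)`. -/
noncomputable def kap₂ (s : ℂ) : (Fin 6 → ℂ) →ₗ[ℂ] ℂ := form ![0, 0, 0, 0, -s, 1]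

/-- The vector with given first two coordinates. -/
def head6 (x y : ℂ) : Fin 6 → ℂ := ![x, y, 0, 0, 0, 0]

/-- The vector of `⟨e₃,…,e₆⟩` with given coordinates `xi₁, xi₂, eta₁, eta₂`. -/
def vec6 (a b c d : ℂ) : Fin 6 → ℂ :=
  ![0, 0, a - 2*b + c, -a + 3*b + d, a - 4*b - 6*c - 4*d, -a + 5*b + 20*c + 10*d]

lemma xi₁_apply (v : Fin 6 → ℂ) : xi₁ v = 10*v 2 + 20*v 3 + 15*v 4 + 4*v 5 := by
  simp [xi₁, form_apply, Fin.sum_univ_six]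

lemma xi₂_apply (v : Fin 6 → ℂ) : xi₂ v = 6*v 2 + 14*v 3 + 11*v 4 + 3*v 5 := by
  simp [xi₂, form_apply, Fin.sum_univ_six]

lemma eta₁_apply (v : Fin 6 → ℂ) : eta₁ v = 3*v 2 + 8*v 3 + 7*v 4 + 2*v 5 := by
  simp [eta₁, form_apply, Fin.sum_univ_six]

lemma eta₂_apply (v : Fin 6 → ℂ) : eta₂ v = -8*v 2 - 21*v 3 - 18*v 4 - 5*v 5 := by
  simp [eta₂, form_apply, Fin.sum_univ_six]; ring

lemma lam_apply (t : ℂ) (v : Fin 6 → ℂ) : lam t v = -10*t^3*v 2 + 10*t^2*v 3 - 5*t * v 4 + v 5 := by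
  simp [lam, form_apply, Fin.sum_univ_six]; ring

lemma kap₁_apply (s : ℂ) (v : Fin 6 → ℂ) : kap₁ s v = v 4 - s * v 3 := by
  simp [kap₁, form_apply, Fin.sum_univ_six]; ring

lemma kap₂_apply (s : ℂ) (v : Fin 6 → ℂ) : kap₂ s v = v 5 - s * v 4 := by
  simp [kap₂, form_apply, Fin.sum_univ_six]; ring

lemma eq_head6_add_vec6 (v : Fin 6 → ℂ) :
    v = head6 (v 0) (v 1) + vec6 (xi₁ v) (xi₂ v) (eta₁ v) (eta₂ v) := by
  ext i
  fin_cases i <;> simp [head6, vec6, xi₁_apply, xi₂_apply, eta₁_apply, eta₂_apply] <;> ring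

section Evaluation

variable (a b c d : ℂ)

lemma xi₁_vec6 : xi₁ (vec6 a b c d) = a := by simp [xi₁_apply, vec6]; ring

lemma xi₂_vec6 : xi₂ (vec6 a b c d) = b := by simp [xi₂_apply, vec6]; ring

lemma eta₁_vec6 : eta₁ (vec6 a b c d) = c := by simp [eta₁_apply, vec6]; ring

lemma eta₂_vec6 : eta₂ (vec6 a b c d) = d := by simp [eta₂_apply, vec6]; ring

lemma xi₁_head6 : xi₁ (head6 a b) = 0 := by simp [xi₁_apply, head6]

lemma xi₂_head6 : xi₂ (head6 a b) = 0 := by simp [xi₂_apply, head6]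

lemma eta₁_head6 : eta₁ (head6 a b) = 0 := by simp [eta₁_apply, head6]

lemma eta₂_head6 : eta₂ (head6 a b) = 0 := by simp [eta₂_apply, head6]

lemma kap₁_head6 (s : ℂ) : kap₁ s (head6 a b) = 0 := by simp [kap₁_apply, head6]

lemma kap₂_head6 (s : ℂ) : kap₂ s (head6 a b) = 0 := by simp [kap₂_apply, head6]

end Evaluation

lemma vec6_combination (p q a b c d : ℂ) :
    vec6 (p * a) (p * b) (q * c) (q * d) = p • vec6 a b 0 0 + q • vec6 0 0 c d := by
  ext i; fin_cases i <;> simp [vec6] <;> ring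

/-- The flag `E` is given by `(a,b)` and `(c,d)`. -/
structure IsFlagA (s t : ℂ) (E : PartialFlag typeA 6) (a b c d : ℂ) : Prop where
  ab : a ≠ 0 ∨ b ≠ 0
  cd : c ≠ 0 ∨ d ≠ 0
  mem_two : ∀ v, v ∈ E.space 2 ↔ b * xi₁ v = a * xi₂ v ∧ d * eta₁ v = c * eta₂ v
  mem_one : ∀ v, v ∈ E.space 1 ↔ v ∈ E.space 2 ∧ v 0 = 0 ∧ v 1 = 0
  mem_zero : ∀ v, v ∈ E.space 0 ↔ v ∈ E.space 1 ∧ v 2 = 0 ∧ lam t v = 0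
  mem_three : ∀ v, v ∈ E.space 3 ↔
    kap₂ s (vec6 a b 0 0) * kap₁ s v = kap₁ s (vec6 a b 0 0) * kap₂ s v

/-- The determinant of `(v₂, λ(v))` and the same for `w`. -/
noncomputable def lamWedge (t : ℂ) (v w : Fin 6 → ℂ) : ℂ := v 2*lam t w - lam t v * w 2

/-- The determinant of `κ(v)` and `κ(w)`. -/
noncomputable def kapWedge (s : ℂ) (v w : Fin 6 → ℂ) : ℂ := kap₁ s v * kap₂ s w - kap₂ s v * kap₁ s w

/-- The equations of the intersection. -/
def EquationsA (s t a b c d : ℂ) : Prop :=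
  lamWedge t (vec6 a b 0 0) (vec6 0 0 c d) = 0 ∧ kapWedge s (vec6 a b 0 0) (vec6 0 0 c d) = 0

lemma lam_ne_zero {t c d : ℂ} (ht : t ≠ -1) (hcd : c ≠ 0 ∨ d ≠ 0) :
    vec6 0 0 c d 2 ≠ 0 ∨ lam t (vec6 0 0 c d) ≠ 0 := by
  by_contra! h
  obtain ⟨h1, h2⟩ := h
  have hc : c = 0 := by simpa [vec6] using h1
  have hd : (t + 1)^2*d = 0 := by
    simp [lam_apply, vec6, hc] at h2
    linear_combination h2 / 10
  have ht' : (t + 1)^2 ≠ 0 := pow_ne_zero 2 fun h => ht (by linear_combination h)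
  exact hcd.elim (fun h => h hc) fun h => h ((mul_eq_zero.mp hd).resolve_left ht')

lemma kap_ne_zero {s a b : ℂ} (hs : s ≠ -1) (hab : a ≠ 0 ∨ b ≠ 0) :
    kap₁ s (vec6 a b 0 0) ≠ 0 ∨ kap₂ s (vec6 a b 0 0) ≠ 0 := by
  by_contra! h
  obtain ⟨h1, h2⟩ := h
  simp [kap₁_apply, vec6] at h1
  simp [kap₂_apply, vec6] at h2
  have hs' : s + 1 ≠ 0 := fun h => hs (by linear_combination h)
  have hb : b = 0 := (mul_eq_zero.mp (show (s + 1) * b = 0 by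
    linear_combination h1 + h2)).resolve_left hs'
  have ha : a = 0 := (mul_eq_zero.mp (show (s + 1) * a = 0 by
    linear_combination h1 + (4 + 3*s) * hb)).resolve_left hs'
  exact hab.elim (fun h => h ha) fun h => h hb

lemma finrank_coordinatesA {a b c d : ℂ} (hab : a ≠ 0 ∨ b ≠ 0) (hcd : c ≠ 0 ∨ d ≠ 0) :
    dim ↥(LinearMap.ker (b • xi₁ - a • xi₂) ⊓ LinearMap.ker (d • eta₁ - c • eta₂)) = 4 := by
  obtain ⟨y, z, hyz⟩ := exists_dual hab
  obtain ⟨y', z', hyz'⟩ := exists_dual hcd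
  have h1 := finrank_inf_ker (S := ⊤) (f := b • xi₁ - a • xi₂) (x := vec6 z (-y) 0 0)
    Submodule.mem_top (by
      have : (b • xi₁ - a • xi₂) (vec6 z (-y) 0 0) = 1 := by
        simp [xi₁_vec6, xi₂_vec6]
        linear_combination hyz
      rw [this]
      exact one_ne_zero)
  rw [top_inf_eq, finrank_top, Module.finrank_fin_fun] at h1
  have h2 := finrank_inf_ker (S := LinearMap.ker (b • xi₁ - a • xi₂))
    (f := d • eta₁ - c • eta₂) (x := vec6 0 0 z' (-y'))
    (by simp [xi₁_vec6, xi₂_vec6]) (by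
      have : (d • eta₁ - c • eta₂) (vec6 0 0 z' (-y')) = 1 := by
        simp [eta₁_vec6, eta₂_vec6]
        linear_combination hyz'
      rw [this]
      exact one_ne_zero)
  omega

lemma mem_coordinatesA {a b c d : ℂ} {v : Fin 6 → ℂ} :
    v ∈ LinearMap.ker (b • xi₁ - a • xi₂) ⊓ LinearMap.ker (d • eta₁ - c • eta₂) ↔
      b * xi₁ v = a * xi₂ v ∧ d * eta₁ v = c * eta₂ v := by
  rw [Submodule.mem_inf, LinearMap.mem_ker, LinearMap.mem_ker]
  simp [sub_eq_zero]

lemma finrank_inf_coordinates {S : Submodule ℂ (Fin 6 → ℂ)} (h : ∀ x y, head6 x y ∈ S) :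
    dim ↥(S ⊓ LinearMap.ker (form ![1, 0, 0, 0, 0, 0]) ⊓
      LinearMap.ker (form ![0, 1, 0, 0, 0, 0])) + 2 = dim S := by
  have h1 := finrank_inf_ker (S := S) (f := form ![1, 0, 0, 0, 0, 0]) (x := head6 1 0) (h 1 0)
    (by simp [form_apply, Fin.sum_univ_six, head6])
  have h2 := finrank_inf_ker (S := S ⊓ LinearMap.ker (form ![1, 0, 0, 0, 0, 0]))
    (f := form ![0, 1, 0, 0, 0, 0]) (x := head6 0 1)
    ⟨h 0 1, by simp [form_apply, Fin.sum_univ_six, head6]⟩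
    (by simp [form_apply, Fin.sum_univ_six, head6])
  omega

lemma mem_inf_coordinates {S : Submodule ℂ (Fin 6 → ℂ)} {v : Fin 6 → ℂ} :
    v ∈ S ⊓ LinearMap.ker (form ![1, 0, 0, 0, 0, 0]) ⊓
      LinearMap.ker (form ![0, 1, 0, 0, 0, 0]) ↔ v ∈ S ∧ v 0 = 0 ∧ v 1 = 0 := by
  rw [Submodule.mem_inf, Submodule.mem_inf, LinearMap.mem_ker, LinearMap.mem_ker, form_apply,
    form_apply]
  simp [Fin.sum_univ_six, and_assoc]

lemma finrank_kapA {s a b : ℂ} (hs : s ≠ -1) (hab : a ≠ 0 ∨ b ≠ 0) :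
    dim ↥(LinearMap.ker (kap₂ s (vec6 a b 0 0) • kap₁ s - kap₁ s (vec6 a b 0 0) • kap₂ s)) = 5 := by
  obtain ⟨y, z, hyz⟩ := exists_dual (kap_ne_zero hs hab)
  have h1 := finrank_inf_ker (S := ⊤) (x := ![0, 0, 0, 0, z, s * z - y])
    (f := kap₂ s (vec6 a b 0 0) • kap₁ s - kap₁ s (vec6 a b 0 0) • kap₂ s)
    Submodule.mem_top (by
      have : (kap₂ s (vec6 a b 0 0) • kap₁ s - kap₁ s (vec6 a b 0 0) • kap₂ s)
          ![0, 0, 0, 0, z, s * z - y] = 1 := by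
        rw [LinearMap.sub_apply, LinearMap.smul_apply, LinearMap.smul_apply,
          kap₁_apply s ![0, 0, 0, 0, z, s * z - y], kap₂_apply s ![0, 0, 0, 0, z, s * z - y]]
        simp
        linear_combination hyz
      rw [this]
      exact one_ne_zero)
  rw [top_inf_eq, finrank_top, Module.finrank_fin_fun] at h1
  omega

lemma mem_kapA {s a b : ℂ} {v : Fin 6 → ℂ} :
    v ∈ LinearMap.ker (kap₂ s (vec6 a b 0 0) • kap₁ s - kap₁ s (vec6 a b 0 0) • kap₂ s) ↔
      kap₂ s (vec6 a b 0 0) * kap₁ s v = kap₁ s (vec6 a b 0 0) * kap₂ s v := by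
  rw [LinearMap.mem_ker]
  simp [sub_eq_zero]

/-- Vectors annihilated by `κ` lie in `⟨e₁,e₂,e₃⟩ + F₁(s)`. -/
lemma mem_of_kap_eq_zero {s : ℂ} (hs : s ≠ 0) {S : Submodule ℂ (Fin 6 → ℂ)}
    (h1 : osc 6 (0 : ℂ) 3 ≤ S)
    (h2 : osc 6 s 1 ≤ S) {v : Fin 6 → ℂ} (k1 : kap₁ s v = 0)
    (k2 : kap₂ s v = 0) : v ∈ S := by
  rw [kap₁_apply] at k1
  rw [kap₂_apply] at k2
  have hg : ![1, s, s^2, s^3, s^4, s^5] ∈ S := h2 (mem_osc_six_one.mpr (by simp))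
  have e : v = (v 3 / s^3) • ![1, s, s^2, s^3, s^4, s^5] +
      (v - (v 3 / s^3) • ![1, s, s^2, s^3, s^4, s^5]) := by abel
  rw [e]
  refine S.add_mem (S.smul_mem _ hg) (h1 (mem_osc_six_zero_three.mpr ⟨?_, ?_, ?_⟩))
  · simp
    field_simp
    ring
  · simp
    field_simp
    linear_combination k1
  · simp
    field_simp
    linear_combination k2 + s * k1

lemma lam_rel {t a b c d p q : ℂ} (ht : t ≠ -1) (hcd : c ≠ 0 ∨ d ≠ 0)
    (h2 : (p • vec6 a b 0 0 + q • vec6 0 0 c d) 2 = 0)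
    (hl : lam t (p • vec6 a b 0 0 + q • vec6 0 0 c d) = 0) {q₀ : ℂ}
    (k2 : vec6 a b 0 0 2 = -q₀ * vec6 0 0 c d 2)
    (kl : lam t (vec6 a b 0 0) = -q₀ * lam t (vec6 0 0 c d)) : q = p * q₀ := by
  rw [Pi.add_apply, Pi.smul_apply, Pi.smul_apply, smul_eq_mul, smul_eq_mul] at h2
  rw [_root_.map_add, _root_.map_smul, _root_.map_smul, smul_eq_mul, smul_eq_mul] at hl
  rcases lam_ne_zero ht hcd with h | h
  · exact mul_right_cancel₀ h (by linear_combination h2 - p * k2)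
  · exact mul_right_cancel₀ h (by linear_combination hl - p * kl)

/-- Every flag in the intersection is given by a solution of the equations. -/
lemma exists_isFlagA {E : PartialFlag typeA 6} {x : Fin 2 → ℂ} (hs : x 0 ≠ 0) (hs' : x 0 ≠ -1)
    (ht : x 1 ≠ -1) (hE : E ∈ intersection typeA condA (pointsAt pointsA x)) :
    ∃ a b c d, IsFlagA (x 0) (x 1) E a b c d ∧ EquationsA (x 0) (x 1) a b c d := by
  obtain ⟨k1, ⟨k2, k3⟩, ⟨k4, k5⟩, ⟨k6, k7⟩, k8⟩ := mem_intersection_A.mp hE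
  have f0 : dim (E.space 0) = 1 := E.finrank_eq 0
  have f1 : dim (E.space 1) = 2 := E.finrank_eq 1
  have f2 : dim (E.space 2) = 4 := E.finrank_eq 2
  have f3 : dim (E.space 3) = 5 := E.finrank_eq 3
  have hE01 : E.space 0 ≤ E.space 1 := E.monotone (by decide)
  have hE12 : E.space 1 ≤ E.space 2 := E.monotone (by decide)
  have hE23 : E.space 2 ≤ E.space 3 := E.monotone (by decide)
  have hE0 : ∀ v ∈ E.space 0, v 0 = 0 ∧ v 1 = 0 ∧ v 2 = 0 := fun v hv =>
    mem_osc_six_infty_three.mp (le_of_finrank_le_finrank_inf (by rw [f0]; exact k2) hv)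
  have hE0' : ∀ v ∈ E.space 0, lam (x 1) v = 0 := by
    intro v hv
    have := mem_osc_six_five.mp (le_of_finrank_le_finrank_inf (by rw [f0]; exact k1) hv)
    obtain ⟨e0, e1, e2⟩ := hE0 v hv
    rw [e0, e1] at this
    rw [lam_apply]
    linear_combination this
  have hE1 : ∀ v ∈ E.space 1, v 0 = 0 ∧ v 1 = 0 := fun v hv =>
    mem_osc_six_infty_four.mp (le_of_finrank_le_finrank_inf (by rw [f1]; exact k3) hv)
  have hhead : ∀ y z, head6 y z ∈ E.space 2 := fun y z =>
    k6 (mem_osc_six_zero_two.mpr ⟨rfl, rfl, rfl, rfl⟩)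
  have hmem1 : ∀ v, v ∈ E.space 1 ↔ v ∈ E.space 2 ∧ v 0 = 0 ∧ v 1 = 0 := by
    have := Submodule.eq_of_le_of_finrank_le (S₁ := E.space 1)
      (fun v hv => mem_inf_coordinates.mpr ⟨hE12 hv, hE1 v hv⟩)
      (by have := finrank_inf_coordinates hhead; omega)
    intro v
    rw [← mem_inf_coordinates, ← this]
  obtain ⟨m, ⟨hm, hm'⟩, hm0⟩ := exists_ne_zero_of_one_le_finrank k4
  obtain ⟨m0, m1⟩ := hE1 m hm
  obtain ⟨e4, e5⟩ := mem_osc_six_neg_one_four.mp hm'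
  have hmv : m = vec6 0 0 (eta₁ m) (eta₂ m) := by
    conv_lhs => rw [eq_head6_add_vec6 m, m0, m1]
    have x1 : xi₁ m = 0 := by
      rw [xi₁_apply]
      linear_combination -5*e4 + 4*e5 + m0
    have x2 : xi₂ m = 0 := by
      rw [xi₂_apply]
      linear_combination -4*e4 + 3*e5 + m0 + m1
    rw [x1, x2]
    ext i
    fin_cases i <;> simp [head6, vec6]
  set c := eta₁ m
  set d := eta₂ m
  have hcd : c ≠ 0 ∨ d ≠ 0 := by
    by_contra! h
    refine hm0 (hmv.trans ?_)
    rw [h.1, h.2]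
    ext i
    fin_cases i <;> simp [vec6]
  obtain ⟨f, ⟨hf, hf'⟩, hf0⟩ := exists_ne_zero_of_one_le_finrank k5
  obtain ⟨g2, g3, g4, g5⟩ := mem_osc_six_neg_one_two.mp hf'
  set a := f 0
  set b := f 0 + f 1 with hb
  have hfv : f = head6 (f 0) (f 1) + vec6 a b 0 0 := by
    ext i
    fin_cases i <;> simp [head6, vec6, g2, g3, g4, g5, a, b] <;> ring
  have hab : a ≠ 0 ∨ b ≠ 0 := by
    by_contra! h
    refine hf0 (hfv.trans ?_)
    have h1 : f 1 = 0 := by rw [hb] at h; linear_combination h.2 - h.1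
    have h0 : f 0 = 0 := h.1
    rw [h.1, h.2, h1, h0]
    ext i
    fin_cases i <;> simp [vec6, head6]
  have hl : vec6 a b 0 0 ∈ E.space 2 := by
    rw [hfv] at hf
    exact (Submodule.add_mem_iff_right _ (hhead _ _)).mp hf
  rw [hmv] at hm
  have hmem2 : ∀ v, v ∈ E.space 2 ↔ b * xi₁ v = a * xi₂ v ∧ d * eta₁ v = c * eta₂ v := by
    have := Submodule.eq_of_le_of_finrank_le (S₂ := E.space 2) (S₁ :=
      LinearMap.ker (b • xi₁ - a • xi₂) ⊓ LinearMap.ker (d • eta₁ - c • eta₂)) (by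
        intro v hv
        obtain ⟨h1, h2⟩ := mem_coordinatesA.mp hv
        obtain ⟨p, p1, p2⟩ := exists_mul_of_cross hab h1
        obtain ⟨q, q1, q2⟩ := exists_mul_of_cross hcd h2
        rw [eq_head6_add_vec6 v, p1, p2, q1, q2, vec6_combination]
        exact add_mem (hhead _ _) (add_mem (Submodule.smul_mem _ _ hl)
          (Submodule.smul_mem _ _ (hE12 hm)))) (by rw [f2, finrank_coordinatesA hab hcd])
    intro v
    rw [← this, mem_coordinatesA]
  have hmem3 : ∀ v, v ∈ E.space 3 ↔
      kap₂ (x 0) (vec6 a b 0 0) * kap₁ (x 0) v = kap₁ (x 0) (vec6 a b 0 0) * kap₂ (x 0) v := by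
    have := Submodule.eq_of_le_of_finrank_le (S₂ := E.space 3)
      (S₁ := LinearMap.ker (kap₂ (x 0) (vec6 a b 0 0) • kap₁ (x 0) -
        kap₁ (x 0) (vec6 a b 0 0) • kap₂ (x 0))) (by
        intro v hv
        obtain ⟨p, p1, p2⟩ := exists_mul_of_cross (kap_ne_zero hs' hab) (mem_kapA.mp hv)
        have h1 := mem_of_kap_eq_zero hs k7 k8 (v := v - p • vec6 a b 0 0)
          (by rw [_root_.map_sub, _root_.map_smul, p1, smul_eq_mul, sub_self])
          (by rw [_root_.map_sub, _root_.map_smul, p2, smul_eq_mul, sub_self])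
        have := add_mem h1 ((E.space 3).smul_mem p (hE23 hl))
        rwa [sub_add_cancel] at this) (by rw [f3, finrank_kapA hs' hab])
    intro v
    rw [← this, mem_kapA]
  have hkap : kapWedge (x 0) (vec6 a b 0 0) (vec6 0 0 c d) = 0 := by
    have := (hmem3 _).mp (hE23 (hE12 hm))
    rw [kapWedge]
    linear_combination -this
  obtain ⟨v, hv, hv0⟩ := exists_ne_zero_of_one_le_finrank (S := E.space 0) (by rw [f0])
  obtain ⟨v0, v1, v2⟩ := hE0 v hv
  have vl := hE0' v hv
  obtain ⟨h1, h2⟩ := (hmem2 v).mp (hE12 (hE01 hv))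
  obtain ⟨p, p1, p2⟩ := exists_mul_of_cross hab h1
  obtain ⟨q, q1, q2⟩ := exists_mul_of_cross hcd h2
  have hvv : v = p • vec6 a b 0 0 + q • vec6 0 0 c d := by
    conv_lhs => rw [eq_head6_add_vec6 v, p1, p2, q1, q2, vec6_combination, v0, v1]
    ext i
    fin_cases i <;> simp [head6]
  have w2 := v2
  have wl := vl
  rw [hvv, Pi.add_apply, Pi.smul_apply, Pi.smul_apply, smul_eq_mul, smul_eq_mul] at w2
  rw [hvv, _root_.map_add, _root_.map_smul, _root_.map_smul, smul_eq_mul, smul_eq_mul] at wl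
  have hp : p ≠ 0 := by
    rintro rfl
    have : q = 0 := by
      rcases lam_ne_zero ht hcd with h | h
      · exact (mul_eq_zero.mp (by linear_combination w2)).resolve_right h
      · exact (mul_eq_zero.mp (by linear_combination wl)).resolve_right h
    rw [this, zero_smul, zero_smul, add_zero] at hvv
    exact hv0 hvv
  have hlam : lamWedge (x 1) (vec6 a b 0 0) (vec6 0 0 c d) = 0 := by
    rw [lamWedge]
    exact (mul_eq_zero.mp (by
      linear_combination lam (x 1) (vec6 0 0 c d) * w2 - vec6 0 0 c d 2*wl)).resolve_left hp
  refine ⟨a, b, c, d, ⟨hab, hcd, hmem2, hmem1, fun w => ⟨fun hw => ⟨hE01 hw, (hE0 w hw).2.2,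
    hE0' w hw⟩, fun ⟨hw, hw2, hwl⟩ => ?_⟩, hmem3⟩, hlam, hkap⟩
  obtain ⟨h1, h2⟩ := (hmem2 w).mp (hE12 hw)
  obtain ⟨r, r1, r2⟩ := exists_mul_of_cross hab h1
  obtain ⟨r', r1', r2'⟩ := exists_mul_of_cross hcd h2
  have hww : w = r • vec6 a b 0 0 + r' • vec6 0 0 c d := by
    conv_lhs => rw [eq_head6_add_vec6 w, r1, r2, r1', r2', vec6_combination, (hE1 w hw).1,
      (hE1 w hw).2]
    ext i
    fin_cases i <;> simp [head6]
  have : r' = r * (q / p) := lam_rel ht hcd (hww ▸ hw2) (hww ▸ hwl)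
    (by field_simp; linear_combination w2) (by field_simp; linear_combination wl)
  have hwv : w = (r / p) • v := by
    rw [hww, hvv, this, smul_add, smul_smul, smul_smul]
    congr 2
    · field_simp
    · ring
  rw [hwv]
  exact (E.space 0).smul_mem _ hv

end ProblemA

section TangentA

variable {E : PartialFlag typeA 6} {x : Fin 2 → ℂ} {s t a b c d : ℂ}
  {ψ : Module.End ℂ (Fin 6 → ℂ)}

/-- The combination of the two basis vectors annihilated by `λ`. -/
lemma exists_lam_eq (ht : t ≠ -1) (hcd : c ≠ 0 ∨ d ≠ 0) {w : Fin 6 → ℂ}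
    (h : lamWedge t w (vec6 0 0 c d) = 0) :
    ∃ q, w 2 = -q * vec6 0 0 c d 2 ∧ lam t w = -q * lam t (vec6 0 0 c d) := by
  obtain ⟨q, q1, q2⟩ := exists_mul_of_cross (lam_ne_zero ht hcd) (x := w 2) (y := lam t w)
    (by rw [lamWedge] at h; linear_combination h)
  exact ⟨-q, by rw [q1, neg_neg], by rw [q2, neg_neg]⟩

/-- The combination of the two basis vectors annihilated by `κ`. -/
lemma exists_kap_eq (hs : s ≠ -1) (hab : a ≠ 0 ∨ b ≠ 0) {w : Fin 6 → ℂ}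
    (h : kapWedge s (vec6 a b 0 0) w = 0) :
    ∃ q, kap₁ s w = q * kap₁ s (vec6 a b 0 0) ∧ kap₂ s w = q * kap₂ s (vec6 a b 0 0) :=
  exists_mul_of_cross (kap_ne_zero hs hab) (by rw [kapWedge] at h; linear_combination -h)

/-- Every solution of the equations defines a flag in the intersection. -/
lemma exists_flag_of_equationsA (hs' : x 0 ≠ -1) (ht : x 1 ≠ -1)
    (hab : a ≠ 0 ∨ b ≠ 0) (hcd : c ≠ 0 ∨ d ≠ 0) (heq : EquationsA (x 0) (x 1) a b c d) :
    ∃ E ∈ intersection typeA condA (pointsAt pointsA x), IsFlagA (x 0) (x 1) E a b c d := by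
  obtain ⟨q, q2, ql⟩ := exists_lam_eq ht hcd heq.1
  set e := vec6 a b 0 0 + q • vec6 0 0 c d with he
  set S₂ := LinearMap.ker (b • xi₁ - a • xi₂) ⊓ LinearMap.ker (d • eta₁ - c • eta₂) with hS₂
  set S₁ := S₂ ⊓ LinearMap.ker (form ![1, 0, 0, 0, 0, 0]) ⊓
    LinearMap.ker (form ![0, 1, 0, 0, 0, 0]) with hS₁
  set S₃ := LinearMap.ker (kap₂ (x 0) (vec6 a b 0 0) • kap₁ (x 0) -
    kap₁ (x 0) (vec6 a b 0 0) • kap₂ (x 0)) with hS₃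
  have hmem2 : ∀ v, v ∈ S₂ ↔ b * xi₁ v = a * xi₂ v ∧ d * eta₁ v = c * eta₂ v :=
    fun v => mem_coordinatesA
  have hmem1 : ∀ v, v ∈ S₁ ↔ v ∈ S₂ ∧ v 0 = 0 ∧ v 1 = 0 := fun v => mem_inf_coordinates
  have hhead : ∀ y z, head6 y z ∈ S₂ := fun y z => (hmem2 _).mpr (by
    simp [xi₁_head6, xi₂_head6, eta₁_head6, eta₂_head6])
  have hf2 : dim S₂ = 4 := finrank_coordinatesA hab hcd
  have hf1 : dim S₁ = 2 := by
    have : dim S₁ + 2 = dim S₂ := finrank_inf_coordinates hhead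
    omega
  have hl : vec6 a b 0 0 ∈ S₁ := (hmem1 _).mpr ⟨(hmem2 _).mpr (by
    simp [xi₁_vec6, xi₂_vec6, eta₁_vec6, eta₂_vec6, mul_comm]), rfl, rfl⟩
  have hm : vec6 0 0 c d ∈ S₁ := (hmem1 _).mpr ⟨(hmem2 _).mpr (by
    simp [xi₁_vec6, xi₂_vec6, eta₁_vec6, eta₂_vec6, mul_comm]), rfl, rfl⟩
  have heS : e ∈ S₁ := S₁.add_mem hl (S₁.smul_mem _ hm)
  have hexp : ∀ v ∈ S₂, ∃ p r : ℂ, v = head6 (v 0) (v 1) + (p • vec6 a b 0 0 + r • vec6 0 0 c d) := by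
    intro v hv
    obtain ⟨h1, h2⟩ := (hmem2 v).mp hv
    obtain ⟨p, p1, p2⟩ := exists_mul_of_cross hab h1
    obtain ⟨r, r1, r2⟩ := exists_mul_of_cross hcd h2
    refine ⟨p, r, ?_⟩
    conv_lhs => rw [eq_head6_add_vec6 v, p1, p2, r1, r2, vec6_combination]
  have he2 : e 2 = 0 := by
    rw [he, Pi.add_apply, Pi.smul_apply, smul_eq_mul, q2]
    ring
  have hel : lam (x 1) e = 0 := by
    rw [he, _root_.map_add, _root_.map_smul, smul_eq_mul, ql]
    ring
  have he0 : e ≠ 0 := by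
    intro h
    have h1 := congrArg xi₁ h
    have h2 := congrArg xi₂ h
    rw [he, _root_.map_add, _root_.map_smul, xi₁_vec6, xi₁_vec6, _root_.map_zero, smul_zero,
      add_zero] at h1
    rw [he, _root_.map_add, _root_.map_smul, xi₂_vec6, xi₂_vec6, _root_.map_zero, smul_zero,
      add_zero] at h2
    exact hab.elim (fun h => h h1) fun h => h h2
  have hmem0 : ∀ v, v ∈ Submodule.span ℂ {e} ↔ v ∈ S₁ ∧ v 2 = 0 ∧ lam (x 1) v = 0 := by
    intro v
    rw [Submodule.mem_span_singleton]
    constructor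
    · rintro ⟨p, rfl⟩
      exact ⟨S₁.smul_mem _ heS, by rw [Pi.smul_apply, he2, smul_zero],
        by rw [_root_.map_smul, hel, smul_zero]⟩
    · rintro ⟨hv, v2, vl⟩
      obtain ⟨h2, v0, v1⟩ := (hmem1 v).mp hv
      obtain ⟨p, r, hpr⟩ := hexp v h2
      have hz : head6 (v 0) (v 1) = 0 := by
        ext i
        fin_cases i <;> simp [head6, v0, v1]
      rw [hz, zero_add] at hpr
      rw [hpr] at v2 vl
      have := lam_rel ht hcd v2 vl q2 ql
      exact ⟨p, by rw [hpr, this, he, smul_add, smul_smul]⟩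
  have hmem3 : ∀ v, v ∈ S₃ ↔ kap₂ (x 0) (vec6 a b 0 0) * kap₁ (x 0) v =
      kap₁ (x 0) (vec6 a b 0 0) * kap₂ (x 0) v := fun v => mem_kapA
  have h01 : Submodule.span ℂ {e} ≤ S₁ := (Submodule.span_singleton_le_iff_mem _ _).mpr heS
  have h12 : S₁ ≤ S₂ := fun v hv => ((hmem1 v).mp hv).1
  have h23 : S₂ ≤ S₃ := by
    intro v hv
    obtain ⟨p, r, hpr⟩ := hexp v hv
    have h2 := heq.2
    rw [kapWedge] at h2
    rw [hmem3, hpr]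
    simp only [_root_.map_add, _root_.map_smul, kap₁_head6, kap₂_head6, smul_eq_mul]
    linear_combination -r * h2
  let E : PartialFlag typeA 6 :=
    { space := ![Submodule.span ℂ {e}, S₁, S₂, S₃]
      monotone := by
        refine Fin.monotone_iff_le_succ.mpr fun i => ?_
        fin_cases i
        exacts [h01, h12, h23]
      finrank_eq := by
        intro i
        fin_cases i
        exacts [finrank_span_singleton he0, hf1, hf2, finrank_kapA hs' hab] }
  have hes : e ∈ Submodule.span ℂ {e} := Submodule.mem_span_singleton_self e
  have e00 : e 0 = 0 := ((hmem1 _).mp heS).2.1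
  have e01 : e 1 = 0 := ((hmem1 _).mp heS).2.2
  refine ⟨E, mem_intersection_A.mpr ⟨?_, ⟨?_, ?_⟩, ⟨?_, ?_⟩, ⟨?_, ?_⟩, ?_⟩,
    hab, hcd, hmem2, hmem1, hmem0, hmem3⟩
  · refine one_le_finrank_of_mem ⟨hes, mem_osc_six_five.mpr ?_⟩ he0
    rw [lam_apply] at hel
    rw [e00, e01]
    linear_combination hel
  · exact one_le_finrank_of_mem ⟨hes, mem_osc_six_infty_three.mpr ⟨e00, e01, he2⟩⟩ he0
  · have : S₁ ⊓ osc 6 ∞ 4 = S₁ :=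
      inf_eq_left.mpr fun v hv => mem_osc_six_infty_four.mpr ((hmem1 v).mp hv).2
    change 2 ≤ dim ↥(S₁ ⊓ osc 6 ∞ 4)
    rw [this, hf1]
  · refine one_le_finrank_of_mem ⟨hm, mem_osc_six_neg_one_four.mpr ?_⟩ fun h => ?_
    · simp [vec6]
      ring
    · have h1 := congrArg eta₁ h
      have h2 := congrArg eta₂ h
      rw [eta₁_vec6, _root_.map_zero] at h1
      rw [eta₂_vec6, _root_.map_zero] at h2
      exact hcd.elim (fun h => h h1) fun h => h h2
  · refine one_le_finrank_of_mem (v := head6 a (b - a) + vec6 a b 0 0)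
      ⟨S₂.add_mem (hhead _ _) (h12 hl), mem_osc_six_neg_one_two.mpr ?_⟩ fun h => ?_
    · simp [vec6, head6]
      refine ⟨?_, ?_, ?_, ?_⟩ <;> ring
    · have h1 := congrFun h 0
      have h2 := congrFun h 1
      simp [head6, vec6] at h1 h2
      exact hab.elim (fun h => h h1) fun h => h (by linear_combination h2 + h1)
  · intro v hv
    obtain ⟨v2, v3, v4, v5⟩ := mem_osc_six_zero_two.mp hv
    refine (hmem2 v).mpr ?_
    simp [xi₁_apply, xi₂_apply, eta₁_apply, eta₂_apply, v2, v3, v4, v5]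
  · intro v hv
    obtain ⟨v3, v4, v5⟩ := mem_osc_six_zero_three.mp hv
    refine (hmem3 v).mpr ?_
    rw [kap₁_apply _ v, kap₂_apply _ v, v3, v4, v5]
    ring
  · intro v hv
    obtain ⟨v1, v2, v3, v4, v5⟩ := mem_osc_six_one.mp hv
    refine (hmem3 v).mpr ?_
    rw [kap₁_apply _ v, kap₂_apply _ v, v3, v4, v5]
    ring

/-- The linearised equations. -/
def LinearisedA (s t a b c d a' b' c' d' : ℂ) : Prop :=
  lamWedge t (vec6 a' b' 0 0) (vec6 0 0 c d) + lamWedge t (vec6 a b 0 0) (vec6 0 0 c' d') = 0 ∧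
    kapWedge s (vec6 a' b' 0 0) (vec6 0 0 c d) + kapWedge s (vec6 a b 0 0) (vec6 0 0 c' d') = 0

namespace IsFlagA

lemma exists_eq (h : IsFlagA s t E a b c d) {v : Fin 6 → ℂ} (hv : v ∈ E.space 2) :
    ∃ p q : ℂ, v = head6 (v 0) (v 1) + (p • vec6 a b 0 0 + q • vec6 0 0 c d) := by
  obtain ⟨h1, h2⟩ := (h.mem_two v).mp hv
  obtain ⟨p, p1, p2⟩ := exists_mul_of_cross h.ab h1
  obtain ⟨q, q1, q2⟩ := exists_mul_of_cross h.cd h2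
  refine ⟨p, q, ?_⟩
  conv_lhs => rw [eq_head6_add_vec6 v, p1, p2, q1, q2, vec6_combination]

lemma exists_eq' (h : IsFlagA s t E a b c d) {v : Fin 6 → ℂ} (hv : v ∈ E.space 1) :
    ∃ p q : ℂ, v = p • vec6 a b 0 0 + q • vec6 0 0 c d := by
  obtain ⟨h1, h2, h3⟩ := (h.mem_one v).mp hv
  obtain ⟨p, q, hpq⟩ := h.exists_eq h1
  have : head6 (v 0) (v 1) = 0 := by
    ext i
    fin_cases i <;> simp [head6, h2, h3]
  exact ⟨p, q, by rwa [this, zero_add] at hpq⟩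

lemma head_mem (h : IsFlagA s t E a b c d) (y z : ℂ) : head6 y z ∈ E.space 2 :=
  (h.mem_two _).mpr (by simp [xi₁_head6, xi₂_head6, eta₁_head6, eta₂_head6])

lemma fst_mem (h : IsFlagA s t E a b c d) : vec6 a b 0 0 ∈ E.space 1 :=
  (h.mem_one _).mpr ⟨(h.mem_two _).mpr (by
    simp [xi₁_vec6, xi₂_vec6, eta₁_vec6, eta₂_vec6, mul_comm]), rfl, rfl⟩

lemma snd_mem (h : IsFlagA s t E a b c d) : vec6 0 0 c d ∈ E.space 1 :=
  (h.mem_one _).mpr ⟨(h.mem_two _).mpr (by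
    simp [xi₁_vec6, xi₂_vec6, eta₁_vec6, eta₂_vec6, mul_comm]), rfl, rfl⟩

lemma eq_smul_of_mem_osc_four (h : IsFlagA s t E a b c d) {v : Fin 6 → ℂ} (hv : v ∈ E.space 1)
    (hv' : v ∈ osc 6 (-1 : ℂ) 4) : ∃ q : ℂ, v = q • vec6 0 0 c d := by
  obtain ⟨p, q, rfl⟩ := h.exists_eq' hv
  obtain ⟨e4, e5⟩ := mem_osc_six_neg_one_four.mp hv'
  simp [vec6] at e4 e5
  have hb : p * b = 0 := by linear_combination -4*e4 + 3*e5
  have ha : p * a = 0 := by linear_combination -5*e4 + 4*e5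
  have hp : p = 0 := by
    rcases h.ab with h | h
    · exact (mul_eq_zero.mp ha).resolve_right h
    · exact (mul_eq_zero.mp hb).resolve_right h
  exact ⟨q, by rw [hp, zero_smul, zero_add]⟩

lemma eq_smul_of_mem_osc_two (h : IsFlagA s t E a b c d) {v : Fin 6 → ℂ} (hv : v ∈ E.space 2)
    (hv' : v ∈ osc 6 (-1 : ℂ) 2) : ∃ p : ℂ, v = p • (head6 a (b - a) + vec6 a b 0 0) := by
  obtain ⟨h1, -⟩ := (h.mem_two v).mp hv
  obtain ⟨p, p1, p2⟩ := exists_mul_of_cross h.ab h1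
  obtain ⟨e2, e3, e4, e5⟩ := mem_osc_six_neg_one_two.mp hv'
  rw [xi₁_apply, e2, e3, e4, e5] at p1
  rw [xi₂_apply, e2, e3, e4, e5] at p2
  have h0 : v 0 = p * a := by linear_combination p1
  have h1 : v 1 = p * b - p * a := by linear_combination p2 - p1
  refine ⟨p, ?_⟩
  ext i
  fin_cases i <;> simp [head6, vec6, e2, e3, e4, e5, h0, h1] <;> ring

end IsFlagA

/-- A tangent vector yields a solution of the linearised equations, and is zero if this solution
is trivial. -/
lemma exists_linearisedA (hs : x 0 ≠ 0) (hs' : x 0 ≠ -1) (ht : x 1 ≠ -1)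
    (hE : E ∈ intersection typeA condA (pointsAt pointsA x))
    (h : IsFlagA (x 0) (x 1) E a b c d) (heq : EquationsA (x 0) (x 1) a b c d)
    (hψ : ∀ l, IsTangent typeA (condA l) (pointsAt pointsA x l) E ψ) :
    ∃ a' b' c' d', LinearisedA (x 0) (x 1) a b c d a' b' c' d' ∧
      (b * a' = a * b' → d * c' = c * d' → ∀ i, (E.space i).map ψ ≤ E.space i) := by
  obtain ⟨k1, ⟨k2, k3⟩, ⟨k4, k5⟩, ⟨k6, k7⟩, k8⟩ := mem_intersection_A.mp hE
  rw [pointsAt_A] at hψ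
  have t0 : IsTangent typeA (condA 0) (x 1 : OnePoint ℂ) E ψ := hψ 0
  have t1 : IsTangent typeA (condA 1) ∞ E ψ := hψ 1
  have t2 : IsTangent typeA (condA 2) (-1 : ℂ) E ψ := hψ 2
  have t3 : IsTangent typeA (condA 3) (0 : ℂ) E ψ := hψ 3
  have t4 : IsTangent typeA (condA 4) (x 0 : OnePoint ℂ) E ψ := hψ 4
  have hE01 : E.space 0 ≤ E.space 1 := E.monotone (by decide)
  have hE12 : E.space 1 ≤ E.space 2 := E.monotone (by decide)
  have hE23 : E.space 2 ≤ E.space 3 := E.monotone (by decide)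
  have f0 : dim (E.space 0) = 1 := E.finrank_eq 0
  have f1 : dim (E.space 1) = 2 := E.finrank_eq 1
  have g0 : E.space 0 ≤ osc 6 ∞ 3 := le_of_finrank_le_finrank_inf (by rwa [f0])
  have g0' : E.space 0 ≤ osc 6 (x 1) 5 :=
    le_of_finrank_le_finrank_inf (by rwa [f0])
  have g1 : E.space 1 ≤ osc 6 ∞ 4 := le_of_finrank_le_finrank_inf (by rwa [f1])
  have m0 : ∀ v ∈ E.space 0, ψ v 0 = 0 ∧ ψ v 1 = 0 ∧ ψ v 2 = 0 := by
    intro v hv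
    have := IsTangent.map_le (hv := by decide) (hinj := by decide) t1 0 (j := 3) (by norm_num)
      (by rw [inf_eq_left.mpr g0]; exact f0) hv (g0 hv)
    rw [sup_eq_right.mpr g0] at this
    exact mem_osc_six_infty_three.mp this
  have m0' : ∀ v ∈ E.space 0, lam (x 1) (ψ v) = 0 := by
    intro v hv
    have := IsTangent.map_le (hv := by decide) (hinj := by decide) t0 0 (j := 5) (by norm_num)
      (by rw [inf_eq_left.mpr g0']; exact f0) hv (g0' hv)
    rw [sup_eq_right.mpr g0', mem_osc_six_five] at this
    obtain ⟨e0, e1, e2⟩ := m0 v hv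
    rw [e0, e1] at this
    rw [lam_apply]
    linear_combination this
  have m1 : ∀ v ∈ E.space 1, ψ v 0 = 0 ∧ ψ v 1 = 0 := by
    intro v hv
    have := IsTangent.map_le (hv := by decide) (hinj := by decide) t1 1 (j := 4) (by norm_num)
      (by rw [inf_eq_left.mpr g1]; exact f1) hv (g1 hv)
    rw [sup_eq_right.mpr g1] at this
    exact mem_osc_six_infty_four.mp this
  have mh : ∀ y z, ψ (head6 y z) ∈ E.space 2 := by
    intro y z
    have hm : head6 y z ∈ osc 6 (0 : ℂ) 2 :=
      mem_osc_six_zero_two.mpr ⟨rfl, rfl, rfl, rfl⟩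
    have := IsTangent.map_le (hv := by decide) (hinj := by decide) t3 2 (j := 2) (by norm_num)
      (by rw [inf_eq_right.mpr k6]; exact finrank_osculatingSpace _ (by norm_num)) (k6 hm) hm
    rwa [sup_eq_left.mpr k6] at this
  have mh3 : osc 6 (0 : ℂ) 3 ≤ (E.space 3).comap ψ := by
    intro v hv
    have := IsTangent.map_le (hv := by decide) (hinj := by decide) t3 3 (j := 3) (by norm_num)
      (by rw [inf_eq_right.mpr k7]; exact finrank_osculatingSpace _ (by norm_num)) (k7 hv) hv
    rwa [sup_eq_left.mpr k7] at this
  have mγ : osc 6 (x 0) 1 ≤ (E.space 3).comap ψ := by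
    intro v hv
    have := IsTangent.map_le (hv := by decide) (hinj := by decide) t4 3 (j := 1) (by norm_num)
      (by rw [inf_eq_right.mpr k8]; exact finrank_osculatingSpace _ (by norm_num)) (k8 hv) hv
    rwa [sup_eq_left.mpr k8] at this
  have mm := IsTangent.map_le (hv := by decide) (hinj := by decide) t2 1 (j := 4) (by norm_num)
    (le_antisymm (finrank_le_one_of_smul _ fun v hv => h.eq_smul_of_mem_osc_four hv.1 hv.2) k4)
    h.snd_mem (by rw [mem_osc_six_neg_one_four]; simp [vec6]; ring)
  obtain ⟨r, hr1, hr2⟩ : ∃ r, xi₁ (ψ (vec6 0 0 c d)) = r * a ∧ xi₂ (ψ (vec6 0 0 c d)) = r * b := by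
    obtain ⟨e, he, g, hg, heg⟩ := Submodule.mem_sup.mp mm
    obtain ⟨p0, p1⟩ := m1 _ h.snd_mem
    obtain ⟨he2, e0, e1⟩ := (h.mem_one e).mp he
    rw [← heg, Pi.add_apply, e0, zero_add] at p0
    rw [← heg, Pi.add_apply, e1, zero_add] at p1
    obtain ⟨g4, g5⟩ := mem_osc_six_neg_one_four.mp hg
    rw [p0, p1] at g4 g5
    have x1 : xi₁ g = 0 := by rw [xi₁_apply]; linear_combination -5*g4 + 4*g5
    have x2 : xi₂ g = 0 := by rw [xi₂_apply]; linear_combination -4*g4 + 3*g5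
    rw [← heg, _root_.map_add, _root_.map_add, x1, x2, add_zero, add_zero]
    exact exists_mul_of_cross h.ab ((h.mem_two e).mp he2).1
  have mf := IsTangent.map_le (hv := by decide) (hinj := by decide) t2 2 (j := 2) (by norm_num)
    (le_antisymm (finrank_le_one_of_smul _ fun v hv => h.eq_smul_of_mem_osc_two hv.1 hv.2) k5)
    (x := head6 a (b - a) + vec6 a b 0 0) (add_mem (h.head_mem _ _) (hE12 h.fst_mem)) (by
      rw [mem_osc_six_neg_one_two]
      simp [vec6, head6]
      refine ⟨?_, ?_, ?_, ?_⟩ <;> ring)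
  obtain ⟨r', hr1', hr2'⟩ : ∃ r', eta₁ (ψ (vec6 a b 0 0)) = r' * c ∧
      eta₂ (ψ (vec6 a b 0 0)) = r' * d := by
    obtain ⟨e, he, g, hg, heg⟩ := Submodule.mem_sup.mp mf
    obtain ⟨g2, g3, g4, g5⟩ := mem_osc_six_neg_one_two.mp hg
    have y1 : eta₁ g = 0 := by rw [eta₁_apply, g2, g3, g4, g5]; ring
    have y2 : eta₂ g = 0 := by rw [eta₂_apply, g2, g3, g4, g5]; ring
    have h1 := ((h.mem_two e).mp he).2
    have h2 := ((h.mem_two _).mp (mh a (b - a))).2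
    have h3 := congrArg eta₁ heg
    have h4 := congrArg eta₂ heg
    simp only [_root_.map_add, y1, y2] at h3 h4
    exact exists_mul_of_cross h.cd (by linear_combination h1 - h2 - d * h3 + c * h4)
  set a' := xi₁ (ψ (vec6 a b 0 0)) with ha'
  set b' := xi₂ (ψ (vec6 a b 0 0)) with hb'
  set c' := eta₁ (ψ (vec6 0 0 c d)) with hc'
  set d' := eta₂ (ψ (vec6 0 0 c d)) with hd'
  have hz : head6 0 0 = 0 := by ext i; fin_cases i <;> rfl
  have hadd : ∀ a b c d : ℂ, vec6 a b c d = vec6 a b 0 0 + vec6 0 0 c d := by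
    intro a b c d
    ext i
    fin_cases i <;> simp [vec6]
    all_goals ring
  have hψl : ψ (vec6 a b 0 0) = vec6 a' b' 0 0 + r' • vec6 0 0 c d := by
    obtain ⟨p0, p1⟩ := m1 _ h.fst_mem
    rw [eq_head6_add_vec6 (ψ (vec6 a b 0 0)), p0, p1, hr1', hr2', hz, zero_add]
    simpa using vec6_combination 1 r' a' b' c d
  have hψm : ψ (vec6 0 0 c d) = r • vec6 a b 0 0 + vec6 0 0 c' d' := by
    obtain ⟨p0, p1⟩ := m1 _ h.snd_mem
    rw [eq_head6_add_vec6 (ψ (vec6 0 0 c d)), p0, p1, hr1, hr2, hz, zero_add]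
    simpa using vec6_combination r 1 a b c' d'
  obtain ⟨q, q2, ql⟩ := exists_lam_eq ht h.cd heq.1
  obtain ⟨q', q1', q2'⟩ := exists_kap_eq hs' h.ab heq.2
  have he : vec6 a b 0 0 + q • vec6 0 0 c d ∈ E.space 0 :=
    (h.mem_zero _).mpr ⟨add_mem h.fst_mem ((E.space 1).smul_mem _ h.snd_mem), by
      rw [Pi.add_apply, Pi.smul_apply, smul_eq_mul, q2]; ring, by
      rw [_root_.map_add, _root_.map_smul, smul_eq_mul, ql]; ring⟩
  have ψe2 := (m0 _ he).2.2
  have ψel := m0' _ he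
  have hf : ψ (vec6 0 0 c d - q' • vec6 a b 0 0) ∈ E.space 3 :=
    mem_of_kap_eq_zero hs mh3 mγ
      (by rw [_root_.map_sub, _root_.map_smul, q1', smul_eq_mul, sub_self])
      (by rw [_root_.map_sub, _root_.map_smul, q2', smul_eq_mul, sub_self])
  have ψf := (h.mem_three _).mp hf
  have hwl := heq.1
  have hwk := heq.2
  rw [lamWedge] at hwl
  rw [kapWedge] at hwk
  refine ⟨a', b', c', d', ⟨?_, ?_⟩, fun h1 h2 => ?_⟩
  · rw [lamWedge, lamWedge]
    rw [_root_.map_add, _root_.map_smul, hψl, hψm] at ψe2 ψel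
    simp only [Pi.add_apply, Pi.smul_apply, smul_eq_mul] at ψe2
    simp only [_root_.map_add, _root_.map_smul, smul_eq_mul] at ψel
    linear_combination lam (x 1) (vec6 0 0 c d) * ψe2 - vec6 0 0 c d 2 * ψel - q * r * hwl +
      lam (x 1) (vec6 0 0 c' d') * q2 - vec6 0 0 c' d' 2*ql
  · rw [kapWedge, kapWedge]
    rw [_root_.map_sub, _root_.map_smul, hψl, hψm] at ψf
    simp only [_root_.map_add, _root_.map_sub, _root_.map_smul, smul_eq_mul] at ψf
    linear_combination -ψf + kap₁ (x 0) (vec6 a' b' 0 0) * q2' -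
      kap₂ (x 0) (vec6 a' b' 0 0) * q1' + q' * r' * hwk
  · obtain ⟨α, ha, hb⟩ := exists_mul_of_cross h.ab h1
    obtain ⟨β, hc, hd⟩ := exists_mul_of_cross h.cd h2
    have v1 : vec6 a' b' 0 0 = α • vec6 a b 0 0 := by
      rw [ha, hb]
      simpa [vec6] using vec6_combination α 0 a b 0 0
    have v2 : vec6 0 0 c' d' = β • vec6 0 0 c d := by
      rw [hc, hd]
      simpa [vec6] using vec6_combination 0 β 0 0 c d
    have pl : ψ (vec6 a b 0 0) ∈ E.space 1 := by
      rw [hψl, v1]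
      exact add_mem (Submodule.smul_mem _ _ h.fst_mem) (Submodule.smul_mem _ _ h.snd_mem)
    have pm : ψ (vec6 0 0 c d) ∈ E.space 1 := by
      rw [hψm, v2]
      exact add_mem (Submodule.smul_mem _ _ h.fst_mem) (Submodule.smul_mem _ _ h.snd_mem)
    have p1 : ∀ v ∈ E.space 1, ψ v ∈ E.space 1 := by
      intro v hv
      obtain ⟨p, q, rfl⟩ := h.exists_eq' hv
      rw [_root_.map_add, _root_.map_smul, _root_.map_smul]
      exact add_mem (Submodule.smul_mem _ _ pl) (Submodule.smul_mem _ _ pm)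
    have p2 : ∀ v ∈ E.space 2, ψ v ∈ E.space 2 := by
      intro v hv
      obtain ⟨p, q, hpq⟩ := h.exists_eq hv
      rw [hpq, _root_.map_add, _root_.map_add, _root_.map_smul, _root_.map_smul]
      exact add_mem (mh _ _) (hE12 (add_mem (Submodule.smul_mem _ _ pl) (Submodule.smul_mem _ _ pm)))
    have p3 : ∀ v ∈ E.space 3, ψ v ∈ E.space 3 := by
      intro v hv
      obtain ⟨p, p1, p2⟩ := exists_mul_of_cross (kap_ne_zero hs' h.ab) ((h.mem_three v).mp hv)
      have h1 : ψ (v - p • vec6 a b 0 0) ∈ E.space 3 := mem_of_kap_eq_zero hs mh3 mγ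
        (by rw [_root_.map_sub, _root_.map_smul, p1, smul_eq_mul, sub_self])
        (by rw [_root_.map_sub, _root_.map_smul, p2, smul_eq_mul, sub_self])
      have := add_mem h1 ((E.space 3).smul_mem p (hE23 (hE12 pl)))
      rwa [← _root_.map_smul, ← _root_.map_add, sub_add_cancel] at this
    intro i
    refine Submodule.map_le_iff_le_comap.mpr fun v hv => ?_
    fin_cases i
    · exact (h.mem_zero _).mpr ⟨p1 v (hE01 hv), (m0 v hv).2.2, m0' v hv⟩
    · exact p1 v hv
    · exact p2 v hv
    · exact p3 v hv

end TangentA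

section TransversalityA

variable {E : PartialFlag typeA 6} {x : Fin 2 → ℂ} {s t a b c d : ℂ}

lemma IsFlagA.mem_three' (h : IsFlagA s t E a b c d) (v : Fin 6 → ℂ) :
    v ∈ E.space 3 ↔ kapWedge s (vec6 a b 0 0) v = 0 := by
  rw [h.mem_three, kapWedge]
  constructor <;> intro h <;> linear_combination -h

lemma kapWedge_add (s : ℂ) (u v w : Fin 6 → ℂ) :
    kapWedge s u (v + w) = kapWedge s u v + kapWedge s u w := by
  simp only [kapWedge, _root_.map_add]; ring

lemma kapWedge_smul (s p : ℂ) (u v : Fin 6 → ℂ) : kapWedge s u (p • v) = p * kapWedge s u v := by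
  simp only [kapWedge, _root_.map_smul, smul_eq_mul]; ring

/-- A functional vanishing on the second space that corrects `Θ` on `⟨e₃⟩ + F₁(s)`. -/
lemma exists_correction (hs : s ≠ 0) (hs' : s ≠ -1) (hcd : c ≠ 0 ∨ d ≠ 0)
    {q : ℂ} (q1 : kap₁ s (vec6 0 0 c d) = q * kap₁ s (vec6 a b 0 0))
    (q2 : kap₂ s (vec6 0 0 c d) = q * kap₂ s (vec6 a b 0 0)) (Θ : (Fin 6 → ℂ) →ₗ[ℂ] ℂ)
    (hΘ : Θ (vec6 0 0 c d) = q * Θ (vec6 a b 0 0)) :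
    ∃ β : ℂ, Θ ![0, 0, 1, 0, 0, 0] = β * (d • eta₁ - c • eta₂) ![0, 0, 1, 0, 0, 0] ∧
      Θ ![0, 0, 1, s, s^2, s^3] = β * (d • eta₁ - c • eta₂) ![0, 0, 1, s, s^2, s^3] := by
  set R := d • eta₁ - c • eta₂ with hR
  set f := vec6 0 0 c d - q • vec6 a b 0 0 with hf
  have k1 : kap₁ s f = 0 := by rw [hf, _root_.map_sub, _root_.map_smul, q1, smul_eq_mul, sub_self]
  have k2 : kap₂ s f = 0 := by rw [hf, _root_.map_sub, _root_.map_smul, q2, smul_eq_mul, sub_self]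
  have hΘf : Θ f = 0 := by rw [hf, _root_.map_sub, _root_.map_smul, hΘ, smul_eq_mul, sub_self]
  have hRf : R f = 0 := by
    simp [hR, hf, eta₁_vec6, eta₂_vec6]
    ring
  have f0 : f 0 = 0 := by simp [hf, vec6]
  have f1 : f 1 = 0 := by simp [hf, vec6]
  rw [kap₁_apply] at k1
  rw [kap₂_apply] at k2
  have hsf : s • f = (s * f 2 - f 3) • ![0, 0, 1, 0, 0, 0] + f 3 • ![0, 0, 1, s, s^2, s^3] := by
    ext i
    fin_cases i <;> simp [f0, f1]
    · ring
    · linear_combination s * k1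
    · linear_combination s * k2 + s^2*k1
  have hne : s * f 2 - f 3 ≠ 0 ∨ f 3 ≠ 0 := by
    by_contra! hc
    have f3 := hc.2
    have f2 : f 2 = 0 := (mul_eq_zero.mp (show s * f 2 = 0 by rw [hc.2, sub_zero] at hc; exact hc.1)).resolve_left hs
    have f4 : f 4 = 0 := by linear_combination k1 + s * f3
    have f5 : f 5 = 0 := by linear_combination k2 + s * f4
    have y1 : eta₁ f = c := by simp [hf, eta₁_vec6]
    have y2 : eta₂ f = d := by simp [hf, eta₂_vec6]
    rw [eta₁_apply, f2, f3, f4, f5] at y1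
    rw [eta₂_apply, f2, f3, f4, f5] at y2
    exact hcd.elim (fun h => h (by linear_combination -y1)) fun h => h (by linear_combination -y2)
  have hRne : R ![0, 0, 1, 0, 0, 0] ≠ 0 ∨ R ![0, 0, 1, s, s^2, s^3] ≠ 0 := by
    by_contra! hc
    obtain ⟨h1, h2⟩ := hc
    simp [hR, eta₁_apply, eta₂_apply] at h1 h2
    have h3 : s * (d * (8 + 7*s + 2*s^2) + c * (21 + 18*s + 5*s^2)) = 0 := by
      linear_combination h2 - h1
    have h4 := (mul_eq_zero.mp h3).resolve_left hs
    have hs1 : (1 + s)^2 ≠ 0 := pow_ne_zero 2 fun h => hs' (by linear_combination h)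
    have hc : c = 0 := (mul_eq_zero.mp (show (1 + s)^2*c = 0 by
      linear_combination (8 + 7*s + 2*s^2) * h1 - 3*h4)).resolve_left hs1
    exact hcd.elim (fun h => h hc) fun h => h (by linear_combination h1 / 3 - 8 / 3*hc)
  have e1 := congrArg Θ hsf
  have e2 := congrArg R hsf
  simp only [_root_.map_add, _root_.map_smul, hΘf, hRf, smul_eq_mul, mul_zero] at e1 e2
  have := cross_eq_zero_of_linear hne e1.symm e2.symm
  exact exists_mul_of_cross hRne (by linear_combination this)

lemma not_isTransverse_of_linearisedA {a' b' c' d' : ℂ} (hs : x 0 ≠ 0) (hs' : x 0 ≠ -1)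
    (ht : x 1 ≠ -1) (hE : E ∈ intersection typeA condA (pointsAt pointsA x))
    (h : IsFlagA (x 0) (x 1) E a b c d) (heq : EquationsA (x 0) (x 1) a b c d)
    (hlin : LinearisedA (x 0) (x 1) a b c d a' b' c' d')
    (hne : b * a' ≠ a * b' ∨ d * c' ≠ c * d') :
    ¬ IsTransverse typeA condA (pointsAt pointsA x) := by
  obtain ⟨-, -, -, ⟨k6, -⟩, -⟩ := mem_intersection_A.mp hE
  obtain ⟨y, z, hyz⟩ := exists_dual h.ab
  obtain ⟨y', z', hyz'⟩ := exists_dual h.cd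
  obtain ⟨q, q2, ql⟩ := exists_lam_eq ht h.cd heq.1
  obtain ⟨q', q1', q2'⟩ := exists_kap_eq hs' h.ab heq.2
  obtain ⟨hl1, hl2⟩ := hlin
  obtain ⟨r, r2, rl⟩ := exists_lam_eq ht h.cd (w := vec6 a' b' 0 0 + q • vec6 0 0 c' d') (by
    simp only [lamWedge, _root_.map_add, _root_.map_smul, Pi.add_apply, Pi.smul_apply,
      smul_eq_mul] at hl1 ⊢
    linear_combination hl1 - lam (x 1) (vec6 0 0 c' d') * q2 + vec6 0 0 c' d' 2*ql)
  obtain ⟨w, w', hw⟩ := exists_dual (kap_ne_zero hs' h.ab)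
  set l := vec6 a b 0 0 with hl
  set m := vec6 0 0 c d with hm
  set l' := vec6 a' b' 0 0 with hl'
  set m' := vec6 0 0 c' d' with hm'
  set T := kapWedge (x 0) l l' with hT
  set T' := kapWedge (x 0) l m' with hT'
  have hTT : T' = q' * T := by
    simp only [kapWedge] at hl2 hT hT'
    rw [hT, hT']
    linear_combination hl2 - kap₁ (x 0) l' * q2' + kap₂ (x 0) l' * q1' - hT'
  set Ξ := y • xi₁ + z • xi₂ with hΞ
  set H := y' • eta₁ + z' • eta₂ with hH
  set R := d • eta₁ - c • eta₂ with hR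
  have Ξl : Ξ l = 1 := by simp [hΞ, hl, xi₁_vec6, xi₂_vec6, hyz]
  have Ξm : Ξ m = 0 := by simp [hΞ, hm, xi₁_vec6, xi₂_vec6]
  have Hl : H l = 0 := by simp [hH, hl, eta₁_vec6, eta₂_vec6]
  have Hm : H m = 1 := by simp [hH, hm, eta₁_vec6, eta₂_vec6, hyz']
  have Rl : R l = 0 := by simp [hR, hl, eta₁_vec6, eta₂_vec6]
  have Rm : R m = 0 := by simp [hR, hm, eta₁_vec6, eta₂_vec6]; ring
  have hhead : ∀ p q, Ξ (head6 p q) = 0 ∧ H (head6 p q) = 0 ∧ R (head6 p q) = 0 := fun p q => by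
    simp [hΞ, hH, hR, xi₁_head6, xi₂_head6, eta₁_head6, eta₂_head6]
  obtain ⟨β, β1, β2⟩ := exists_correction hs hs' h.cd q1' q2' (T • Ξ + T' • H) (by
    simp [← hl, ← hm, Ξl, Ξm, Hl, Hm, hTT])
  rw [← hR] at β1 β2
  set w₀ : Fin 6 → ℂ := ![0, 0, 0, 0, -w', w - x 0*w'] with hw₀
  have hκw : kapWedge (x 0) l w₀ = 1 := by
    rw [kapWedge, kap₁_apply _ w₀, kap₂_apply _ w₀, ← hw]
    simp [hw₀]
    ring
  let ψ : Module.End ℂ (Fin 6 → ℂ) :=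
    Ξ.smulRight (l' + r • m) + H.smulRight m' - (β • R).smulRight w₀
  have hψ : ∀ v, ψ v = Ξ v • (l' + r • m) + H v • m' - (β * R v) • w₀ := fun v => rfl
  have hψl : ψ l = l' + r • m := by
    rw [hψ, Ξl, Hl, Rl, mul_zero, one_smul, zero_smul, zero_smul, add_zero, sub_zero]
  have hψm : ψ m = m' := by
    rw [hψ, Ξm, Hm, Rm, mul_zero, one_smul, zero_smul, zero_smul, zero_add, sub_zero]
  have hψhead : ∀ p q, ψ (head6 p q) = 0 := by
    intro p q
    obtain ⟨h1, h2, h3⟩ := hhead p q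
    rw [hψ, h1, h2, h3, mul_zero, zero_smul, zero_smul, zero_smul, add_zero, sub_zero]
  have hψ0 : ∀ v, ψ v 0 = 0 ∧ ψ v 1 = 0 := by
    intro v
    rw [hψ]
    simp [hl', hm, hm', hw₀, vec6]
  have hψ3 : ∀ v, ψ v ∈ E.space 3 ↔ T * Ξ v + T' * H v - β * R v = 0 := by
    intro v
    have h2 := heq.2
    rw [h.mem_three', hψ, sub_eq_add_neg, ← neg_smul, kapWedge_add, kapWedge_add, kapWedge_smul,
      kapWedge_smul, kapWedge_smul, kapWedge_add, kapWedge_smul, h2, hκw, ← hT, ← hT']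
    constructor <;> intro h <;> linear_combination h
  have hE12 : E.space 1 ≤ E.space 2 := E.monotone (by decide)
  have he : ∀ v ∈ E.space 0, ∃ p : ℂ, v = p • (l + q • m) := by
    intro v hv
    obtain ⟨hv1, v2, vl⟩ := (h.mem_zero v).mp hv
    obtain ⟨p, p', rfl⟩ := h.exists_eq' hv1
    exact ⟨p, by rw [lam_rel ht h.cd v2 vl q2 ql, smul_add, smul_smul]⟩
  have hψe2 : ψ (l + q • m) 2 = 0 := by
    rw [_root_.map_add, _root_.map_smul, hψl, hψm]
    simp only [Pi.add_apply, Pi.smul_apply, smul_eq_mul] at r2 ⊢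
    linear_combination r2
  have hψel : lam (x 1) (ψ (l + q • m)) = 0 := by
    rw [_root_.map_add, _root_.map_smul, hψl, hψm]
    simp only [_root_.map_add, _root_.map_smul, smul_eq_mul] at rl ⊢
    linear_combination rl
  have hψE : ∀ v ∈ E.space 0, ψ v 2 = 0 ∧ lam (x 1) (ψ v) = 0 := by
    intro v hv
    obtain ⟨p, rfl⟩ := he v hv
    rw [_root_.map_smul, _root_.map_smul, Pi.smul_apply, hψe2, hψel, smul_zero]
    exact ⟨rfl, rfl⟩
  intro htr
  have hpres := htr E hE ψ (by
    rw [pointsAt_A]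
    intro i
    fin_cases i
    · refine isTangent_A_zero (fun v hv => mem_osc_six_five.mpr ?_)
        (Submodule.map_le_iff_le_comap.mpr fun v hv => mem_osc_six_five.mpr ?_)
      · obtain ⟨hv1, v2, vl⟩ := (h.mem_zero v).mp hv
        obtain ⟨-, v0, v1⟩ := (h.mem_one v).mp hv1
        rw [lam_apply] at vl
        rw [v0, v1]
        linear_combination vl
      · have hv' := (hψE v hv).2
        rw [lam_apply] at hv'
        rw [(hψ0 v).1, (hψ0 v).2]
        linear_combination hv'
    · refine isTangent_A_one (fun v hv => mem_osc_six_infty_three.mpr ?_)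
        (fun v hv => mem_osc_six_infty_four.mpr ((h.mem_one v).mp hv).2)
        (Submodule.map_le_iff_le_comap.mpr fun v hv => mem_osc_six_infty_three.mpr
          ⟨(hψ0 v).1, (hψ0 v).2, (hψE v hv).1⟩)
        (Submodule.map_le_iff_le_comap.mpr fun v hv => mem_osc_six_infty_four.mpr (hψ0 v))
      obtain ⟨hv1, v2, vl⟩ := (h.mem_zero v).mp hv
      obtain ⟨-, v0, v1⟩ := (h.mem_one v).mp hv1
      exact ⟨v0, v1, v2⟩
    · refine isTangent_A_two (Submodule.map_le_iff_le_comap.mpr fun v hv => ?_)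
        (Submodule.map_le_iff_le_comap.mpr fun v hv => ?_)
      · obtain ⟨p, rfl⟩ := h.eq_smul_of_mem_osc_four hv.1 hv.2
        rw [Submodule.mem_comap, _root_.map_smul, ← hm, hψm]
        refine Submodule.smul_mem _ _ (Submodule.mem_sup_right (mem_osc_six_neg_one_four.mpr ?_))
        simp [hm', vec6]
        ring
      · obtain ⟨p, rfl⟩ := h.eq_smul_of_mem_osc_two hv.1 hv.2
        rw [Submodule.mem_comap, _root_.map_smul, _root_.map_add, hψhead, zero_add, ← hl, hψl]
        refine Submodule.smul_mem _ _ (Submodule.mem_sup.mpr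
          ⟨r • m + head6 (-a') (a' - b'), add_mem (Submodule.smul_mem _ _ (hE12 h.snd_mem))
            (h.head_mem _ _), l' + head6 a' (b' - a'), mem_osc_six_neg_one_two.mpr ?_, ?_⟩)
        · simp [hl', vec6, head6]
          refine ⟨?_, ?_, ?_, ?_⟩ <;> ring
        · have : head6 (-a') (a' - b') = -head6 a' (b' - a') := by
            ext i
            fin_cases i <;> simp [head6]
          rw [this]
          abel
    · refine isTangent_A_three k6 (Submodule.map_le_iff_le_comap.mpr fun v hv => ?_)
        (Submodule.map_le_iff_le_comap.mpr fun v hv => ?_)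
      · obtain ⟨v2, v3, v4, v5⟩ := mem_osc_six_zero_two.mp hv
        have : v = head6 (v 0) (v 1) := by
          ext i
          fin_cases i <;> simp [head6, v2, v3, v4, v5]
        rw [Submodule.mem_comap, this, hψhead]
        exact zero_mem _
      · obtain ⟨v3, v4, v5⟩ := mem_osc_six_zero_three.mp hv
        have : v = head6 (v 0) (v 1) + v 2 • ![0, 0, 1, 0, 0, 0] := by
          ext i
          fin_cases i <;> simp [head6, v3, v4, v5]
        rw [Submodule.mem_comap, this, _root_.map_add, hψhead, zero_add, _root_.map_smul]
        refine Submodule.smul_mem _ _ ((hψ3 _).mpr ?_)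
        simp only [LinearMap.add_apply, LinearMap.smul_apply, smul_eq_mul] at β1
        linear_combination β1
    · refine isTangent_A_four (Submodule.map_le_iff_le_comap.mpr fun v hv => ?_)
      obtain ⟨v1, v2, v3, v4, v5⟩ := mem_osc_six_one.mp hv
      have : v = head6 (v 0) (v 1) + (x 0^2*v 0) • ![0, 0, 1, x 0, x 0^2, x 0^3] := by
        ext i
        fin_cases i <;> simp [head6, v2, v3, v4, v5] <;> ring
      rw [Submodule.mem_comap, this, _root_.map_add, hψhead, zero_add, _root_.map_smul]
      refine Submodule.smul_mem _ _ ((hψ3 _).mpr ?_)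
      simp only [LinearMap.add_apply, LinearMap.smul_apply, smul_eq_mul] at β2
      linear_combination β2)
  have hpres1 : ∀ v ∈ E.space 1, ψ v ∈ E.space 1 := fun v hv => hpres 1 ⟨v, hv, rfl⟩
  rcases hne with hne | hne
  · have h1 := ((h.mem_two _).mp ((h.mem_one _).mp (hpres1 _ h.fst_mem)).1).1
    rw [← hl, hψl, _root_.map_add, _root_.map_add, _root_.map_smul, _root_.map_smul, hl', hm,
      xi₁_vec6, xi₂_vec6, xi₁_vec6, xi₂_vec6, smul_zero, add_zero, add_zero] at h1
    exact hne h1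
  · have h1 := ((h.mem_two _).mp ((h.mem_one _).mp (hpres1 _ h.snd_mem)).1).2
    rw [← hm, hψm, hm', eta₁_vec6, eta₂_vec6] at h1
    exact hne h1

/-- The first equation as a linear form in `(c,d,0)`. -/
noncomputable def rowLam (t a b : ℂ) : Fin 3 → ℂ :=
  ![lamWedge t (vec6 a b 0 0) (vec6 0 0 1 0), lamWedge t (vec6 a b 0 0) (vec6 0 0 0 1), 0]

/-- The second equation as a linear form in `(c,d,0)`. -/
noncomputable def rowKap (s a b : ℂ) : Fin 3 → ℂ :=
  ![kapWedge s (vec6 a b 0 0) (vec6 0 0 1 0), kapWedge s (vec6 a b 0 0) (vec6 0 0 0 1), 0]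

lemma dot3_rowLam (t a b : ℂ) (r : Fin 3 → ℂ) :
    dot3 (rowLam t a b) r = lamWedge t (vec6 a b 0 0) (vec6 0 0 (r 0) (r 1)) := by
  simp [dot3, rowLam, lamWedge, lam_apply, vec6]; ring

lemma dot3_rowKap (s a b : ℂ) (r : Fin 3 → ℂ) :
    dot3 (rowKap s a b) r = kapWedge s (vec6 a b 0 0) (vec6 0 0 (r 0) (r 1)) := by
  simp [dot3, rowKap, kapWedge, kap₁_apply, kap₂_apply, vec6]; ring

/-- A coefficient of the quadratic form whose zeros parametrise the intersection. -/
def coefA₀ (s t : ℂ) : ℂ :=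
  -30*s^2*t^2 - 15*s^2*t + 3*s^2 - 110*s * t^2 - 85*s * t - 11*s
    - 80*t^2 - 70*t - 14

/-- A coefficient of the quadratic form whose zeros parametrise the intersection. -/
def coefA₁ (s t : ℂ) : ℂ :=
  130*s^2*t^2 + 80*s^2*t - 3*s^2 + 480*s * t^2 + 405*s * t + 70*s
    + 400*t^2 + 380*t + 90

/-- A coefficient of the quadratic form whose zeros parametrise the intersection. -/
def coefA₂ (s t : ℂ) : ℂ :=
  -120*s^2*t^2 - 80*s^2*t - 450*s * t^2 - 400*s * t - 75*s - 400*t^2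
    - 400*t - 100

lemma disc_coefA (s t : ℂ) : polyA s t = coefA₁ s t^2 - 4*coefA₀ s t * coefA₂ s t := by
  simp only [coefA₀, coefA₁, coefA₂, polyA]
  ring

/-- The determinant whose zeros parametrise the intersection. -/
noncomputable def detA (s t a b : ℂ) : ℂ := det3 (rowLam t a b) (rowKap s a b) ![0, 0, 1]

/-- The differential of `detA`. -/
noncomputable def detA' (s t a b a' b' : ℂ) : ℂ :=
  det3' (rowLam t a b) (rowKap s a b) ![0, 0, 1] (rowLam t a' b') (rowKap s a' b') 0

lemma detA_eq (s t : ℂ) : detA s t = quadraticForm (coefA₀ s t) (coefA₁ s t) (coefA₂ s t) := by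
  funext a b
  simp only [detA, det3, rowLam, rowKap, lamWedge, kapWedge, lam_apply, kap₁_apply, kap₂_apply,
    vec6, quadraticForm, Matrix.cons_val, coefA₀, coefA₁, coefA₂]
  ring

lemma detA'_eq (s t : ℂ) : detA' s t = quadraticForm' (coefA₀ s t) (coefA₁ s t) (coefA₂ s t) := by
  funext a b a' b'
  simp only [detA', det3', det3, rowLam, rowKap, lamWedge, kapWedge, lam_apply, kap₁_apply,
    kap₂_apply, vec6, quadraticForm', Matrix.cons_val, Pi.zero_apply, coefA₀, coefA₁, coefA₂]
  ring

lemma detA_roots (s t : ℂ) : (polyA s t ≠ 0 → HasSimpleRoots 2 (detA s t) (detA' s t)) ∧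
    (polyA s t = 0 → HasDoubleRoot (detA s t) (detA' s t)) := by
  rw [detA_eq, detA'_eq, disc_coefA]
  exact quadratic_roots _ _ _

lemma equationsA_iff : EquationsA s t a b c d ↔
    dot3 (rowLam t a b) ![c, d, 0] = 0 ∧ dot3 (rowKap s a b) ![c, d, 0] = 0 := by
  rw [dot3_rowLam, dot3_rowKap]
  rfl

lemma linearisedA_iff {a' b' c' d' : ℂ} : LinearisedA s t a b c d a' b' c' d' ↔
    dot3 (rowLam t a' b') ![c, d, 0] + dot3 (rowLam t a b) ![c', d', 0] = 0 ∧
      dot3 (rowKap s a' b') ![c, d, 0] + dot3 (rowKap s a b) ![c', d', 0] = 0 := by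
  rw [dot3_rowLam, dot3_rowKap, dot3_rowLam, dot3_rowKap]
  rfl

lemma dot3_last (r : Fin 3 → ℂ) : dot3 ![0, 0, 1] r = r 2 := by simp [dot3]

lemma eq_of_last_eq_zero {r : Fin 3 → ℂ} (h : r 2 = 0) : r = ![r 0, r 1, 0] := by
  ext i
  fin_cases i
  exacts [rfl, rfl, h]

lemma cons_ne_zero (hcd : c ≠ 0 ∨ d ≠ 0) : (![c, d, 0] : Fin 3 → ℂ) ≠ 0 := fun h =>
  hcd.elim (fun h' => h' (congrFun h 0)) fun h' => h' (congrFun h 1)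

lemma rowLam_smul (t p a b : ℂ) : rowLam t (p * a) (p * b) = p • rowLam t a b := by
  ext i; fin_cases i <;> simp [rowLam, lamWedge, lam_apply, vec6] <;> ring

lemma rowKap_smul (s p a b : ℂ) : rowKap s (p * a) (p * b) = p • rowKap s a b := by
  ext i; fin_cases i <;> simp [rowKap, kapWedge, kap₁_apply, kap₂_apply, vec6] <;> ring

lemma det_eq_zero_of_equationsA (hcd : c ≠ 0 ∨ d ≠ 0) (h : EquationsA s t a b c d) :
    detA s t a b = 0 := by
  obtain ⟨h1, h2⟩ := equationsA_iff.mp h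
  exact det3_eq_zero_of_kernel (cons_ne_zero hcd) h1 h2 (by simp [dot3])

/-- At a simple root the kernel is a line. -/
lemma kernel_unique_A (hsimple : HasSimpleRoots 2 (detA s t) (detA' s t)) {c' d' : ℂ}
    (hab : a ≠ 0 ∨ b ≠ 0) (hcd : c ≠ 0 ∨ d ≠ 0) (h : EquationsA s t a b c d)
    (h' : EquationsA s t a b c' d') : ∃ p : ℂ, c' = p * c ∧ d' = p * d := by
  obtain ⟨y, z, hyz⟩ := exists_dual hab
  obtain ⟨h1, h2⟩ := equationsA_iff.mp h
  obtain ⟨h1', h2'⟩ := equationsA_iff.mp h'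
  obtain ⟨p, hp⟩ := eq_smul_of_det3'_ne_zero (u' := rowLam t (-z) y) (v' := rowKap s (-z) y)
    (w' := 0) (fun h0 => by
      have := hsimple.simple a b (-z) y hab (det_eq_zero_of_equationsA hcd h) h0
      exact one_ne_zero (hyz.symm.trans (by linear_combination this)))
    (cons_ne_zero hcd) h1 h2 (by simp [dot3]) h1' h2' (w := ![0, 0, 1]) (by simp [dot3])
  exact ⟨p, congrFun hp 0, congrFun hp 1⟩

lemma IsFlagA.congr (h : IsFlagA s t E a b c d) {a₁ b₁ c₁ d₁ p q : ℂ} (hab : a₁ ≠ 0 ∨ b₁ ≠ 0)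
    (hcd : c₁ ≠ 0 ∨ d₁ ≠ 0) (ha : a = p * a₁) (hb : b = p * b₁) (hc : c = q * c₁)
    (hd : d = q * d₁) : IsFlagA s t E a₁ b₁ c₁ d₁ := by
  have hp : p ≠ 0 := by
    rintro rfl
    exact h.ab.elim (fun h => h (by rw [ha, zero_mul])) fun h => h (by rw [hb, zero_mul])
  have hq : q ≠ 0 := by
    rintro rfl
    exact h.cd.elim (fun h => h (by rw [hc, zero_mul])) fun h => h (by rw [hd, zero_mul])
  refine ⟨hab, hcd, fun v => ?_, h.mem_one, h.mem_zero, fun v => ?_⟩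
  · rw [h.mem_two, ha, hb, hc, hd, mul_assoc, mul_assoc, mul_assoc, mul_assoc,
      mul_right_inj' hp, mul_right_inj' hq]
  · have : vec6 a b 0 0 = p • vec6 a₁ b₁ 0 0 := by
      rw [ha, hb]
      simpa [vec6] using vec6_combination p 0 a₁ b₁ 0 0
    rw [h.mem_three, this, _root_.map_smul, _root_.map_smul, smul_eq_mul, smul_eq_mul, mul_assoc,
      mul_assoc, mul_right_inj' hp]

lemma IsFlagA.ext {E' : PartialFlag typeA 6} (h : IsFlagA s t E a b c d)
    (h' : IsFlagA s t E' a b c d) : E = E' := by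
  have h2 : E.space 2 = E'.space 2 := by
    ext v
    rw [h.mem_two, h'.mem_two]
  have h1 : E.space 1 = E'.space 1 := by
    ext v
    rw [h.mem_one, h'.mem_one, h2]
  have h0 : E.space 0 = E'.space 0 := by
    ext v
    rw [h.mem_zero, h'.mem_zero, h1]
  have h3 : E.space 3 = E'.space 3 := by
    ext v
    rw [h.mem_three, h'.mem_three]
  refine PartialFlag.ext_space fun i => ?_
  fin_cases i
  exacts [h0, h1, h2, h3]

theorem isTransverse_A_iff (x : Fin 2 → ℂ) (hx : Function.Injective (pointsAt pointsA x)) :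
    IsTransverse typeA condA (pointsAt pointsA x) ↔ polyA (x 0) (x 1) ≠ 0 := by
  obtain ⟨hs, -, hs', ht, -⟩ := (injective_pointsAt_A x).mp hx
  constructor
  · intro htr h0
    obtain ⟨a, b, hab, h1, h2⟩ := (detA_roots (x 0) (x 1)).2 h0
    obtain ⟨y, z, hyz⟩ := exists_dual hab
    obtain ⟨r, hr, ⟨k1, k2, k3⟩, hdef⟩ := deformableKernel_of_det3 h1 (h2 (-z) y)
    rw [dot3_last] at k3
    rw [eq_of_last_eq_zero k3] at k1 k2
    have hcd : r 0 ≠ 0 ∨ r 1 ≠ 0 := by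
      rcases exists_ne_zero_fin_three hr with h | h | h
      exacts [Or.inl h, Or.inr h, absurd k3 h]
    have heq := equationsA_iff.mpr ⟨k1, k2⟩
    obtain ⟨E, hE, hEr⟩ := exists_flag_of_equationsA hs' ht hab hcd heq
    rcases hdef with ⟨r', l1, l2, l3⟩ | ⟨r', hne, l1, l2, l3⟩
    · have r2' : r' 2 = 0 := by rw [dot3_last] at l3; simpa [dot3] using l3
      rw [eq_of_last_eq_zero k3, eq_of_last_eq_zero r2'] at l1 l2
      refine not_isTransverse_of_linearisedA hs hs' ht hE hEr heq
        (linearisedA_iff.mpr ⟨l1, l2⟩) (Or.inl fun h => ?_) htr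
      exact one_ne_zero (hyz.symm.trans (by linear_combination -h))
    · rw [dot3_last] at l3
      rw [eq_of_last_eq_zero l3] at l1 l2
      refine not_isTransverse_of_linearisedA (a' := 0) (b' := 0) (c' := r' 0) (d' := r' 1) hs hs' ht
        hE hEr heq (linearisedA_iff.mpr ⟨?_, ?_⟩) (Or.inr fun h => ?_) htr
      · rw [l1]
        simp [dot3, rowLam, lamWedge, lam_apply, vec6]
      · rw [l2]
        simp [dot3, rowKap, kapWedge, kap₁_apply, kap₂_apply, vec6]
      · obtain ⟨p, p1, p2⟩ := exists_mul_of_cross hcd h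
        refine hne p (funext fun i => ?_)
        fin_cases i
        · exact p1
        · exact p2
        · change r' 2 = p * r 2
          rw [k3, l3, mul_zero]
  · intro h0 E hE ψ hψ
    have hsimple := (detA_roots (x 0) (x 1)).1 h0
    obtain ⟨a, b, c, d, hEr, heq⟩ := exists_isFlagA hs hs' ht hE
    obtain ⟨a', b', c', d', hlin, hpres⟩ := exists_linearisedA hs hs' ht hE hEr heq hψ
    obtain ⟨e1, e2⟩ := equationsA_iff.mp heq
    obtain ⟨l1, l2⟩ := linearisedA_iff.mp hlin
    have hpar := hsimple.simple a b a' b' hEr.ab (det_eq_zero_of_equationsA hEr.cd heq)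
      (det3'_eq_zero_of_kernel (cons_ne_zero hEr.cd) e1 e2 (by simp [dot3]) l1 l2 (by simp [dot3]))
    have hpar' : b * a' = a * b' := by linear_combination -hpar
    obtain ⟨p, rfl, rfl⟩ := exists_mul_of_cross hEr.ab hpar'
    rw [rowLam_smul, dot3_smul_left, e1, mul_zero, zero_add] at l1
    rw [rowKap_smul, dot3_smul_left, e2, mul_zero, zero_add] at l2
    obtain ⟨q, rfl, rfl⟩ := kernel_unique_A hsimple hEr.ab hEr.cd heq (equationsA_iff.mpr ⟨l1, l2⟩)
    exact hpres hpar' (by ring)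

theorem encard_A (x : Fin 2 → ℂ) (hx : Function.Injective (pointsAt pointsA x))
    (h : polyA (x 0) (x 1) ≠ 0) : (intersection typeA condA (pointsAt pointsA x)).encard = 2 := by
  obtain ⟨hs, -, hs', ht, -⟩ := (injective_pointsAt_A x).mp hx
  have hsimple := (detA_roots (x 0) (x 1)).1 h
  obtain ⟨a, b, hroot, hdist, hall⟩ := hsimple.exists_roots
  refine encard_eq_of_correspondence (d := 2)
    (fun E k => ∃ c d, IsFlagA (x 0) (x 1) E (a k) (b k) c d ∧
      EquationsA (x 0) (x 1) (a k) (b k) c d) ?_ ?_ ?_ ?_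
  · intro k
    obtain ⟨r, hr, ⟨k1, k2, k3⟩, -⟩ := deformableKernel_of_det3 (u' := 0) (v' := 0) (w' := 0)
      (hroot k).2 (by simp [det3', det3])
    rw [dot3_last] at k3
    rw [eq_of_last_eq_zero k3] at k1 k2
    have hcd : r 0 ≠ 0 ∨ r 1 ≠ 0 := by
      rcases exists_ne_zero_fin_three hr with h | h | h
      exacts [Or.inl h, Or.inr h, absurd k3 h]
    have heq := equationsA_iff.mpr ⟨k1, k2⟩
    obtain ⟨E, hE, hEr⟩ := exists_flag_of_equationsA hs' ht (hroot k).1 hcd heq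
    exact ⟨E, hE, r 0, r 1, hEr, heq⟩
  · intro E hE
    obtain ⟨a', b', c, d, hEr, heq⟩ := exists_isFlagA hs hs' ht hE
    obtain ⟨k, hk⟩ := hall a' b' (det_eq_zero_of_equationsA hEr.cd heq)
    obtain ⟨p, rfl, rfl⟩ := exists_mul_of_cross (hroot k).1 (x := a') (y := b')
      (by linear_combination -hk)
    have hp : p ≠ 0 := by
      rintro rfl
      simpa using hEr.ab
    refine ⟨k, c, d, hEr.congr (hroot k).1 hEr.cd rfl rfl (one_mul c).symm (one_mul d).symm, ?_⟩
    obtain ⟨e1, e2⟩ := equationsA_iff.mp heq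
    rw [rowLam_smul, dot3_smul_left] at e1
    rw [rowKap_smul, dot3_smul_left] at e2
    exact equationsA_iff.mpr ⟨(mul_eq_zero.mp e1).resolve_left hp,
      (mul_eq_zero.mp e2).resolve_left hp⟩
  · rintro E - E' - k ⟨c, d, hEr, heq⟩ ⟨c', d', hEr', heq'⟩
    obtain ⟨p, p1, p2⟩ := kernel_unique_A hsimple hEr.ab hEr.cd heq heq'
    exact hEr.ext (hEr'.congr hEr'.ab hEr.cd (one_mul _).symm (one_mul _).symm p1 p2)
  · rintro E - k l ⟨c, d, hEr, -⟩ ⟨c', d', hEr', -⟩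
    by_contra hkl
    have := ((hEr'.mem_two _).mp ((hEr.mem_one _).mp hEr.fst_mem).1).1
    rw [xi₁_vec6, xi₂_vec6] at this
    exact hdist k l hkl (by linear_combination this)

end TransversalityA

/-! ### Flags of type `(3,4)` in 7-space -/

section OsculatingSeven

variable {v : Fin 7 → ℂ}

lemma mem_osc_seven_infty_two : v ∈ osc 7 ∞ 2 ↔
    v 0 = 0 ∧ v 1 = 0 ∧ v 2 = 0 ∧ v 3 = 0 ∧ v 4 = 0 := by
  rw [mem_osculatingSpace_infty]
  simp [Fin.forall_fin_succ]

lemma mem_osc_seven_infty_four : v ∈ osc 7 ∞ 4 ↔ v 0 = 0 ∧ v 1 = 0 ∧ v 2 = 0 := by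
  rw [mem_osculatingSpace_infty]
  simp [Fin.forall_fin_succ]

lemma mem_osc_seven_zero_three : v ∈ osc 7 (0 : ℂ) 3 ↔ v 3 = 0 ∧ v 4 = 0 ∧ v 5 = 0 ∧ v 6 = 0 := by
  rw [mem_osculatingSpace_coe_zero]
  simp [Fin.forall_fin_succ]

lemma mem_osc_seven_zero_five : v ∈ osc 7 (0 : ℂ) 5 ↔ v 5 = 0 ∧ v 6 = 0 := by
  rw [mem_osculatingSpace_coe_zero]
  simp [Fin.forall_fin_succ]

lemma mem_osc_seven_four {z : ℂ} : v ∈ osc 7 z 4 ↔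
    z^4*v 0 - 4*z^3*v 1 + 6*z^2*v 2 - 4*z * v 3 + v 4 = 0 ∧
    z^4*v 1 - 4*z^3*v 2 + 6*z^2*v 3 - 4*z * v 4 + v 5 = 0 ∧
    z^4*v 2 - 4*z^3*v 3 + 6*z^2*v 4 - 4*z * v 5 + v 6 = 0 := by
  rw [mem_osculatingSpace_coe]
  constructor
  · intro h
    have h4 := h 4 le_rfl (by norm_num)
    have h5 := h 5 (by norm_num) (by norm_num)
    have h6 := h 6 (by norm_num) (by norm_num)
    simp [Fin.sum_univ_seven, Nat.choose] at h4 h5 h6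
    refine ⟨?_, ?_, ?_⟩
    · linear_combination h4
    · linear_combination h5 + z * h4
    · linear_combination h6 + 2*z * h5 + z^2*h4
  · rintro ⟨h4, h5, h6⟩ i hi hi'
    interval_cases i <;> simp [Fin.sum_univ_seven, Nat.choose]
    · linear_combination h4
    · linear_combination h5 - z * h4
    · linear_combination h6 - 2*z * h5 + z^2*h4

lemma mem_osc_seven_three {z : ℂ} : v ∈ osc 7 z 3 ↔ v 3 = 3*z * v 2 - 3*z^2*v 1 + z^3*v 0 ∧
    v 4 = 3*z * v 3 - 3*z^2*v 2 + z^3*v 1 ∧ v 5 = 3*z * v 4 - 3*z^2*v 3 + z^3*v 2 ∧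
    v 6 = 3*z * v 5 - 3*z^2*v 4 + z^3*v 3 := by
  rw [mem_osculatingSpace_coe]
  constructor
  · intro h
    have h3 := h 3 le_rfl (by norm_num)
    have h4 := h 4 (by norm_num) (by norm_num)
    have h5 := h 5 (by norm_num) (by norm_num)
    have h6 := h 6 (by norm_num) (by norm_num)
    simp [Fin.sum_univ_seven, Nat.choose] at h3 h4 h5 h6
    refine ⟨?_, ?_, ?_, ?_⟩
    · linear_combination h3
    · linear_combination h4 + z * h3
    · linear_combination h5 + 2*z * h4 + z^2*h3
    · linear_combination h6 + 3*z * h5 + 3*z^2*h4 + z^3*h3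
  · rintro ⟨h3, h4, h5, h6⟩ i hi hi'
    interval_cases i <;> simp [Fin.sum_univ_seven, Nat.choose]
    · linear_combination h3
    · linear_combination h4 - z * h3
    · linear_combination h5 - 2*z * h4 + z^2*h3
    · linear_combination h6 - 3*z * h5 + 3*z^2*h4 - z^3*h3

lemma mem_osc_seven_two {z : ℂ} : v ∈ osc 7 z 2 ↔
    v 2 = 2*z * v 1 - z^2*v 0 ∧ v 3 = 2*z * v 2 - z^2*v 1 ∧
    v 4 = 2*z * v 3 - z^2*v 2 ∧ v 5 = 2*z * v 4 - z^2*v 3 ∧ v 6 = 2*z * v 5 - z^2*v 4 := by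
  rw [mem_osculatingSpace_coe]
  constructor
  · intro h
    have h2 := h 2 le_rfl (by norm_num)
    have h3 := h 3 (by norm_num) (by norm_num)
    have h4 := h 4 (by norm_num) (by norm_num)
    have h5 := h 5 (by norm_num) (by norm_num)
    have h6 := h 6 (by norm_num) (by norm_num)
    simp [Fin.sum_univ_seven, Nat.choose] at h2 h3 h4 h5 h6
    refine ⟨?_, ?_, ?_, ?_, ?_⟩
    · linear_combination h2
    · linear_combination h3 + z * h2
    · linear_combination h4 + 2*z * h3 + z^2*h2
    · linear_combination h5 + 3*z * h4 + 3*z^2*h3 + z^3*h2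
    · linear_combination h6 + 4*z * h5 + 6*z^2*h4 + 4*z^3*h3 + z^4*h2
  · rintro ⟨h2, h3, h4, h5, h6⟩ i hi hi'
    interval_cases i <;> simp [Fin.sum_univ_seven, Nat.choose]
    · linear_combination h2
    · linear_combination h3 - z * h2
    · linear_combination h4 - 2*z * h3 + z^2*h2
    · linear_combination h5 - 3*z * h4 + 3*z^2*h3 - z^3*h2
    · linear_combination h6 - 4*z * h5 + 6*z^2*h4 - 4*z^3*h3 + z^4*h2

end OsculatingSeven

section FlagsC

variable {E : PartialFlag typeC 7} {τ : OnePoint ℂ} {ψ : Module.End ℂ (Fin 7 → ℂ)}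

lemma flagC_le (E : PartialFlag typeC 7) (F : Submodule ℂ (Fin 7 → ℂ)) :
    dim ↥(E.space 0 ⊓ F) ≤ dim ↥(E.space 1 ⊓ F) ∧
      dim ↥(E.space 1 ⊓ F) ≤ dim ↥(E.space 0 ⊓ F) + 1 := by
  have h := finrank_inf_le_add (E.monotone (show (0 : Fin 2) ≤ 1 by decide)) F
  rw [E.finrank_eq, E.finrank_eq] at h
  simp only [typeC, Matrix.cons_val] at h
  omega

lemma mem_schubertVariety_C_zero : E ∈ schubertVariety typeC (condC 0) τ ↔
    1 ≤ dim ↥(E.space 0 ⊓ osc 7 τ 2) ∧ 2 ≤ dim ↥(E.space 0 ⊓ osc 7 τ 4) := by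
  constructor
  · intro h
    have h := (mem_schubertVariety_oneLine (hv := by decide) (hinj := by decide)).mp h
    exact ⟨h 0 2 (by norm_num), h 0 4 (by norm_num)⟩
  · rintro ⟨h1, h2⟩
    refine mem_schubertVariety_of_essential (hv := by decide) (hinj := by decide)
      fun i j hj hg => ?_
    have h3 := h1.trans (finrank_inf_osculatingSpace_succ (E.space 0) τ (by norm_num)).1
    have h4 := h1.trans (flagC_le E (osc 7 τ 2)).1
    have h5 := h3.trans (flagC_le E (osc 7 τ 3)).1
    have h6 := h2.trans (flagC_le E (osc 7 τ 4)).1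
    have h7 := h2.trans (finrank_inf_osculatingSpace_succ (E.space 0) τ (by norm_num)).1
    fin_cases i <;> interval_cases j <;>
      first
      | exact absurd (by decide) hg
      | (refine le_trans ?_ (by assumption); decide)

lemma mem_schubertVariety_C_one : E ∈ schubertVariety typeC (condC 1) τ ↔
    1 ≤ dim ↥(E.space 0 ⊓ osc 7 τ 3) ∧ 2 ≤ dim ↥(E.space 0 ⊓ osc 7 τ 5) := by
  constructor
  · intro h
    have h := (mem_schubertVariety_oneLine (hv := by decide) (hinj := by decide)).mp h
    exact ⟨h 0 3 (by norm_num), h 0 5 (by norm_num)⟩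
  · rintro ⟨h1, h2⟩
    refine mem_schubertVariety_of_essential (hv := by decide) (hinj := by decide)
      fun i j hj hg => ?_
    have h3 := h1.trans (finrank_inf_osculatingSpace_succ (E.space 0) τ (by norm_num)).1
    have h4 := h1.trans (flagC_le E (osc 7 τ 3)).1
    fin_cases i <;> interval_cases j <;>
      first
      | exact absurd (by decide) hg
      | (refine le_trans ?_ (by assumption); decide)

lemma mem_schubertVariety_C_two : E ∈ schubertVariety typeC (condC 2) τ ↔
    1 ≤ dim ↥(E.space 1 ⊓ osc 7 τ 2) ∧ 2 ≤ dim ↥(E.space 1 ⊓ osc 7 τ 4) := by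
  constructor
  · intro h
    have h := (mem_schubertVariety_oneLine (hv := by decide) (hinj := by decide)).mp h
    exact ⟨h 1 2 (by norm_num), h 1 4 (by norm_num)⟩
  · rintro ⟨h1, h2⟩
    refine mem_schubertVariety_of_essential (hv := by decide) (hinj := by decide)
      fun i j hj hg => ?_
    have h3 := h1.trans (finrank_inf_osculatingSpace_succ (E.space 1) τ (by norm_num)).1
    have h4 : 1 ≤ dim ↥(E.space 0 ⊓ osc 7 τ 4) := by
      have := flagC_le E (osc 7 τ 4)
      omega
    fin_cases i <;> interval_cases j <;>
      first
      | exact absurd (by decide) hg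
      | (refine le_trans ?_ (by assumption); decide)

lemma mem_schubertVariety_C_three : E ∈ schubertVariety typeC (condC 3) τ ↔
    2 ≤ dim ↥(E.space 1 ⊓ osc 7 τ 3) := by
  constructor
  · intro h
    have h := (mem_schubertVariety_oneLine (hv := by decide) (hinj := by decide)).mp h
    exact h 1 3 (by norm_num)
  · intro h1
    refine mem_schubertVariety_of_essential (hv := by decide) (hinj := by decide)
      fun i j hj hg => ?_
    have h2 := h1.trans (finrank_inf_osculatingSpace_succ (E.space 1) τ (by norm_num)).1
    have h3 : 1 ≤ dim ↥(E.space 0 ⊓ osc 7 τ 3) := by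
      have := flagC_le E (osc 7 τ 3)
      omega
    have h4 := h3.trans (finrank_inf_osculatingSpace_succ (E.space 0) τ (by norm_num)).1
    have h5 : 1 ≤ dim ↥(E.space 1 ⊓ osc 7 τ 2) := by
      have := h1.trans (finrank_inf_osculatingSpace_succ (E.space 1) τ (show 2 < 7 by norm_num)).2
      omega
    fin_cases i <;> interval_cases j <;>
      first
      | exact absurd (by decide) hg
      | (refine le_trans ?_ (by assumption); decide)

lemma isTangent_C_zero
    (h2 : 1 ≤ dim ↥(E.space 0 ⊓ osc 7 τ 2))
    (h4 : 2 ≤ dim ↥(E.space 0 ⊓ osc 7 τ 4))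
    (k2 : (E.space 0 ⊓ osc 7 τ 2).map ψ ≤ E.space 0 ⊔ osc 7 τ 2)
    (k4 : (E.space 0 ⊓ osc 7 τ 4).map ψ ≤ E.space 0 ⊔ osc 7 τ 4) :
    IsTangent typeC (condC 0) τ E ψ := by
  refine isTangent_oneLine (hv := by decide) (hinj := by decide) fun i j hj hg hfin => ?_
  have hE01 := E.monotone (show (0 : Fin 2) ≤ 1 by decide)
  fin_cases i <;> interval_cases j <;>
    first
    | exact absurd (by decide) hg
    | assumption
    | exact map_inf_le_sup_mono le_rfl (osculatingSpace_mono _ _ (by norm_num))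
        ((hfin.trans (by decide)).trans_le h2) k2
    | exact map_inf_le_sup_mono le_rfl (osculatingSpace_mono _ _ (by norm_num))
        ((hfin.trans (by decide)).trans_le h4) k4
    | exact map_inf_le_sup_mono hE01 (osculatingSpace_mono _ _ (by norm_num))
        ((hfin.trans (by decide)).trans_le h2) k2
    | exact map_inf_le_sup_mono hE01 (osculatingSpace_mono _ _ (by norm_num))
        ((hfin.trans (by decide)).trans_le h4) k4

lemma isTangent_C_one
    (h3 : 1 ≤ dim ↥(E.space 0 ⊓ osc 7 τ 3))
    (k3 : (E.space 0 ⊓ osc 7 τ 3).map ψ ≤ E.space 0 ⊔ osc 7 τ 3)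
    (k5 : (E.space 0 ⊓ osc 7 τ 5).map ψ ≤ E.space 0 ⊔ osc 7 τ 5) :
    IsTangent typeC (condC 1) τ E ψ := by
  refine isTangent_oneLine (hv := by decide) (hinj := by decide) fun i j hj hg hfin => ?_
  have hE01 := E.monotone (show (0 : Fin 2) ≤ 1 by decide)
  fin_cases i <;> interval_cases j <;>
    first
    | exact absurd (by decide) hg
    | assumption
    | exact map_inf_le_sup_mono le_rfl (osculatingSpace_mono _ _ (by norm_num))
        ((hfin.trans (by decide)).trans_le h3) k3
    | exact map_inf_le_sup_mono hE01 (osculatingSpace_mono _ _ (by norm_num))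
        ((hfin.trans (by decide)).trans_le h3) k3

lemma sup_finrank_le_of_generic {i i' : Fin 2} {j j' : ℕ} (hj : j ≤ 7) (hj' : j' ≤ 7)
    (h' : dim (E.space i') + j' + dim ↥(E.space i ⊓ osc 7 τ j) ≤ dim (E.space i) + j +
        dim ↥(E.space i' ⊓ osc 7 τ j')) : dim ↥(E.space i' ⊔ osc 7 τ j') ≤
      dim ↥(E.space i ⊔ osc 7 τ j) := by
  have e2 := Submodule.finrank_sup_add_finrank_inf_eq (E.space i) (osc 7 τ j)
  have e3 := Submodule.finrank_sup_add_finrank_inf_eq (E.space i') (osc 7 τ j')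
  rw [finrank_osculatingSpace τ hj] at e2
  rw [finrank_osculatingSpace τ hj'] at e3
  omega

lemma isTangent_C_two
    (h2 : 1 ≤ dim ↥(E.space 1 ⊓ osc 7 τ 2))
    (h4 : 2 ≤ dim ↥(E.space 1 ⊓ osc 7 τ 4))
    (k2 : (E.space 1 ⊓ osc 7 τ 2).map ψ ≤ E.space 1 ⊔ osc 7 τ 2)
    (k4 : (E.space 1 ⊓ osc 7 τ 4).map ψ ≤ E.space 1 ⊔ osc 7 τ 4) :
    IsTangent typeC (condC 2) τ E ψ := by
  refine isTangent_oneLine (hv := by decide) (hinj := by decide) fun i j hj hg hfin => ?_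
  have hE01 := E.monotone (show (0 : Fin 2) ≤ 1 by decide)
  have f0 : dim (E.space 0) = 3 := E.finrank_eq 0
  have f1 : dim (E.space 1) = 4 := E.finrank_eq 1
  have e0 : dim ↥(E.space 0 ⊓ osc 7 τ 4) = 1 → dim ↥(E.space 1 ⊔ osc 7 τ 4) ≤
      dim ↥(E.space 0 ⊔ osc 7 τ 4) := fun h =>
    sup_finrank_le_of_generic (by norm_num) (by norm_num) (by omega)
  fin_cases i <;> interval_cases j <;>
    first
    | exact absurd (by decide) hg
    | assumption
    | exact map_inf_le_sup_mono le_rfl (osculatingSpace_mono _ _ (by norm_num))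
        ((hfin.trans (by decide)).trans_le h2) k2
    | exact map_inf_le_sup_anti hE01 le_rfl (e0 (hfin.trans (by decide))) k4

lemma isTangent_C_three
    (h3 : 2 ≤ dim ↥(E.space 1 ⊓ osc 7 τ 3))
    (k3 : (E.space 1 ⊓ osc 7 τ 3).map ψ ≤ E.space 1 ⊔ osc 7 τ 3) :
    IsTangent typeC (condC 3) τ E ψ := by
  refine isTangent_oneLine (hv := by decide) (hinj := by decide) fun i j hj hg hfin => ?_
  have hE01 := E.monotone (show (0 : Fin 2) ≤ 1 by decide)
  have f0 : dim (E.space 0) = 3 := E.finrank_eq 0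
  have f1 : dim (E.space 1) = 4 := E.finrank_eq 1
  have g0 : 1 ≤ dim ↥(E.space 0 ⊓ osc 7 τ 3) := by
    have := flagC_le E (osc 7 τ 3)
    omega
  have k33 : dim ↥(E.space 0 ⊓ osc 7 τ 3) = 1 →
      (E.space 0 ⊓ osc 7 τ 3).map ψ ≤ E.space 0 ⊔ osc 7 τ 3 := fun h =>
    map_inf_le_sup_anti hE01 le_rfl
      (sup_finrank_le_of_generic (by norm_num) (by norm_num) (by omega)) k3
  have k42 : dim ↥(E.space 1 ⊓ osc 7 τ 2) = 1 →
      (E.space 1 ⊓ osc 7 τ 2).map ψ ≤ E.space 1 ⊔ osc 7 τ 2 := fun h =>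
    map_inf_le_sup_anti le_rfl (osculatingSpace_mono _ _ (by norm_num))
      (sup_finrank_le_of_generic (by norm_num) (by norm_num) (by omega)) k3
  have k34 : dim ↥(E.space 0 ⊓ osc 7 τ 4) = 1 →
      (E.space 0 ⊓ osc 7 τ 4).map ψ ≤ E.space 0 ⊔ osc 7 τ 4 := fun h =>
    map_inf_le_sup_mono le_rfl (osculatingSpace_mono _ _ (by norm_num)) (h.trans_le g0)
      (k33 (le_antisymm ((finrank_inf_osculatingSpace_succ (E.space 0) τ
        (show 3 < 7 by norm_num)).1.trans h.le) g0))
  have k44 : dim ↥(E.space 1 ⊓ osc 7 τ 4) = 2 →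
      (E.space 1 ⊓ osc 7 τ 4).map ψ ≤ E.space 1 ⊔ osc 7 τ 4 := fun h =>
    map_inf_le_sup_mono le_rfl (osculatingSpace_mono _ _ (by norm_num)) (h.trans_le h3) k3
  fin_cases i <;> interval_cases j <;>
    first
    | exact absurd (by decide) hg
    | exact k3
    | (refine k33 ?_; exact hfin.trans (by decide))
    | (refine k42 ?_; exact hfin.trans (by decide))
    | (refine k34 ?_; exact hfin.trans (by decide))
    | (refine k44 ?_; exact hfin.trans (by decide))

lemma mem_intersection_C {x : Fin 1 → ℂ} : E ∈ intersection typeC condC (pointsAt pointsC x) ↔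
      (1 ≤ dim ↥(E.space 0 ⊓ osc 7 ∞ 2) ∧ 2 ≤ dim ↥(E.space 0 ⊓ osc 7 ∞ 4)) ∧
      (1 ≤ dim ↥(E.space 0 ⊓ osc 7 (0 : ℂ) 3) ∧ 2 ≤ dim ↥(E.space 0 ⊓ osc 7 (0 : ℂ) 5)) ∧
      (1 ≤ dim ↥(E.space 1 ⊓ osc 7 (x 0) 2) ∧ 2 ≤ dim ↥(E.space 1 ⊓ osc 7 (x 0) 4)) ∧
      2 ≤ dim ↥(E.space 1 ⊓ osc 7 (1 : ℂ) 3) := by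
  rw [← mem_schubertVariety_C_zero, ← mem_schubertVariety_C_one, ← mem_schubertVariety_C_two,
    ← mem_schubertVariety_C_three, pointsAt_C]
  exact ⟨fun h => ⟨h 0, h 1, h 2, h 3⟩, fun ⟨h0, h1, h2, h3⟩ l => by
    fin_cases l
    exacts [h0, h1, h2, h3]⟩

end FlagsC

section ProblemC

/-- The vectors of `⟨e₆,e₇⟩`. -/
def pvec (s a e : ℂ) : Fin 7 → ℂ := ![0, 0, 0, 0, 0, a, (2*s + 3) * a - e]

/-- The vectors of `⟨e₄,e₅⟩`. -/
def qvec (c d : ℂ) : Fin 7 → ℂ := ![0, 0, 0, c, d, 0, 0]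

/-- The vectors of `⟨e₁,e₂,e₃⟩`. -/
def rvec (r : Fin 3 → ℂ) : Fin 7 → ℂ := ![r 0, r 1, r 2, 0, 0, 0, 0]

/-- The coefficients of `(z-1)³(q₀+q₁z+q₂z²+q₃z³)`. -/
def cubeCoeff (q₀ q₁ q₂ q₃ : ℂ) : Fin 7 → ℂ :=
  ![-q₀, 3*q₀ - q₁, -3*q₀ + 3*q₁ - q₂, q₀ - 3*q₁ + 3*q₂ - q₃, q₁ - 3*q₂ + 3*q₃, q₂ - 3*q₃, q₃]

/-- The linear form given by the coefficients of `(z-1)³(z-s)²(e+az)`, which annihilates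
`F₃(1)`, `F₂(s)` and `pvec s a e`. -/
noncomputable def hForm (s a e : ℂ) : (Fin 7 → ℂ) →ₗ[ℂ] ℂ :=
  form (cubeCoeff (s^2*e) (s^2*a - 2*s * e) (e - 2*s * a) a)

/-- The linear form given by the coefficients of `(z-1)³(3c-d+cz)`, which annihilates
`F₃(1)`, `F₂(∞)` and `qvec c d`. -/
noncomputable def mForm (c d : ℂ) : (Fin 7 → ℂ) →ₗ[ℂ] ℂ := form (cubeCoeff (3*c - d) c 0 0)

/-- The linear form given by the coefficients of `(z-s)⁴(κ₀+κ₁z+κ₂z²)`, which annihilates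
`F₄(s)`. -/
noncomputable def kForm (s : ℂ) (κ : Fin 3 → ℂ) : (Fin 7 → ℂ) →ₗ[ℂ] ℂ :=
  form ![s^4*κ 0, -4*s^3*κ 0 + s^4*κ 1, 6*s^2*κ 0 - 4*s^3*κ 1 + s^4*κ 2,
    -4*s * κ 0 + 6*s^2*κ 1 - 4*s^3*κ 2, κ 0 - 4*s * κ 1 + 6*s^2*κ 2, κ 1 - 4*s * κ 2, κ 2]

lemma form_cubeCoeff (q₀ q₁ q₂ q₃ : ℂ) (v : Fin 7 → ℂ) : form (cubeCoeff q₀ q₁ q₂ q₃) v =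
    q₀ * (v 3 - 3*v 2 + 3*v 1 - v 0) + q₁ * (v 4 - 3*v 3 + 3*v 2 - v 1) +
      q₂ * (v 5 - 3*v 4 + 3*v 3 - v 2) + q₃ * (v 6 - 3*v 5 + 3*v 4 - v 3) := by
  simp [form_apply, Fin.sum_univ_seven, cubeCoeff]
  ring

lemma kForm_apply (s : ℂ) (κ : Fin 3 → ℂ) (v : Fin 7 → ℂ) : kForm s κ v =
    κ 0*(s^4*v 0 - 4*s^3*v 1 + 6*s^2*v 2 - 4*s * v 3 + v 4) +
    κ 1*(s^4*v 1 - 4*s^3*v 2 + 6*s^2*v 3 - 4*s * v 4 + v 5) +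
    κ 2*(s^4*v 2 - 4*s^3*v 3 + 6*s^2*v 4 - 4*s * v 5 + v 6) := by
  simp [kForm, form_apply, Fin.sum_univ_seven]
  ring

variable {s a e c d : ℂ} {r κ : Fin 3 → ℂ} {v : Fin 7 → ℂ}

lemma form_cubeCoeff_eq_zero {q₀ q₁ q₂ q₃ : ℂ}
    (hv : v ∈ osc 7 (1 : ℂ) 3) : form (cubeCoeff q₀ q₁ q₂ q₃) v = 0 := by
  obtain ⟨h3, h4, h5, h6⟩ := mem_osc_seven_three.mp hv
  rw [form_cubeCoeff]
  linear_combination q₀ * h3 + q₁ * h4 + q₂ * h5 + q₃ * h6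

lemma hForm_eq_zero (hv : v ∈ osc 7 s 2) : hForm s a e v = 0 := by
  obtain ⟨h2, h3, h4, h5, h6⟩ := mem_osc_seven_two.mp hv
  rw [hForm, form_cubeCoeff]
  linear_combination -e * h2 + (3*e - a) * h3 + (-3*e + 3*a) * h4 + (e - 3*a) * h5 + a * h6

lemma kForm_eq_zero (hv : v ∈ osc 7 s 4) : kForm s κ v = 0 := by
  obtain ⟨h4, h5, h6⟩ := mem_osc_seven_four.mp hv
  rw [kForm_apply, h4, h5, h6]
  ring

lemma hForm_pvec (a e a' e' : ℂ) : hForm s a e (pvec s a' e') = e * a' - a * e' := by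
  rw [hForm, form_cubeCoeff]
  simp [pvec]
  ring

lemma mForm_pvec : mForm c d (pvec s a e) = 0 := by
  rw [mForm, form_cubeCoeff]
  simp [pvec]

lemma mForm_qvec (c d c' d' : ℂ) : mForm c d (qvec c' d') = c * d' - d * c' := by
  rw [mForm, form_cubeCoeff]
  simp [qvec]
  ring

lemma hForm_smul (t : ℂ) : hForm s (t * a) (t * e) = t • hForm s a e := by
  refine LinearMap.ext fun v => ?_
  rw [LinearMap.smul_apply, hForm, hForm, form_cubeCoeff, form_cubeCoeff, smul_eq_mul]
  ring

lemma mForm_smul (t : ℂ) : mForm (t * c) (t * d) = t • mForm c d := by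
  refine LinearMap.ext fun v => ?_
  rw [LinearMap.smul_apply, mForm, mForm, form_cubeCoeff, form_cubeCoeff, smul_eq_mul]
  ring

lemma kForm_smul (t : ℂ) : kForm s (t • κ) = t • kForm s κ := by
  refine LinearMap.ext fun v => ?_
  rw [LinearMap.smul_apply, kForm_apply, kForm_apply, smul_eq_mul]
  simp
  ring

lemma eq_cubeCoeff {x : Fin 7 → ℂ}
    (h : ∀ v ∈ osc 7 (1 : ℂ) 3, form x v = 0) :
    ∃ q₀ q₁ q₂ q₃, x = cubeCoeff q₀ q₁ q₂ q₃ ∧ q₃ = x 6 ∧ q₂ = x 5 + 3*x 6 := by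
  have h0 := h ![1, 0, 0, 1, 3, 6, 10] (mem_osc_seven_three.mpr (by simp; norm_num))
  have h1 := h ![0, 1, 0, -3, -8, -15, -24] (mem_osc_seven_three.mpr (by simp; norm_num))
  have h2 := h ![0, 0, 1, 3, 6, 10, 15] (mem_osc_seven_three.mpr (by simp; norm_num))
  simp [form_apply, Fin.sum_univ_seven] at h0 h1 h2
  refine ⟨x 3 + 3*x 4 + 6*x 5 + 10*x 6, x 4 + 3*x 5 + 6*x 6, x 5 + 3*x 6, x 6, ?_, rfl, rfl⟩
  ext i
  fin_cases i <;> simp [cubeCoeff]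
  · linear_combination h0
  · linear_combination h1
  · linear_combination h2
  · ring
  · ring

lemma exists_hForm (hs : s ≠ 1) {x : Fin 7 → ℂ}
    (h : ∀ v ∈ osc 7 (1 : ℂ) 3, form x v = 0)
    (h' : ∀ v ∈ osc 7 s 2, form x v = 0) : ∃ a e, form x = hForm s a e := by
  obtain ⟨q₀, q₁, q₂, q₃, rfl, -⟩ := eq_cubeCoeff h
  have h0 := h' ![1, 0, -s^2, -2*s^3, -3*s^4, -4*s^5, -5*s^6]
    (mem_osc_seven_two.mpr (by simp; refine ⟨?_, ?_, ?_, ?_⟩ <;> ring))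
  have h1 := h' ![0, 1, 2*s, 3*s^2, 4*s^3, 5*s^4, 6*s^5]
    (mem_osc_seven_two.mpr (by simp; refine ⟨?_, ?_, ?_, ?_⟩ <;> ring))
  rw [form_cubeCoeff] at h0 h1
  simp at h0 h1
  have hs' : s - 1 ≠ 0 := sub_ne_zero.mpr hs
  have hA : q₀ + q₁ * s + q₂ * s^2 + q₃ * s^3 = 0 :=
    (mul_eq_zero.mp (show (s - 1)^3*(q₀ + q₁ * s + q₂ * s^2 + q₃ * s^3) = 0 by
      linear_combination h0 + s * h1)).resolve_left (pow_ne_zero 3 hs')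
  have hB : q₁ + 2*q₂ * s + 3*q₃ * s^2 = 0 :=
    (mul_eq_zero.mp (show (s - 1)^3*(q₁ + 2*q₂ * s + 3*q₃ * s^2) = 0 by
      linear_combination h1 - 3*(s - 1)^2*hA)).resolve_left (pow_ne_zero 3 hs')
  refine ⟨q₃, q₂ + 2*s * q₃, ?_⟩
  rw [hForm]
  congr 2
  · linear_combination hA - s * hB
  · linear_combination hB
  · ring

lemma exists_mForm {x : Fin 7 → ℂ}
    (h : ∀ v ∈ osc 7 (1 : ℂ) 3, form x v = 0)
    (h' : ∀ v ∈ osc 7 ∞ 2, form x v = 0) : ∃ c d, form x = mForm c d := by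
  obtain ⟨q₀, q₁, q₂, q₃, hx, h3, h2⟩ := eq_cubeCoeff h
  have h5 := h' ![0, 0, 0, 0, 0, 1, 0] (mem_osc_seven_infty_two.mpr (by simp))
  have h6 := h' ![0, 0, 0, 0, 0, 0, 1] (mem_osc_seven_infty_two.mpr (by simp))
  simp [form_apply, Fin.sum_univ_seven] at h5 h6
  rw [h6] at h3
  rw [h5, h6] at h2
  refine ⟨q₁, 3*q₁ - q₀, ?_⟩
  rw [hx, mForm, h3, h2]
  congr 2 <;> ring

lemma exists_kForm {x : Fin 7 → ℂ} (h : ∀ v ∈ osc 7 s 4, form x v = 0) :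
    ∃ κ, form x = kForm s κ := by
  have h0 := h ![1, 0, 0, 0, -s^4, -4*s^5, -10*s^6]
    (mem_osc_seven_four.mpr (by simp; refine ⟨?_, ?_⟩ <;> ring))
  have h1 := h ![0, 1, 0, 0, 4*s^3, 15*s^4, 36*s^5]
    (mem_osc_seven_four.mpr (by simp; refine ⟨?_, ?_⟩ <;> ring))
  have h2 := h ![0, 0, 1, 0, -6*s^2, -20*s^3, -45*s^4]
    (mem_osc_seven_four.mpr (by simp; refine ⟨?_, ?_⟩ <;> ring))
  have h3 := h ![0, 0, 0, 1, 4*s, 10*s^2, 20*s^3]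
    (mem_osc_seven_four.mpr (by simp; refine ⟨?_, ?_⟩ <;> ring))
  simp [form_apply, Fin.sum_univ_seven] at h0 h1 h2 h3
  refine ⟨![x 4 + 4*s * x 5 + 10*s^2*x 6, x 5 + 4*s * x 6, x 6], ?_⟩
  rw [kForm]
  congr 1
  ext i
  fin_cases i <;> simp
  · linear_combination h0
  · linear_combination h1
  · linear_combination h2
  · linear_combination h3
  · ring

lemma exists_hForm_ne_zero (hae : a ≠ 0 ∨ e ≠ 0) : ∃ y z, hForm s a e (pvec s y z) = 1 := by
  obtain ⟨y, z, hyz⟩ := exists_dual hae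
  exact ⟨z, -y, by rw [hForm_pvec]; linear_combination hyz⟩

lemma exists_mForm_ne_zero (hs : s ≠ 1) (hcd : c ≠ 0 ∨ d ≠ 0) :
    ∃ u ∈ osc 7 s 2, mForm c d u = 1 := by
  have hs' : s - 1 ≠ 0 := sub_ne_zero.mpr hs
  suffices ∃ u ∈ osc 7 s 2, mForm c d u ≠ 0 by
    obtain ⟨u, hu, hu0⟩ := this
    exact ⟨(mForm c d u)⁻¹ • u, Submodule.smul_mem _ _ hu, by
      rw [_root_.map_smul, smul_eq_mul, inv_mul_cancel₀ hu0]⟩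
  by_contra! h
  have h0 := h ![1, 0, -s^2, -2*s^3, -3*s^4, -4*s^5, -5*s^6]
    (mem_osc_seven_two.mpr (by simp; refine ⟨?_, ?_, ?_, ?_⟩ <;> ring))
  have h1 := h ![0, 1, 2*s, 3*s^2, 4*s^3, 5*s^4, 6*s^5]
    (mem_osc_seven_two.mpr (by simp; refine ⟨?_, ?_, ?_, ?_⟩ <;> ring))
  rw [mForm, form_cubeCoeff] at h0 h1
  simp at h0 h1
  have hA : 3*c - d + c * s = 0 :=
    (mul_eq_zero.mp (show (s - 1)^3*(3*c - d + c * s) = 0 by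
      linear_combination h0 + s * h1)).resolve_left (pow_ne_zero 3 hs')
  have hc : c = 0 := (mul_eq_zero.mp (show (s - 1)^3*c = 0 by
      linear_combination h1 - 3*(s - 1)^2*hA)).resolve_left (pow_ne_zero 3 hs')
  exact hcd.elim (fun h => h hc) fun h => h (by linear_combination -hA + (3 + s) * hc)

lemma exists_kForm_ne_zero (hs : s ≠ 1) (hκ : κ ≠ 0) : ∃ u ∈ osc 7 (1 : ℂ) 3, kForm s κ u = 1 := by
  have hs' : 1 - s ≠ 0 := sub_ne_zero.mpr hs.symm
  suffices ∃ u ∈ osc 7 (1 : ℂ) 3, kForm s κ u ≠ 0 by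
    obtain ⟨u, hu, hu0⟩ := this
    exact ⟨(kForm s κ u)⁻¹ • u, Submodule.smul_mem _ _ hu, by
      rw [_root_.map_smul, smul_eq_mul, inv_mul_cancel₀ hu0]⟩
  by_contra! h
  have h0 := h ![1, 1, 1, 1, 1, 1, 1] (mem_osc_seven_three.mpr (by simp))
  have h1 := h ![0, 1, 2, 3, 4, 5, 6] (mem_osc_seven_three.mpr (by simp; norm_num))
  have h2 := h ![0, 0, 1, 3, 6, 10, 15] (mem_osc_seven_three.mpr (by simp; norm_num))
  rw [kForm_apply] at h0 h1 h2
  simp at h0 h1 h2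
  have e0 : κ 0 + κ 1 + κ 2 = 0 :=
    (mul_eq_zero.mp (show (1 - s)^4*(κ 0 + κ 1 + κ 2) = 0 by
      linear_combination h0)).resolve_left (pow_ne_zero 4 hs')
  have e1 : κ 1 + 2*κ 2 = 0 :=
    (mul_eq_zero.mp (show (1 - s)^4*(κ 1 + 2*κ 2) = 0 by
      linear_combination h1 - 4*(1 - s)^3*e0)).resolve_left (pow_ne_zero 4 hs')
  have e2 : κ 2 = 0 :=
    (mul_eq_zero.mp (show (1 - s)^4*κ 2 = 0 by
      linear_combination h2 - 6*(1 - s)^2*e0 - 4*(1 - s)^3*e1)).resolve_left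
      (pow_ne_zero 4 hs')
  have e1' : κ 1 = 0 := by linear_combination e1 - 2*e2
  have e0' : κ 0 = 0 := by linear_combination e0 - e1' - e2
  refine hκ (funext fun i => ?_)
  fin_cases i
  exacts [e0', e1', e2]

/-- Vectors dual to the three linear forms. -/
lemma exists_dual_vectors (hs : s ≠ 1) (hae : a ≠ 0 ∨ e ≠ 0) (hcd : c ≠ 0 ∨ d ≠ 0) (hκ : κ ≠ 0) :
    ∃ x, ∃ y ∈ osc 7 s 2, ∃ z ∈ osc 7 (1 : ℂ) 3,
      (hForm s a e x = 1 ∧ mForm c d x = 0 ∧ kForm s κ x = 0) ∧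
      (hForm s a e y = 0 ∧ mForm c d y = 1 ∧ kForm s κ y = 0) ∧
      (hForm s a e z = 0 ∧ mForm c d z = 0 ∧ kForm s κ z = 1) := by
  obtain ⟨x₁, x₂, hx⟩ := exists_hForm_ne_zero (s := s) hae
  obtain ⟨y, hy, hy1⟩ := exists_mForm_ne_zero hs hcd
  obtain ⟨z, hz, hz1⟩ := exists_kForm_ne_zero hs hκ
  have hy2 : kForm s κ y = 0 := kForm_eq_zero (osculatingSpace_mono 7 _ (by norm_num) hy)
  have hz2 : hForm s a e z = 0 := form_cubeCoeff_eq_zero hz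
  have hz3 : mForm c d z = 0 := form_cubeCoeff_eq_zero hz
  refine ⟨pvec s x₁ x₂ - kForm s κ (pvec s x₁ x₂) • z, y, hy, z, hz, ⟨?_, ?_, ?_⟩,
    ⟨hForm_eq_zero hy, hy1, hy2⟩, hz2, hz3, hz1⟩
  · rw [_root_.map_sub, _root_.map_smul, hx, hz2, smul_zero, sub_zero]
  · rw [_root_.map_sub, _root_.map_smul, mForm_pvec, hz3, smul_zero, sub_zero]
  · rw [_root_.map_sub, _root_.map_smul, hz1, smul_eq_mul, mul_one, sub_self]

lemma finrank_ker_inf_three {n : ℕ} {f g h : (Fin n → ℂ) →ₗ[ℂ] ℂ} {x y z : Fin n → ℂ}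
    (hx : f x = 1) (hy : f y = 0) (hy' : g y = 1) (hz : f z = 0) (hz' : g z = 0) (hz'' : h z = 1) :
    dim ↥(LinearMap.ker f ⊓ LinearMap.ker g ⊓ LinearMap.ker h) + 3 = n := by
  have h1 := finrank_inf_ker (S := ⊤) (f := f) (x := x) Submodule.mem_top (by rw [hx]; exact one_ne_zero)
  rw [top_inf_eq, finrank_top, Module.finrank_fin_fun] at h1
  have h2 := finrank_inf_ker (S := LinearMap.ker f) (f := g) (x := y) hy
    (by rw [hy']; exact one_ne_zero)
  have h3 := finrank_inf_ker (S := LinearMap.ker f ⊓ LinearMap.ker g) (f := h) (x := z) ⟨hz, hz'⟩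
    (by rw [hz'']; exact one_ne_zero)
  omega

/-- Two subspaces whose sum is proper are annihilated by a linear form. -/
lemma exists_form_ne_zero {n : ℕ} {A B : Submodule ℂ (Fin n → ℂ)}
    (h : dim A + dim B < n + dim ↥(A ⊓ B)) :
    ∃ c : Fin n → ℂ, form c ≠ 0 ∧ (∀ v ∈ A, form c v = 0) ∧ ∀ v ∈ B, form c v = 0 := by
  obtain ⟨c, hc, h1, h2⟩ := exists_form h
  refine ⟨c, fun h0 => hc (funext fun i => ?_), fun v hv => (form_apply c v).trans (h1 v hv),
    fun v hv => (form_apply c v).trans (h2 v hv)⟩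
  have := LinearMap.congr_fun h0 (Pi.single i 1)
  rw [form_apply] at this
  simpa [Pi.single_apply] using this

/-- The span of the three vectors. -/
noncomputable def spanC (s a e c d : ℂ) (r : Fin 3 → ℂ) : Submodule ℂ (Fin 7 → ℂ) :=
  Submodule.span ℂ (Set.range ![rvec r, qvec c d, pvec s a e])

lemma mem_spanC : v ∈ spanC s a e c d r ↔
    ∃ x y z : ℂ, v = x • rvec r + y • qvec c d + z • pvec s a e := by
  rw [spanC, Submodule.mem_span_range_iff_exists_fun]
  constructor
  · rintro ⟨t, rfl⟩
    exact ⟨t 0, t 1, t 2, by simp [Fin.sum_univ_three]⟩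
  · rintro ⟨x, y, z, rfl⟩
    exact ⟨![x, y, z], by simp [Fin.sum_univ_three]⟩

lemma combination_apply (x y z : ℂ) : x • rvec r + y • qvec c d + z • pvec s a e =
    ![x * r 0, x * r 1, x * r 2, y * c, y * d, z * a, z * ((2*s + 3) * a - e)] := by
  ext i
  fin_cases i <;> simp [rvec, qvec, pvec]

lemma combination_eq_zero (hae : a ≠ 0 ∨ e ≠ 0) (hcd : c ≠ 0 ∨ d ≠ 0) (hr : r ≠ 0) {x y z : ℂ}
    (h : x • rvec r + y • qvec c d + z • pvec s a e = 0) : x = 0 ∧ y = 0 ∧ z = 0 := by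
  rw [combination_apply] at h
  have h' := fun i => congrFun h i
  simp only [Fin.forall_fin_succ, Matrix.cons_val_zero, Matrix.cons_val_succ, Pi.zero_apply] at h'
  obtain ⟨h0, h1, h2, h3, h4, h5, h6, -⟩ := h'
  refine ⟨?_, ?_, ?_⟩
  · rcases exists_ne_zero_fin_three hr with hr | hr | hr
    exacts [(mul_eq_zero.mp h0).resolve_right hr, (mul_eq_zero.mp h1).resolve_right hr,
      (mul_eq_zero.mp h2).resolve_right hr]
  · rcases hcd with hc | hd
    exacts [(mul_eq_zero.mp h3).resolve_right hc, (mul_eq_zero.mp h4).resolve_right hd]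
  · rcases hae with ha | he
    · exact (mul_eq_zero.mp h5).resolve_right ha
    · exact (mul_eq_zero.mp (show z * e = 0 by
        linear_combination (2*s + 3) * h5 - h6)).resolve_right he

lemma finrank_spanC (hae : a ≠ 0 ∨ e ≠ 0) (hcd : c ≠ 0 ∨ d ≠ 0) (hr : r ≠ 0) :
    dim (spanC s a e c d r) = 3 := by
  rw [spanC, finrank_span_eq_card, Fintype.card_fin]
  rw [Fintype.linearIndependent_iff]
  intro t ht
  rw [Fin.sum_univ_three] at ht
  obtain ⟨h0, h1, h2⟩ := combination_eq_zero hae hcd hr ht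
  intro i
  fin_cases i
  exacts [h0, h1, h2]

/-- The flag `E` is given by `(a,e)`, `(c,d)`, `r` and `κ`. -/
structure IsFlagC (s : ℂ) (E : PartialFlag typeC 7) (a e c d : ℂ) (r κ : Fin 3 → ℂ) : Prop where
  ae : a ≠ 0 ∨ e ≠ 0
  cd : c ≠ 0 ∨ d ≠ 0
  r_ne : r ≠ 0
  κ_ne : κ ≠ 0
  mem_zero : ∀ v, v ∈ E.space 0 ↔ ∃ x y z : ℂ, v = x • rvec r + y • qvec c d + z • pvec s a e
  mem_one : ∀ v, v ∈ E.space 1 ↔ hForm s a e v = 0 ∧ mForm c d v = 0 ∧ kForm s κ v = 0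

/-- The equations of the intersection. -/
structure EquationsC (s a e c d : ℂ) (r κ : Fin 3 → ℂ) : Prop where
  hq : hForm s a e (qvec c d) = 0
  hr : hForm s a e (rvec r) = 0
  mr : mForm c d (rvec r) = 0
  kp : kForm s κ (pvec s a e) = 0
  kq : kForm s κ (qvec c d) = 0
  kr : kForm s κ (rvec r) = 0

/-- Every flag in the intersection is given by a solution of the equations. -/
lemma exists_isFlagC {E : PartialFlag typeC 7} {x : Fin 1 → ℂ} (hs : x 0 ≠ 1)
    (hE : E ∈ intersection typeC condC (pointsAt pointsC x)) :
    ∃ a e c d r κ, IsFlagC (x 0) E a e c d r κ ∧ EquationsC (x 0) a e c d r κ := by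
  obtain ⟨⟨k1, k2⟩, ⟨k3, k4⟩, ⟨k5, k6⟩, k7⟩ := mem_intersection_C.mp hE
  have f0 : dim (E.space 0) = 3 := E.finrank_eq 0
  have f1 : dim (E.space 1) = 4 := E.finrank_eq 1
  have hE01 : E.space 0 ≤ E.space 1 := E.monotone (by decide)
  obtain ⟨p, ⟨hp, hp'⟩, hp0⟩ := exists_ne_zero_of_one_le_finrank k1
  obtain ⟨p0, p1, p2, p3, p4⟩ := mem_osc_seven_infty_two.mp hp'
  obtain ⟨a, e, rfl⟩ : ∃ a e, p = pvec (x 0) a e := ⟨p 5, (2*x 0 + 3) * p 5 - p 6, by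
    ext i; fin_cases i <;> simp [pvec, p0, p1, p2, p3, p4]⟩
  have hae : a ≠ 0 ∨ e ≠ 0 := by
    by_contra! h
    refine hp0 ?_
    rw [h.1, h.2]
    ext i; fin_cases i <;> simp [pvec]
  obtain ⟨r', ⟨hr, hr'⟩, hr0⟩ := exists_ne_zero_of_one_le_finrank k3
  obtain ⟨r3, r4, r5, r6⟩ := mem_osc_seven_zero_three.mp hr'
  obtain ⟨r, rfl⟩ : ∃ r, r' = rvec r := ⟨![r' 0, r' 1, r' 2], by
    ext i; fin_cases i <;> simp [rvec, r3, r4, r5, r6]⟩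
  have hrne : r ≠ 0 := by
    rintro rfl
    refine hr0 ?_
    ext i; fin_cases i <;> simp [rvec]
  obtain ⟨q, ⟨⟨hq, hq'⟩, -, hq''⟩, hq0⟩ := exists_ne_zero_of_one_le_finrank
    (S := (E.space 0 ⊓ osc 7 ∞ 4) ⊓
      (E.space 0 ⊓ osc 7 (0 : ℂ) 5)) (by
    have h1 := Submodule.finrank_sup_add_finrank_inf_eq (E.space 0 ⊓ osc 7 ∞ 4)
      (E.space 0 ⊓ osc 7 (0 : ℂ) 5)
    have h2 : dim ↥(E.space 0 ⊓ osc 7 ∞ 4 ⊔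
        E.space 0 ⊓ osc 7 (0 : ℂ) 5) ≤ dim (E.space 0) :=
      Submodule.finrank_mono (sup_le inf_le_left inf_le_left)
    omega)
  obtain ⟨q0, q1, q2⟩ := mem_osc_seven_infty_four.mp hq'
  obtain ⟨q5, q6⟩ := mem_osc_seven_zero_five.mp hq''
  obtain ⟨c, d, rfl⟩ : ∃ c d, q = qvec c d := ⟨q 3, q 4, by
    ext i; fin_cases i <;> simp [qvec, q0, q1, q2, q5, q6]⟩
  have hcd : c ≠ 0 ∨ d ≠ 0 := by
    by_contra! h
    refine hq0 ?_
    rw [h.1, h.2]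
    ext i; fin_cases i <;> simp [qvec]
  have hsp : spanC (x 0) a e c d r = E.space 0 := by
    refine Submodule.eq_of_le_of_finrank_le (Submodule.span_le.mpr ?_)
      (by rw [f0, finrank_spanC hae hcd hrne])
    rintro - ⟨i, rfl⟩
    fin_cases i
    exacts [hr, hq, hp]
  have g1 := Submodule.finrank_sup_add_finrank_inf_eq (E.space 1)
    (osc 7 (1 : ℂ) 3)
  have g2 := Submodule.finrank_sup_add_finrank_inf_eq (E.space 1)
    (osc 7 (x 0) 2)
  rw [finrank_osculatingSpace _ (by norm_num)] at g1 g2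
  have hh : ∀ v ∈ E.space 1, hForm (x 0) a e v = 0 := by
    obtain ⟨w, hw, h1, h2⟩ := exists_form_ne_zero
      (A := E.space 1 ⊔ osc 7 (1 : ℂ) 3)
      (B := E.space 1 ⊔ osc 7 (x 0) 2) (by
        have : dim (E.space 1) ≤ Module.finrank ℂ
            ↥((E.space 1 ⊔ osc 7 (1 : ℂ) 3) ⊓
              (E.space 1 ⊔ osc 7 (x 0) 2)) :=
          Submodule.finrank_mono (le_inf le_sup_left le_sup_left)
        omega)
    obtain ⟨a', e', h⟩ := exists_hForm hs (fun v hv => h1 v (Submodule.mem_sup_right hv))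
      fun v hv => h2 v (Submodule.mem_sup_right hv)
    have hpw := h1 _ (Submodule.mem_sup_left (hE01 hp))
    rw [h, hForm_pvec] at hpw
    obtain ⟨t, rfl, rfl⟩ := exists_mul_of_cross hae (x := a') (y := e') (by linear_combination -hpw)
    rw [hForm_smul] at h
    have ht : t ≠ 0 := by
      rintro rfl
      rw [zero_smul] at h
      exact hw h
    intro v hv
    have := h1 v (Submodule.mem_sup_left hv)
    rw [h, LinearMap.smul_apply, smul_eq_mul] at this
    exact (mul_eq_zero.mp this).resolve_left ht
  have hm : ∀ v ∈ E.space 1, mForm c d v = 0 := by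
    obtain ⟨w, hw, h1, h2⟩ := exists_form_ne_zero
      (A := E.space 1 ⊔ osc 7 (1 : ℂ) 3) (B := osc 7 ∞ 2) (by
        have := one_le_finrank_of_mem (S := (E.space 1 ⊔ osc 7 (1 : ℂ) 3) ⊓
          osc 7 ∞ 2) ⟨Submodule.mem_sup_left (hE01 hp), hp'⟩ hp0
        rw [finrank_osculatingSpace _ (by norm_num)]
        omega)
    obtain ⟨c', d', h⟩ := exists_mForm (fun v hv => h1 v (Submodule.mem_sup_right hv)) h2
    have hqw := h1 _ (Submodule.mem_sup_left (hE01 hq))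
    rw [h, mForm_qvec] at hqw
    obtain ⟨t, rfl, rfl⟩ := exists_mul_of_cross hcd (x := c') (y := d') (by linear_combination hqw)
    rw [mForm_smul] at h
    have ht : t ≠ 0 := by
      rintro rfl
      rw [zero_smul] at h
      exact hw h
    intro v hv
    have := h1 v (Submodule.mem_sup_left hv)
    rw [h, LinearMap.smul_apply, smul_eq_mul] at this
    exact (mul_eq_zero.mp this).resolve_left ht
  obtain ⟨w, hw, h1, h2⟩ := exists_form_ne_zero (A := E.space 1)
    (B := osc 7 (x 0) 4) (by
      rw [finrank_osculatingSpace _ (by norm_num)]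
      omega)
  obtain ⟨κ, h⟩ := exists_kForm h2
  rw [h] at hw h1
  have hκ : κ ≠ 0 := by
    rintro rfl
    refine hw (LinearMap.ext fun v => ?_)
    rw [kForm_apply]
    simp
  obtain ⟨u, v, -, w, -, ⟨u1, -, -⟩, ⟨v1, v2, -⟩, w1, w2, w3⟩ := exists_dual_vectors hs hae hcd hκ
  have hker := finrank_ker_inf_three u1 v1 v2 w1 w2 w3
  have hE1 := Submodule.eq_of_le_of_finrank_le (S₁ := E.space 1)
    (S₂ := LinearMap.ker (hForm (x 0) a e) ⊓ LinearMap.ker (mForm c d) ⊓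
      LinearMap.ker (kForm (x 0) κ)) (fun v hv => ⟨⟨hh v hv, hm v hv⟩, h1 v hv⟩) (by rw [f1]; omega)
  refine ⟨a, e, c, d, r, κ, ⟨hae, hcd, hrne, hκ, fun v => ?_, fun v => ?_⟩,
    hh _ (hE01 hq), hh _ (hE01 hr), hm _ (hE01 hr), h1 _ (hE01 hp), h1 _ (hE01 hq), h1 _ (hE01 hr)⟩
  · rw [← hsp, mem_spanC]
  · rw [hE1, Submodule.mem_inf, Submodule.mem_inf, LinearMap.mem_ker, LinearMap.mem_ker,
      LinearMap.mem_ker, and_assoc]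

lemma two_le_finrank_of_mem {n : ℕ} {S : Submodule ℂ (Fin n → ℂ)} {u v : Fin n → ℂ} (hu : u ∈ S)
    (hv : v ∈ S) (h : ∀ x y : ℂ, x • u + y • v = 0 → x = 0 ∧ y = 0) : 2 ≤ dim S := by
  refine le_finrank_of_injective (Fintype.linearCombination ℂ ![u, v]) (fun t ht => ?_) fun t => ?_
  · simp only [Fintype.linearCombination_apply, Fin.sum_univ_two, Matrix.cons_val] at ht
    obtain ⟨h0, h1⟩ := h _ _ ht
    ext i
    fin_cases i
    exacts [h0, h1]
  · simp only [Fintype.linearCombination_apply, Fin.sum_univ_two, Matrix.cons_val]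
    exact S.add_mem (S.smul_mem _ hu) (S.smul_mem _ hv)

/-- Every solution of the equations defines a flag in the intersection. -/
lemma exists_flag_of_equationsC {x : Fin 1 → ℂ} (hs : x 0 ≠ 1) (hae : a ≠ 0 ∨ e ≠ 0)
    (hcd : c ≠ 0 ∨ d ≠ 0) (hr : r ≠ 0) (hκ : κ ≠ 0) (heq : EquationsC (x 0) a e c d r κ) :
    ∃ E ∈ intersection typeC condC (pointsAt pointsC x), IsFlagC (x 0) E a e c d r κ := by
  obtain ⟨u, v, hv, w, hw, ⟨u1, -, -⟩, ⟨v1, v2, -⟩, w1, w2, w3⟩ :=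
    exists_dual_vectors hs hae hcd hκ
  have hker := finrank_ker_inf_three u1 v1 v2 w1 w2 w3
  set S := LinearMap.ker (hForm (x 0) a e) ⊓ LinearMap.ker (mForm c d) ⊓
    LinearMap.ker (kForm (x 0) κ) with hS
  have hmemS : ∀ v, v ∈ S ↔ hForm (x 0) a e v = 0 ∧ mForm c d v = 0 ∧ kForm (x 0) κ v = 0 := by
    intro v
    rw [hS, Submodule.mem_inf, Submodule.mem_inf, LinearMap.mem_ker, LinearMap.mem_ker,
      LinearMap.mem_ker, and_assoc]
  have h01 : spanC (x 0) a e c d r ≤ S := by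
    refine Submodule.span_le.mpr ?_
    rintro - ⟨i, rfl⟩
    rw [SetLike.mem_coe, hmemS]
    fin_cases i
    · exact ⟨heq.hr, heq.mr, heq.kr⟩
    · exact ⟨heq.hq, by simp [mForm_qvec, mul_comm], heq.kq⟩
    · exact ⟨by simp [hForm_pvec, mul_comm], by simp [mForm_pvec], heq.kp⟩
  let E : PartialFlag typeC 7 :=
    { space := ![spanC (x 0) a e c d r, S]
      monotone := by
        refine Fin.monotone_iff_le_succ.mpr fun i => ?_
        fin_cases i
        exact h01
      finrank_eq := by
        intro i
        fin_cases i
        exacts [finrank_spanC hae hcd hr, by change dim S = 4; omega] }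
  have hp : pvec (x 0) a e ∈ spanC (x 0) a e c d r := mem_spanC.mpr ⟨0, 0, 1, by simp⟩
  have hq : qvec c d ∈ spanC (x 0) a e c d r := mem_spanC.mpr ⟨0, 1, 0, by simp⟩
  have hr' : rvec r ∈ spanC (x 0) a e c d r := mem_spanC.mpr ⟨1, 0, 0, by simp⟩
  have hne := @combination_eq_zero (x 0) a e c d r hae hcd hr
  refine ⟨E, mem_intersection_C.mpr ⟨⟨?_, ?_⟩, ⟨?_, ?_⟩, ⟨?_, ?_⟩, ?_⟩, hae, hcd, hr, hκ,
    fun v => mem_spanC, hmemS⟩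
  · refine one_le_finrank_of_mem ⟨hp, mem_osc_seven_infty_two.mpr (by simp [pvec])⟩ fun h => ?_
    exact one_ne_zero (hne (x := 0) (y := 0) (z := 1) (by simp [h])).2.2
  · exact two_le_finrank_of_mem ⟨hp, mem_osc_seven_infty_four.mpr (by simp [pvec])⟩
      ⟨hq, mem_osc_seven_infty_four.mpr (by simp [qvec])⟩ fun y z h =>
      (hne (x := 0) (y := z) (z := y) (by rw [zero_smul, zero_add, add_comm, h])).2.symm
  · refine one_le_finrank_of_mem ⟨hr', mem_osc_seven_zero_three.mpr (by simp [rvec])⟩ fun h => ?_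
    exact one_ne_zero (hne (x := 1) (y := 0) (z := 0) (by simp [h])).1
  · refine two_le_finrank_of_mem ⟨hr', mem_osc_seven_zero_five.mpr (by simp [rvec])⟩
      ⟨hq, mem_osc_seven_zero_five.mpr (by simp [qvec])⟩ fun y z h => ?_
    obtain ⟨h1, h2, -⟩ := hne (x := y) (y := z) (z := 0) (by rw [zero_smul, add_zero, h])
    exact ⟨h1, h2⟩
  · have h2 := finrank_inf_ker (S := osc 7 (x 0) 2) (f := mForm c d) hv
      (by rw [v2]; exact one_ne_zero)
    rw [finrank_osculatingSpace _ (by norm_num)] at h2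
    have h3 : dim ↥(osc 7 (x 0) 2 ⊓ LinearMap.ker (mForm c d)) ≤ dim ↥(S ⊓ osc 7 (x 0) 2) :=
      Submodule.finrank_mono fun y hy => ⟨(hmemS y).mpr ⟨hForm_eq_zero hy.1, hy.2,
        kForm_eq_zero (osculatingSpace_mono 7 _ (by norm_num) hy.1)⟩, hy.1⟩
    change 1 ≤ dim ↥(S ⊓ osc 7 (x 0) 2)
    omega
  · have := le_finrank_add_of_equations (S := S ⊓ osc 7 (x 0) 4)
      (LinearMap.pi ![hForm (x 0) a e, mForm c d, form ![x 0^4, -4*x 0^3, 6*x 0^2, -4*x 0, 1, 0, 0],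
        form ![0, x 0^4, -4*x 0^3, 6*x 0^2, -4*x 0, 1, 0],
        form ![0, 0, x 0^4, -4*x 0^3, 6*x 0^2, -4*x 0, 1]]) (by
          intro y hy
          have h0 : hForm (x 0) a e y = 0 := congrFun hy 0
          have h1 : mForm c d y = 0 := congrFun hy 1
          have h2 := congrFun hy 2
          have h3 := congrFun hy 3
          have h4 := congrFun hy 4
          simp [form_apply, Fin.sum_univ_seven] at h2 h3 h4
          have hy4 : y ∈ osc 7 (x 0) 4 := mem_osc_seven_four.mpr
            ⟨by linear_combination h2, by linear_combination h3, by linear_combination h4⟩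
          exact ⟨(hmemS y).mpr ⟨h0, h1, kForm_eq_zero hy4⟩, hy4⟩)
    change 2 ≤ dim ↥(S ⊓ osc 7 (x 0) 4)
    omega
  · have h2 := finrank_inf_ker (S := osc 7 (1 : ℂ) 3) (f := kForm (x 0) κ)
      hw (by rw [w3]; exact one_ne_zero)
    rw [finrank_osculatingSpace _ (by norm_num)] at h2
    have h3 : dim ↥(osc 7 (1 : ℂ) 3 ⊓
        LinearMap.ker (kForm (x 0) κ)) ≤ dim ↥(S ⊓ osc 7 (1 : ℂ) 3) :=
      Submodule.finrank_mono fun y hy => ⟨(hmemS y).mpr ⟨form_cubeCoeff_eq_zero hy.1,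
        form_cubeCoeff_eq_zero hy.1, hy.2⟩, hy.1⟩
    change 2 ≤ dim ↥(S ⊓ osc 7 (1 : ℂ) 3)
    omega

end ProblemC

/-- A linear form on `S` that vanishes on `S ∩ G` extends to one that vanishes on `G`. -/
lemma exists_form_extension {n : ℕ} {S G : Submodule ℂ (Fin n → ℂ)} (f : (Fin n → ℂ) →ₗ[ℂ] ℂ)
    (h : ∀ v ∈ S, v ∈ G → f v = 0) : ∃ c, (∀ v ∈ S, form c v = f v) ∧ ∀ v ∈ G, form c v = 0 := by
  have hf : f ∈ (S ⊓ G).dualAnnihilator :=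
    (Submodule.mem_dualAnnihilator _).mpr fun v hv => h v hv.1 hv.2
  rw [Subspace.dualAnnihilator_inf_eq] at hf
  obtain ⟨f₁, h₁, f₂, h₂, rfl⟩ := Submodule.mem_sup.mp hf
  have hfe : ∀ v, form (fun i => f₂ (Pi.single i 1)) v = f₂ v := by
    intro v
    conv_rhs => rw [pi_eq_sum_univ' v]
    simp [form_apply, _root_.map_sum, mul_comm]
  refine ⟨fun i => f₂ (Pi.single i 1), fun v hv => ?_, fun v hv => ?_⟩
  · rw [hfe, LinearMap.add_apply, (Submodule.mem_dualAnnihilator _).mp h₁ v hv, zero_add]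
  · rw [hfe, (Submodule.mem_dualAnnihilator _).mp h₂ v hv]

lemma finrank_le_two_of_combination {n : ℕ} {S : Submodule ℂ (Fin n → ℂ)} (p q : Fin n → ℂ)
    (h : ∀ v ∈ S, ∃ x y : ℂ, v = x • p + y • q) : dim S ≤ 2 := by
  refine (Submodule.finrank_mono (t := Submodule.span ℂ (Set.range ![p, q])) fun v hv => ?_).trans
    ((finrank_range_le_card (R := ℂ) ![p, q]).trans (by simp))
  obtain ⟨x, y, rfl⟩ := h v hv
  exact add_mem (Submodule.smul_mem _ _ (Submodule.subset_span ⟨0, rfl⟩))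
    (Submodule.smul_mem _ _ (Submodule.subset_span ⟨1, rfl⟩))

section TangentC

variable {E : PartialFlag typeC 7} {x : Fin 1 → ℂ} {s a e c d : ℂ} {r κ : Fin 3 → ℂ}
  {ψ : Module.End ℂ (Fin 7 → ℂ)} {v : Fin 7 → ℂ}

/-- The linearised equations. -/
structure LinearisedC (s a e c d : ℂ) (r κ : Fin 3 → ℂ) (a' e' c' d' : ℂ) (r' κ' : Fin 3 → ℂ) :
    Prop where
  hq : hForm s a' e' (qvec c d) + hForm s a e (qvec c' d') = 0
  hr : hForm s a' e' (rvec r) + hForm s a e (rvec r') = 0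
  mr : mForm c' d' (rvec r) + mForm c d (rvec r') = 0
  kp : kForm s κ' (pvec s a e) + kForm s κ (pvec s a' e') = 0
  kq : kForm s κ' (qvec c d) + kForm s κ (qvec c' d') = 0
  kr : kForm s κ' (rvec r) + kForm s κ (rvec r') = 0

lemma pvec_smul (t : ℂ) : pvec s (t * a) (t * e) = t • pvec s a e := by
  ext i; fin_cases i <;> simp [pvec]; ring

lemma qvec_smul (t : ℂ) : qvec (t * c) (t * d) = t • qvec c d := by
  ext i; fin_cases i <;> simp [qvec]

lemma rvec_smul (t : ℂ) : rvec (t • r) = t • rvec r := by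
  ext i; fin_cases i <;> simp [rvec]

lemma eq_pvec (h : v ∈ osc 7 ∞ 2) : ∃ a e, v = pvec s a e := by
  obtain ⟨h0, h1, h2, h3, h4⟩ := mem_osc_seven_infty_two.mp h
  exact ⟨v 5, (2*s + 3) * v 5 - v 6, by ext i; fin_cases i <;> simp [pvec, h0, h1, h2, h3, h4]⟩

lemma eq_rvec (h : v ∈ osc 7 (0 : ℂ) 3) : ∃ r, v = rvec r := by
  obtain ⟨h3, h4, h5, h6⟩ := mem_osc_seven_zero_three.mp h
  exact ⟨![v 0, v 1, v 2], by ext i; fin_cases i <;> simp [rvec, h3, h4, h5, h6]⟩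

lemma pvec_mem : pvec s a e ∈ osc 7 ∞ 2 := mem_osc_seven_infty_two.mpr (by simp [pvec])

lemma qvec_mem : qvec c d ∈ osc 7 ∞ 4 := mem_osc_seven_infty_four.mpr (by simp [qvec])

lemma qvec_mem' : qvec c d ∈ osc 7 (0 : ℂ) 5 :=
  mem_osc_seven_zero_five.mpr (by simp [qvec])

lemma rvec_mem : rvec r ∈ osc 7 (0 : ℂ) 3 :=
  mem_osc_seven_zero_three.mpr (by simp [rvec])

lemma kForm_injective {κ' : Fin 3 → ℂ} (h : kForm s κ = kForm s κ') : κ = κ' := by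
  have h0 := LinearMap.congr_fun h ![0, 0, 0, 0, 1, 4*s, 10*s^2]
  have h1 := LinearMap.congr_fun h ![0, 0, 0, 0, 0, 1, 4*s]
  have h2 := LinearMap.congr_fun h ![0, 0, 0, 0, 0, 0, 1]
  rw [kForm_apply, kForm_apply] at h0 h1 h2
  simp at h0 h1 h2
  have e0 : κ 0 = κ' 0 := by linear_combination h0
  ext i
  fin_cases i
  exacts [e0, h1, h2]

namespace IsFlagC

lemma p_mem (h : IsFlagC s E a e c d r κ) : pvec s a e ∈ E.space 0 :=
  (h.mem_zero _).mpr ⟨0, 0, 1, by simp⟩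

lemma q_mem (h : IsFlagC s E a e c d r κ) : qvec c d ∈ E.space 0 :=
  (h.mem_zero _).mpr ⟨0, 1, 0, by simp⟩

lemma r_mem (h : IsFlagC s E a e c d r κ) : rvec r ∈ E.space 0 :=
  (h.mem_zero _).mpr ⟨1, 0, 0, by simp⟩

lemma head_eq_zero (h : IsFlagC s E a e c d r κ) {x : ℂ}
    (h0 : x * r 0 = 0) (h1 : x * r 1 = 0) (h2 : x * r 2 = 0) : x = 0 := by
  rcases exists_ne_zero_fin_three h.r_ne with hr | hr | hr
  exacts [(mul_eq_zero.mp h0).resolve_right hr, (mul_eq_zero.mp h1).resolve_right hr,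
    (mul_eq_zero.mp h2).resolve_right hr]

lemma mid_eq_zero (h : IsFlagC s E a e c d r κ) {y : ℂ} (h3 : y * c = 0) (h4 : y * d = 0) :
    y = 0 := by
  rcases h.cd with hc | hd
  exacts [(mul_eq_zero.mp h3).resolve_right hc, (mul_eq_zero.mp h4).resolve_right hd]

lemma tail_eq_zero (h : IsFlagC s E a e c d r κ) {z : ℂ} (h5 : z * a = 0)
    (h6 : z * ((2*s + 3) * a - e) = 0) : z = 0 := by
  rcases h.ae with ha | he
  · exact (mul_eq_zero.mp h5).resolve_right ha
  · exact (mul_eq_zero.mp (show z * e = 0 by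
      linear_combination (2*s + 3) * h5 - h6)).resolve_right he

lemma eq_of_mem_infty_four (h : IsFlagC s E a e c d r κ) (hv : v ∈ E.space 0)
    (hv' : v ∈ osc 7 ∞ 4) : ∃ y z : ℂ, v = y • qvec c d + z • pvec s a e := by
  obtain ⟨x, y, z, rfl⟩ := (h.mem_zero v).mp hv
  rw [combination_apply, mem_osc_seven_infty_four] at hv'
  rw [h.head_eq_zero hv'.1 hv'.2.1 hv'.2.2]
  exact ⟨y, z, by rw [zero_smul, zero_add]⟩

lemma eq_of_mem_infty_two (h : IsFlagC s E a e c d r κ) (hv : v ∈ E.space 0)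
    (hv' : v ∈ osc 7 ∞ 2) : ∃ z : ℂ, v = z • pvec s a e := by
  obtain ⟨x, y, z, rfl⟩ := (h.mem_zero v).mp hv
  rw [combination_apply, mem_osc_seven_infty_two] at hv'
  rw [h.head_eq_zero hv'.1 hv'.2.1 hv'.2.2.1, h.mid_eq_zero hv'.2.2.2.1 hv'.2.2.2.2]
  exact ⟨z, by rw [zero_smul, zero_smul, zero_add, zero_add]⟩

lemma eq_of_mem_zero_five (h : IsFlagC s E a e c d r κ) (hv : v ∈ E.space 0)
    (hv' : v ∈ osc 7 (0 : ℂ) 5) : ∃ x y : ℂ, v = x • rvec r + y • qvec c d := by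
  obtain ⟨x, y, z, rfl⟩ := (h.mem_zero v).mp hv
  rw [combination_apply, mem_osc_seven_zero_five] at hv'
  rw [h.tail_eq_zero hv'.1 hv'.2]
  exact ⟨x, y, by rw [zero_smul, add_zero]⟩

lemma eq_of_mem_zero_three (h : IsFlagC s E a e c d r κ) (hv : v ∈ E.space 0)
    (hv' : v ∈ osc 7 (0 : ℂ) 3) : ∃ x : ℂ, v = x • rvec r := by
  obtain ⟨x, y, z, rfl⟩ := (h.mem_zero v).mp hv
  rw [combination_apply, mem_osc_seven_zero_three] at hv'
  rw [h.tail_eq_zero hv'.2.2.1 hv'.2.2.2, h.mid_eq_zero hv'.1 hv'.2.1]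
  exact ⟨x, by rw [zero_smul, zero_smul, add_zero, add_zero]⟩

lemma finrank_inf_one_three (h : IsFlagC s E a e c d r κ) (hs : s ≠ 1) :
    dim ↥(E.space 1 ⊓ osc 7 (1 : ℂ) 3) ≤ 2 := by
  obtain ⟨u, hu, hu1⟩ := exists_kForm_ne_zero hs h.κ_ne
  have h2 := finrank_inf_ker hu (f := kForm s κ) (by rw [hu1]; exact one_ne_zero)
  rw [finrank_osculatingSpace _ (by norm_num)] at h2
  have h3 : dim ↥(E.space 1 ⊓ osc 7 (1 : ℂ) 3) ≤
      dim ↥(osc 7 (1 : ℂ) 3 ⊓ LinearMap.ker (kForm s κ)) :=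
    Submodule.finrank_mono fun y hy => ⟨hy.2, ((h.mem_one y).mp hy.1).2.2⟩
  omega

lemma finrank_inf_two (h : IsFlagC s E a e c d r κ) (hs : s ≠ 1) :
    dim ↥(E.space 1 ⊓ osc 7 s 2) ≤ 1 := by
  obtain ⟨u, hu, hu1⟩ := exists_mForm_ne_zero hs h.cd
  have h2 := finrank_inf_ker hu (f := mForm c d) (by rw [hu1]; exact one_ne_zero)
  rw [finrank_osculatingSpace _ (by norm_num)] at h2
  have h3 : dim ↥(E.space 1 ⊓ osc 7 s 2) ≤ dim ↥(osc 7 s 2 ⊓ LinearMap.ker (mForm c d)) :=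
    Submodule.finrank_mono fun y hy => ⟨hy.2, ((h.mem_one y).mp hy.1).2.1⟩
  omega

end IsFlagC

lemma osc_three_inf_osc_four (hs : s ≠ 1) : osc 7 (1 : ℂ) 3 ⊓ osc 7 s 4 = ⊥ := by
  rw [eq_bot_iff]
  rintro v ⟨h, h'⟩
  obtain ⟨h3, h4, h5, h6⟩ := mem_osc_seven_three.mp h
  obtain ⟨k4, k5, k6⟩ := mem_osc_seven_four.mp h'
  have e3 : v 3 = 3*v 2 - 3*v 1 + v 0 := by linear_combination h3
  have e4 : v 4 = 6*v 2 - 8*v 1 + 3*v 0 := by linear_combination h4 + 3*h3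
  have e5 : v 5 = 10*v 2 - 15*v 1 + 6*v 0 := by linear_combination h5 + 3*h4 + 6*h3
  have e6 : v 6 = 15*v 2 - 24*v 1 + 10*v 0 := by
    linear_combination h6 + 3*h5 + 6*h4 + 10*h3
  rw [e3, e4] at k4
  rw [e3, e4, e5] at k5
  rw [e3, e4, e5, e6] at k6
  have hs' : (1 - s)^4 ≠ 0 := pow_ne_zero 4 (sub_ne_zero.mpr hs.symm)
  have z2 : v 2 - 2*v 1 + v 0 = 0 := (mul_eq_zero.mp (show
    (1 - s)^4*(v 2 - 2*v 1 + v 0) = 0 by linear_combination k6 - 2*k5 + k4)).resolve_left hs'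
  have z1 : v 1 - v 0 = 0 := (mul_eq_zero.mp (show
    (1 - s)^4*(v 1 - v 0) = 0 by
      linear_combination k5 - k4 - 4*(1 - s)^3*z2)).resolve_left hs'
  have z0 : v 0 = 0 := (mul_eq_zero.mp (show
    (1 - s)^4*v 0 = 0 by
      linear_combination k4 - 4*(1 - s)^3*z1 - 6*(1 - s)^2*z2)).resolve_left hs'
  have z1' : v 1 = 0 := by linear_combination z1 + z0
  have z2' : v 2 = 0 := by linear_combination z2 + 2*z1' - z0
  rw [Submodule.mem_bot]
  ext i
  fin_cases i <;> simp [e3, e4, e5, e6, z0, z1', z2']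

namespace IsFlagC

lemma finrank_inf_four (hs : s ≠ 1)
    (h1 : 2 ≤ dim ↥(E.space 1 ⊓ osc 7 (1 : ℂ) 3)) : dim ↥(E.space 1 ⊓ osc 7 s 4) ≤ 2 := by
  have f1 : dim (E.space 1) = 4 := E.finrank_eq 1
  have h2 := Submodule.finrank_sup_add_finrank_inf_eq
    (E.space 1 ⊓ osc 7 (1 : ℂ) 3)
    (E.space 1 ⊓ osc 7 s 4)
  have h3 : dim ↥((E.space 1 ⊓ osc 7 (1 : ℂ) 3) ⊔
      (E.space 1 ⊓ osc 7 s 4)) ≤ dim (E.space 1) :=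
    Submodule.finrank_mono (sup_le inf_le_left inf_le_left)
  have h4 : (E.space 1 ⊓ osc 7 (1 : ℂ) 3) ⊓
      (E.space 1 ⊓ osc 7 s 4) = ⊥ := by
    rw [← inf_inf_distrib_left, osc_three_inf_osc_four hs, inf_bot_eq]
  rw [h4, finrank_bot] at h2
  omega

/-- The sum of `E₄` and `F₄(s)` is the kernel of the third linear form. -/
lemma mem_sup_four (h : IsFlagC s E a e c d r κ) (hs : s ≠ 1)
    (h1 : 2 ≤ dim ↥(E.space 1 ⊓ osc 7 (1 : ℂ) 3)) :
    v ∈ E.space 1 ⊔ osc 7 s 4 ↔ kForm s κ v = 0 := by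
  have f1 : dim (E.space 1) = 4 := E.finrank_eq 1
  have h2 := Submodule.finrank_sup_add_finrank_inf_eq (E.space 1)
    (osc 7 s 4)
  rw [finrank_osculatingSpace _ (by norm_num)] at h2
  have h3 := finrank_inf_four hs h1
  obtain ⟨u, hu, hu1⟩ := exists_kForm_ne_zero hs h.κ_ne
  have h4 := finrank_inf_ker (Submodule.mem_top (x := u)) (f := kForm s κ)
    (by rw [hu1]; exact one_ne_zero)
  rw [top_inf_eq, finrank_top, Module.finrank_fin_fun] at h4
  have h5 := Submodule.eq_of_le_of_finrank_le (S₁ := E.space 1 ⊔ osc 7 s 4)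
    (S₂ := LinearMap.ker (kForm s κ))
    (sup_le (fun v hv => ((h.mem_one v).mp hv).2.2) fun v hv => kForm_eq_zero hv) (by omega)
  rw [h5, LinearMap.mem_ker]

lemma hForm_sup_two (h : IsFlagC s E a e c d r κ)
    (hv : v ∈ E.space 1 ⊔ osc 7 s 2) : hForm s a e v = 0 := by
  obtain ⟨y, hy, z, hz, rfl⟩ := Submodule.mem_sup.mp hv
  rw [_root_.map_add, ((h.mem_one y).mp hy).1, hForm_eq_zero hz, add_zero]

lemma forms_sup_three (h : IsFlagC s E a e c d r κ)
    (hv : v ∈ E.space 1 ⊔ osc 7 (1 : ℂ) 3) : hForm s a e v = 0 ∧ mForm c d v = 0 := by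
  obtain ⟨y, hy, z, hz, rfl⟩ := Submodule.mem_sup.mp hv
  have h1 : hForm s a e z = 0 := form_cubeCoeff_eq_zero hz
  have h2 : mForm c d z = 0 := form_cubeCoeff_eq_zero hz
  rw [_root_.map_add, _root_.map_add, ((h.mem_one y).mp hy).1, ((h.mem_one y).mp hy).2.1, h1, h2]
  simp

end IsFlagC

end TangentC

section TangentC

variable {E : PartialFlag typeC 7} {x : Fin 1 → ℂ} {a e c d : ℂ} {r κ : Fin 3 → ℂ}
  {ψ : Module.End ℂ (Fin 7 → ℂ)}

lemma hForm_add (s t a e a' e' : ℂ) (v : Fin 7 → ℂ) :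
    hForm s (a' + t * a) (e' + t * e) v = hForm s a' e' v + t * hForm s a e v := by
  simp only [hForm, form_cubeCoeff]
  ring

lemma mForm_add (t c d c' d' : ℂ) (v : Fin 7 → ℂ) :
    mForm (c' + t * c) (d' + t * d) v = mForm c' d' v + t * mForm c d v := by
  simp only [mForm, form_cubeCoeff]
  ring

lemma exists_sub_mul_of_cross {a b x y x' y' : ℂ} (hab : a ≠ 0 ∨ b ≠ 0)
    (h : b * (x - x') = a * (y - y')) : ∃ t, x = x' + t * a ∧ y = y' + t * b := by
  obtain ⟨t, h1, h2⟩ := exists_mul_of_cross hab h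
  exact ⟨t, by linear_combination h1, by linear_combination h2⟩

/-- A tangent vector yields a solution of the linearised equations, and is zero if this solution
is trivial. -/
lemma exists_linearisedC (hs : x 0 ≠ 1)
    (hE : E ∈ intersection typeC condC (pointsAt pointsC x))
    (h : IsFlagC (x 0) E a e c d r κ) (heq : EquationsC (x 0) a e c d r κ)
    (hψ : ∀ l, IsTangent typeC (condC l) (pointsAt pointsC x l) E ψ) :
    ∃ a' e' c' d' r' κ', LinearisedC (x 0) a e c d r κ a' e' c' d' r' κ' ∧
      (e * a' = a * e' → d * c' = c * d' → (∃ t : ℂ, r' = t • r) → (∃ t : ℂ, κ' = t • κ) →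
        ∀ i, (E.space i).map ψ ≤ E.space i) := by
  obtain ⟨⟨k1, k2⟩, ⟨k3, k4⟩, ⟨k5, k6⟩, k7⟩ := mem_intersection_C.mp hE
  rw [pointsAt_C] at hψ
  have t0 : IsTangent typeC (condC 0) ∞ E ψ := hψ 0
  have t1 : IsTangent typeC (condC 1) (0 : ℂ) E ψ := hψ 1
  have t2 : IsTangent typeC (condC 2) (x 0 : OnePoint ℂ) E ψ := hψ 2
  have t3 : IsTangent typeC (condC 3) (1 : ℂ) E ψ := hψ 3
  have hE01 : E.space 0 ≤ E.space 1 := E.monotone (by decide)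
  have m2 : ∀ v ∈ E.space 1, v ∈ osc 7 (x 0) 2 → ψ v ∈ E.space 1 ⊔ osc 7 (x 0) 2 := fun v hv hv' =>
    IsTangent.map_le (hv := by decide) (hinj := by decide) t2 1 (j := 2) (by norm_num)
      (le_antisymm (h.finrank_inf_two hs) k5) hv hv'
  have m4 : ∀ v ∈ E.space 1, v ∈ osc 7 (x 0) 4 → ψ v ∈ E.space 1 ⊔ osc 7 (x 0) 4 := fun v hv hv' =>
    IsTangent.map_le (hv := by decide) (hinj := by decide) t2 1 (j := 4) (by norm_num)
      (le_antisymm (IsFlagC.finrank_inf_four hs k7) k6) hv hv'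
  have m3 : ∀ v ∈ E.space 1, v ∈ osc 7 (1 : ℂ) 3 →
      ψ v ∈ E.space 1 ⊔ osc 7 (1 : ℂ) 3 := fun v hv hv' =>
    IsTangent.map_le (hv := by decide) (hinj := by decide) t3 1 (j := 3) (by norm_num)
      (le_antisymm (h.finrank_inf_one_three hs) k7) hv hv'
  have mp := IsTangent.map_le (hv := by decide) (hinj := by decide) t0 0 (j := 2) (by norm_num)
    (le_antisymm (finrank_le_one_of_smul _ fun v hv => h.eq_of_mem_infty_two hv.1 hv.2) k1)
    h.p_mem pvec_mem
  have mq := IsTangent.map_le (hv := by decide) (hinj := by decide) t0 0 (j := 4) (by norm_num)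
    (le_antisymm (finrank_le_two_of_combination _ _ fun v hv =>
      h.eq_of_mem_infty_four hv.1 hv.2) k2) h.q_mem qvec_mem
  have mq' := IsTangent.map_le (hv := by decide) (hinj := by decide) t1 0 (j := 5) (by norm_num)
    (le_antisymm (finrank_le_two_of_combination _ _ fun v hv =>
      h.eq_of_mem_zero_five hv.1 hv.2) k4) h.q_mem qvec_mem'
  have mr := IsTangent.map_le (hv := by decide) (hinj := by decide) t1 0 (j := 3) (by norm_num)
    (le_antisymm (finrank_le_one_of_smul _ fun v hv => h.eq_of_mem_zero_three hv.1 hv.2) k3)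
    h.r_mem rvec_mem
  obtain ⟨w₁, hw₁, p', hp', hp⟩ := Submodule.mem_sup.mp mp
  obtain ⟨a', e', rfl⟩ := eq_pvec (s := x 0) hp'
  obtain ⟨w₃, hw₃, r'', hr'', hr⟩ := Submodule.mem_sup.mp mr
  obtain ⟨r', rfl⟩ := eq_rvec hr''
  obtain ⟨c', d', w₂, hw₂, hq⟩ : ∃ c' d', ∃ w₂ ∈ E.space 0, w₂ + qvec c' d' = ψ (qvec c d) := by
    obtain ⟨u₁, hu₁, g₁, hg₁, e₁⟩ := Submodule.mem_sup.mp mq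
    obtain ⟨u₂, hu₂, g₂, hg₂, e₂⟩ := Submodule.mem_sup.mp mq'
    obtain ⟨y₁, y₂, y₃, rfl⟩ := (h.mem_zero u₁).mp hu₁
    obtain ⟨z₁, z₂, z₃, rfl⟩ := (h.mem_zero u₂).mp hu₂
    obtain ⟨g0, g1, g2⟩ := mem_osc_seven_infty_four.mp hg₁
    obtain ⟨g5, g6⟩ := mem_osc_seven_zero_five.mp hg₂
    refine ⟨ψ (qvec c d) 3, ψ (qvec c d) 4, y₁ • rvec r + z₃ • pvec (x 0) a e,
      (h.mem_zero _).mpr ⟨y₁, 0, z₃, by simp⟩, ?_⟩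
    rw [combination_apply] at e₁ e₂
    generalize ψ (qvec c d) = w at e₁ e₂
    ext i
    fin_cases i
    · simpa [← e₁, rvec, pvec, qvec, Matrix.vecHead, Matrix.vecTail] using g0
    · simpa [← e₁, rvec, pvec, qvec, Matrix.vecHead, Matrix.vecTail] using g1
    · simpa [← e₁, rvec, pvec, qvec, Matrix.vecHead, Matrix.vecTail] using g2
    · simp [rvec, pvec, qvec]
    · simp [rvec, pvec, qvec]
    · simpa [← e₂, rvec, pvec, qvec, Matrix.vecHead, Matrix.vecTail] using g5
    · simpa [← e₂, rvec, pvec, qvec, Matrix.vecHead, Matrix.vecTail] using g6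
  have hzero : ∀ w ∈ E.space 0,
      hForm (x 0) a e w = 0 ∧ mForm c d w = 0 ∧ kForm (x 0) κ w = 0 := fun w hw =>
    (h.mem_one w).mp (hE01 hw)
  obtain ⟨f₁, hf₁, hf₁'⟩ := exists_form_extension (S := E.space 1)
    (G := osc 7 (1 : ℂ) 3 ⊔ osc 7 (x 0) 2)
    (-(hForm (x 0) a e ∘ₗ ψ)) (by
      intro v hv hv'
      obtain ⟨y, hy, z, hz, rfl⟩ := Submodule.mem_sup.mp hv'
      obtain ⟨-, v2, v3⟩ := (h.mem_one _).mp hv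
      have my : mForm c d y = 0 := form_cubeCoeff_eq_zero hy
      rw [_root_.map_add, my, zero_add] at v2
      have hz1 : z ∈ E.space 1 := (h.mem_one z).mpr ⟨hForm_eq_zero hz, v2,
        kForm_eq_zero (osculatingSpace_mono 7 _ (by norm_num) hz)⟩
      have hy1 : y ∈ E.space 1 := (Submodule.add_mem_iff_left _ hz1).mp hv
      rw [LinearMap.neg_apply, LinearMap.comp_apply, _root_.map_add, _root_.map_add,
        h.hForm_sup_two (m2 z hz1 hz), (h.forms_sup_three (m3 y hy1 hy)).1, add_zero, neg_zero])
  obtain ⟨f₂, hf₂, hf₂'⟩ := exists_form_extension (S := E.space 1)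
    (G := osc 7 (1 : ℂ) 3) (-(mForm c d ∘ₗ ψ)) (by
      intro v hv hv'
      rw [LinearMap.neg_apply, LinearMap.comp_apply, (h.forms_sup_three (m3 v hv hv')).2, neg_zero])
  obtain ⟨f₃, hf₃, hf₃'⟩ := exists_form_extension (S := E.space 1)
    (G := osc 7 (x 0) 4) (-(kForm (x 0) κ ∘ₗ ψ)) (by
      intro v hv hv'
      rw [LinearMap.neg_apply, LinearMap.comp_apply,
        (h.mem_sup_four hs k7).mp (m4 v hv hv'), neg_zero])
  obtain ⟨a₁, e₁, g₁⟩ := exists_hForm hs (fun v hv => hf₁' v (Submodule.mem_sup_left hv))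
    fun v hv => hf₁' v (Submodule.mem_sup_right hv)
  obtain ⟨q₀, q₁, q₂, q₃, rfl, -⟩ := eq_cubeCoeff hf₂'
  obtain ⟨κ', g₃⟩ := exists_kForm hf₃'
  have hf : ∀ v ∈ E.space 1, hForm (x 0) a₁ e₁ v + hForm (x 0) a e (ψ v) = 0 := by
    intro v hv
    rw [← g₁, hf₁ v hv, LinearMap.neg_apply, LinearMap.comp_apply, neg_add_cancel]
  have kf : ∀ v ∈ E.space 1, kForm (x 0) κ' v + kForm (x 0) κ (ψ v) = 0 := by
    intro v hv
    rw [← g₃, hf₃ v hv, LinearMap.neg_apply, LinearMap.comp_apply, neg_add_cancel]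
  have hpE := hE01 h.p_mem
  have hqE := hE01 h.q_mem
  have hrE := hE01 h.r_mem
  have hp1 := hf _ hpE
  have hq1 := hf _ hqE
  have hr1 := hf _ hrE
  rw [← hp, _root_.map_add, (hzero _ hw₁).1, zero_add, hForm_pvec, hForm_pvec] at hp1
  rw [← hq, _root_.map_add, (hzero _ hw₂).1, zero_add] at hq1
  rw [← hr, _root_.map_add, (hzero _ hw₃).1, zero_add] at hr1
  obtain ⟨t, rfl, rfl⟩ := exists_sub_mul_of_cross h.ae (x := a₁) (x' := a') (y := e₁) (y' := e')
    (by linear_combination -hp1)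
  rw [hForm_add, heq.hq, mul_zero, add_zero] at hq1
  rw [hForm_add, heq.hr, mul_zero, add_zero] at hr1
  obtain ⟨t', h3, h2⟩ : ∃ t', q₃ = t' * a ∧ q₂ + 2*x 0*q₃ = t' * e := by
    refine exists_mul_of_cross h.ae ?_
    have := hf₂ _ hpE
    rw [LinearMap.neg_apply, LinearMap.comp_apply, ← hp, _root_.map_add, (hzero _ hw₁).2.1,
      mForm_pvec, form_cubeCoeff] at this
    simp [pvec] at this
    linear_combination -this
  obtain ⟨c₁, d₁, mf⟩ : ∃ c₁ d₁, ∀ v ∈ E.space 1, mForm c₁ d₁ v + mForm c d (ψ v) = 0 := by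
    refine ⟨q₁ - t' * (x 0^2*a - 2*x 0*e), 3*(q₁ - t' * (x 0^2*a - 2*x 0*e)) -
      (q₀ - t' * (x 0^2*e)), fun v hv => ?_⟩
    have e1 := hf₂ v hv
    have e2 := ((h.mem_one v).mp hv).1
    have h2' : q₂ = t' * e - 2*x 0*(t' * a) := by rw [← h3]; linear_combination h2
    rw [LinearMap.neg_apply, LinearMap.comp_apply, form_cubeCoeff, h3, h2'] at e1
    rw [hForm, form_cubeCoeff] at e2
    rw [mForm, form_cubeCoeff]
    linear_combination e1 - t' * e2
  have mq1 := mf _ hqE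
  have mr1 := mf _ hrE
  rw [← hq, _root_.map_add, (hzero _ hw₂).2.1, zero_add, mForm_qvec, mForm_qvec] at mq1
  rw [← hr, _root_.map_add, (hzero _ hw₃).2.1, zero_add] at mr1
  obtain ⟨u, rfl, rfl⟩ := exists_sub_mul_of_cross h.cd (x := c₁) (x' := c') (y := d₁) (y' := d')
    (by linear_combination mq1)
  rw [mForm_add, heq.mr, mul_zero, add_zero] at mr1
  have kp1 := kf _ hpE
  have kq1 := kf _ hqE
  have kr1 := kf _ hrE
  rw [← hp, _root_.map_add, (hzero _ hw₁).2.2, zero_add] at kp1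
  rw [← hq, _root_.map_add, (hzero _ hw₂).2.2, zero_add] at kq1
  rw [← hr, _root_.map_add, (hzero _ hw₃).2.2, zero_add] at kr1
  refine ⟨a', e', c', d', r', κ', ⟨hq1, hr1, mr1, kp1, kq1, kr1⟩, ?_⟩
  rintro hpar hpar' ⟨t₃, rfl⟩ ⟨t₄, rfl⟩
  obtain ⟨t₁, rfl, rfl⟩ := exists_mul_of_cross h.ae hpar
  obtain ⟨t₂, rfl, rfl⟩ := exists_mul_of_cross h.cd hpar'
  have pres0 : ∀ v ∈ E.space 0, ψ v ∈ E.space 0 := by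
    intro v hv
    obtain ⟨y₁, y₂, y₃, rfl⟩ := (h.mem_zero v).mp hv
    rw [_root_.map_add, _root_.map_add, _root_.map_smul, _root_.map_smul, _root_.map_smul, ← hp,
      ← hq, ← hr, pvec_smul, qvec_smul, rvec_smul]
    have hp := h.p_mem
    have hq := h.q_mem
    have hr := h.r_mem
    exact add_mem (add_mem (Submodule.smul_mem _ _ (add_mem hw₃ (Submodule.smul_mem _ _ hr)))
      (Submodule.smul_mem _ _ (add_mem hw₂ (Submodule.smul_mem _ _ hq))))
      (Submodule.smul_mem _ _ (add_mem hw₁ (Submodule.smul_mem _ _ hp)))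
  have pres1 : ∀ v ∈ E.space 1, ψ v ∈ E.space 1 := by
    intro v hv
    obtain ⟨v1, v2, v3⟩ := (h.mem_one v).mp hv
    refine (h.mem_one _).mpr ⟨?_, ?_, ?_⟩
    · have := hf v hv
      rwa [hForm_add, hForm_smul, LinearMap.smul_apply, v1, smul_zero, mul_zero, zero_add,
        zero_add] at this
    · have := mf v hv
      rwa [mForm_add, mForm_smul, LinearMap.smul_apply, v2, smul_zero, mul_zero, zero_add,
        zero_add] at this
    · have := kf v hv
      rwa [kForm_smul, LinearMap.smul_apply, v3, smul_zero, zero_add] at this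
  intro i
  rw [Submodule.map_le_iff_le_comap]
  fin_cases i
  exacts [pres0, pres1]

/-- A nontrivial solution of the linearised equations yields a nonzero tangent vector. -/
lemma not_isTransverse_of_linearisedC {a' e' c' d' : ℂ} {r' κ' : Fin 3 → ℂ} (hs : x 0 ≠ 1)
    (hE : E ∈ intersection typeC condC (pointsAt pointsC x))
    (h : IsFlagC (x 0) E a e c d r κ)
    (hlin : LinearisedC (x 0) a e c d r κ a' e' c' d' r' κ')
    (hne : ¬(e * a' = a * e' ∧ d * c' = c * d' ∧ (∃ t : ℂ, r' = t • r) ∧ ∃ t : ℂ, κ' = t • κ)) :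
    ¬IsTransverse typeC condC (pointsAt pointsC x) := by
  obtain ⟨⟨k1, k2⟩, ⟨k3, k4⟩, ⟨k5, k6⟩, k7⟩ := mem_intersection_C.mp hE
  have hE01 : E.space 0 ≤ E.space 1 := E.monotone (by decide)
  obtain ⟨u, y, hy, z, hz, ⟨u1, u2, u3⟩, ⟨y1, y2, y3⟩, z1, z2, z3⟩ :=
    exists_dual_vectors hs h.ae h.cd h.κ_ne
  obtain ⟨b₁, b₂, hb⟩ := exists_dual h.ae
  obtain ⟨b₃, b₄, hb'⟩ := exists_dual h.cd
  obtain ⟨b, hbr⟩ := exists_dot3_ne_zero h.r_ne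
  set ξ := form ![b 0 / dot3 b r, b 1 / dot3 b r, b 2 / dot3 b r, 0, 0, 0, 0] with hξ
  set η := form ![0, 0, 0, b₃, b₄, 0, 0] with hη
  set ζ := form ![0, 0, 0, 0, 0, b₁ + (2*x 0 + 3) * b₂, -b₂] with hζ
  have xr : ξ (rvec r) = 1 := by
    simp [hξ, form_apply, Fin.sum_univ_seven, rvec]
    field_simp
    simp [dot3]
  have xq : ξ (qvec c d) = 0 := by simp [hξ, form_apply, Fin.sum_univ_seven, qvec]
  have xp : ξ (pvec (x 0) a e) = 0 := by simp [hξ, form_apply, Fin.sum_univ_seven, pvec]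
  have nr : η (rvec r) = 0 := by simp [hη, form_apply, Fin.sum_univ_seven, rvec]
  have nq : η (qvec c d) = 1 := by simpa [hη, form_apply, Fin.sum_univ_seven, qvec] using hb'
  have np : η (pvec (x 0) a e) = 0 := by simp [hη, form_apply, Fin.sum_univ_seven, pvec]
  have zr : ζ (rvec r) = 0 := by simp [hζ, form_apply, Fin.sum_univ_seven, rvec]
  have zq : ζ (qvec c d) = 0 := by simp [hζ, form_apply, Fin.sum_univ_seven, qvec]
  have zp : ζ (pvec (x 0) a e) = 1 := by
    simp [hζ, form_apply, Fin.sum_univ_seven, pvec]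
    linear_combination hb
  set ψ₁ : Module.End ℂ (Fin 7 → ℂ) := ξ.smulRight (rvec r') + η.smulRight (qvec c' d') +
    ζ.smulRight (pvec (x 0) a' e') with hψ₁
  have hψ₁' : ∀ v, ψ₁ v = ξ v • rvec r' + η v • qvec c' d' + ζ v • pvec (x 0) a' e' := fun v => rfl
  set ψ : Module.End ℂ (Fin 7 → ℂ) := ψ₁ -
    ((hForm (x 0) a' e' + hForm (x 0) a e ∘ₗ ψ₁).smulRight u +
      (mForm c' d' + mForm c d ∘ₗ ψ₁).smulRight y +
      (kForm (x 0) κ' + kForm (x 0) κ ∘ₗ ψ₁).smulRight z) with hψ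
  have hψ' : ∀ v, ψ v = ψ₁ v - ((hForm (x 0) a' e' v + hForm (x 0) a e (ψ₁ v)) • u +
      (mForm c' d' v + mForm c d (ψ₁ v)) • y + (kForm (x 0) κ' v + kForm (x 0) κ (ψ₁ v)) • z) :=
    fun v => rfl
  have hh : ∀ v, hForm (x 0) a e (ψ v) = -hForm (x 0) a' e' v := by
    intro v
    simp only [hψ', _root_.map_sub, _root_.map_add, _root_.map_smul, u1, y1, z1, smul_eq_mul]
    ring
  have hm : ∀ v, mForm c d (ψ v) = -mForm c' d' v := by
    intro v
    simp only [hψ', _root_.map_sub, _root_.map_add, _root_.map_smul, u2, y2, z2, smul_eq_mul]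
    ring
  have hk : ∀ v, kForm (x 0) κ (ψ v) = -kForm (x 0) κ' v := by
    intro v
    simp only [hψ', _root_.map_sub, _root_.map_add, _root_.map_smul, u3, y3, z3, smul_eq_mul]
    ring
  have ψp : ψ (pvec (x 0) a e) = pvec (x 0) a' e' := by
    have e1 : ψ₁ (pvec (x 0) a e) = pvec (x 0) a' e' := by rw [hψ₁', xp, np, zp]; simp
    have e2 : hForm (x 0) a' e' (pvec (x 0) a e) + hForm (x 0) a e (pvec (x 0) a' e') = 0 := by
      rw [hForm_pvec, hForm_pvec]; ring
    rw [hψ', e1, e2, mForm_pvec, mForm_pvec, hlin.kp]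
    simp
  have ψq : ψ (qvec c d) = qvec c' d' := by
    have e1 : ψ₁ (qvec c d) = qvec c' d' := by rw [hψ₁', xq, nq, zq]; simp
    have e2 : mForm c' d' (qvec c d) + mForm c d (qvec c' d') = 0 := by
      rw [mForm_qvec, mForm_qvec]; ring
    rw [hψ', e1, e2, hlin.hq, hlin.kq]
    simp
  have ψr : ψ (rvec r) = rvec r' := by
    have e1 : ψ₁ (rvec r) = rvec r' := by rw [hψ₁', xr, nr, zr]; simp
    rw [hψ', e1, hlin.hr, hlin.mr, hlin.kr]
    simp
  clear_value ψ
  intro htr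
  have hpres := htr E hE ψ (by
    rw [pointsAt_C]
    intro l
    fin_cases l
    · refine isTangent_C_zero k1 k2 (Submodule.map_le_iff_le_comap.mpr fun v hv => ?_)
        (Submodule.map_le_iff_le_comap.mpr fun v hv => ?_)
      · obtain ⟨b₃, rfl⟩ := h.eq_of_mem_infty_two hv.1 hv.2
        rw [Submodule.mem_comap, _root_.map_smul, ψp]
        exact Submodule.smul_mem _ _ (Submodule.mem_sup_right pvec_mem)
      · obtain ⟨b₂, b₃, rfl⟩ := h.eq_of_mem_infty_four hv.1 hv.2
        rw [Submodule.mem_comap, _root_.map_add, _root_.map_smul, _root_.map_smul, ψp, ψq]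
        exact add_mem (Submodule.smul_mem _ _ (Submodule.mem_sup_right qvec_mem))
          (Submodule.smul_mem _ _ (Submodule.mem_sup_right
            (osculatingSpace_mono 7 _ (by norm_num) pvec_mem)))
    · refine isTangent_C_one k3 (Submodule.map_le_iff_le_comap.mpr fun v hv => ?_)
        (Submodule.map_le_iff_le_comap.mpr fun v hv => ?_)
      · obtain ⟨b₁, rfl⟩ := h.eq_of_mem_zero_three hv.1 hv.2
        rw [Submodule.mem_comap, _root_.map_smul, ψr]
        exact Submodule.smul_mem _ _ (Submodule.mem_sup_right rvec_mem)
      · obtain ⟨b₁, b₂, rfl⟩ := h.eq_of_mem_zero_five hv.1 hv.2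
        rw [Submodule.mem_comap, _root_.map_add, _root_.map_smul, _root_.map_smul, ψr, ψq]
        exact add_mem (Submodule.smul_mem _ _ (Submodule.mem_sup_right
            (osculatingSpace_mono 7 _ (by norm_num) rvec_mem)))
          (Submodule.smul_mem _ _ (Submodule.mem_sup_right qvec_mem'))
    · refine isTangent_C_two k5 k6 (Submodule.map_le_iff_le_comap.mpr fun v hv => ?_)
        (Submodule.map_le_iff_le_comap.mpr fun v hv => ?_)
      · have e1 : hForm (x 0) a e (ψ v) = 0 := by rw [hh, hForm_eq_zero hv.2, neg_zero]
        have e3 : kForm (x 0) κ (ψ v) = 0 := by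
          rw [hk, kForm_eq_zero (osculatingSpace_mono 7 _ (by norm_num) hv.2), neg_zero]
        refine Submodule.mem_sup.mpr ⟨ψ v - mForm c d (ψ v) • y, (h.mem_one _).mpr ⟨?_, ?_, ?_⟩,
          mForm c d (ψ v) • y, Submodule.smul_mem _ _ hy, sub_add_cancel _ _⟩
        · rw [_root_.map_sub, _root_.map_smul, e1, y1, smul_zero, sub_zero]
        · rw [_root_.map_sub, _root_.map_smul, y2, smul_eq_mul, mul_one, sub_self]
        · rw [_root_.map_sub, _root_.map_smul, e3, y3, smul_zero, sub_zero]
      · refine (h.mem_sup_four hs k7).mpr ?_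
        rw [hk, kForm_eq_zero hv.2, neg_zero]
    · refine isTangent_C_three k7 (Submodule.map_le_iff_le_comap.mpr fun v hv => ?_)
      have e1 : hForm (x 0) a e (ψ v) = 0 := by
        rw [hh, hForm, form_cubeCoeff_eq_zero hv.2, neg_zero]
      have e2 : mForm c d (ψ v) = 0 := by rw [hm, mForm, form_cubeCoeff_eq_zero hv.2, neg_zero]
      refine Submodule.mem_sup.mpr ⟨ψ v - kForm (x 0) κ (ψ v) • z, (h.mem_one _).mpr ⟨?_, ?_, ?_⟩,
        kForm (x 0) κ (ψ v) • z, Submodule.smul_mem _ _ hz, sub_add_cancel _ _⟩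
      · rw [_root_.map_sub, _root_.map_smul, e1, z1, smul_zero, sub_zero]
      · rw [_root_.map_sub, _root_.map_smul, e2, z2, smul_zero, sub_zero]
      · rw [_root_.map_sub, _root_.map_smul, z3, smul_eq_mul, mul_one, sub_self])
  have hpres0 : ∀ v ∈ E.space 0, ψ v ∈ E.space 0 := fun v hv => hpres 0 ⟨v, hv, rfl⟩
  have hpres1 : ∀ v ∈ E.space 1, ψ v ∈ E.space 1 := fun v hv => hpres 1 ⟨v, hv, rfl⟩
  refine hne ⟨?_, ?_, ?_, ?_⟩
  · have := hpres0 _ h.p_mem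
    rw [ψp] at this
    have := ((h.mem_one _).mp (hE01 this)).1
    rw [hForm_pvec] at this
    linear_combination this
  · have := hpres0 _ h.q_mem
    rw [ψq] at this
    have := ((h.mem_one _).mp (hE01 this)).2.1
    rw [mForm_qvec] at this
    linear_combination -this
  · have := hpres0 _ h.r_mem
    rw [ψr] at this
    obtain ⟨t, ht⟩ := h.eq_of_mem_zero_three this rvec_mem
    rw [← rvec_smul] at ht
    refine ⟨t, funext fun i => ?_⟩
    fin_cases i
    exacts [congrFun ht 0, congrFun ht 1, congrFun ht 2]
  · have hk0 : ∀ v, kForm (x 0) κ v = 0 → kForm (x 0) κ' v = 0 := by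
      intro v hv
      obtain ⟨w, hw, g, hg, rfl⟩ := Submodule.mem_sup.mp ((h.mem_sup_four hs k7).mpr hv)
      have := ((h.mem_one _).mp (hpres1 w hw)).2.2
      rw [hk, neg_eq_zero] at this
      rw [_root_.map_add, this, kForm_eq_zero hg, add_zero]
    refine ⟨kForm (x 0) κ' z, kForm_injective (s := x 0) (LinearMap.ext fun v => ?_)⟩
    have := hk0 (v - kForm (x 0) κ v • z) (by
      rw [_root_.map_sub, _root_.map_smul, z3, smul_eq_mul, mul_one, sub_self])
    rw [_root_.map_sub, _root_.map_smul, smul_eq_mul] at this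
    rw [kForm_smul, LinearMap.smul_apply, smul_eq_mul]
    linear_combination this

end TangentC

section EliminationC

/-- `hForm s a e` on `⟨e₁,e₂,e₃⟩`. -/
def rowH (s a e : ℂ) : Fin 3 → ℂ :=
  ![-(s^2*e), 3*s^2*e - (s^2*a - 2*s * e), -3*s^2*e + 3*(s^2*a - 2*s * e) - (e - 2*s * a)]

/-- `mForm c d` on `⟨e₁,e₂,e₃⟩`. -/
def rowM (c d : ℂ) : Fin 3 → ℂ :=
  ![-(3*c - d), 3*(3*c - d) - c, -3*(3*c - d) + 3*c]

/-- The vector `w` as a linear form on the forms vanishing on `F₄(s)`. -/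
def rowK (s : ℂ) (w : Fin 7 → ℂ) : Fin 3 → ℂ :=
  ![s^4*w 0 - 4*s^3*w 1 + 6*s^2*w 2 - 4*s * w 3 + w 4,
    s^4*w 1 - 4*s^3*w 2 + 6*s^2*w 3 - 4*s * w 4 + w 5,
    s^4*w 2 - 4*s^3*w 3 + 6*s^2*w 4 - 4*s * w 5 + w 6]

/-- The linear form on `⟨e₁,e₂,e₃⟩` whose kernel is spanned by `u` and `v` modulo `F₄(s)`. -/
def rowR (s : ℂ) (u v : Fin 7 → ℂ) : Fin 3 → ℂ :=
  ![s^4*cross3 (rowK s u) (rowK s v) 0,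
    -4*s^3*cross3 (rowK s u) (rowK s v) 0 + s^4*cross3 (rowK s u) (rowK s v) 1,
    6*s^2*cross3 (rowK s u) (rowK s v) 0 - 4*s^3*cross3 (rowK s u) (rowK s v) 1 +
      s^4*cross3 (rowK s u) (rowK s v) 2]

variable {s a e c d a' e' c' d' : ℂ} {r κ r' κ' : Fin 3 → ℂ} {u v u' v' : Fin 7 → ℂ}

lemma hForm_rvec : hForm s a e (rvec r) = dot3 (rowH s a e) r := by
  simp [hForm, form_cubeCoeff, rvec, dot3, rowH]; ring

lemma mForm_rvec : mForm c d (rvec r) = dot3 (rowM c d) r := by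
  simp [mForm, form_cubeCoeff, rvec, dot3, rowM]; ring

lemma kForm_eq_dot3 (w : Fin 7 → ℂ) : kForm s κ w = dot3 (rowK s w) κ := by
  rw [kForm_apply]; simp [dot3, rowK]; ring

lemma dot3_rowR : dot3 (rowR s u v) r = det3 (rowK s u) (rowK s v) (rowK s (rvec r)) := by
  simp [dot3, rowR, det3, cross3, rowK, rvec]; ring

lemma det3'_rowK : det3' (rowK s u) (rowK s v) (rowK s (rvec r)) (rowK s u') (rowK s v')
      (rowK s (rvec r')) = dot3 (rowR s u' v + rowR s u v') r + dot3 (rowR s u v) r' := by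
  have : ∀ x y : Fin 3 → ℂ, dot3 (x + y) r = dot3 x r + dot3 y r := fun x y => by
    simp [dot3]; ring
  rw [this, dot3_rowR, dot3_rowR, dot3_rowR, det3']

/-- The condition that `hForm` vanishes at `qvec`. -/
noncomputable def gamC (s a e c d : ℂ) : ℂ := hForm s a e (qvec c d)

/-- The eliminant of the remaining conditions. -/
def detC (s a e c d : ℂ) : ℂ :=
  det3 (rowH s a e) (rowM c d) (rowR s (pvec s a e) (qvec c d))

/-- The differential of `gamC`. -/
noncomputable def gamC' (s a e c d a' e' c' d' : ℂ) : ℂ := gamC s a' e' c d + gamC s a e c' d'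

/-- The differential of `detC`. -/
def detC' (s a e c d a' e' c' d' : ℂ) : ℂ :=
  det3' (rowH s a e) (rowM c d) (rowR s (pvec s a e) (qvec c d)) (rowH s a' e') (rowM c' d')
    (rowR s (pvec s a' e') (qvec c d) + rowR s (pvec s a e) (qvec c' d'))

lemma equationsC_iff : EquationsC s a e c d r κ ↔ gamC s a e c d = 0 ∧
    (dot3 (rowH s a e) r = 0 ∧ dot3 (rowM c d) r = 0) ∧ dot3 (rowK s (pvec s a e)) κ = 0 ∧
    dot3 (rowK s (qvec c d)) κ = 0 ∧ dot3 (rowK s (rvec r)) κ = 0 := by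
  rw [← hForm_rvec, ← mForm_rvec, ← kForm_eq_dot3, ← kForm_eq_dot3, ← kForm_eq_dot3]
  exact ⟨fun ⟨h1, h2, h3, h4, h5, h6⟩ => ⟨h1, ⟨h2, h3⟩, h4, h5, h6⟩,
    fun ⟨h1, ⟨h2, h3⟩, h4, h5, h6⟩ => ⟨h1, h2, h3, h4, h5, h6⟩⟩

lemma linearisedC_iff : LinearisedC s a e c d r κ a' e' c' d' r' κ' ↔
    gamC' s a e c d a' e' c' d' = 0 ∧ (dot3 (rowH s a' e') r + dot3 (rowH s a e) r' = 0 ∧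
      dot3 (rowM c' d') r + dot3 (rowM c d) r' = 0) ∧
    dot3 (rowK s (pvec s a' e')) κ + dot3 (rowK s (pvec s a e)) κ' = 0 ∧
    dot3 (rowK s (qvec c' d')) κ + dot3 (rowK s (qvec c d)) κ' = 0 ∧
    dot3 (rowK s (rvec r')) κ + dot3 (rowK s (rvec r)) κ' = 0 := by
  simp only [← hForm_rvec, ← mForm_rvec, ← kForm_eq_dot3]
  simp only [add_comm (kForm s κ _)]
  exact ⟨fun ⟨h1, h2, h3, h4, h5, h6⟩ => ⟨h1, ⟨h2, h3⟩, h4, h5, h6⟩,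
    fun ⟨h1, ⟨h2, h3⟩, h4, h5, h6⟩ => ⟨h1, h2, h3, h4, h5, h6⟩⟩

lemma EquationsC.rowR (h : EquationsC s a e c d r κ) (hκ : κ ≠ 0) :
    dot3 (rowR s (pvec s a e) (qvec c d)) r = 0 := by
  obtain ⟨-, -, h3, h4, h5⟩ := equationsC_iff.mp h
  rw [dot3_rowR]
  exact det3_eq_zero_of_kernel hκ h3 h4 h5

lemma EquationsC.eliminate (h : EquationsC s a e c d r κ) (hr : r ≠ 0) (hκ : κ ≠ 0) :
    gamC s a e c d = 0 ∧ detC s a e c d = 0 := by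
  obtain ⟨h0, ⟨h1, h2⟩, -⟩ := equationsC_iff.mp h
  exact ⟨h0, det3_eq_zero_of_kernel hr h1 h2 (h.rowR hκ)⟩

lemma LinearisedC.rowR (h : EquationsC s a e c d r κ) (hκ : κ ≠ 0)
    (hl : LinearisedC s a e c d r κ a' e' c' d' r' κ') :
    dot3 (rowR s (pvec s a' e') (qvec c d) + rowR s (pvec s a e) (qvec c' d')) r +
      dot3 (rowR s (pvec s a e) (qvec c d)) r' = 0 := by
  obtain ⟨-, -, h3, h4, h5⟩ := equationsC_iff.mp h
  obtain ⟨-, -, l3, l4, l5⟩ := linearisedC_iff.mp hl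
  rw [← det3'_rowK]
  exact det3'_eq_zero_of_kernel hκ h3 h4 h5 l3 l4 l5

lemma LinearisedC.eliminate (h : EquationsC s a e c d r κ) (hr : r ≠ 0) (hκ : κ ≠ 0)
    (hl : LinearisedC s a e c d r κ a' e' c' d' r' κ') :
    gamC' s a e c d a' e' c' d' = 0 ∧ detC' s a e c d a' e' c' d' = 0 := by
  obtain ⟨h0, ⟨h1, h2⟩, -⟩ := equationsC_iff.mp h
  obtain ⟨l0, ⟨l1, l2⟩, -⟩ := linearisedC_iff.mp hl
  exact ⟨l0, det3'_eq_zero_of_kernel hr h1 h2 (h.rowR hκ) l1 l2 (hl.rowR h hκ)⟩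

lemma exists_equationsC (h0 : gamC s a e c d = 0) (h : detC s a e c d = 0) :
    ∃ r κ, r ≠ 0 ∧ κ ≠ 0 ∧ EquationsC s a e c d r κ := by
  obtain ⟨r, hr, ⟨h1, h2, h3⟩, -⟩ := deformableKernel_of_det3 (u' := 0) (v' := 0) (w' := 0) h
    (by simp [det3', det3])
  rw [dot3_rowR] at h3
  obtain ⟨κ, hκ, h3, -⟩ := deformableKernel_of_det3 (u' := 0) (v' := 0) (w' := 0) h3
    (by simp [det3', det3])
  exact ⟨r, κ, hr, hκ, equationsC_iff.mpr ⟨h0, ⟨h1, h2⟩, h3⟩⟩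

lemma gamC_smul (p q : ℂ) : gamC s (p * a) (p * e) (q * c) (q * d) = p * q * gamC s a e c d := by
  rw [gamC, gamC, hForm_smul, qvec_smul, LinearMap.smul_apply, _root_.map_smul, smul_eq_mul,
    smul_eq_mul, mul_assoc]

/-- The point `(a : e), (c : d)` is a simple solution of the eliminated equations. -/
def IsSimpleC (s a e c d : ℂ) : Prop := ∀ a' e' c' d', gamC' s a e c d a' e' c' d' = 0 →
  detC' s a e c d a' e' c' d' = 0 → e * a' = a * e' ∧ d * c' = c * d'

lemma IsSimpleC.exists_deformation (hae : a ≠ 0 ∨ e ≠ 0) (hcd : c ≠ 0 ∨ d ≠ 0)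
    (hs : IsSimpleC s a e c d) : ∃ a' e' c' d', detC' s a e c d a' e' c' d' ≠ 0 := by
  obtain ⟨y, z, hyz⟩ := exists_dual hae
  obtain ⟨y', z', hyz'⟩ := exists_dual hcd
  obtain ⟨p, q, hpq, h⟩ := exists_root_of_linear (gamC s (-z) y c d) (gamC s a e (-z') y')
  refine ⟨p * -z, p * y, q * -z', q * y', fun h0 => ?_⟩
  obtain ⟨h1, h2⟩ := hs _ _ _ _ (by
    have e1 := gamC_smul (s := s) (a := -z) (e := y) (c := c) (d := d) p 1
    have e2 := gamC_smul (s := s) (a := a) (e := e) (c := -z') (d := y') 1 q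
    rw [one_mul, one_mul] at e1 e2
    rw [gamC', e1, e2]
    linear_combination h) h0
  exact hpq.elim (fun h => h (by linear_combination -p * hyz - h1)) fun h =>
    h (by linear_combination -q * hyz' - h2)

lemma kernel_unique_C (hae : a ≠ 0 ∨ e ≠ 0) (hcd : c ≠ 0 ∨ d ≠ 0) (hs : IsSimpleC s a e c d)
    (hr : r ≠ 0) (hκ : κ ≠ 0) (h : EquationsC s a e c d r κ)
    (h1 : dot3 (rowH s a e) r' = 0) (h2 : dot3 (rowM c d) r' = 0)
    (h3 : dot3 (rowR s (pvec s a e) (qvec c d)) r' = 0) : ∃ t : ℂ, r' = t • r := by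
  obtain ⟨a', e', c', d', hD⟩ := hs.exists_deformation hae hcd
  obtain ⟨-, ⟨k1, k2⟩, -⟩ := equationsC_iff.mp h
  exact eq_smul_of_det3'_ne_zero hD hr k1 k2 (h.rowR hκ) h1 h2 h3

lemma kernel_unique_C' (hae : a ≠ 0 ∨ e ≠ 0) (hcd : c ≠ 0 ∨ d ≠ 0) (hs : IsSimpleC s a e c d)
    (hr : r ≠ 0) (hκ : κ ≠ 0) (h : EquationsC s a e c d r κ) (h' : EquationsC s a e c d r κ') :
    ∃ t : ℂ, κ' = t • κ := by
  obtain ⟨-, ⟨k1, k2⟩, k3⟩ := equationsC_iff.mp h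
  obtain ⟨-, -, l3⟩ := equationsC_iff.mp h'
  obtain ⟨a', e', c', d', r', hD⟩ : ∃ a' e' c' d' r', det3' (rowK s (pvec s a e))
      (rowK s (qvec c d)) (rowK s (rvec r)) (rowK s (pvec s a' e')) (rowK s (qvec c' d'))
      (rowK s (rvec r')) ≠ 0 := by
    simp only [det3'_rowK]
    by_cases hR : FlagSchubert.rowR s (pvec s a e) (qvec c d) = 0
    · obtain ⟨a', e', c', d', hD⟩ := hs.exists_deformation hae hcd
      refine ⟨a', e', c', d', 0, fun h0 => hD ?_⟩
      rw [detC', det3', hR]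
      rw [hR, show dot3 0 0 = 0 by simp [dot3], add_zero] at h0
      rw [det3_eq_zero_of_kernel hr k1 k2 h0]
      simp [det3]
    · obtain ⟨x, hx⟩ := exists_dot3_ne_zero hR
      refine ⟨0, 0, 0, 0, x, ?_⟩
      rw [dot3_comm] at hx
      simpa [dot3, rowR, cross3, rowK, pvec, qvec] using hx
  exact eq_smul_of_det3'_ne_zero hD hκ k3.1 k3.2.1 k3.2.2 l3.1 l3.2.1 l3.2.2

lemma IsSimpleC.trivial (hae : a ≠ 0 ∨ e ≠ 0) (hcd : c ≠ 0 ∨ d ≠ 0) (hs : IsSimpleC s a e c d)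
    (hr : r ≠ 0) (hκ : κ ≠ 0) (h : EquationsC s a e c d r κ)
    (hl : LinearisedC s a e c d r κ a' e' c' d' r' κ') :
    e * a' = a * e' ∧ d * c' = c * d' ∧ (∃ t : ℂ, r' = t • r) ∧ ∃ t : ℂ, κ' = t • κ := by
  obtain ⟨g1, g2⟩ := hl.eliminate h hr hκ
  obtain ⟨p1, p2⟩ := hs _ _ _ _ g1 g2
  refine ⟨p1, p2, ?_⟩
  obtain ⟨p, rfl, rfl⟩ := exists_mul_of_cross hae p1
  obtain ⟨q, rfl, rfl⟩ := exists_mul_of_cross hcd p2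
  have hR := hl.rowR h hκ
  obtain ⟨l1, l2, l3, l4, l5, l6⟩ := hl
  rw [hForm_smul, LinearMap.smul_apply, h.hr, smul_zero, zero_add, hForm_rvec] at l2
  rw [mForm_smul, LinearMap.smul_apply, h.mr, smul_zero, zero_add, mForm_rvec] at l3
  rw [pvec_smul, _root_.map_smul, h.kp, smul_zero, add_zero] at l4
  rw [qvec_smul, _root_.map_smul, h.kq, smul_zero, add_zero] at l5
  have hR' : dot3 (FlagSchubert.rowR s (pvec s a e) (qvec c d)) r' = 0 := by
    have h0 := h.rowR hκ
    rw [pvec_smul, qvec_smul] at hR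
    simp only [dot3, FlagSchubert.rowR, cross3, rowK, Matrix.cons_val, Pi.add_apply, Pi.smul_apply,
      smul_eq_mul] at hR h0 ⊢
    linear_combination hR - (p + q) * h0
  obtain ⟨t, rfl⟩ := kernel_unique_C hae hcd hs hr hκ h l2 l3 hR'
  rw [rvec_smul, _root_.map_smul, h.kr, smul_zero, add_zero] at l6
  exact ⟨⟨t, rfl⟩, kernel_unique_C' hae hcd hs hr hκ h ⟨h.hq, h.hr, h.mr, l4, l5, l6⟩⟩

lemma exists_linearisedC_of_not_isSimpleC (h0 : gamC s a e c d = 0) (h : detC s a e c d = 0)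
    (hs : ¬ IsSimpleC s a e c d) : ∃ r κ a' e' c' d' r' κ', r ≠ 0 ∧ κ ≠ 0 ∧
      EquationsC s a e c d r κ ∧ LinearisedC s a e c d r κ a' e' c' d' r' κ' ∧
      ¬ (e * a' = a * e' ∧ d * c' = c * d' ∧ (∃ t : ℂ, r' = t • r) ∧ ∃ t : ℂ, κ' = t • κ) := by
  have zero : ∀ x : Fin 3 → ℂ, dot3 0 x = 0 ∧ dot3 x 0 = 0 := fun x => by simp [dot3]
  have inner : ∀ a' e' c' d' r r', r ≠ 0 → dot3 (rowH s a e) r = 0 → dot3 (rowM c d) r = 0 →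
      dot3 (rowR s (pvec s a e) (qvec c d)) r = 0 → gamC' s a e c d a' e' c' d' = 0 →
      dot3 (rowH s a' e') r + dot3 (rowH s a e) r' = 0 →
      dot3 (rowM c' d') r + dot3 (rowM c d) r' = 0 →
      dot3 (rowR s (pvec s a' e') (qvec c d) + rowR s (pvec s a e) (qvec c' d')) r +
        dot3 (rowR s (pvec s a e) (qvec c d)) r' = 0 →
      ¬ (e * a' = a * e' ∧ d * c' = c * d' ∧ ∃ t : ℂ, r' = t • r) →
      ∃ r κ a' e' c' d' r' κ', r ≠ 0 ∧ κ ≠ 0 ∧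
      EquationsC s a e c d r κ ∧ LinearisedC s a e c d r κ a' e' c' d' r' κ' ∧
      ¬ (e * a' = a * e' ∧ d * c' = c * d' ∧ (∃ t : ℂ, r' = t • r) ∧ ∃ t : ℂ, κ' = t • κ) := by
    intro a' e' c' d' r r' hr h1 h2 h3 l0 l1 l2 l3 hne
    rw [← det3'_rowK] at l3
    rw [dot3_rowR] at h3
    obtain ⟨κ, hκ, k, ⟨κ', l⟩ | ⟨κ', hκ', l4, l5, l6⟩⟩ := deformableKernel_of_det3 h3 l3
    · exact ⟨r, κ, a', e', c', d', r', κ', hr, hκ, equationsC_iff.mpr ⟨h0, ⟨h1, h2⟩, k⟩,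
        linearisedC_iff.mpr ⟨l0, ⟨l1, l2⟩, l⟩, fun h => hne ⟨h.1, h.2.1, h.2.2.1⟩⟩
    · refine ⟨r, κ, 0, 0, 0, 0, 0, κ', hr, hκ, equationsC_iff.mpr ⟨h0, ⟨h1, h2⟩, k⟩,
        linearisedC_iff.mpr ?_, fun ⟨_, _, _, t, ht⟩ => hκ' t ht⟩
      rw [l4, l5, l6]
      simp [gamC', gamC, hForm, form_cubeCoeff, dot3, rowH, rowM, rowK, pvec, qvec, rvec]
  simp only [IsSimpleC, not_forall] at hs
  obtain ⟨a', e', c', d', g, hD, hne⟩ := hs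
  obtain ⟨r, hr, ⟨h1, h2, h3⟩, ⟨r', l1, l2, l3⟩ | ⟨r', hr', l1, l2, l3⟩⟩ :=
    deformableKernel_of_det3 h hD
  · exact inner a' e' c' d' r r' hr h1 h2 h3 g l1 l2 l3 fun h => hne ⟨h.1, h.2.1⟩
  · refine inner 0 0 0 0 r r' hr h1 h2 h3 ?_ ?_ ?_ ?_ fun ⟨_, _, t, ht⟩ => hr' t ht
    · simp [gamC', gamC, hForm, form_cubeCoeff, qvec]
    · rw [l1]; simp [dot3, rowH]
    · rw [l2]; simp [dot3, rowM]
    · rw [l3]; simp [dot3, rowR, cross3, rowK, pvec, qvec]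

end EliminationC

section SolutionsC

variable {s a e c d a' e' c' d' : ℂ}

/-- The form of bidegree `(2,2)` to which `detC` reduces. -/
def formC (s a e c d : ℂ) : ℂ :=
  c^2*((-144*s^5 + 412*s^4 - 168*s^3 - 180*s^2) * a^2 +
    (48*s^5 - 732*s^3 + 984*s^2 - 180*s) * a * e + (36*s^4 + 156*s^3 - 292*s^2 + 60*s) * e^2) +
  c * d * ((48*s^5 - 96*s^4 - 194*s^3 + 252*s^2 + 90*s) * a^2 +
    (-72*s^4 + 402*s^3 - 29*s^2 - 636*s + 225) * a * e + (-96*s^3 + 3*s^2 + 198*s - 75) * e^2) +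
  d^2*((-12*s^4 + 78*s^3 - 56*s^2 - 30*s) * a^2 +
    (-153*s^2 + 248*s - 75) * a * e + (48*s^2 - 78*s + 25) * e^2)

/-- The differential of `formC`. -/
def formC' (s a e c d a' e' c' d' : ℂ) : ℂ :=
  formC s (a + a') (e + e') c d - formC s a' e' c d + formC s a e (c + c') (d + d') -
    formC s a e c' d' - 2*formC s a e c d

lemma detC_eq : detC s a e c d = s^4*formC s a e c d := by
  simp only [detC, det3, rowH, rowM, rowR, cross3, rowK, pvec, qvec, formC, Matrix.cons_val]
  ring

lemma detC'_eq : detC' s a e c d a' e' c' d' = s^4*formC' s a e c d a' e' c' d' := by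
  simp only [detC', det3', det3, rowH, rowM, rowR, cross3, rowK, pvec, qvec, formC', formC,
    Matrix.cons_val, Pi.add_apply]
  ring

/-- The coefficient of `c` in `gamC s a e c d`. -/
def gamC₀ (s a e : ℂ) : ℂ := e * (s^2 + 6*s + 3) - a * (3*s^2 + 6*s + 1)

/-- The coefficient of `d` in `gamC s a e c d`. -/
def gamC₁ (s a e : ℂ) : ℂ := a * (s^2 + 6*s + 3) - e * (2*s + 3)

lemma gamC_eq : gamC s a e c d = gamC₀ s a e * c + gamC₁ s a e * d := by
  rw [gamC, hForm, form_cubeCoeff, gamC₀, gamC₁]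
  simp [qvec]
  ring

/-- The eliminated equations have four solutions, all simple. -/
def HasSimpleSolutionsC (s : ℂ) : Prop :=
  (∃ a e c d : Fin 4 → ℂ, (∀ k, (a k ≠ 0 ∨ e k ≠ 0) ∧ (c k ≠ 0 ∨ d k ≠ 0) ∧
      gamC s (a k) (e k) (c k) (d k) = 0 ∧ formC s (a k) (e k) (c k) (d k) = 0) ∧
    (∀ k l, k ≠ l → e k * a l = a k * e l → d k * c l ≠ c k * d l) ∧
    ∀ a' e' c' d', (a' ≠ 0 ∨ e' ≠ 0) → (c' ≠ 0 ∨ d' ≠ 0) → gamC s a' e' c' d' = 0 →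
      formC s a' e' c' d' = 0 → ∃ k, e k * a' = a k * e' ∧ d k * c' = c k * d') ∧
  ∀ a e c d a' e' c' d', (a ≠ 0 ∨ e ≠ 0) → (c ≠ 0 ∨ d ≠ 0) → gamC s a e c d = 0 →
    formC s a e c d = 0 → gamC' s a e c d a' e' c' d' = 0 →
    formC' s a e c d a' e' c' d' = 0 → e * a' = a * e' ∧ d * c' = c * d'

/-- The restriction of `formC` to the curve on which `gamC` vanishes. -/
def curveC (s : ℂ) : ℂ → ℂ → ℂ :=
  quarticForm (-56*s^5 - 336*s^4 - 384*s^3 - 160*s^2 - 24*s)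
    (24*s^5 + 316*s^4 + 708*s^3 + 144*s^2 - 212*s - 60)
    (-36*s^4 - 136*s^3 + 240*s^2 + 687*s + 245)
    (-12*s^3 - 148*s^2 - 390*s - 210) (12*s^2 + 63*s + 45)

/-- The differential of `curveC`. -/
def curveC' (s : ℂ) : ℂ → ℂ → ℂ → ℂ → ℂ :=
  quarticForm' (-56*s^5 - 336*s^4 - 384*s^3 - 160*s^2 - 24*s)
    (24*s^5 + 316*s^4 + 708*s^3 + 144*s^2 - 212*s - 60)
    (-36*s^4 - 136*s^3 + 240*s^2 + 687*s + 245)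
    (-12*s^3 - 148*s^2 - 390*s - 210) (12*s^2 + 63*s + 45)

lemma curveC_roots (hw : s^4 + 6*s^3 + 21*s^2 + 16*s + 6 ≠ 0) :
    (polyC s ≠ 0 → HasSimpleRoots 4 (curveC s) (curveC' s)) ∧
      (polyC s = 0 → HasDoubleRoot (curveC s) (curveC' s)) := by
  have h := quartic_roots (-56*s^5 - 336*s^4 - 384*s^3 - 160*s^2 - 24*s)
    (24*s^5 + 316*s^4 + 708*s^3 + 144*s^2 - 212*s - 60)
    (-36*s^4 - 136*s^3 + 240*s^2 + 687*s + 245)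
    (-12*s^3 - 148*s^2 - 390*s - 210) (12*s^2 + 63*s + 45)
  rw [show quarticDisc _ _ _ _ _ = 62208*(s^4 + 6*s^3 + 21*s^2 + 16*s + 6)^2*polyC s by
    rw [quarticDisc, polyC]; ring] at h
  exact ⟨fun h0 => h.1 (mul_ne_zero (mul_ne_zero (by norm_num) (pow_ne_zero 2 hw)) h0),
    fun h0 => h.2 (by rw [h0, mul_zero])⟩

lemma formC_curve (p : ℂ) : formC s a e (p * gamC₁ s a e) (-(p * gamC₀ s a e)) =
    10*p^2*(s - 1)^3*curveC s a e := by
  rw [formC, gamC₀, gamC₁, curveC, quarticForm]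
  ring

lemma formC'_curve (p q : ℂ) : formC' s a e (p * gamC₁ s a e) (-(p * gamC₀ s a e)) a' e'
      (p * gamC₁ s a' e' + q * gamC₁ s a e) (-(p * gamC₀ s a' e' + q * gamC₀ s a e)) =
    10*(s - 1)^3*(p^2*curveC' s a e a' e' + 2*p * q * curveC s a e) := by
  simp only [formC', formC, gamC₀, gamC₁, curveC, curveC', quarticForm, quarticForm']
  ring

lemma gamC_ne_zero (hw : s^4 + 6*s^3 + 21*s^2 + 16*s + 6 ≠ 0)
    (hae : a ≠ 0 ∨ e ≠ 0) : gamC₁ s a e ≠ 0 ∨ gamC₀ s a e ≠ 0 := by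
  by_contra! h
  obtain ⟨h1, h0⟩ := h
  rw [gamC₁] at h1
  rw [gamC₀] at h0
  rcases hae with ha | he
  · exact mul_ne_zero hw ha (by
      linear_combination (s^2 + 6*s + 3) * h1 + (2*s + 3) * h0)
  · exact mul_ne_zero hw he (by
      linear_combination (3*s^2 + 6*s + 1) * h1 + (s^2 + 6*s + 3) * h0)

lemma exists_curveC (hw : s^4 + 6*s^3 + 21*s^2 + 16*s + 6 ≠ 0)
    (hae : a ≠ 0 ∨ e ≠ 0) (hcd : c ≠ 0 ∨ d ≠ 0) (h : gamC s a e c d = 0) :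
    ∃ p, p ≠ 0 ∧ c = p * gamC₁ s a e ∧ d = -(p * gamC₀ s a e) := by
  rw [gamC_eq] at h
  obtain ⟨p, h1, h2⟩ := exists_mul_of_cross (gamC_ne_zero hw hae) (x := c) (y := -d)
    (by linear_combination h)
  refine ⟨p, ?_, h1, by linear_combination -h2⟩
  rintro rfl
  exact hcd.elim (fun h => h (by linear_combination h1)) fun h => h (by linear_combination -h2)

lemma hasSimpleSolutionsC_of_ne (h1 : s ≠ 1)
    (hw : s^4 + 6*s^3 + 21*s^2 + 16*s + 6 ≠ 0) (h : polyC s ≠ 0) : HasSimpleSolutionsC s := by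
  have hs := (curveC_roots hw).1 h
  have h1' : (10 : ℂ) * (s - 1)^3 ≠ 0 :=
    mul_ne_zero (by norm_num) (pow_ne_zero 3 (sub_ne_zero.mpr h1))
  constructor
  · obtain ⟨a, e, hroot, hdist, hall⟩ := hs.exists_roots
    refine ⟨a, e, fun k => 1*gamC₁ s (a k) (e k), fun k => -(1*gamC₀ s (a k) (e k)),
      fun k => ⟨(hroot k).1, ?_, ?_, ?_⟩, fun k l hkl h _ => hdist k l hkl ?_, ?_⟩
    · simp only [one_mul, neg_ne_zero]
      exact gamC_ne_zero hw (hroot k).1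
    · rw [gamC_eq]; ring
    · rw [formC_curve, (hroot k).2, mul_zero]
    · linear_combination -h
    · intro a' e' c' d' hae hcd h0 hf
      obtain ⟨p, hp, rfl, rfl⟩ := exists_curveC hw hae hcd h0
      rw [formC_curve, mul_right_comm _ (p^2), mul_assoc, mul_eq_zero, or_iff_right h1',
        mul_eq_zero, or_iff_right (pow_ne_zero 2 hp)] at hf
      obtain ⟨k, hk⟩ := hall a' e' hf
      obtain ⟨t, rfl, rfl⟩ := exists_mul_of_cross (hroot k).1 (x := a') (y := e')
        (by linear_combination -hk)
      exact ⟨k, by ring, by simp only [gamC₀, gamC₁]; ring⟩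
  · intro a e c d a' e' c' d' hae hcd h0 hf l0 lf
    obtain ⟨p, hp, rfl, rfl⟩ := exists_curveC hw hae hcd h0
    rw [formC_curve, mul_right_comm _ (p^2), mul_assoc, mul_eq_zero, or_iff_right h1',
      mul_eq_zero, or_iff_right (pow_ne_zero 2 hp)] at hf
    rw [gamC', gamC_eq, gamC_eq] at l0
    obtain ⟨q, q1, q2⟩ := exists_mul_of_cross (gamC_ne_zero hw hae)
      (x := c' - p * gamC₁ s a' e') (y := -d' - p * gamC₀ s a' e') (by linear_combination l0)
    obtain rfl : c' = p * gamC₁ s a' e' + q * gamC₁ s a e := by linear_combination q1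
    obtain rfl : d' = -(p * gamC₀ s a' e' + q * gamC₀ s a e) := by linear_combination -q2
    rw [formC'_curve, hf, mul_zero, add_zero, mul_eq_zero, or_iff_right h1', mul_eq_zero,
      or_iff_right (pow_ne_zero 2 hp)] at lf
    obtain ⟨t, rfl, rfl⟩ := exists_mul_of_cross hae (x := a') (y := e')
      (by linear_combination -hs.simple a e a' e' hae hf lf)
    exact ⟨by ring, by simp only [gamC₀, gamC₁]; ring⟩

lemma exists_not_isSimpleC (hw : s^4 + 6*s^3 + 21*s^2 + 16*s + 6 ≠ 0)
    (h : polyC s = 0) : ∃ a e c d, (a ≠ 0 ∨ e ≠ 0) ∧ (c ≠ 0 ∨ d ≠ 0) ∧ gamC s a e c d = 0 ∧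
      detC s a e c d = 0 ∧ ¬ IsSimpleC s a e c d := by
  obtain ⟨a, e, hae, h1, h2⟩ := (curveC_roots hw).2 h
  obtain ⟨y, z, hyz⟩ := exists_dual hae
  refine ⟨a, e, 1*gamC₁ s a e, -(1*gamC₀ s a e), hae, ?_, ?_, ?_, fun hs => ?_⟩
  · rw [one_mul, one_mul, neg_ne_zero]
    exact gamC_ne_zero hw hae
  · rw [gamC_eq]; ring
  · rw [detC_eq, formC_curve, h1]; ring
  · refine one_ne_zero (hyz.symm.trans ?_)
    linear_combination -(hs (-z) y (1*gamC₁ s (-z) y + 0*gamC₁ s a e)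
      (-(1*gamC₀ s (-z) y + 0*gamC₀ s a e)) (by rw [gamC', gamC_eq, gamC_eq]; ring)
      (by rw [detC'_eq, formC'_curve, h1, h2]; ring)).1


/-- The restriction of `formC` to one component of the curve on which `gamC` vanishes. -/
def lineC (s : ℂ) : ℂ → ℂ → ℂ :=
  quadraticForm (-288000 - 828000*s - 1137600*s^2 - 410400*s^3)
    (483000 + 1342200*s + 1781400*s^2 + 545400*s^3)
    (-28550 - 58200*s - 52650*s^2 + 28900*s^3)

/-- The differential of `lineC`. -/
def lineC' (s : ℂ) : ℂ → ℂ → ℂ → ℂ → ℂ :=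
  quadraticForm' (-288000 - 828000*s - 1137600*s^2 - 410400*s^3)
    (483000 + 1342200*s + 1781400*s^2 + 545400*s^3)
    (-28550 - 58200*s - 52650*s^2 + 28900*s^3)

/-- The restriction of `formC` to the other component. -/
def coLineC (s : ℂ) : ℂ → ℂ → ℂ :=
  quadraticForm (255600 + 663600*s + 837000*s^2 + 168800*s^3)
    (-5400 - 20400*s - 23800*s^2 - 2400*s^3)
    (2250 + 7200*s + 7950*s^2 - 900*s^3)

/-- The differential of `coLineC`. -/
def coLineC' (s : ℂ) : ℂ → ℂ → ℂ → ℂ → ℂ :=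
  quadraticForm' (255600 + 663600*s + 837000*s^2 + 168800*s^3)
    (-5400 - 20400*s - 23800*s^2 - 2400*s^3)
    (2250 + 7200*s + 7950*s^2 - 900*s^3)

lemma lineC_roots (hw : s^4 + 6*s^3 + 21*s^2 + 16*s + 6 = 0) :
    HasSimpleRoots 2 (lineC s) (lineC' s) := by
  refine (quadratic_roots ..).1 fun h => ?_
  have : (64801652486400000000000 : ℂ) = 0 := by
    linear_combination (12008217186769198 + 22544386486170756*s + 6689143719355359*s^2 +
      1159602800859172*s^3) * h + (-401062452940958136280200000 -
      1954957144382931784096800000*s - 4153294960264294440917760000*s^2 -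
      4498460463324115492184160000*s^3 - 2212956828068262409491480000*s^4 -
      399950948665851343984800000*s^5) * hw
  norm_num at this

lemma coLineC_roots (hw : s^4 + 6*s^3 + 21*s^2 + 16*s + 6 = 0) :
    HasSimpleRoots 2 (coLineC s) (coLineC' s) := by
  refine (quadratic_roots ..).1 fun h => ?_
  have : (182652930036900000000000 : ℂ) = 0 := by
    linear_combination (30422008655897482 + 22985415020490204*s + 6113938460449581*s^2 +
      825120083563348*s^3) * h + (11546389311609582836280000 +
      44399652742214108352000000*s + 66635122260845915998320000*s^2 +
      26870489361147193393040000*s^3 + 1135034610403735073280000*s^4 -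
      506161664061100197120000*s^5) * hw
  norm_num at this

lemma lineC_ne_zero (hw : s^4 + 6*s^3 + 21*s^2 + 16*s + 6 = 0)
    (hcd : c ≠ 0 ∨ d ≠ 0) (h : lineC s c d = 0) : (2*s + 3) * d ≠ (s^2 + 6*s + 3) * c := by
  intro h0
  have hX : s^2 + 6*s + 3 ≠ 0 := fun h => by
    have : (300 : ℂ) = 0 := by
      linear_combination (-152 - 414*s - 126*s^2 - 23*s^3) * h + (126 + 23*s) * hw
    norm_num at this
  obtain ⟨t, rfl, rfl⟩ := exists_mul_of_cross (a := 2*s + 3) (Or.inr hX) h0.symm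
  have ht : t ≠ 0 := by
    rintro rfl
    simp at hcd
  rw [lineC, quadraticForm] at h
  have : t^2*(91432966950000000 : ℂ) = 0 := by
    linear_combination (-6427439485466 + 4361614191948*s + 1634005762347*s^2 +
      396273824176*s^3) * h + t^2*(1620009781358723550 + 6601944059492434500*s +
      727510524774380100*s^2 - 5121067688837615800*s^3 - 3195404093237969850*s^4 -
      527328318212261100*s^5 - 11452313518686400*s^6) * hw
  exact mul_ne_zero (pow_ne_zero 2 ht) (by norm_num) this

lemma formC_line (hw : s^4 + 6*s^3 + 21*s^2 + 16*s + 6 = 0) (t : ℂ) :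
    formC s (t * (s^2 + 6*s + 3)) (t * (3*s^2 + 6*s + 1)) c d = t^2*lineC s c d := by
  rw [formC, lineC, quadraticForm]
  linear_combination t^2*(c^2*(48000 + 9920*s - 5280*s^2 + 480*s^3 +
    160*s^4) + c * d * (-80400 - 8700*s + 7656*s^2 - 1580*s^3 - 24*s^4 +
    48*s^5) + d^2*(4725 - 3084*s + 565*s^2 + 6*s^3 - 12*s^4)) * hw

lemma formC_coLine (hw : s^4 + 6*s^3 + 21*s^2 + 16*s + 6 = 0) (t : ℂ) :
    formC s a e (t * (2*s + 3)) (t * (s^2 + 6*s + 3)) = t^2*coLineC s a e := by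
  rw [formC, coLineC, quadraticForm]
  linear_combination t^2*(a^2*(-42600 + 3090*s + 1564*s^2 - 618*s^3 +
    84*s^4) + a * e * (1125 - 2*s - 141*s^2 + 48*s^3) + e^2*(-450 + 120*s)) * hw

lemma formC'_line (hw : s^4 + 6*s^3 + 21*s^2 + 16*s + 6 = 0) (t t' : ℂ) :
    formC' s (t * (s^2 + 6*s + 3)) (t * (3*s^2 + 6*s + 1)) c d
      (t' * (s^2 + 6*s + 3)) (t' * (3*s^2 + 6*s + 1)) c' d' =
    2*t * t' * lineC s c d + t^2*lineC' s c d c' d' := by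
  rw [formC', ← add_mul, ← add_mul]
  simp only [formC_line hw]
  rw [lineC', lineC]
  simp only [quadraticForm, quadraticForm']
  ring

lemma formC'_coLine (hw : s^4 + 6*s^3 + 21*s^2 + 16*s + 6 = 0) (t t' : ℂ) :
    formC' s a e (t * (2*s + 3)) (t * (s^2 + 6*s + 3)) a' e'
      (t' * (2*s + 3)) (t' * (s^2 + 6*s + 3)) =
    2*t * t' * coLineC s a e + t^2*coLineC' s a e a' e' := by
  rw [formC', ← add_mul, ← add_mul]
  simp only [formC_coLine hw]
  rw [coLineC', coLineC]
  simp only [quadraticForm, quadraticForm']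
  ring

lemma hasSimpleSolutionsC_of_eq (hw : s^4 + 6*s^3 + 21*s^2 + 16*s + 6 = 0) :
    HasSimpleSolutionsC s := by
  have hgam : ∀ a e c d, (s^2 + 6*s + 3) * gamC s a e c d =
      (e * (s^2 + 6*s + 3) - a * (3*s^2 + 6*s + 1)) *
        ((s^2 + 6*s + 3) * c - (2*s + 3) * d) := fun a e c d => by
    rw [gamC_eq, gamC₀, gamC₁]
    linear_combination a * d * hw
  have hX : s^2 + 6*s + 3 ≠ 0 := fun h => by
    have : (300 : ℂ) = 0 := by
      linear_combination (-152 - 414*s - 126*s^2 - 23*s^3) * h + (126 + 23*s) * hw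
    norm_num at this
  have hsplit : ∀ {a e c d}, (a ≠ 0 ∨ e ≠ 0) → (c ≠ 0 ∨ d ≠ 0) → gamC s a e c d = 0 →
      formC s a e c d = 0 → (∃ t, t ≠ 0 ∧ a = t * (s^2 + 6*s + 3) ∧
        e = t * (3*s^2 + 6*s + 1) ∧ lineC s c d = 0 ∧ (s^2 + 6*s + 3) * c - (2*s + 3) * d ≠ 0) ∨
      ∃ t, t ≠ 0 ∧ c = t * (2*s + 3) ∧ d = t * (s^2 + 6*s + 3) ∧ coLineC s a e = 0 ∧
        e * (s^2 + 6*s + 3) - a * (3*s^2 + 6*s + 1) ≠ 0 := by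
    intro a e c d hae hcd h0 hf
    have hline : e * (s^2 + 6*s + 3) - a * (3*s^2 + 6*s + 1) = 0 →
        ∃ t, t ≠ 0 ∧ a = t * (s^2 + 6*s + 3) ∧ e = t * (3*s^2 + 6*s + 1) ∧
          lineC s c d = 0 ∧ (s^2 + 6*s + 3) * c - (2*s + 3) * d ≠ 0 := by
      intro h
      obtain ⟨t, rfl, rfl⟩ := exists_mul_of_cross (b := 3*s^2 + 6*s + 1) (Or.inl hX)
        (x := a) (y := e) (by linear_combination -h)
      have ht : t ≠ 0 := by
        rintro rfl
        simp at hae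
      rw [formC_line hw, mul_eq_zero, or_iff_right (pow_ne_zero 2 ht)] at hf
      exact ⟨t, ht, rfl, rfl, hf, fun h => lineC_ne_zero hw hcd hf (by linear_combination -h)⟩
    by_cases hl : e * (s^2 + 6*s + 3) - a * (3*s^2 + 6*s + 1) = 0
    · exact Or.inl (hline hl)
    have hm := hgam a e c d
    rw [h0, mul_zero, eq_comm, mul_eq_zero, or_iff_right hl] at hm
    obtain ⟨t, rfl, rfl⟩ := exists_mul_of_cross (a := 2*s + 3) (Or.inr hX)
      (x := c) (y := d) (by linear_combination hm)
    have ht : t ≠ 0 := by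
      rintro rfl
      simp at hcd
    rw [formC_coLine hw, mul_eq_zero, or_iff_right (pow_ne_zero 2 ht)] at hf
    exact Or.inr ⟨t, ht, rfl, rfl, hf, hl⟩
  have hs₁ := lineC_roots hw
  have hs₂ := coLineC_roots hw
  constructor
  · obtain ⟨c, d, hroot, hdist, hall⟩ := hs₁.exists_roots
    obtain ⟨a, e, hroot', hdist', hall'⟩ := hs₂.exists_roots
    refine ⟨Fin.append (m := 2) (fun _ => s^2 + 6*s + 3) a,
      Fin.append (m := 2) (fun _ => 3*s^2 + 6*s + 1) e, Fin.append (n := 2) c fun _ => 2*s + 3,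
      Fin.append (n := 2) d fun _ => s^2 + 6*s + 3, fun k => ?_, fun k l => ?_, ?_⟩
    · refine Fin.addCases (m := 2) (n := 2) (fun i => ?_) (fun i => ?_) k
      · simp only [Fin.append_left]
        refine ⟨Or.inl hX, (hroot i).1, (mul_eq_zero.mp ((hgam ..).trans ?_)).resolve_left hX, ?_⟩
        · ring
        · simpa [(hroot i).2] using formC_line hw 1 (c := c i) (d := d i)
      · simp only [Fin.append_right]
        refine ⟨(hroot' i).1, Or.inr hX, (mul_eq_zero.mp ((hgam ..).trans ?_)).resolve_left hX, ?_⟩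
        · ring
        · simpa [(hroot' i).2] using formC_coLine hw 1 (a := a i) (e := e i)
    · have hno := fun i => lineC_ne_zero hw (hroot i).1 (hroot i).2
      refine Fin.addCases (m := 2) (n := 2) (fun i => ?_) (fun i => ?_) k <;>
        refine Fin.addCases (m := 2) (n := 2) (fun j => ?_) (fun j => ?_) l <;>
        simp only [Fin.append_left, Fin.append_right]
      · exact fun hkl _ h => hdist i j (fun h => hkl (h ▸ rfl)) (by linear_combination -h)
      · exact fun _ _ h => hno i (by linear_combination h)
      · exact fun _ _ h => hno j (by linear_combination -h)
      · exact fun hkl h _ => hdist' i j (fun h => hkl (h ▸ rfl)) (by linear_combination -h)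
    · intro a' e' c' d' hae hcd h0 hf
      rcases hsplit hae hcd h0 hf with ⟨t, -, rfl, rfl, h, -⟩ | ⟨t, -, rfl, rfl, h, -⟩
      · obtain ⟨k, hk⟩ := hall _ _ h
        refine ⟨Fin.castAdd 2 k, ?_⟩
        simp only [Fin.append_left]
        exact ⟨by ring, by linear_combination -hk⟩
      · obtain ⟨k, hk⟩ := hall' _ _ h
        refine ⟨Fin.natAdd 2 k, ?_⟩
        simp only [Fin.append_right]
        exact ⟨by linear_combination -hk, by ring⟩
  · intro a e c d a' e' c' d' hae hcd h0 hf l0 lf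
    have l0' := congrArg ((s^2 + 6*s + 3) * ·) l0
    simp only [gamC', mul_add, hgam, mul_zero] at l0'
    rcases hsplit hae hcd h0 hf with ⟨t, ht, rfl, rfl, h, hne⟩ | ⟨t, ht, rfl, rfl, h, hne⟩
    · obtain ⟨t', rfl, rfl⟩ := exists_mul_of_cross (b := 3*s^2 + 6*s + 1) (Or.inl hX)
        (x := a') (y := e') (mul_right_cancel₀ hne (by linear_combination -l0'))
      rw [formC'_line hw, h, mul_zero, zero_add, mul_eq_zero, or_iff_right (pow_ne_zero 2 ht)] at lf
      exact ⟨by ring, by linear_combination -hs₁.simple _ _ _ _ hcd h lf⟩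
    · obtain ⟨t', rfl, rfl⟩ := exists_mul_of_cross (a := 2*s + 3) (Or.inr hX)
        (x := c') (y := d') (mul_left_cancel₀ hne (by linear_combination l0'))
      rw [formC'_coLine hw, h, mul_zero, zero_add, mul_eq_zero, or_iff_right (pow_ne_zero 2 ht)] at lf
      exact ⟨by linear_combination -hs₂.simple _ _ _ _ hae h lf, by ring⟩

lemma ne_zero_of_polyC (h : polyC s = 0) : s^4 + 6*s^3 + 21*s^2 + 16*s + 6 ≠ 0 := by
  intro hw
  rw [polyC] at h
  have : (1047335488258690203824553033424873401000 : ℂ) = 0 := by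
    linear_combination (398221997007978047715178920433198 + 613357956469505724323986708756356*s +
      179211650117953223094398415282459*s^2 + 30143794520862881797204219867972*s^3) * h + (-58777286662080436695687143120514719625 - 3205492742708254311876524627398805093500*s -
      10696850061436556983676602458215192250625*s^2 -
      24647974344901502458796390976806657900750*s^3 -
      37696744284787941455494491255366735379600*s^4 -
      30313776174148325456469639336708451553280*s^5 - 3541762765239483782492589993095641179211
      * s^6 + 19984907004991423806973973926147476575050*s^7 +
      16306173302672115382927618236078049744029*s^8 -
      16976696060118421798078210156343875592516*s^9 -
      42418179229829683646601789922438111220672*s^10 -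
      34922858462720717418656877511013037487744*s^11 -
      14840882657599812458580051265189548378432*s^12 -
      3437038695095645055241023409256651225664*s^13 - 409126832019220899633995190219721272000
      * s^14 - 19533178849519147404588334474445856000*s^15) * hw
  norm_num at this

lemma hasSimpleSolutionsC (h1 : s ≠ 1) (h : polyC s ≠ 0) : HasSimpleSolutionsC s := by
  by_cases hw : s^4 + 6*s^3 + 21*s^2 + 16*s + 6 = 0
  · exact hasSimpleSolutionsC_of_eq hw
  · exact hasSimpleSolutionsC_of_ne h1 hw h

end SolutionsC

section TransversalityC

variable {E E' : PartialFlag typeC 7} {s a e c d p q t u : ℂ} {r κ : Fin 3 → ℂ}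

lemma EquationsC.scale (h : EquationsC s a e c d r κ) (p q t u : ℂ) :
    EquationsC s (p * a) (p * e) (q * c) (q * d) (t • r) (u • κ) := by
  obtain ⟨h1, h2, h3, h4, h5, h6⟩ := h
  constructor <;>
    simp only [hForm_smul, mForm_smul, kForm_smul, pvec_smul, qvec_smul, rvec_smul,
      LinearMap.smul_apply, _root_.map_smul, h1, h2, h3, h4, h5, h6, smul_zero]

lemma IsFlagC.scale (h : IsFlagC s E a e c d r κ) (hp : p ≠ 0) (hq : q ≠ 0) (ht : t ≠ 0)
    (hu : u ≠ 0) : IsFlagC s E (p * a) (p * e) (q * c) (q * d) (t • r) (u • κ) := by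
  refine ⟨?_, ?_, smul_ne_zero ht h.r_ne, smul_ne_zero hu h.κ_ne, fun v => ?_, fun v => ?_⟩
  · simpa [hp] using h.ae
  · simpa [hq] using h.cd
  · rw [h.mem_zero, pvec_smul, qvec_smul, rvec_smul]
    constructor
    · rintro ⟨x, y, z, rfl⟩
      exact ⟨x * t⁻¹, y * q⁻¹, z * p⁻¹, by simp [smul_smul, hp, hq, ht]⟩
    · rintro ⟨x, y, z, rfl⟩
      exact ⟨x * t, y * q, z * p, by simp only [smul_smul]⟩
  · rw [h.mem_one, hForm_smul, mForm_smul, kForm_smul]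
    simp [hp, hq, hu]

lemma IsFlagC.ext (h : IsFlagC s E a e c d r κ) (h' : IsFlagC s E' a e c d r κ) : E = E' := by
  refine PartialFlag.ext_space fun i => ?_
  fin_cases i
  · exact SetLike.ext fun v => (h.mem_zero v).trans (h'.mem_zero v).symm
  · exact SetLike.ext fun v => (h.mem_one v).trans (h'.mem_one v).symm

lemma HasSimpleSolutionsC.isSimpleC (hS : HasSimpleSolutionsC s) (hs : s ≠ 0)
    (hae : a ≠ 0 ∨ e ≠ 0) (hcd : c ≠ 0 ∨ d ≠ 0) (h0 : gamC s a e c d = 0)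
    (h : detC s a e c d = 0) : IsSimpleC s a e c d := by
  intro a' e' c' d' g hD
  rw [detC_eq, mul_eq_zero, or_iff_right (pow_ne_zero 4 hs)] at h
  rw [detC'_eq, mul_eq_zero, or_iff_right (pow_ne_zero 4 hs)] at hD
  exact hS.2 a e c d a' e' c' d' hae hcd h0 h g hD

theorem isTransverse_C_iff (x : Fin 1 → ℂ) (hx : Function.Injective (pointsAt pointsC x)) :
    IsTransverse typeC condC (pointsAt pointsC x) ↔ polyC (x 0) ≠ 0 := by
  obtain ⟨hs, hs'⟩ := (injective_pointsAt_C x).mp hx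
  constructor
  · intro htr h0
    obtain ⟨a, e, c, d, hae, hcd, h1, h2, h3⟩ := exists_not_isSimpleC (ne_zero_of_polyC h0) h0
    obtain ⟨r, κ, a', e', c', d', r', κ', hr, hκ, heq, hlin, hne⟩ :=
      exists_linearisedC_of_not_isSimpleC h1 h2 h3
    obtain ⟨E, hE, hEr⟩ := exists_flag_of_equationsC hs' hae hcd hr hκ heq
    exact not_isTransverse_of_linearisedC hs' hE hEr hlin hne htr
  · intro h0 E hE ψ hψ
    obtain ⟨a, e, c, d, r, κ, hEr, heq⟩ := exists_isFlagC hs' hE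
    obtain ⟨a', e', c', d', r', κ', hlin, hpres⟩ := exists_linearisedC hs' hE hEr heq hψ
    obtain ⟨h1, h2⟩ := heq.eliminate hEr.r_ne hEr.κ_ne
    obtain ⟨k1, k2, k3, k4⟩ := ((hasSimpleSolutionsC hs' h0).isSimpleC hs hEr.ae hEr.cd h1 h2).trivial
      hEr.ae hEr.cd hEr.r_ne hEr.κ_ne heq hlin
    exact hpres k1 k2 k3 k4

theorem encard_C (x : Fin 1 → ℂ) (hx : Function.Injective (pointsAt pointsC x))
    (h : polyC (x 0) ≠ 0) : (intersection typeC condC (pointsAt pointsC x)).encard = 4 := by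
  obtain ⟨hs, hs'⟩ := (injective_pointsAt_C x).mp hx
  have hS := hasSimpleSolutionsC hs' h
  obtain ⟨⟨a, e, c, d, hroot, hdist, hall⟩, -⟩ := id hS
  refine encard_eq_of_correspondence (d := 4)
    (fun E k => ∃ r κ, IsFlagC (x 0) E (a k) (e k) (c k) (d k) r κ ∧
      EquationsC (x 0) (a k) (e k) (c k) (d k) r κ) ?_ ?_ ?_ ?_
  · intro k
    obtain ⟨hae, hcd, h1, h2⟩ := hroot k
    obtain ⟨r, κ, hr, hκ, heq⟩ := exists_equationsC h1 (by rw [detC_eq, h2, mul_zero])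
    obtain ⟨E, hE, hEr⟩ := exists_flag_of_equationsC hs' hae hcd hr hκ heq
    exact ⟨E, hE, r, κ, hEr, heq⟩
  · intro E hE
    obtain ⟨a', e', c', d', r, κ, hEr, heq⟩ := exists_isFlagC hs' hE
    obtain ⟨h1, h2⟩ := heq.eliminate hEr.r_ne hEr.κ_ne
    rw [detC_eq, mul_eq_zero, or_iff_right (pow_ne_zero 4 hs)] at h2
    obtain ⟨k, k1, k2⟩ := hall a' e' c' d' hEr.ae hEr.cd h1 h2
    obtain ⟨p, rfl, rfl⟩ := exists_mul_of_cross (hroot k).1 k1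
    obtain ⟨q, rfl, rfl⟩ := exists_mul_of_cross (hroot k).2.1 k2
    have hp : p ≠ 0 := by
      rintro rfl
      simpa using hEr.ae
    have hq : q ≠ 0 := by
      rintro rfl
      simpa using hEr.cd
    refine ⟨k, r, κ, ?_, ?_⟩
    · simpa [hp, hq] using hEr.scale (inv_ne_zero hp) (inv_ne_zero hq) one_ne_zero one_ne_zero
    · simpa [hp, hq] using heq.scale p⁻¹ q⁻¹ 1 1
  · rintro E - E' - k ⟨r, κ, hEr, heq⟩ ⟨r', κ', hEr', heq'⟩
    obtain ⟨hae, hcd, h1, h2⟩ := hroot k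
    have hsim := hS.isSimpleC hs hae hcd h1 (by rw [detC_eq, h2, mul_zero])
    obtain ⟨-, ⟨k1, k2⟩, -⟩ := equationsC_iff.mp heq'
    obtain ⟨t, rfl⟩ := kernel_unique_C hae hcd hsim hEr.r_ne hEr.κ_ne heq k1 k2
      (heq'.rowR hEr'.κ_ne)
    have ht := (smul_ne_zero_iff.mp hEr'.r_ne).1
    obtain ⟨u, rfl⟩ := kernel_unique_C' hae hcd hsim hEr.r_ne hEr.κ_ne heq
      (by simpa [smul_smul, ht] using heq'.scale 1 1 t⁻¹ 1)
    have hu := (smul_ne_zero_iff.mp hEr'.κ_ne).1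
    refine hEr.ext ?_
    simpa [smul_smul, ht, hu] using
      hEr'.scale one_ne_zero one_ne_zero (inv_ne_zero ht) (inv_ne_zero hu)
  · rintro E - k l ⟨r, κ, hEr, -⟩ ⟨r', κ', hEr', -⟩
    by_contra hkl
    have hle : E.space 0 ≤ E.space 1 := E.monotone (by decide)
    have h1 := ((hEr.mem_one _).mp (hle hEr'.p_mem)).1
    have h2 := ((hEr.mem_one _).mp (hle hEr'.q_mem)).2.1
    rw [hForm_pvec] at h1
    rw [mForm_qvec] at h2
    exact hdist k l hkl (by linear_combination h1) (by linear_combination -h2)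

end TransversalityC

/-! ### The discriminants of the three problems -/

lemma aeval_discA (x : Fin 2 → ℂ) : aeval x discA = polyA (x 0) (x 1) := by
  simp only [discA, polyA, map_add, map_mul, map_pow, aeval_X, map_ofNat]

lemma aeval_discB (x : Fin 2 → ℂ) : aeval x discB = (x 0 + x 1 + 2) * polyB (x 1) (x 0 - x 1) := by
  simp only [discB, polyB, map_add, map_sub, map_mul, map_pow, aeval_X, map_ofNat]

lemma aeval_discC (x : Fin 1 → ℂ) : aeval x discC = polyC (x 0) := by
  simp only [discC, polyC, map_add, map_sub, map_mul, map_pow, map_one, aeval_X, map_ofNat]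

theorem isDiscriminantPolynomial_A : IsDiscriminantPolynomial typeA condA pointsA discA where
  squarefree := squarefree_discA
  isRelPrime := isRelPrime_discA
  not_isTransverse_iff x hx := by rw [isTransverse_A_iff x hx, aeval_discA, not_ne_iff]

theorem isDiscriminantPolynomial_B : IsDiscriminantPolynomial typeB condB pointsB discB where
  squarefree := squarefree_discB
  isRelPrime := isRelPrime_discB
  not_isTransverse_iff x hx := by rw [isTransverse_B_iff x hx, aeval_discB, not_ne_iff]

theorem isDiscriminantPolynomial_C : IsDiscriminantPolynomial typeC condC pointsC discC where
  squarefree := squarefree_discC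
  isRelPrime := isRelPrime_discC
  not_isTransverse_iff x hx := by rw [isTransverse_C_iff x hx, aeval_discC, not_ne_iff]

end FlagSchubert

theorem theorem3p9 : -- the problem on flags of type `(1,2,4,5)` in 6-space
    (IsSchubertProblem typeA condA ∧ (∀ x : Fin 2 → ℂ, Function.Injective (pointsAt pointsA x) →
        IsTransverse typeA condA (pointsAt pointsA x) →
        (intersection typeA condA (pointsAt pointsA x)).encard = 2) ∧
      IsDiscriminantPolynomial typeA condA pointsA discA ∧
      discA ∈ generatedPreorder ![X 0, X 1, 1 + X 0, 1 + X 1, X 1 - X 0] ∧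
      discA ∈ nonnegCombinations ![X 0, X 1] ∧
      (∀ s t : ℝ, IsMonotone condA (pointsAt pointsA ![s, t]) ↔ 0 < s ∧ s < t) ∧
      (∀ s t : ℝ, 0 < s → 0 < t → 0 < eval ![s, t] discA)) ∧
    -- the problem on flags of type `(2,3)` in 5-space
    (IsSchubertProblem typeB condB ∧ (∀ x : Fin 2 → ℂ, Function.Injective (pointsAt pointsB x) →
        IsTransverse typeB condB (pointsAt pointsB x) →
        (intersection typeB condB (pointsAt pointsB x)).encard = 3) ∧
      IsDiscriminantPolynomial typeB condB pointsB discB ∧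
      discB ∈ generatedPreorder ![1 + X 0, 1 + X 1] ∧
      rename (Equiv.swap (0 : Fin 2) 1) discB = discB ∧
      discB ∈ nonnegCombinations ![X 1, X 0 - X 1] ∧
      discB ∈ nonnegCombinations ![1 + X 1, -X 1, X 0] ∧
      discB ∈ nonnegCombinations ![1 + X 1, X 0 - X 1, -X 0] ∧
      (∀ s t : ℝ, IsMonotone condB (pointsAt pointsB ![s, t]) ↔
        -1 < s ∧ -1 < t ∧ s ≠ 0 ∧ t ≠ 0 ∧ s ≠ t) ∧
      (∀ s t : ℝ, -1 < s → -1 < t → s ≠ 0 → t ≠ 0 → s ≠ t → 0 < eval ![s, t] discB)) ∧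
    -- the problem on flags of type `(3,4)` in 7-space
    (IsSchubertProblem typeC condC ∧ (∀ x : Fin 1 → ℂ, Function.Injective (pointsAt pointsC x) →
        IsTransverse typeC condC (pointsAt pointsC x) →
        (intersection typeC condC (pointsAt pointsC x)).encard = 4) ∧
      IsDiscriminantPolynomial typeC condC pointsC discC ∧ discC ∈ generatedPreorder ![X 0] ∧
      discC ∈ nonnegCombinations ![X 0, (1 - X 0^4)^2] ∧
      (∀ s : ℝ, IsMonotone condC (pointsAt pointsC ![s]) ↔ 0 < s ∧ s ≠ 1) ∧
      (∀ s : ℝ, 0 < s → 0 < eval ![s] discC)) :=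
  ⟨⟨isSchubertProblem_A, fun x hx h => encard_A x hx ((isTransverse_A_iff x hx).mp h),
      isDiscriminantPolynomial_A, discA_mem_preorder, discA_mem_nonneg, isMonotone_A_iff,
      discA_pos⟩, ⟨isSchubertProblem_B,
      fun x hx h => encard_B x hx ((isTransverse_B_iff x hx).mp h),
      isDiscriminantPolynomial_B, discB_mem_preorder, discB_symm, discB_mem_nonneg,
      discB_mem_nonneg_mixed, discB_mem_nonneg_neg, isMonotone_B_iff, discB_pos⟩,
    ⟨isSchubertProblem_C, fun x hx h => encard_C x hx ((isTransverse_C_iff x hx).mp h),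
      isDiscriminantPolynomial_C, discC_mem_preorder, discC_mem_nonneg, isMonotone_C_iff,
      discC_pos⟩⟩
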